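/- **Theorem 3.1.** Let $n\ge 1$, let $a_0\ge 0$, and let $a:(0,\infty)\to\mathbb R$ be measurable, integrable on $(0,1)$ and bounded on every $[\varepsilon,\infty)$, $\varepsilon>0$. Put $A(t)=a_0+\int_0^t a(s)\,ds$. Let $u_0\in L^1(\mathbb R^n)$ and $U_0=\int_{\mathbb R^n}u_0\,dx$. Let $t\mapsto u(\cdot,t)$, $t\ge 0$, be a measurable and locally bounded family of tempered distributions on $\mathbb R^n$ that is a weak solution of $u_t=a_0\Delta u+a*\Delta u$, $u(\cdot,0)=u_0$, that is, for all $\Phi\in C_0^\infty(\mathbb R^n\times[0,\infty))$, $$\int_0^\infty\Big\langle u(\cdot,s),\ \Phi_t(\cdot,s)+a_0\Delta\Phi(\cdot,s)+\int_s^\infty a(t-s)\,\Delta\Phi(\cdot,t)\,dt\Big\rangle ds+\int_{\mathbb R^n}u_0(x)\Phi(x,0)\,dx=0 .$$ Suppose that $A$ is eventually positive and regularly varying with index $\beta\in(-1,1]$, i.e. $A(T\tau)/A(T)\to\tau^\beta$ as $T\to\infty$ for every $\tau>0$. For a distribution $V$ on $\mathbb R^n$ and $c>0$ let $D_cV$ be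 defined by $\langle D_cV,\varphi\rangle=\langle V,\varphi(c^{-1}\cdot)\rangle$, and for a scaling function $k$ put $u_{T,k}(\cdot,t)=D_{k(T)}\,u(\cdot,Tt)$. For families $v_j$, $v$ of tempered distributions indexed by $t>0$, we say that $v_j\to v$ *a.e. boundedly in $H^s$* if $v_j(\cdot,t)\to v(\cdot,t)$ in $H^s(\mathbb R^n)$ for a.e. $t>0$ and if for every $M>0$ there is a constant $C$ such that, for all large $j$, $\|v_j(\cdot,t)\|_{H^s}\le C$ for a.e. $t\in(0,M)$. Suppose that there are a non-decreasing $k_0:[0,\infty)\to[0,\infty)$ with $k_0(t)\to\infty$ as $t\to\infty$, a sequence $T_j\to\infty$, some $s\in\mathbb R$, and a family $u_\infty(\cdot,t)$, with $u_\infty(\cdot,t)\in H^s(\mathbb R^n)$ for a.e. $t>0$, which is non-trivial (as a distribution on $\mathbb R^n\times[0,\infty)$ it is neither zero nor supported on $\{0\}\times[0,\infty)$), such that $u_{T_j,k_0}\to u_\infty$ a.e. boundedly in $H^s$ as $j\to\infty$. Let $$k(t)=\sqrt{t\,A(t)\,\Gamma(1+\beta)}$$ (defined for all large $t$). Then: 1.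 For every $t\ge0$ there is a tempered distribution $w_{1+\beta}(\cdot,t)$ on $\mathbb R^n$ with Fourier transform $\hat w_{1+\beta}(\xi,t)=E_{1+\beta}(-|\xi|^2t^{1+\beta})$, where $\hat f(\xi)=\int e^{-ix\cdot\xi}f(x)\,dx$ and $E_\alpha(z)=\sum_{j\ge0}z^j/\Gamma(1+\alpha j)$. For all $t\ge 0$ it satisfies, in the sense of distributions, $$w(\cdot,t)-\Delta\Big(\int_0^t\frac{(t-s)^\beta}{\Gamma(1+\beta)}\,w(\cdot,s)\,ds\Big)=\delta_0 .$$ 2. The limit $c=\lim_{j\to\infty}k(T_j)/k_0(T_j)$ exists, $0<c<\infty$, and $U_0\,w_{1+\beta}(\cdot,t)=D_c\,u_\infty(\cdot,t)$ for a.e. $t>0$. In particular $U_0w_{1+\beta}=u_\infty$ once $k_0$ is normalized (replaced by $c\,k_0$) so that $c=1$. Moreover $k_0$ may be replaced with $k$: $u_{T_j,k}\to U_0w_{1+\beta}$ a.e. boundedly in $H^s$. 3. Along the full limit $T\to\infty$, $u_{T,k}\to U_0\,w_{1+\beta}$ in the sense of distributions: for all $\Phi\in C_0^\infty(\mathbb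 R^n\times(0,\infty))$, $$\int_0^\infty\langle u_{T,k}(\cdot,t),\Phi(\cdot,t)\rangle\,dt\ \to\ U_0\int_0^\infty\langle w_{1+\beta}(\cdot,t),\Phi(\cdot,t)\rangle\,dt .$$ In addition, the spatial Fourier transforms converge locally uniformly: for all $R,M,\varepsilon>0$ there is $T_*$ such that for all $T\ge T_*$ and a.e. $t\in(0,M)$ the Fourier transform $\hat u_{T,k}(\cdot,t)$ is a continuous function with $|\hat u_{T,k}(\xi,t)-U_0E_{1+\beta}(-|\xi|^2t^{1+\beta})|\le\varepsilon$ for all $|\xi|\le R$. -/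

import Mathlib

open MeasureTheory Filter Topology Set
open scoped SchwartzMap FourierTransform Laplacian ContDiff ENNReal NNReal

noncomputable section

namespace SelfSimilar

/-- Euclidean space `ℝⁿ`. -/
abbrev Rn (n : ℕ) : Type := EuclideanSpace ℝ (Fin n)

/-! ### Kernels and regular variation -/

/-- Standing assumptions on the coefficients: `a₀ ≥ 0`, and the (measurable, real-valued) kernel
`a : (0, ∞) → ℝ` is integrable on `(0, 1)` and bounded on every set `[ε, ∞)`, `ε > 0`. -/
structure IsAdmissibleKernel (a₀ : ℝ) (a : ℝ → ℝ) : Prop where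
  nonneg : 0 ≤ a₀
  aestronglyMeasurable : AEStronglyMeasurable a (volume.restrict (Ioi 0))
  integrable : IntegrableOn a (Ioo 0 1)
  bounded : ∀ ε > 0, ∃ C : ℝ, ∀ t ≥ ε, |a t| ≤ C

/-- The integrated kernel `A(t) = a₀ + ∫₀ᵗ a(s) ds`. -/
def primitive (a₀ : ℝ) (a : ℝ → ℝ) (t : ℝ) : ℝ := a₀ + ∫ s in (0 : ℝ)..t, a s

/-- `f` is eventually positive and regularly varying (at `∞`) with index `β`. -/
def IsRegularlyVarying (f : ℝ → ℝ) (β : ℝ) : Prop :=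
  (∀ᶠ t in atTop, 0 < f t) ∧
    ∀ τ : ℝ, 0 < τ → Tendsto (fun T : ℝ => f (T * τ) / f T) atTop (𝓝 (τ ^ β))

/-- The scaling function `k(t) = √(t A(t) Γ(1 + β))`. -/
def scale (a₀ : ℝ) (a : ℝ → ℝ) (β t : ℝ) : ℝ :=
  √(t * primitive a₀ a t * Real.Gamma (1 + β))

/-- The Mittag-Leffler function `E_α(z) = ∑ zʲ / Γ(1 + α j)`. -/
def mittagLeffler (α : ℝ) (z : ℂ) : ℂ := ∑' j : ℕ, z ^ j / (Real.Gamma (1 + α * j) : ℂ)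

/-! ### Test functions on space-time -/

/-- Test functions `Φ ∈ C_c^∞(ℝⁿ × ℝ)`; their restrictions to `ℝⁿ × [0, ∞)` are the test functions
on `ℝⁿ × [0, ∞)` (they need not vanish at `t = 0`). -/
structure SpaceTimeTest (n : ℕ) where
  toFun : Rn n × ℝ → ℂ
  smooth : ContDiff ℝ ∞ toFun
  compact : HasCompactSupport toFun

namespace SpaceTimeTest

variable {n : ℕ}

theorem slice_smooth (Φ : SpaceTimeTest n) (t : ℝ) :
    ContDiff ℝ ∞ (fun x : Rn n => Φ.toFun (x, t)) :=
  Φ.smooth.comp (contDiff_id.prodMk contDiff_const)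

theorem slice_compact (Φ : SpaceTimeTest n) (t : ℝ) :
    HasCompactSupport (fun x : Rn n => Φ.toFun (x, t)) := by
  refine HasCompactSupport.intro (Φ.compact.isCompact.image continuous_fst) (fun x hx => ?_)
  by_contra h
  exact hx ⟨(x, t), subset_tsupport _ h, rfl⟩

/-- The spatial test function `Φ(·, t)`. -/
def slice (Φ : SpaceTimeTest n) (t : ℝ) : 𝓢(Rn n, ℂ) :=
  (Φ.slice_compact t).toSchwartzMap (Φ.slice_smooth t)

/-- The time derivative `Φ_t`. -/
def timeDeriv (Φ : SpaceTimeTest n) : SpaceTimeTest n where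
  toFun p := fderiv ℝ Φ.toFun p (0, 1)
  smooth := (Φ.smooth.fderiv_right (m := ∞) (by simp)).clm_apply contDiff_const
  compact := Φ.compact.fderiv_apply ℝ (0, 1)

theorem slice_apply (Φ : SpaceTimeTest n) (t : ℝ) (x : Rn n) :
    Φ.slice t x = Φ.toFun (x, t) := rfl

end SpaceTimeTest

/-! ### Families of tempered distributions and weak solutions -/

/-- `t ↦ u(·, t)` is measurable, and locally bounded on `[0, ∞)` for the usual seminorms: on every
bounded time interval all `u(·, t)` satisfy one common Schwartz seminorm estimate (that is, they
form a bounded set of tempered distributions). -/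
structure IsMeasurableLocallyBounded {n : ℕ} (u : ℝ → 𝓢'(Rn n, ℂ)) : Prop where
  measurable : ∀ φ : 𝓢(Rn n, ℂ),
    AEStronglyMeasurable (fun t => u t φ) (volume.restrict (Ioi 0))
  bounded : ∀ M : ℝ, ∃ (C : ℝ) (N : ℕ), ∀ t ∈ Icc 0 M, ∀ φ : 𝓢(Rn n, ℂ),
    ‖u t φ‖ ≤ C * ((Finset.Iic (N, N)).sup fun m => SchwartzMap.seminorm ℂ m.1 m.2) φ

/-- `u` is a weak solution of `u_t = a₀ Δu + a * Δu` with initial data `u₀`: for all test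
functions `Φ` on `ℝⁿ × [0, ∞)`,
`∫₀^∞ ⟨u(s), Φ_t(s) + a₀ ΔΦ(s) + ∫ₛ^∞ a(t - s) ΔΦ(t) dt⟩ ds + ⟨u₀, Φ(0)⟩ = 0`.
The pairing with `u(s)` is taken inside the `t`-integral. -/
structure IsWeakSolution {n : ℕ} (a₀ : ℝ) (a : ℝ → ℝ) (u₀ : Rn n → ℂ)
    (u : ℝ → 𝓢'(Rn n, ℂ)) : Prop where
  family : IsMeasurableLocallyBounded u
  weak : ∀ Φ : SpaceTimeTest n,
    (∫ s in Ioi (0 : ℝ), (u s (Φ.timeDeriv.slice s) + (a₀ : ℂ) * u s (Δ (Φ.slice s))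
        + ∫ t in Ioi s, (a (t - s) : ℂ) * u s (Δ (Φ.slice t))))
      + ∫ x, u₀ x * Φ.toFun (x, 0) = 0

/-! ### Scaling -/

/-- `⟨dilate c U, φ⟩ = ⟨U, φ(c⁻¹ ·)⟩`, i.e. `x ↦ cⁿ U(c x)` for functions
(`0` in the meaningless case `c = 0`). -/
def dilate {n : ℕ} (c : ℝ) (U : 𝓢'(Rn n, ℂ)) : 𝓢'(Rn n, ℂ) :=
  if hc : c ≠ 0 then
    PointwiseConvergenceCLM.precomp ℂ
      (SchwartzMap.compCLMOfContinuousLinearEquiv ℂ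
        (ContinuousLinearEquiv.smulLeft (R₁ := ℝ) (M₁ := Rn n) (Units.mk0 c⁻¹ (inv_ne_zero hc)))) U
  else 0

/-- The scaled family `⟨u_{T,k}(·, t), φ⟩ = ⟨u(·, T t), φ(k(T)⁻¹ ·)⟩`. -/
def rescale {n : ℕ} (u : ℝ → 𝓢'(Rn n, ℂ)) (k : ℝ → ℝ) (T t : ℝ) : 𝓢'(Rn n, ℂ) :=
  dilate (k T) (u (T * t))

/-! ### Sobolev norms, convergence and non-triviality -/

/-- The norm of `H^s(ℝⁿ)`, extended by `∞` to all tempered distributions (the infimum is over the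
at most one `L²` function that represents the Bessel potential of `U`). -/
def eSobolevNorm {n : ℕ} (s : ℝ) (U : 𝓢'(Rn n, ℂ)) : ℝ≥0∞ :=
  ⨅ (f : Lp ℂ 2 (volume : Measure (Rn n)))
    (_ : TemperedDistribution.besselPotential (Rn n) ℂ s U = (f : 𝓢'(Rn n, ℂ))), ‖f‖ₑ

/-- `v_j → v` almost everywhere boundedly in `H^s`: `v_j(t) → v(t)` in `H^s` for a.e. `t > 0`, and
on every bounded time interval the `H^s` norms of `v_j(t)` are bounded by one constant, for a.e. `t`
and all large `j`. -/
def TendstoAEBoundedly {n : ℕ} (s : ℝ) (v : ℕ → ℝ → 𝓢'(Rn n, ℂ)) (v' : ℝ → 𝓢'(Rn n, ℂ)) : Prop :=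
  (∀ᵐ t ∂volume.restrict (Ioi (0 : ℝ)),
      Tendsto (fun j => eSobolevNorm s (v j t - v' t)) atTop (𝓝 0)) ∧
    ∀ M : ℝ, ∃ C : ℝ≥0, ∀ᶠ j in atTop,
      ∀ᵐ t ∂volume.restrict (Ioo 0 M), eSobolevNorm s (v j t) ≤ C

/-- A family of distributions is non-trivial if, as a distribution on `ℝⁿ × [0, ∞)`, it is neither
zero nor supported on `{0} × [0, ∞)`. -/
def IsNontrivial {n : ℕ} (v : ℝ → 𝓢'(Rn n, ℂ)) : Prop :=
  (¬ ∀ᵐ t ∂volume.restrict (Ioi (0 : ℝ)), v t = 0) ∧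
    ¬ ∀ᵐ t ∂volume.restrict (Ioi (0 : ℝ)), Distribution.dsupport (v t) ⊆ {0}

/-! ### Fourier transforms and the limiting fundamental solution -/

/-- The Fourier transform of `W`, with the convention `Ŵ(ξ) = ∫ e^{-i x·ξ} W(x) dx`, is the function
`m`. In terms of Mathlib's transform `𝓕 W(ξ) = ∫ e^{-2π i x·ξ} W(x) dx` this says
`𝓕 W(ξ) = m(2π ξ)`. -/
def HasFourierTransform {n : ℕ} (W : 𝓢'(Rn n, ℂ)) (m : Rn n → ℂ) : Prop :=
  ∀ φ : 𝓢(Rn n, ℂ), Integrable (fun ξ => m ((2 * Real.pi) • ξ) * φ ξ) ∧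
    (𝓕 W) φ = ∫ ξ, m ((2 * Real.pi) • ξ) * φ ξ

/-- `t ↦ w(·, t)` is the family `w_α` with spatial Fourier transform `E_α(-|ξ|² t^α)`, `t ≥ 0`. -/
def IsMittagLefflerFamily {n : ℕ} (α : ℝ) (w : ℝ → 𝓢'(Rn n, ℂ)) : Prop :=
  ∀ t : ℝ, 0 ≤ t →
    HasFourierTransform (w t) fun ξ => mittagLeffler α ((-(‖ξ‖ ^ 2 * t ^ α) : ℝ) : ℂ)

/-- `w(·, t) - Δ ∫₀ᵗ Γ(1 + β)⁻¹ (t - s)^β w(·, s) ds = δ₀` in the sense of distributions. -/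
def IsFractionalFundamentalSolution {n : ℕ} (β : ℝ) (w : ℝ → 𝓢'(Rn n, ℂ)) : Prop :=
  ∀ t : ℝ, 0 ≤ t → ∀ φ : 𝓢(Rn n, ℂ),
    IntervalIntegrable
        (fun s => (((t - s) ^ β / Real.Gamma (1 + β) : ℝ) : ℂ) * w s (Δ φ)) volume 0 t ∧
      w t φ - ∫ s in (0 : ℝ)..t, (((t - s) ^ β / Real.Gamma (1 + β) : ℝ) : ℂ) * w s (Δ φ) = φ 0

/-- `v_T → v` as `T → ∞` in the sense of distributions on `ℝⁿ × (0, ∞)`. -/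
def TendstoDistribution {n : ℕ} (v : ℝ → ℝ → 𝓢'(Rn n, ℂ)) (v' : ℝ → 𝓢'(Rn n, ℂ)) : Prop :=
  ∀ Φ : SpaceTimeTest n, (∀ p ∈ tsupport Φ.toFun, 0 < p.2) →
    Tendsto (fun T => ∫ t in Ioi (0 : ℝ), v T t (Φ.slice t)) atTop
      (𝓝 (∫ t in Ioi (0 : ℝ), v' t (Φ.slice t)))

/-- As `T → ∞`, the spatial Fourier transforms of `v_T(·, t)` are continuous functions (for a.e.
`t`) that converge to `m(·, t)` uniformly for `|ξ| ≤ R` and a.e. `t ∈ (0, M)`, for all `R`, `M`. -/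
def FourierTendstoLocallyUniformly {n : ℕ} (v : ℝ → ℝ → 𝓢'(Rn n, ℂ)) (m : ℝ → Rn n → ℂ) : Prop :=
  ∀ R M ε : ℝ, 0 < ε → ∀ᶠ T in atTop, ∀ᵐ t ∂volume.restrict (Ioo 0 M),
    ∃ g : Rn n → ℂ, Continuous g ∧ HasFourierTransform (v T t) g ∧
      ∀ ξ : Rn n, ‖ξ‖ ≤ R → ‖g ξ - m t ξ‖ ≤ ε

end SelfSimilar

end

namespace SelfSimilar

/-! ### Scalar Volterra equations -/

/-! On the Fourier side the equation decouples into scalar Volterra equations. Let `A` be the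
integrated kernel and let `r(λ, t)` solve `r + λ A * r = 1` (`resolvent`). Testing the weak
formulation with products whose time factor is an antiderivative turns `a` into `A`. On a bounded
set of frequencies, multiplication by the symbol of the Laplacian is a bounded operation, so the
Volterra equation has only one solution there, and `û(ξ, t) = r(|ξ|², t) û₀(ξ)` wherever the
transform is a function (`IsWeakSolution.fourier_ae_eq`, `IsWeakSolution.ae_fourierRep`; the symbol
is `4π²|ξ|²` in Mathlib's normalization).

Rescaling time by `T` and space by `k(T)` replaces `A` with `A(Tτ) / (A(T) Γ(1 + β))` and leaves `λ`
unchanged; this is the reason for the choice of `k`. Potter's bounds make the rescaled kernels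
converge in `L¹(0, M)` to `τ^β / Γ(1 + β)`, whose resolvent is `E_{1+β}(-λ t^{1+β})`. Resolvents
depend continuously on the kernel in `L¹`, locally uniformly in `(λ, t)` (`tendsto_resolvent`).
Together with `û₀(ξ / k(T)) → û₀(0) = U₀` this is the locally uniform convergence of the Fourier
transforms.

Along the given sequence put `ρ_j = k(T_j) / k₀(T_j)`. If `ρ_j → ∞` on a subsequence, dividing the
scaled equation by `ρ_j²` shows that a fractional integral of the limit vanishes, hence the limit is
zero. If `ρ_j → 0`, the limit has a constant Fourier transform and sits at the origin.
Non-triviality excludes both, so subsequences have finite positive limits `c`, and then `û_∞ = U₀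
E_{1+β}(-c²|ξ|² t^{1+β})`. As this function determines `c`, the whole sequence converges
(`IsLimitAlong.exists_limit`). The `H^s` bound on `u_∞` also shows that `w_{1+β}` is a tempered
distribution, and strong continuity of dilations in `H^s` allows `k₀` to be replaced with `k`.

The full limit in the sense of distributions is the hard part: `H^s` bounds are available only along
`T_j`, so for general `T` high frequencies need a separate estimate that is uniform in `T`. By
Laplace inversion on `Re z = 1`, the pairing of `r(λ, ·)` with a test function is an integral of `1
/ (z (1 + λ K(z)))`, where `K(z)` is the Laplace transform of the rescaled kernel. The sequence
bounds show that `r` does not grow exponentially along a sequence of times, for almost every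
relevant `λ`; so `1 + λ K(z)` has no zeros in the right half-plane, first for almost all and, by the
open mapping theorem, for all relevant `λ`. A pointwise lower bound uniform in `T` is not available,
but an average over `ξ` suffices. The imaginary part of `K / (1 + λ K)` integrates over `λ` to at
most `π` whatever `K` is (`integral_poisson_le`), and the Borel–Carathéodory theorem turns this
bound into quadratic growth of the averages on `Re z = 1`. The test functions decay faster, and
frequencies `|ξ| ≥ R` contribute `O(1/R)` uniformly in `T` (`exists_norm_integral_resolvent_le`). -/

/-- The iterated integrals `1 * K * ⋯ * K`. -/
noncomputable def volterraIter (K : ℝ → ℝ) : ℕ → ℝ → ℝ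
  | 0, _ => 1
  | m + 1, t => ∫ s in Ioc 0 t, K s * volterraIter K m (t - s)

/-- The solution `r` of `r + lam K * r = 1`, as a Neumann series. -/
noncomputable def resolvent (K : ℝ → ℝ) (lam t : ℝ) : ℝ :=
  ∑' m : ℕ, (-lam) ^ m * volterraIter K m t

/-- The mass of `K` on `(0, M)` with an exponential weight. -/
noncomputable def weightedMass (K : ℝ → ℝ) (σ M : ℝ) : ℝ :=
  ∫ s in Ioc 0 M, Real.exp (-σ * s) * |K s|

theorem weightedMass_nonneg (K : ℝ → ℝ) (σ M : ℝ) : 0 ≤ weightedMass K σ M :=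
  integral_nonneg fun s => by positivity

theorem integrableOn_weight {K : ℝ → ℝ} {M : ℝ} (hK : IntegrableOn K (Ioc 0 M)) (σ : ℝ) :
    IntegrableOn (fun s => Real.exp (-σ * s) * |K s|) (Ioc 0 M) := by
  exact IntegrableOn.continuousOn_mul_of_subset (K := Icc 0 M) (by fun_prop) hK.abs
    isCompact_Icc measurableSet_Ioc Ioc_subset_Icc_self

/-- Dominated convergence. This is what makes convolution with `K` a contraction on any bounded
interval and for any spectral parameter: instead of shortening the interval, the exponential weight
is increased. -/
theorem tendsto_weightedMass {K : ℝ → ℝ} {M : ℝ} (hK : IntegrableOn K (Ioc 0 M)) :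
    Tendsto (fun σ => weightedMass K σ M) atTop (𝓝 0) := by
  have h : ∫ s in Ioc (0 : ℝ) M, (0 : ℝ) = 0 := by simp
  rw [← h]
  refine tendsto_integral_filter_of_dominated_convergence (fun s => |K s|) ?_ ?_ hK.abs ?_
  · exact Eventually.of_forall fun σ => (integrableOn_weight hK σ).aestronglyMeasurable
  · filter_upwards [eventually_ge_atTop 0] with σ hσ
    filter_upwards [ae_restrict_mem measurableSet_Ioc] with s hs
    rw [Real.norm_of_nonneg (by positivity)]
    refine mul_le_of_le_one_left (abs_nonneg _) (Real.exp_le_one_iff.2 ?_)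
    nlinarith [hs.1]
  · filter_upwards [ae_restrict_mem measurableSet_Ioc] with s hs
    have : Tendsto (fun σ : ℝ => Real.exp (-σ * s)) atTop (𝓝 0) := by
      refine Real.tendsto_exp_atBot.comp ?_
      exact (tendsto_neg_atTop_atBot).atBot_mul_const hs.1
    simpa using this.mul_const |K s|

theorem exists_weightedMass_le {K : ℝ → ℝ} {M : ℝ} (hK : IntegrableOn K (Ioc 0 M)) {δ : ℝ}
    (hδ : 0 < δ) : ∃ σ, 0 ≤ σ ∧ weightedMass K σ M ≤ δ := by
  obtain ⟨σ, h1, h2⟩ := ((tendsto_weightedMass hK).eventually_le_const hδ |>.and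
    (eventually_ge_atTop 0)).exists
  exact ⟨σ, h2, h1⟩

/-- The basic convolution estimate with an exponential weight. -/
theorem abs_setIntegral_conv_le {K d : ℝ → ℝ} {M σ B t : ℝ} (hK : IntegrableOn K (Ioc 0 M))
    (hB : 0 ≤ B) (ht : t ≤ M)
    (hd : ∀ᵐ s, s ∈ Ioc 0 t → |d (t - s)| ≤ B * Real.exp (σ * (t - s))) :
    |∫ s in Ioc 0 t, K s * d (t - s)| ≤ B * Real.exp (σ * t) * weightedMass K σ M := by
  have hsub : Ioc 0 t ⊆ Ioc 0 M := Ioc_subset_Ioc_right ht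
  have hi := integrableOn_weight hK σ
  calc |∫ s in Ioc 0 t, K s * d (t - s)|
      ≤ ∫ s in Ioc 0 t, B * Real.exp (σ * t) * (Real.exp (-σ * s) * |K s|) := by
        rw [← Real.norm_eq_abs]
        refine norm_integral_le_of_norm_le ((hi.mono_set hsub).const_mul _) ?_
        rw [ae_restrict_iff' measurableSet_Ioc]
        filter_upwards [hd] with s hs hmem
        rw [norm_mul, Real.norm_eq_abs, Real.norm_eq_abs]
        calc |K s| * |d (t - s)| ≤ |K s| * (B * Real.exp (σ * (t - s))) := by
              gcongr; exact hs hmem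
          _ = B * Real.exp (σ * t) * (Real.exp (-σ * s) * |K s|) := by
              rw [show σ * (t - s) = σ * t + -σ * s by ring, Real.exp_add]; ring
    _ = B * Real.exp (σ * t) * ∫ s in Ioc 0 t, Real.exp (-σ * s) * |K s| := by
        rw [integral_const_mul]
    _ ≤ _ := by
        gcongr
        exact setIntegral_mono_set hi (Eventually.of_forall fun s => by positivity)
          (Eventually.of_forall hsub)

theorem volterraIter_zero (K : ℝ → ℝ) (t : ℝ) : volterraIter K 0 t = 1 := rfl

theorem volterraIter_succ (K : ℝ → ℝ) (m : ℕ) (t : ℝ) :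
    volterraIter K (m + 1) t = ∫ s in Ioc 0 t, K s * volterraIter K m (t - s) := rfl

theorem volterraIter_succ_of_nonpos (K : ℝ → ℝ) (m : ℕ) {t : ℝ} (ht : t ≤ 0) :
    volterraIter K (m + 1) t = 0 := by
  rw [volterraIter_succ, Ioc_eq_empty (by simpa using ht)]; simp

theorem abs_volterraIter_le {K : ℝ → ℝ} {M : ℝ} (hK : IntegrableOn K (Ioc 0 M)) {σ : ℝ}
    (hσ : 0 ≤ σ) (m : ℕ) {t : ℝ} (ht0 : 0 ≤ t) (ht : t ≤ M) :
    |volterraIter K m t| ≤ weightedMass K σ M ^ m * Real.exp (σ * t) := by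
  induction m generalizing t with
  | zero => simpa [volterraIter_zero] using mul_nonneg hσ ht0
  | succ m ih =>
    rw [volterraIter_succ]
    have := abs_setIntegral_conv_le (d := volterraIter K m) (σ := σ) hK
      (pow_nonneg (weightedMass_nonneg K σ M) m) ht (Eventually.of_forall fun s hs =>
        ih (t := t - s) (by linarith [hs.2]) (by linarith [hs.1]))
    calc _ ≤ _ := this
      _ = _ := by ring

/-- The bound of `abs_volterraIter_le` for all times up to `M`, at the price of `|t|`. -/
theorem abs_volterraIter_le' {K : ℝ → ℝ} {M : ℝ} (hK : IntegrableOn K (Ioc 0 M)) {σ : ℝ}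
    (hσ : 0 ≤ σ) (m : ℕ) {t : ℝ} (ht : t ≤ M) :
    |volterraIter K m t| ≤ weightedMass K σ M ^ m * Real.exp (σ * |t|) := by
  rcases le_or_gt 0 t with h | h
  · simpa [abs_of_nonneg h] using abs_volterraIter_le hK hσ m h ht
  · cases m with
    | zero => simpa [volterraIter_zero] using mul_nonneg hσ (abs_nonneg t)
    | succ m =>
      rw [volterraIter_succ_of_nonpos K m h.le]
      simpa using mul_nonneg (pow_nonneg (weightedMass_nonneg K σ M) (m + 1)) (Real.exp_pos _).le

variable {K : ℝ → ℝ}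

/-- The kernel is only integrable, so the moving endpoint is put into an indicator on a fixed
interval. The integrand is then continuous in `t` at `t₀` except for `s = t₀`, a null set, and
dominated convergence applies. -/
theorem continuous_setIntegral_conv (hK : ∀ M, IntegrableOn K (Ioc 0 M)) {d : ℝ → ℝ}
    (hd : Continuous d) : Continuous fun t => ∫ s in Ioc 0 t, K s * d (t - s) := by
  rw [continuous_iff_continuousAt]
  intro t₀
  have hrw : ∀ t, t < t₀ + 1 → ∫ s in Ioc 0 t, K s * d (t - s)
      = ∫ s in Ioc 0 (t₀ + 1), (Iic t).indicator (fun s => K s * d (t - s)) s := by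
    intro t ht
    rw [setIntegral_indicator measurableSet_Iic]
    congr 2
    ext s; simp only [mem_Ioc, mem_inter_iff, mem_Iic]
    constructor
    · rintro ⟨h1, h2⟩; exact ⟨⟨h1, by linarith⟩, h2⟩
    · rintro ⟨⟨h1, _⟩, h2⟩; exact ⟨h1, h2⟩
  obtain ⟨B, hB⟩ := (isCompact_Icc (a := (-1 : ℝ)) (b := |t₀| + 1)).exists_bound_of_continuousOn
    hd.continuousOn
  have key : ContinuousAt
      (fun t => ∫ s in Ioc 0 (t₀ + 1), (Iic t).indicator (fun s => K s * d (t - s)) s) t₀ := by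
    refine continuousAt_of_dominated (bound := fun s => |K s| * B) ?_ ?_
      ((hK (t₀ + 1)).abs.mul_const B) ?_
    · refine Eventually.of_forall fun t => AEStronglyMeasurable.indicator ?_ measurableSet_Iic
      exact (hK _).aestronglyMeasurable.mul (by fun_prop)
    · filter_upwards [Iio_mem_nhds (lt_add_one t₀)] with t ht
      filter_upwards [ae_restrict_mem measurableSet_Ioc] with s hs
      by_cases hst : s ∈ Iic t
      · rw [indicator_of_mem hst, norm_mul]
        gcongr
        · rfl
        · refine hB _ ⟨?_, ?_⟩
          · linarith [mem_Iic.1 hst]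
          · have := le_abs_self t₀; linarith [hs.1, mem_Iio.1 ht]
      · rw [indicator_of_notMem hst, norm_zero]
        have : 0 ≤ B := (norm_nonneg _).trans (hB 0 ⟨by norm_num, by positivity⟩)
        positivity
    · have hne : ∀ᵐ s ∂volume.restrict (Ioc 0 (t₀ + 1)), s ≠ t₀ :=
        ae_restrict_of_ae (by simp [ae_iff])
      filter_upwards [hne] with s hs
      rcases lt_or_gt_of_ne hs with h | h
      · have : ContinuousAt (fun t => K s * d (t - s)) t₀ := by fun_prop
        refine this.congr ?_
        filter_upwards [Ioi_mem_nhds h] with t ht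
        rw [indicator_of_mem (mem_Iic.2 (le_of_lt ht))]
      · refine (continuousAt_const (y := (0 : ℝ))).congr ?_
        filter_upwards [Iio_mem_nhds h] with t ht
        rw [indicator_of_notMem (by simpa using ht)]
  refine key.congr ?_
  filter_upwards [Iio_mem_nhds (lt_add_one t₀)] with t ht
  exact (hrw t ht).symm

theorem continuous_volterraIter (hK : ∀ M, IntegrableOn K (Ioc 0 M)) (m : ℕ) :
    Continuous (volterraIter K m) := by
  induction m with
  | zero => exact continuous_const
  | succ m ih => exact continuous_setIntegral_conv hK ih

theorem abs_resolvent_term_le (hK : ∀ M, IntegrableOn K (Ioc 0 M)) {Λ M σ : ℝ} (hσ : 0 ≤ σ)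
    (hq : Λ * weightedMass K σ M ≤ 1 / 2) (m : ℕ) {lam t : ℝ} (hlam : |lam| ≤ Λ) (ht : t ≤ M) :
    |(-lam) ^ m * volterraIter K m t| ≤ (1 / 2) ^ m * Real.exp (σ * |t|) := by
  have hq0 := weightedMass_nonneg K σ M
  rw [abs_mul, abs_pow, abs_neg]
  calc |lam| ^ m * |volterraIter K m t|
      ≤ Λ ^ m * (weightedMass K σ M ^ m * Real.exp (σ * |t|)) := by
        gcongr
        · exact pow_nonneg ((abs_nonneg _).trans hlam) m
        · exact abs_volterraIter_le' (hK M) hσ m ht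
    _ = (Λ * weightedMass K σ M) ^ m * Real.exp (σ * |t|) := by rw [mul_pow]; ring
    _ ≤ _ := by
        gcongr
        exact mul_nonneg ((abs_nonneg _).trans hlam) hq0

theorem exists_sigma (hK : ∀ M, IntegrableOn K (Ioc 0 M)) (Λ M : ℝ) :
    ∃ σ, 0 ≤ σ ∧ |Λ| * weightedMass K σ M ≤ 1 / 2 := by
  obtain ⟨σ, h1, h2⟩ := exists_weightedMass_le (hK M)
    -- The summand `1` keeps the target positive and finite when `Λ = 0`.
    (show (0 : ℝ) < 1 / (2 * (|Λ| + 1)) by positivity)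
  refine ⟨σ, h1, ?_⟩
  calc |Λ| * weightedMass K σ M ≤ |Λ| * (1 / (2 * (|Λ| + 1))) := by gcongr
    _ ≤ 1 / 2 := by
      rw [mul_one_div, div_le_div_iff₀ (by positivity) (by norm_num)]; linarith

theorem summable_resolvent (hK : ∀ M, IntegrableOn K (Ioc 0 M)) (lam t : ℝ) :
    Summable fun m : ℕ => (-lam) ^ m * volterraIter K m t := by
  obtain ⟨σ, hσ, hq⟩ := exists_sigma hK lam t
  refine Summable.of_norm_bounded (g := fun m => (1 / 2 : ℝ) ^ m * Real.exp (σ * |t|))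
    ((summable_geometric_of_lt_one (by norm_num) (by norm_num)).mul_right _) fun m => ?_
  exact abs_resolvent_term_le hK hσ hq m le_rfl le_rfl

theorem abs_resolvent_le (hK : ∀ M, IntegrableOn K (Ioc 0 M)) {Λ M σ : ℝ} (hσ : 0 ≤ σ)
    (hq : Λ * weightedMass K σ M ≤ 1 / 2) {lam t : ℝ} (hlam : |lam| ≤ Λ) (ht : t ≤ M) :
    |resolvent K lam t| ≤ 2 * Real.exp (σ * |t|) := by
  have hs : HasSum (fun m => (1 / 2 : ℝ) ^ m * Real.exp (σ * |t|)) (2 * Real.exp (σ * |t|)) :=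
    hasSum_geometric_two.mul_right _
  exact tsum_of_norm_bounded (f := fun m : ℕ => (-lam) ^ m * volterraIter K m t) hs
    fun m => abs_resolvent_term_le hK hσ hq m hlam ht

/-- One weight `σ` serves a whole neighbourhood of the point, so the Neumann series has a geometric
majorant there and the Weierstrass test gives joint continuity. -/
theorem continuous_resolvent (hK : ∀ M, IntegrableOn K (Ioc 0 M)) :
    Continuous fun p : ℝ × ℝ => resolvent K p.1 p.2 := by
  rw [continuous_iff_continuousAt]
  rintro ⟨lam₀, t₀⟩
  obtain ⟨σ, hσ, hq⟩ := exists_sigma hK (|lam₀| + 1) (|t₀| + 1)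
  rw [abs_of_nonneg (by positivity)] at hq
  let S : Set (ℝ × ℝ) := Metric.ball lam₀ 1 ×ˢ Metric.ball t₀ 1
  have hS : S ∈ 𝓝 (lam₀, t₀) :=
    prod_mem_nhds (Metric.ball_mem_nhds _ one_pos) (Metric.ball_mem_nhds _ one_pos)
  have hc : ContinuousOn (fun p : ℝ × ℝ => resolvent K p.1 p.2) S := by
    refine continuousOn_tsum (u := fun m => (1 / 2 : ℝ) ^ m * Real.exp (σ * (|t₀| + 1)))
      (fun m => ?_) ((summable_geometric_of_lt_one (by norm_num) (by norm_num)).mul_right _) ?_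
    · have := continuous_volterraIter hK m
      exact (by fun_prop : Continuous fun p : ℝ × ℝ => (-p.1) ^ m * volterraIter K m p.2).continuousOn
    · rintro m ⟨lam, t⟩ ⟨h1, h2⟩
      simp only [Metric.mem_ball, Real.dist_eq] at h1 h2
      have h3 : |lam| ≤ |lam₀| + 1 := by
        have := abs_sub_abs_le_abs_sub lam lam₀; linarith
      have h4 : |t| ≤ |t₀| + 1 := by
        have := abs_sub_abs_le_abs_sub t t₀; linarith
      refine (abs_resolvent_term_le hK hσ hq m h3 ((le_abs_self t).trans h4)).trans ?_
      gcongr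
  exact hc.continuousAt hS

theorem resolvent_zero_right (K : ℝ → ℝ) (lam : ℝ) : resolvent K lam 0 = 1 := by
  unfold resolvent
  rw [tsum_eq_single 0]
  · simp [volterraIter_zero]
  · intro m hm
    obtain ⟨m, rfl⟩ := Nat.exists_eq_succ_of_ne_zero hm
    simp [volterraIter_succ_of_nonpos]

theorem resolvent_zero_left (K : ℝ → ℝ) (t : ℝ) : resolvent K 0 t = 1 := by
  unfold resolvent
  rw [tsum_eq_single 0]
  · simp [volterraIter_zero]
  · intro m hm
    simp [hm]

theorem integrableOn_conv (hK : ∀ M, IntegrableOn K (Ioc 0 M)) {d : ℝ → ℝ} (hd : Continuous d)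
    (t : ℝ) : IntegrableOn (fun s => K s * d (t - s)) (Ioc 0 t) :=
  IntegrableOn.mul_continuousOn_of_subset (K := Icc 0 t) (hK t) (by fun_prop) measurableSet_Ioc
    isCompact_Icc Ioc_subset_Icc_self

theorem continuous_resolvent_right (hK : ∀ M, IntegrableOn K (Ioc 0 M)) (lam : ℝ) :
    Continuous (resolvent K lam) :=
  (continuous_resolvent hK).comp (by fun_prop : Continuous fun t : ℝ => (lam, t))

/-- Convolution with `-lam * K` shifts the Neumann series by one index; the geometric majorant
permits integration term by term. -/
theorem resolvent_eq (hK : ∀ M, IntegrableOn K (Ioc 0 M)) (lam t : ℝ) :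
    resolvent K lam t = 1 - lam * ∫ s in Ioc 0 t, K s * resolvent K lam (t - s) := by
  obtain ⟨σ, hσ, hq⟩ := exists_sigma hK lam t
  have hswap : HasSum (fun m : ℕ => ∫ s in Ioc 0 t, K s * ((-lam) ^ m * volterraIter K m (t - s)))
      (∫ s in Ioc 0 t, K s * resolvent K lam (t - s)) := by
    refine hasSum_integral_of_dominated_convergence
      (fun m s => |K s| * ((1 / 2 : ℝ) ^ m * Real.exp (σ * t))) ?_ ?_ ?_ ?_ ?_
    · intro m
      have := continuous_volterraIter hK m
      exact (integrableOn_conv hK (d := fun x => (-lam) ^ m * volterraIter K m x) (by fun_prop)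
        t).aestronglyMeasurable
    · intro m
      filter_upwards [ae_restrict_mem measurableSet_Ioc] with s hs
      rw [norm_mul, Real.norm_eq_abs, Real.norm_eq_abs]
      gcongr
      refine (abs_resolvent_term_le hK hσ hq m le_rfl (by linarith [hs.1])).trans ?_
      rw [abs_of_nonneg (by linarith [hs.2])]
      gcongr
      linarith [hs.1]
    · refine Eventually.of_forall fun s => ?_
      exact (((summable_geometric_of_lt_one (by norm_num) (by norm_num)).mul_right _)).mul_left _
    · simp_rw [tsum_mul_left]
      exact (hK t).abs.mul_const _
    · refine Eventually.of_forall fun s => ?_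
      exact (summable_resolvent hK lam (t - s)).hasSum.mul_left _
  have h1 : resolvent K lam t = 1 + ∑' m : ℕ, (-lam) ^ (m + 1) * volterraIter K (m + 1) t := by
    unfold resolvent
    rw [(summable_resolvent hK lam t).tsum_eq_zero_add]
    simp [volterraIter_zero]
  rw [h1, ← hswap.tsum_eq, sub_eq_add_neg, ← neg_mul, ← tsum_mul_left]
  congr 1
  refine tsum_congr fun m => ?_
  rw [volterraIter_succ, pow_succ', mul_assoc, ← integral_const_mul]
  congr 1
  refine integral_congr_ae (Eventually.of_forall fun s => ?_)
  ring

/-- A bounded `d` with `|d| ≤ ε + lam |K| * |d|` on `[0, M]` is of size `ε`. -/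
theorem abs_le_of_volterra_le {d : ℝ → ℝ} {M σ lam ε : ℝ} (hK : IntegrableOn K (Ioc 0 M))
    (hσ : 0 ≤ σ) (hlam : 0 ≤ lam) (hq : lam * weightedMass K σ M ≤ 1 / 2) (hε : 0 ≤ ε)
    (hbd : ∃ B, ∀ t ∈ Icc 0 M, |d t| ≤ B)
    (hd : ∀ t ∈ Icc 0 M, |d t| ≤ ε + lam * |∫ s in Ioc 0 t, K s * d (t - s)|) :
    ∀ t ∈ Icc 0 M, |d t| ≤ 2 * ε * Real.exp (σ * t) := by
  obtain ⟨B, hB⟩ := hbd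
  have hB' : ∀ t ∈ Icc 0 M, |d t| ≤ |B| * Real.exp (σ * t) := fun t ht =>
    (hB t ht).trans ((le_abs_self B).trans (le_mul_of_one_le_right (abs_nonneg _)
      (Real.one_le_exp (mul_nonneg hσ ht.1))))
  -- Each substitution of the current bound into the inequality halves the contribution of the
  -- unknown constant `B`, so that in the limit only the forcing `ε` is left.
  have step : ∀ n : ℕ, ∀ t ∈ Icc 0 M, |d t| ≤ (2 * ε + |B| * (1 / 2) ^ n) * Real.exp (σ * t) := by
    intro n
    induction n with
    | zero =>
      intro t ht
      refine (hB' t ht).trans ?_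
      gcongr
      simp only [pow_zero, mul_one]; linarith
    | succ n ih =>
      intro t ht
      have h1 := abs_setIntegral_conv_le (d := d) (σ := σ) (B := 2 * ε + |B| * (1 / 2) ^ n) hK
        (by positivity) ht.2 (Eventually.of_forall fun s hs =>
          ih (t - s) ⟨by linarith [hs.2], by linarith [hs.1, ht.2]⟩)
      have h2 : (1 : ℝ) ≤ Real.exp (σ * t) := Real.one_le_exp (mul_nonneg hσ ht.1)
      calc |d t| ≤ ε + lam * ((2 * ε + |B| * (1 / 2) ^ n) * Real.exp (σ * t)
              * weightedMass K σ M) := (hd t ht).trans (by gcongr)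
        _ = ε + (2 * ε + |B| * (1 / 2) ^ n) * Real.exp (σ * t)
              * (lam * weightedMass K σ M) := by ring
        _ ≤ ε * Real.exp (σ * t) + (2 * ε + |B| * (1 / 2) ^ n) * Real.exp (σ * t) * (1 / 2) := by
            gcongr
            exact le_mul_of_one_le_right hε h2
        _ = _ := by rw [pow_succ]; ring
  intro t ht
  have hlim : Tendsto (fun n : ℕ => (2 * ε + |B| * (1 / 2) ^ n) * Real.exp (σ * t)) atTop
      (𝓝 ((2 * ε + |B| * 0) * Real.exp (σ * t))) :=
    (((tendsto_pow_atTop_nhds_zero_of_lt_one (by norm_num) (by norm_num)).const_mul _).const_add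
      _).mul_const _
  simpa using ge_of_tendsto' hlim fun n => step n t ht

/-- Convergence of the kernels in `L¹(0, M)` implies locally uniform convergence of the
resolvents. -/
theorem tendsto_resolvent {ι : Type*} {l : Filter ι} {Kι : ι → ℝ → ℝ}
    (hK : ∀ M, IntegrableOn K (Ioc 0 M)) (hKι : ∀ᶠ i in l, ∀ M, IntegrableOn (Kι i) (Ioc 0 M))
    (Λ M : ℝ) (hconv : Tendsto (fun i => ∫ s in Ioc 0 M, |Kι i s - K s|) l (𝓝 0))
    {ε : ℝ} (hε : 0 < ε) :
    ∀ᶠ i in l, ∀ lam ∈ Icc 0 Λ, ∀ t ∈ Icc 0 M, |resolvent (Kι i) lam t - resolvent K lam t| ≤ ε := by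
  -- A quarter instead of a half: the other quarter is reserved for the `L¹` distance of the
  -- kernels, so that the same weight works for all nearby kernels.
  obtain ⟨σ, hσ, hq⟩ := exists_weightedMass_le (hK M)
    (show (0 : ℝ) < 1 / (4 * (|Λ| + 1)) by positivity)
  obtain ⟨σ', hσ', hq'⟩ := exists_sigma hK Λ M
  set B := 2 * Real.exp (σ' * |M|) with hB
  have hBpos : 0 < B := by positivity
  have hsmall : (0 : ℝ) < min (1 / (4 * (|Λ| + 1)))
      (ε / (2 * (|Λ| + 1) * B * Real.exp (σ * |M|))) := by positivity
  filter_upwards [hKι, hconv.eventually_le_const hsmall] with i hi hle lam hlam t ht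
  have hdiff : IntegrableOn (fun s => |Kι i s - K s|) (Ioc 0 M) := ((hi M).sub (hK M)).abs
  set η := ∫ s in Ioc 0 M, |Kι i s - K s| with hη
  have hη0 : 0 ≤ η := integral_nonneg fun s => abs_nonneg _
  have hLam : lam ≤ |Λ| + 1 := by have := le_abs_self Λ; linarith [hlam.2]
  -- the weighted mass of `Kι i`
  have hmass : weightedMass (Kι i) σ M ≤ weightedMass K σ M + η := by
    unfold weightedMass
    rw [hη, ← integral_add (integrableOn_weight (hK M) σ) hdiff]
    refine setIntegral_mono_on (integrableOn_weight (hi M) σ)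
      ((integrableOn_weight (hK M) σ).add hdiff) measurableSet_Ioc fun s hs => ?_
    have h1 : Real.exp (-σ * s) ≤ 1 := Real.exp_le_one_iff.2 (by nlinarith [hs.1])
    have h2 : |Kι i s| ≤ |K s| + |Kι i s - K s| := by
      have := abs_add_le (K s) (Kι i s - K s); simpa using this
    calc Real.exp (-σ * s) * |Kι i s| ≤ Real.exp (-σ * s) * (|K s| + |Kι i s - K s|) := by gcongr
      _ ≤ _ := by
        rw [mul_add]; gcongr; exact mul_le_of_le_one_left (abs_nonneg _) h1
  have hqi : lam * weightedMass (Kι i) σ M ≤ 1 / 2 := by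
    have h1 : weightedMass (Kι i) σ M ≤ 1 / (2 * (|Λ| + 1)) := by
      refine hmass.trans ((add_le_add hq (hle.trans (min_le_left _ _))).trans (le_of_eq ?_))
      field_simp; norm_num
    calc lam * weightedMass (Kι i) σ M ≤ (|Λ| + 1) * (1 / (2 * (|Λ| + 1))) := by
          gcongr; exact weightedMass_nonneg _ _ _
      _ = 1 / 2 := by field_simp
  have hres : ∀ s ∈ Icc 0 M, |resolvent K lam s| ≤ B := by
    intro s hs
    refine (abs_resolvent_le hK hσ' hq' (lam := lam) (t := s) ?_ hs.2).trans ?_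
    · rw [abs_of_nonneg hlam.1]; exact hlam.2.trans (le_abs_self _)
    · rw [hB, abs_of_nonneg hs.1]; gcongr; exact hs.2.trans (le_abs_self _)
  have hci := continuous_resolvent_right hi lam
  have hc := continuous_resolvent_right hK lam
  have main := abs_le_of_volterra_le (K := Kι i)
    (d := fun t => resolvent (Kι i) lam t - resolvent K lam t) (ε := lam * (B * η))
    (hi M) hσ hlam.1 hqi (mul_nonneg hlam.1 (by positivity)) ?_ ?_ t ht
  · refine main.trans ?_
    have hM : t ≤ |M| := ht.2.trans (le_abs_self _)
    calc 2 * (lam * (B * η)) * Real.exp (σ * t)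
        ≤ 2 * ((|Λ| + 1) * (B * (ε / (2 * (|Λ| + 1) * B * Real.exp (σ * |M|)))))
            * Real.exp (σ * |M|) := by
          gcongr
          exact hle.trans (min_le_right _ _)
      _ = ε := by field_simp
  · obtain ⟨C, hC⟩ := (isCompact_Icc (a := (0 : ℝ)) (b := M)).exists_bound_of_continuousOn
      (hci.sub hc).continuousOn
    exact ⟨C, hC⟩
  · intro t ht
    -- The difference of the resolvents solves a Volterra equation with the kernel `Kι i`, forced by
    -- the error of the kernel convolved with the limiting resolvent.
    have e : resolvent (Kι i) lam t - resolvent K lam t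
        = -(lam * ∫ s in Ioc 0 t, (Kι i s - K s) * resolvent K lam (t - s))
          - lam * ∫ s in Ioc 0 t, Kι i s * (resolvent (Kι i) lam (t - s)
              - resolvent K lam (t - s)) := by
      rw [resolvent_eq hi lam t, resolvent_eq hK lam t]
      have i1 := integrableOn_conv hi hci t
      have i2 := integrableOn_conv hi hc t
      have i3 := integrableOn_conv hK hc t
      simp_rw [sub_mul, mul_sub]
      rw [integral_sub i2 i3, integral_sub i1 i2]
      ring
    rw [e]
    refine (abs_sub _ _).trans ?_
    rw [abs_neg, abs_mul, abs_mul, abs_of_nonneg hlam.1]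
    gcongr
    · exact hlam.1
    rw [← Real.norm_eq_abs]
    have hsub : Ioc 0 t ⊆ Ioc 0 M := Ioc_subset_Ioc_right ht.2
    calc ‖∫ s in Ioc 0 t, (Kι i s - K s) * resolvent K lam (t - s)‖
        ≤ ∫ s in Ioc 0 t, B * |Kι i s - K s| := by
          refine norm_integral_le_of_norm_le ((hdiff.mono_set hsub).const_mul _) ?_
          filter_upwards [ae_restrict_mem measurableSet_Ioc] with s hs
          rw [norm_mul, mul_comm]
          gcongr
          · exact hres _ ⟨by linarith [hs.2], by linarith [hs.1, ht.2]⟩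
          · rfl
      _ = B * ∫ s in Ioc 0 t, |Kι i s - K s| := integral_const_mul _ _
      _ ≤ B * η := by
          gcongr
          exact setIntegral_mono_set hdiff (Eventually.of_forall fun s => abs_nonneg _)
            (Eventually.of_forall hsub)

/-! ### Scaling of resolvents, and the fractional kernel. -/

theorem volterraIter_scale (K : ℝ → ℝ) (c : ℝ) {T : ℝ} (hT : 0 < T) (m : ℕ) (t : ℝ) :
    volterraIter (fun s => c * K (T * s)) m t = (c / T) ^ m * volterraIter K m (T * t) := by
  induction m generalizing t with
  | zero => simp [volterraIter_zero]
  | succ m ih =>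
    rw [volterraIter_succ, volterraIter_succ]
    simp_rw [ih]
    rcases le_or_gt t 0 with h | h
    · rw [Ioc_eq_empty (by simpa using h),
        Ioc_eq_empty (by simpa using mul_nonpos_of_nonneg_of_nonpos hT.le h)]
      simp
    · rw [← intervalIntegral.integral_of_le h.le, ← intervalIntegral.integral_of_le (by positivity)]
      have := intervalIntegral.integral_comp_mul_left (a := 0) (b := t)
        (fun s => K s * volterraIter K m (T * t - s)) hT.ne'
      rw [mul_zero] at this
      rw [smul_eq_mul] at this
      calc ∫ s in (0:ℝ)..t, c * K (T * s) * ((c / T) ^ m * volterraIter K m (T * (t - s)))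
          = ∫ s in (0:ℝ)..t, (c * (c / T) ^ m) * (K (T * s) * volterraIter K m (T * t - T * s)) := by
            congr 1; ext s; rw [mul_sub]; ring
        _ = (c * (c / T) ^ m) * (T⁻¹ * ∫ s in (0:ℝ)..(T * t), K s * volterraIter K m (T * t - s)) := by
            rw [intervalIntegral.integral_const_mul, this]
        _ = _ := by rw [pow_succ]; field_simp

/-- Every convolution contributes one factor `1 / T` from the substitution and one factor `c` from
the kernel, which the spectral parameter absorbs. -/
theorem resolvent_scale (K : ℝ → ℝ) (c : ℝ) {T : ℝ} (hT : 0 < T) (lam t : ℝ) :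
    resolvent (fun s => c * K (T * s)) lam t = resolvent K (lam * (c / T)) (T * t) := by
  unfold resolvent
  refine tsum_congr fun m => ?_
  rw [volterraIter_scale K c hT, ← neg_mul, mul_pow]; ring

/-- The kernel `s ^ β / Γ(1 + β)` of fractional integration of order `1 + β`. -/
noncomputable def fracKernel (β s : ℝ) : ℝ := s ^ β / Real.Gamma (1 + β)

theorem integrableOn_fracKernel {β : ℝ} (hβ : -1 < β) (M : ℝ) :
    IntegrableOn (fracKernel β) (Ioc 0 M) := by
  rcases le_or_gt M 0 with h | h
  · rw [Ioc_eq_empty (by simpa using h)]; exact integrableOn_empty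
  · exact ((intervalIntegrable_iff_integrableOn_Ioc_of_le h.le).1
      (intervalIntegral.intervalIntegrable_rpow' hβ)).div_const _

/-- The semigroup property of fractional integration. -/
theorem fracKernel_conv {β γ : ℝ} (hβ : -1 < β) (hγ : -1 < γ) {t : ℝ} (ht : 0 < t) :
    ∫ s in Ioc 0 t, fracKernel β s * fracKernel γ (t - s) = fracKernel (β + γ + 1) t := by
  have h := Complex.betaIntegral_scaled ((1 + β : ℝ) : ℂ) ((1 + γ : ℝ) : ℂ) ht
  have hb := Complex.betaIntegral_eq_Gamma_mul_div ((1 + β : ℝ) : ℂ) ((1 + γ : ℝ) : ℂ)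
    (by simpa using by linarith) (by simpa using by linarith)
  have hΓβ : Real.Gamma (1 + β) ≠ 0 := (Real.Gamma_pos_of_pos (by linarith)).ne'
  have hΓγ : Real.Gamma (1 + γ) ≠ 0 := (Real.Gamma_pos_of_pos (by linarith)).ne'
  have hreal : ∫ s in (0:ℝ)..t, s ^ β * (t - s) ^ γ
      = t ^ (β + γ + 1) * (Real.Gamma (1 + β) * Real.Gamma (1 + γ)
          / Real.Gamma (1 + (β + γ + 1))) := by
    have e1 : ((∫ s in (0:ℝ)..t, s ^ β * (t - s) ^ γ : ℝ) : ℂ)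
        = ∫ s in (0:ℝ)..t, (s : ℂ) ^ (((1 + β : ℝ) : ℂ) - 1)
            * ((t : ℂ) - s) ^ (((1 + γ : ℝ) : ℂ) - 1) := by
      rw [← intervalIntegral.integral_ofReal]
      refine intervalIntegral.integral_congr fun s hs => ?_
      rw [uIcc_of_le ht.le] at hs
      simp only [Complex.ofReal_mul]
      rw [Complex.ofReal_cpow hs.1, Complex.ofReal_cpow (by linarith [hs.2])]
      push_cast
      congr 2 <;> ring
    have e2 : ((t : ℂ)) ^ ((((1 + β : ℝ) : ℂ)) + ((1 + γ : ℝ) : ℂ) - 1)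
        = ((t ^ (β + γ + 1) : ℝ) : ℂ) := by
      rw [Complex.ofReal_cpow ht.le]; push_cast; congr 1; ring
    rw [h, hb, e2] at e1
    have e3 : ((1 + β : ℝ) : ℂ) + ((1 + γ : ℝ) : ℂ) = ((1 + (β + γ + 1) : ℝ) : ℂ) := by
      push_cast; ring
    rw [e3, Complex.Gamma_ofReal, Complex.Gamma_ofReal, Complex.Gamma_ofReal] at e1
    exact_mod_cast e1
  rw [← intervalIntegral.integral_of_le ht.le]
  unfold fracKernel
  calc ∫ s in (0:ℝ)..t, s ^ β / Real.Gamma (1 + β) * ((t - s) ^ γ / Real.Gamma (1 + γ))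
      = ∫ s in (0:ℝ)..t, (Real.Gamma (1 + β) * Real.Gamma (1 + γ))⁻¹ * (s ^ β * (t - s) ^ γ) := by
        congr 1; ext s; field_simp
    _ = _ := by
        rw [intervalIntegral.integral_const_mul, hreal]; field_simp

theorem volterraIter_fracKernel {β : ℝ} (hβ : -1 < β) (m : ℕ) {t : ℝ} (ht : 0 ≤ t) :
    volterraIter (fracKernel β) m t = t ^ ((1 + β) * m) / Real.Gamma (1 + (1 + β) * m) := by
  induction m generalizing t with
  | zero => simp [volterraIter_zero]
  | succ m ih =>
    rcases ht.eq_or_lt with rfl | ht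
    · rw [volterraIter_succ_of_nonpos _ _ le_rfl, Real.zero_rpow, zero_div]
      have : 0 < 1 + β := by linarith
      positivity
    · have hγ : -1 < (1 + β) * m := by
        have : 0 ≤ (1 + β) * m := mul_nonneg (by linarith) (Nat.cast_nonneg m)
        linarith
      rw [volterraIter_succ]
      have := fracKernel_conv hβ hγ ht
      have e : β + (1 + β) * m + 1 = (1 + β) * ((m + 1 : ℕ) : ℝ) := by push_cast; ring
      rw [e] at this
      rw [← fracKernel, ← this]
      refine setIntegral_congr_fun measurableSet_Ioc fun s hs => ?_
      rw [ih (by linarith [hs.2])]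
      rfl

/-- The resolvent of the fractional kernel is the Mittag-Leffler function. -/
theorem mittagLeffler_eq_resolvent {β : ℝ} (hβ : -1 < β) (lam : ℝ) {t : ℝ} (ht : 0 ≤ t) :
    mittagLeffler (1 + β) ((-(lam * t ^ (1 + β)) : ℝ) : ℂ)
      = ((resolvent (fracKernel β) lam t : ℝ) : ℂ) := by
  unfold mittagLeffler resolvent
  rw [Complex.ofReal_tsum]
  refine tsum_congr fun m => ?_
  rw [volterraIter_fracKernel hβ m ht, Real.rpow_mul ht, Real.rpow_natCast]
  push_cast
  rw [← neg_mul, mul_pow]; ring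

end SelfSimilar

namespace SelfSimilar

/-! ### Regularly varying functions -/

/-- Baire category in the additive variable `x = log τ`. For each `x` the ratio `A(t eˣ) / A(t)`
converges to a positive number, so it lies between `1/N` and `N` for `t` beyond `N` plus a constant,
if `N` is large. These sets of `x` are closed by continuity of `A`, they cover the line, and one of
them contains a ball, which is then translated to the origin. -/
theorem IsRegularlyVarying.exists_local_bound {A : ℝ → ℝ} {β : ℝ} (hA : IsRegularlyVarying A β)
    (hc : Continuous A) : ∃ δ > 0, ∃ C ≥ 1, ∃ X > 0, ∀ t ≥ X, ∀ v, |v| ≤ δ →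
      A (t * Real.exp v) ≤ C * A t := by
  obtain ⟨X₀, hX₀⟩ := eventually_atTop.1 hA.1
  let E : ℕ → Set ℝ := fun N => {x | ∀ t ≥ max X₀ 1 + N,
    A (t * Real.exp x) ≤ N * A t ∧ A t ≤ N * A (t * Real.exp x)}
  have hclosed : ∀ N, IsClosed (E N) := by
    intro N
    have : E N = ⋂ t ∈ Ici (max X₀ 1 + (N : ℝ)), ({x | A (t * Real.exp x) ≤ N * A t}
        ∩ {x | A t ≤ N * A (t * Real.exp x)}) := by
      ext x; simp [E]
    rw [this]
    refine isClosed_biInter fun t _ => IsClosed.inter ?_ ?_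
    · exact isClosed_le (by fun_prop) continuous_const
    · exact isClosed_le continuous_const (by fun_prop)
  have hunion : ⋃ N, E N = univ := by
    refine eq_univ_of_forall fun x => mem_iUnion.2 ?_
    have hlim := hA.2 (Real.exp x) (Real.exp_pos x)
    set y := Real.exp x ^ β with hy
    have hypos : 0 < y := Real.rpow_pos_of_pos (Real.exp_pos x) _
    have ev := (hlim.eventually_lt_const (show y < 2 * y by linarith)).and
      (hlim.eventually_const_lt (show y / 2 < y by linarith))
    obtain ⟨X₁, hX₁⟩ := eventually_atTop.1 (ev.and hA.1)
    obtain ⟨N, hN⟩ := exists_nat_ge (max X₁ (max (2 * y) (2 / y)))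
    refine ⟨N, fun t ht => ?_⟩
    have h1 : X₁ ≤ N := (le_max_left _ _).trans hN
    have h2 : 2 * y ≤ N := ((le_max_left _ _).trans (le_max_right _ _)).trans hN
    have h3 : 2 / y ≤ N := ((le_max_right _ _).trans (le_max_right _ _)).trans hN
    have h4 : (1 : ℝ) ≤ max X₀ 1 := le_max_right _ _
    obtain ⟨⟨ha, hb⟩, hpos⟩ := hX₁ t (by linarith)
    rw [div_lt_iff₀ hpos] at ha
    rw [lt_div_iff₀ hpos] at hb
    refine ⟨ha.le.trans (by gcongr), ?_⟩
    have h5 : A t ≤ 2 / y * A (t * Real.exp x) := by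
      rw [div_mul_eq_mul_div, le_div_iff₀ hypos]; linarith
    refine h5.trans ?_
    have : 0 < A (t * Real.exp x) := lt_trans (by positivity) hb
    gcongr
  obtain ⟨N, x₀, hx₀⟩ := nonempty_interior_of_iUnion_of_closed hclosed hunion
  obtain ⟨δ, hδ, hball⟩ := Metric.mem_nhds_iff.1 (mem_interior_iff_mem_nhds.1 hx₀)
  have hx₀E : x₀ ∈ E N := interior_subset hx₀
  have hpos1 : (0 : ℝ) < max X₀ 1 + N := by
    have : (1 : ℝ) ≤ max X₀ 1 := le_max_right _ _
    positivity
  refine ⟨δ / 2, by positivity, max 1 ((N : ℝ) * N), le_max_left _ _,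
    max (max X₀ 1 + N) ((max X₀ 1 + N) * Real.exp x₀), lt_max_of_lt_left hpos1, fun t ht v hv => ?_⟩
  have hv' : x₀ + v ∈ E N := hball (by
    rw [Metric.mem_ball, Real.dist_eq]; simpa using lt_of_le_of_lt hv (by linarith))
  -- The translation: `A(t eᵛ)` is compared with `A(t e^{-x₀})` by the upper inequality at `x₀ + v`,
  -- and the latter with `A(t)` by the lower inequality at `x₀`. This needs the base point `t
  -- e^{-x₀}` to be large.
  have ht' : max X₀ 1 + N ≤ t * Real.exp (-x₀) := by
    rw [Real.exp_neg, ← div_eq_mul_inv, le_div_iff₀ (Real.exp_pos _)]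
    exact (le_max_right _ _).trans ht
  have h1 := (hv' _ ht').1
  have h2 := (hx₀E _ ht').2
  rw [mul_assoc, ← Real.exp_add, show -x₀ + (x₀ + v) = v by ring] at h1
  rw [mul_assoc (t : ℝ), ← Real.exp_add, show -x₀ + x₀ = 0 by ring, Real.exp_zero, mul_one] at h2
  have htpos : 0 < A t := by
    refine hX₀ t ((le_max_left X₀ 1).trans ?_)
    have h6 : max X₀ 1 + (N : ℝ) ≤ t := (le_max_left _ _).trans ht
    have : (0 : ℝ) ≤ N := Nat.cast_nonneg N
    linarith
  calc A (t * Real.exp v) ≤ N * (N * A t) := h1.trans (by gcongr)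
    _ = (N * N : ℝ) * A t := by ring
    _ ≤ _ := by gcongr; exact le_max_right _ _

/-- A displacement of size at most `1` is divided into `k ≥ 1/δ` displacements to which the local
bound applies; each costs one factor `C`. -/
theorem IsRegularlyVarying.exists_bound {A : ℝ → ℝ} {β : ℝ} (hA : IsRegularlyVarying A β)
    (hc : Continuous A) : ∃ C ≥ 1, ∃ X > 0, ∀ t ≥ X, ∀ v, |v| ≤ 1 →
      A (t * Real.exp v) ≤ C * A t := by
  obtain ⟨δ, hδ, C, hC, X, hX, h⟩ := hA.exists_local_bound hc
  have step : ∀ k : ℕ, ∀ t ≥ X * Real.exp (k * δ), ∀ v, |v| ≤ k * δ →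
      A (t * Real.exp v) ≤ C ^ k * A t := by
    intro k
    induction k with
    | zero =>
      intro t _ v hv
      have : v = 0 := by simpa using hv
      simp [this]
    | succ k ih =>
      intro t ht v hv
      push_cast at ht hv
      set v' := v * (k / (k + 1)) with hv'
      have hk : (0 : ℝ) < k + 1 := by positivity
      have e : v = v' + v / (k + 1) := by rw [hv']; field_simp
      have h1 : |v'| ≤ k * δ := by
        rw [hv', abs_mul, abs_of_nonneg (by positivity : (0 : ℝ) ≤ k / (k + 1))]
        calc |v| * (k / (k + 1)) ≤ (k + 1) * δ * (k / (k + 1)) := by gcongr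
          _ = k * δ := by field_simp
      have h2 : |v / (k + 1)| ≤ δ := by
        rw [abs_div, abs_of_pos hk, div_le_iff₀ hk]; linarith
      have hge : X * Real.exp (k * δ) ≤ t * Real.exp (v / (k + 1)) := by
        have hh : t * Real.exp (-δ) ≤ t * Real.exp (v / (k + 1)) := by
          have : 0 ≤ t := le_trans (by positivity) ht
          gcongr; exact (abs_le.1 h2).1
        refine le_trans ?_ hh
        rw [Real.exp_neg, ← div_eq_mul_inv, le_div_iff₀ (Real.exp_pos _), mul_assoc,
          ← Real.exp_add]
        rwa [show (k : ℝ) * δ + δ = (k + 1) * δ by ring]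
      have htX : X ≤ t := le_trans (le_mul_of_one_le_right hX.le
        (Real.one_le_exp (by positivity))) ht
      calc A (t * Real.exp v) = A (t * Real.exp (v / (k + 1)) * Real.exp v') := by
            rw [mul_assoc, ← Real.exp_add]; congr 3; rw [add_comm]; exact e
        _ ≤ C ^ k * (C * A t) := (ih _ hge _ h1).trans (by gcongr; exact h t htX _ h2)
        _ = _ := by ring
  obtain ⟨k, hk⟩ := exists_nat_ge (1 / δ)
  rw [div_le_iff₀ hδ] at hk
  exact ⟨C ^ k, one_le_pow₀ hC, X * Real.exp (k * δ), by positivity, fun t ht v hv =>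
    step k t ht v (hv.trans hk)⟩

/-- Potter's bounds. -/
theorem IsRegularlyVarying.potter {A : ℝ → ℝ} {β : ℝ} (hA : IsRegularlyVarying A β)
    (hc : Continuous A) {ε : ℝ} (hε : 0 < ε) : ∃ C > 0, ∃ X > 0, (∀ t ≥ X, 0 < A t) ∧
      (∀ t ≥ X, ∀ τ ≥ 1, A (t * τ) ≤ C * τ ^ (β + ε) * A t) ∧
      (∀ t ≥ X, ∀ τ, 0 < τ → τ ≤ 1 → X ≤ t * τ → A (t * τ) ≤ C * τ ^ (β - ε) * A t) := by
  obtain ⟨C, hC, X, hX, h⟩ := hA.exists_bound hc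
  have hlim := hA.2 (Real.exp 1) (Real.exp_pos 1)
  have hy : Real.exp 1 ^ β = Real.exp β := by rw [← Real.exp_mul, one_mul]
  rw [hy] at hlim
  have ev := (hlim.eventually_lt_const (show Real.exp β < Real.exp (β + ε) by
    gcongr; linarith)).and (hlim.eventually_const_lt (show Real.exp (β - ε) < Real.exp β by
    gcongr; linarith))
  obtain ⟨X₁, hX₁⟩ := eventually_atTop.1 (ev.and hA.1)
  set X₂ := max X X₁ with hX₂
  have hX₂pos : 0 < X₂ := lt_max_of_lt_left hX
  have hpos : ∀ t ≥ X₂, 0 < A t := fun t ht => (hX₁ t ((le_max_right _ _).trans ht)).2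
  -- The limit at the single ratio `τ = e`, iterated, controls `A` along `t eᵐ` from both sides. The
  -- fractional part of `log τ` is left to the uniform bound for `|v| ≤ 1`.
  have up : ∀ m : ℕ, ∀ t ≥ X₂, A (t * Real.exp m) ≤ Real.exp ((β + ε) * m) * A t := by
    intro m
    induction m with
    | zero => intro t _; simp
    | succ m ih =>
      intro t ht
      have hge : X₂ ≤ t * Real.exp m := ht.trans (le_mul_of_one_le_right
        (hX₂pos.le.trans ht) (Real.one_le_exp (Nat.cast_nonneg m)))
      have h1 := (hX₁ _ ((le_max_right _ _).trans hge)).1.1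
      rw [div_lt_iff₀ (hpos _ hge), mul_assoc, ← Real.exp_add] at h1
      push_cast
      refine h1.le.trans ?_
      calc Real.exp (β + ε) * A (t * Real.exp m)
          ≤ Real.exp (β + ε) * (Real.exp ((β + ε) * m) * A t) :=
            mul_le_mul_of_nonneg_left (ih t ht) (Real.exp_pos _).le
        _ = _ := by rw [mul_add, Real.exp_add _ ((β + ε) * 1), mul_one]; ring
  have low : ∀ m : ℕ, ∀ t ≥ X₂, Real.exp ((β - ε) * m) * A t ≤ A (t * Real.exp m) := by
    intro m
    induction m with
    | zero => intro t _; simp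
    | succ m ih =>
      intro t ht
      have hge : X₂ ≤ t * Real.exp m := ht.trans (le_mul_of_one_le_right
        (hX₂pos.le.trans ht) (Real.one_le_exp (Nat.cast_nonneg m)))
      have h1 := (hX₁ _ ((le_max_right _ _).trans hge)).1.2
      rw [lt_div_iff₀ (hpos _ hge), mul_assoc, ← Real.exp_add] at h1
      push_cast
      refine le_trans ?_ h1.le
      calc Real.exp ((β - ε) * (m + 1)) * A t
          = Real.exp (β - ε) * (Real.exp ((β - ε) * m) * A t) := by
            rw [mul_add, Real.exp_add _ ((β - ε) * 1), mul_one]; ring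
        _ ≤ _ := mul_le_mul_of_nonneg_left (ih t ht) (Real.exp_pos _).le
  have frac : ∀ y : ℝ, 0 ≤ y → |y - ⌊y⌋₊| ≤ 1 := fun y hy => by
    rw [abs_le]; constructor <;> linarith [Nat.floor_le hy, Nat.lt_floor_add_one y]
  refine ⟨C * Real.exp (|β| + ε), by positivity, X₂, hX₂pos, hpos, fun t ht τ hτ => ?_,
    fun t ht τ hτ0 hτ1 htτ => ?_⟩
  · set y := Real.log τ with hy'
    have hτpos : 0 < τ := by linarith
    have hy0 : 0 ≤ y := Real.log_nonneg hτ
    have hτe : τ = Real.exp ⌊y⌋₊ * Real.exp (y - ⌊y⌋₊) := by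
      rw [← Real.exp_add, add_sub_cancel, hy', Real.exp_log hτpos]
    have hge : X₂ ≤ t * Real.exp ⌊y⌋₊ := ht.trans (le_mul_of_one_le_right
        (hX₂pos.le.trans ht) (Real.one_le_exp (Nat.cast_nonneg _)))
    have h1 := h _ ((le_max_left _ _).trans hge) _ (frac y hy0)
    rw [mul_assoc, ← hτe] at h1
    refine h1.trans ?_
    have h2 : Real.exp ((β + ε) * ⌊y⌋₊) ≤ Real.exp (|β| + ε) * τ ^ (β + ε) := by
      rw [Real.rpow_def_of_pos hτpos, ← Real.exp_add, ← hy']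
      gcongr
      have h3 : -(β + ε) * (y - ⌊y⌋₊) ≤ |β| + ε := by
        calc -(β + ε) * (y - ⌊y⌋₊) ≤ |(-(β + ε)) * (y - ⌊y⌋₊)| := le_abs_self _
          _ = |β + ε| * |y - ⌊y⌋₊| := by rw [abs_mul, abs_neg]
          _ ≤ (|β| + ε) * 1 := by
            gcongr
            · exact (abs_add_le _ _).trans (by rw [abs_of_pos hε])
            · exact frac y hy0
          _ = _ := mul_one _
      linarith
    have hAt := hpos t ht
    calc C * A (t * Real.exp ⌊y⌋₊) ≤ C * (Real.exp ((β + ε) * ⌊y⌋₊) * A t) := by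
          gcongr; exact up _ t ht
      _ ≤ C * (Real.exp (|β| + ε) * τ ^ (β + ε) * A t) := by gcongr
      _ = _ := by ring
  · set y := -Real.log τ with hy'
    have hy0 : 0 ≤ y := neg_nonneg.2 (Real.log_nonpos hτ0.le hτ1)
    have hτe : τ = Real.exp (-y) := by rw [hy', neg_neg, Real.exp_log hτ0]
    -- For `τ ≤ 1` the steps are taken upwards from `t τ`, which must itself be beyond the
    -- threshold.
    have h1 := low ⌊y⌋₊ _ htτ
    have h2 := h t ((le_max_left _ _).trans ht) (-(y - ⌊y⌋₊)) (by rw [abs_neg]; exact frac y hy0)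
    have e : t * τ * Real.exp ⌊y⌋₊ = t * Real.exp (-(y - ⌊y⌋₊)) := by
      rw [hτe, mul_assoc, ← Real.exp_add]; congr 2; ring
    rw [e] at h1
    have h3 : A (t * τ) ≤ Real.exp (-((β - ε) * ⌊y⌋₊)) * (C * A t) := by
      rw [Real.exp_neg, ← div_eq_inv_mul, le_div_iff₀ (Real.exp_pos _), mul_comm]
      exact h1.trans h2
    refine h3.trans ?_
    have h4 : Real.exp (-((β - ε) * ⌊y⌋₊)) ≤ Real.exp (|β| + ε) * τ ^ (β - ε) := by
      rw [Real.rpow_def_of_pos hτ0, ← Real.exp_add, show Real.log τ = -y by rw [hy', neg_neg]]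
      gcongr
      have h3 : (β - ε) * (y - ⌊y⌋₊) ≤ |β| + ε := by
        calc (β - ε) * (y - ⌊y⌋₊) ≤ |(β - ε) * (y - ⌊y⌋₊)| := le_abs_self _
          _ = |β - ε| * |y - ⌊y⌋₊| := by rw [abs_mul]
          _ ≤ (|β| + ε) * 1 := by
            gcongr
            · exact (abs_sub _ _).trans (by rw [abs_of_pos hε])
            · exact frac y hy0
          _ = _ := mul_one _
      linarith
    have hAt := hpos t ht
    calc Real.exp (-((β - ε) * ⌊y⌋₊)) * (C * A t)
        ≤ Real.exp (|β| + ε) * τ ^ (β - ε) * (C * A t) := by gcongr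
      _ = _ := by ring

/-- The rescaled kernels `A(T τ) / (A(T) Γ(1 + β))`. -/
noncomputable def scaledKernel (A : ℝ → ℝ) (β T τ : ℝ) : ℝ :=
  A (T * τ) / (A T * Real.Gamma (1 + β))

variable {A : ℝ → ℝ} {β : ℝ}

/-- Potter's bound between the fixed point `X` and `T` gives `A(T) ≥ const * T ^ (β - ε)`. With `ε =
(1 + β) / 2` the product `T A(T)` grows at least like `T ^ ((1 + β) / 2)`. -/
theorem IsRegularlyVarying.tendsto_mul_self (hA : IsRegularlyVarying A β) (hc : Continuous A)
    (hβ : -1 < β) : Tendsto (fun T => T * A T) atTop atTop := by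
  have hε : 0 < (1 + β) / 2 := by linarith
  obtain ⟨C, hC, X, hX, hpos, -, hlow⟩ := hA.potter hc hε
  have hp : 0 < (1 + β) / 2 := hε
  have hAX := hpos X le_rfl
  have hbase : Tendsto (fun T : ℝ => A X / C * X ^ (-(β - (1 + β) / 2)) * T ^ ((1 + β) / 2))
      atTop atTop := (tendsto_rpow_atTop hp).const_mul_atTop (by positivity)
  refine tendsto_atTop_mono' _ ?_ hbase
  filter_upwards [eventually_ge_atTop X] with T hT
  have hTpos : 0 < T := hX.trans_le hT
  have h := hlow T hT (X / T) (by positivity) ((div_le_one hTpos).2 hT)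
    (by rw [mul_div_cancel₀ _ hTpos.ne'])
  rw [mul_div_cancel₀ _ hTpos.ne', Real.div_rpow hX.le hTpos.le] at h
  have e : T ^ ((1 + β) / 2) = T * T ^ (β - (1 + β) / 2) := by
    rw [← Real.rpow_one_add' hTpos.le (by linarith)]; congr 1; ring
  have hXp : 0 < X ^ (β - (1 + β) / 2) := Real.rpow_pos_of_pos hX _
  have hTp : 0 < T ^ (β - (1 + β) / 2) := Real.rpow_pos_of_pos hTpos _
  rw [e, Real.rpow_neg hX.le]
  have h2 : A X * T ^ (β - (1 + β) / 2) ≤ C * X ^ (β - (1 + β) / 2) * A T := by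
    rw [mul_comm C, mul_assoc, div_mul_eq_mul_div, le_div_iff₀ hTp] at h
    linarith
  calc A X / C * (X ^ (β - (1 + β) / 2))⁻¹ * (T * T ^ (β - (1 + β) / 2))
      = T * ((A X * T ^ (β - (1 + β) / 2)) / (C * X ^ (β - (1 + β) / 2))) := by field_simp
    _ ≤ T * A T := by
      gcongr
      rw [div_le_iff₀ (by positivity)]; linarith

/-- Potter's bounds say nothing where `T τ ≤ X`. The mass of the rescaled kernel on this interval is
a constant divided by `T A(T)` and so vanishes in the limit. -/
theorem setIntegral_abs_scaledKernel (A : ℝ → ℝ) (β : ℝ) {T X : ℝ} (hT : 0 < T) (hX : 0 ≤ X)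
    (hAT : 0 < A T) (hβ : -1 < β) :
    ∫ τ in Ioc 0 (X / T), |scaledKernel A β T τ|
      = (∫ s in Ioc 0 X, |A s|) / (T * A T * Real.Gamma (1 + β)) := by
  have hΓ : 0 < Real.Gamma (1 + β) := Real.Gamma_pos_of_pos (by linarith)
  rw [← intervalIntegral.integral_of_le (by positivity), ← intervalIntegral.integral_of_le hX]
  unfold scaledKernel
  have := intervalIntegral.integral_comp_mul_left (a := 0) (b := X / T) (fun s => |A s|) hT.ne'
  rw [mul_zero, mul_div_cancel₀ _ hT.ne', smul_eq_mul] at this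
  simp_rw [abs_div, abs_of_pos (mul_pos hAT hΓ)]
  rw [intervalIntegral.integral_div, this]
  field_simp

/-- Convergence of the rescaled kernels in weighted `L¹(0, ∞)`. -/
theorem IsRegularlyVarying.tendsto_integral_scaledKernel (hA : IsRegularlyVarying A β)
    (hc : Continuous A) (hβ : -1 < β) {g : ℝ → ℝ} (hg : Measurable g) (hg0 : ∀ τ, 0 ≤ g τ)
    (hg1 : ∀ τ, 0 < τ → g τ ≤ 1)
    (hgi : IntegrableOn (fun τ => g τ * (τ ^ (β - (1 + β) / 2) + τ ^ (β + (1 + β) / 2))) (Ioi 0)) :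
    Tendsto (fun T => ∫ τ in Ioi 0, g τ * |scaledKernel A β T τ - fracKernel β τ|) atTop (𝓝 0) := by
  have hε : 0 < (1 + β) / 2 := by linarith
  have hΓ : 0 < Real.Gamma (1 + β) := Real.Gamma_pos_of_pos (by linarith)
  obtain ⟨C, hC, X, hX, hpos, hup, hlow⟩ := hA.potter hc hε
  set p : ℝ → ℝ := fun τ => τ ^ (β - (1 + β) / 2) + τ ^ (β + (1 + β) / 2) with hp
  -- The part of the kernel within reach of Potter's bounds. It converges pointwise and is dominated
  -- by a multiple of `p`; the rest has small mass, and there the weight is only needed to be at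
  -- most `1`.
  let B : ℝ → ℝ → ℝ := fun T τ => if X ≤ T * τ then scaledKernel A β T τ else 0
  have hmeasS : ∀ T, Measurable (scaledKernel A β T) := fun T =>
    (hc.measurable.comp (measurable_const.mul measurable_id)).div_const _
  have hmeasB : ∀ T, Measurable (B T) := fun T =>
    Measurable.ite (measurableSet_le measurable_const (measurable_const.mul measurable_id))
      (hmeasS T) measurable_const
  have hmeasF : Measurable (fracKernel β) := (measurable_id.pow_const β).div_const _
  have hpow : ∀ τ : ℝ, 0 < τ → τ ^ β ≤ p τ := by
    intro τ hτ
    rcases le_total 1 τ with h | h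
    · have : τ ^ β ≤ τ ^ (β + (1 + β) / 2) := Real.rpow_le_rpow_of_exponent_le h (by linarith)
      have h2 : 0 ≤ τ ^ (β - (1 + β) / 2) := by positivity
      simp only [hp]; linarith
    · have : τ ^ β ≤ τ ^ (β - (1 + β) / 2) := Real.rpow_le_rpow_of_exponent_ge hτ h (by linarith)
      have h2 : 0 ≤ τ ^ (β + (1 + β) / 2) := by positivity
      simp only [hp]; linarith
  have hBbound : ∀ T ≥ X, ∀ τ, 0 < τ → |B T τ| ≤ C / Real.Gamma (1 + β) * p τ := by
    intro T hT τ hτ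
    have hp0 : 0 ≤ p τ := le_trans (by positivity) (hpow τ hτ)
    by_cases h : X ≤ T * τ
    · have hAT := hpos T hT
      have hnum := hpos _ h
      simp only [B, if_pos h, scaledKernel]
      rw [abs_of_pos (by positivity), div_le_iff₀ (by positivity)]
      have : A (T * τ) ≤ C * p τ * A T := by
        rcases le_total 1 τ with h' | h'
        · refine (hup T hT τ h').trans ?_
          gcongr
          exact le_add_of_nonneg_left (by positivity)
        · refine (hlow T hT τ hτ h' h).trans ?_
          gcongr
          exact le_add_of_nonneg_right (by positivity)
      calc A (T * τ) ≤ C * p τ * A T := this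
        _ = _ := by field_simp
    · simp only [B, if_neg h, abs_zero]; positivity
  have hlim1 : Tendsto (fun T => ∫ τ in Ioi 0, g τ * |B T τ - fracKernel β τ|) atTop (𝓝 0) := by
    have h0 : ∫ τ in Ioi (0 : ℝ), (0 : ℝ) = 0 := by simp
    suffices Tendsto (fun T => ∫ τ in Ioi 0, g τ * |B T τ - fracKernel β τ|) atTop
      (𝓝 (∫ τ in Ioi (0 : ℝ), (0 : ℝ))) by rwa [h0] at this
    refine tendsto_integral_filter_of_dominated_convergence
      (fun τ => (C / Real.Gamma (1 + β) + 1 / Real.Gamma (1 + β)) * (g τ * p τ)) ?_ ?_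
      (hgi.const_mul _) ?_
    · exact Eventually.of_forall fun T =>
        (hg.mul ((hmeasB T).sub hmeasF).abs).aestronglyMeasurable
    · filter_upwards [eventually_ge_atTop X] with T hT
      filter_upwards [ae_restrict_mem measurableSet_Ioi] with τ hτ
      rw [Real.norm_of_nonneg (mul_nonneg (hg0 τ) (abs_nonneg _)), mul_left_comm]
      refine mul_le_mul_of_nonneg_left ?_ (hg0 τ)
      refine (abs_sub _ _).trans ?_
      rw [add_mul]
      gcongr
      · exact hBbound T hT τ hτ
      · unfold fracKernel
        rw [abs_of_nonneg (by have := (mem_Ioi.1 hτ).le; positivity), div_eq_inv_mul, one_div]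
        gcongr
        exact hpow τ hτ
    · filter_upwards [ae_restrict_mem measurableSet_Ioi] with τ hτ
      have h1 : Tendsto (fun T => B T τ) atTop (𝓝 (fracKernel β τ)) := by
        have h2 := (hA.2 τ hτ).div_const (Real.Gamma (1 + β))
        refine h2.congr' ?_
        filter_upwards [(tendsto_id.atTop_mul_const (mem_Ioi.1 hτ)).eventually_ge_atTop X] with T hT
        simp only [B]
        rw [if_pos (by simpa using hT), scaledKernel, div_div]
      have h3 := ((h1.sub_const (fracKernel β τ)).abs).const_mul (g τ)
      simpa using h3
  have hlim2 : Tendsto (fun T => (∫ s in Ioc 0 X, |A s|) / (T * A T * Real.Gamma (1 + β)))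
      atTop (𝓝 0) :=
    tendsto_const_nhds.div_atTop ((hA.tendsto_mul_self hc hβ).atTop_mul_const hΓ)
  have hsum := hlim1.add hlim2
  rw [add_zero] at hsum
  refine tendsto_of_tendsto_of_tendsto_of_le_of_le' tendsto_const_nhds hsum
    (Eventually.of_forall fun T => integral_nonneg fun τ => mul_nonneg (hg0 τ) (abs_nonneg _)) ?_
  filter_upwards [eventually_ge_atTop X] with T hT
  have hTpos : 0 < T := hX.trans_le hT
  rw [← setIntegral_abs_scaledKernel A β hTpos hX.le (hpos T hT) hβ]
  have hi1 : IntegrableOn (fun τ => g τ * |B T τ - fracKernel β τ|) (Ioi 0) := by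
    refine Integrable.mono'
      (g := fun τ => (C / Real.Gamma (1 + β) + 1 / Real.Gamma (1 + β)) * (g τ * p τ))
      (hgi.const_mul _) (hg.mul ((hmeasB T).sub hmeasF).abs).aestronglyMeasurable ?_
    filter_upwards [ae_restrict_mem measurableSet_Ioi] with τ hτ
    rw [Real.norm_of_nonneg (mul_nonneg (hg0 τ) (abs_nonneg _)), mul_left_comm]
    refine mul_le_mul_of_nonneg_left ?_ (hg0 τ)
    refine (abs_sub _ _).trans ?_
    rw [add_mul]
    gcongr
    · exact hBbound T hT τ hτ
    · unfold fracKernel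
      rw [abs_of_nonneg (by have := (mem_Ioi.1 hτ).le; positivity), div_eq_inv_mul, one_div]
      gcongr
      exact hpow τ hτ
  have hi2 : IntegrableOn (fun τ => |scaledKernel A β T τ|) (Ioc 0 (X / T)) := by
    refine (ContinuousOn.integrableOn_Icc ?_).mono_set Ioc_subset_Icc_self
    unfold scaledKernel
    fun_prop
  have hi3 : IntegrableOn ((Ioc 0 (X / T)).indicator fun τ => |scaledKernel A β T τ|) (Ioi 0) :=
    ((integrable_indicator_iff measurableSet_Ioc).2 hi2).integrableOn
  calc ∫ τ in Ioi 0, g τ * |scaledKernel A β T τ - fracKernel β τ|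
      ≤ ∫ τ in Ioi 0, (g τ * |B T τ - fracKernel β τ|
          + (Ioc 0 (X / T)).indicator (fun τ => |scaledKernel A β T τ|) τ) := by
        refine integral_mono_of_nonneg (Eventually.of_forall fun τ =>
          mul_nonneg (hg0 τ) (abs_nonneg _)) (hi1.add hi3) ?_
        filter_upwards [ae_restrict_mem measurableSet_Ioi] with τ hτ
        by_cases h : X ≤ T * τ
        · simp only [B, if_pos h]
          exact le_add_of_nonneg_right (indicator_nonneg (fun _ _ => abs_nonneg _) _)
        · have hmem : τ ∈ Ioc 0 (X / T) := ⟨hτ, by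
            rw [le_div_iff₀ hTpos, mul_comm]; exact (not_le.1 h).le⟩
          simp only [B, if_neg h, indicator_of_mem hmem]
          have h1 : |scaledKernel A β T τ - fracKernel β τ|
              ≤ |0 - fracKernel β τ| + |scaledKernel A β T τ| := by
            rw [zero_sub, abs_neg, add_comm]; exact abs_sub _ _
          calc g τ * |scaledKernel A β T τ - fracKernel β τ|
              ≤ g τ * (|0 - fracKernel β τ| + |scaledKernel A β T τ|) := by
                have := hg0 τ
                gcongr
            _ ≤ _ := by
              rw [mul_add]
              gcongr
              exact mul_le_of_le_one_left (abs_nonneg _) (hg1 τ hτ)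
    _ = _ := by
        rw [integral_add hi1 hi3]
        congr 1
        rw [setIntegral_indicator measurableSet_Ioc]
        congr 2
        exact inter_eq_right.2 fun τ hτ => hτ.1

theorem IsRegularlyVarying.tendsto_scaledKernel_Ioc (hA : IsRegularlyVarying A β)
    (hc : Continuous A) (hβ : -1 < β) (M : ℝ) :
    Tendsto (fun T => ∫ τ in Ioc 0 M, |scaledKernel A β T τ - fracKernel β τ|) atTop (𝓝 0) := by
  have key := hA.tendsto_integral_scaledKernel hc hβ (g := (Ioc 0 M).indicator 1)
    (measurable_one.indicator measurableSet_Ioc) (fun τ => indicator_nonneg (by simp) τ)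
    (fun τ _ => indicator_le_self' (by simp) τ) ?_
  · refine key.congr fun T => ?_
    have : ∀ τ, (Ioc 0 M).indicator (1 : ℝ → ℝ) τ * |scaledKernel A β T τ - fracKernel β τ|
        = (Ioc 0 M).indicator (fun τ => |scaledKernel A β T τ - fracKernel β τ|) τ := by
      intro τ; by_cases h : τ ∈ Ioc 0 M <;> simp [h]
    simp_rw [this]
    rw [setIntegral_indicator measurableSet_Ioc]
    congr 2
    exact inter_eq_right.2 fun τ hτ => hτ.1
  · have : (fun τ : ℝ => (Ioc 0 M).indicator (1 : ℝ → ℝ) τ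
        * (τ ^ (β - (1 + β) / 2) + τ ^ (β + (1 + β) / 2)))
        = (Ioc 0 M).indicator (fun τ => τ ^ (β - (1 + β) / 2) + τ ^ (β + (1 + β) / 2)) := by
      ext τ; by_cases h : τ ∈ Ioc 0 M <;> simp [h]
    rw [this]
    refine ((integrable_indicator_iff measurableSet_Ioc).2 ?_).integrableOn
    rcases le_or_gt M 0 with h | h
    · rw [Ioc_eq_empty (by simpa using h)]; exact integrableOn_empty
    · exact ((intervalIntegrable_iff_integrableOn_Ioc_of_le h.le).1
        (intervalIntegral.intervalIntegrable_rpow' (by linarith))).add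
        ((intervalIntegrable_iff_integrableOn_Ioc_of_le h.le).1
        (intervalIntegral.intervalIntegrable_rpow' (by linarith)))

/-! ### Exponential weights and kernels of linear growth. -/

theorem integrableOn_exp_mul_rpow {p c : ℝ} (hp : -1 < p) (hc : 0 < c) :
    IntegrableOn (fun τ : ℝ => Real.exp (-c * τ) * τ ^ p) (Ioi 0) := by
  have := integrableOn_rpow_mul_exp_neg_mul_rpow (p := 1) (s := p) hp one_pos hc
  simpa [mul_comm] using this

/-- A kernel with at most linear growth, extended by its value at `0` to negative times. -/
structure IsTameKernel (A : ℝ → ℝ) : Prop where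
  continuous : Continuous A
  growth : ∃ C, ∀ t, 0 ≤ t → |A t| ≤ C * (1 + t)

theorem IsTameKernel.integrableOn_Ioc (hA : IsTameKernel A) (M : ℝ) : IntegrableOn A (Ioc 0 M) :=
  (hA.continuous.integrableOn_Icc).mono_set Ioc_subset_Icc_self

theorem IsTameKernel.integrableOn_exp (hA : IsTameKernel A) {c : ℝ} (hc : 0 < c) :
    IntegrableOn (fun τ => Real.exp (-c * τ) * A τ) (Ioi 0) := by
  obtain ⟨C, hC⟩ := hA.growth
  have h0 := integrableOn_exp_mul_rpow (p := 0) (by norm_num) hc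
  have h1 := integrableOn_exp_mul_rpow (p := 1) (by norm_num) hc
  have hcont := hA.continuous
  refine Integrable.mono' ((h0.add h1).const_mul C)
    (by fun_prop : Continuous fun τ => Real.exp (-c * τ) * A τ).aestronglyMeasurable ?_
  filter_upwards [ae_restrict_mem measurableSet_Ioi] with τ hτ
  rw [norm_mul, Real.norm_of_nonneg (Real.exp_pos _).le, Real.norm_eq_abs]
  calc Real.exp (-c * τ) * |A τ| ≤ Real.exp (-c * τ) * (C * (1 + τ)) := by
        gcongr; exact hC τ (le_of_lt hτ)
    _ = _ := by simp only [Pi.add_apply, Real.rpow_zero, Real.rpow_one]; ring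

theorem IsTameKernel.scaled (hA : IsTameKernel A) (β : ℝ) {T : ℝ} (hT : 0 ≤ T) :
    IsTameKernel (scaledKernel A β T) := by
  obtain ⟨C, hC⟩ := hA.growth
  have hcont := hA.continuous
  refine ⟨by unfold scaledKernel; fun_prop, |C| * (1 + T) / |A T * Real.Gamma (1 + β)|,
    fun t ht => ?_⟩
  unfold scaledKernel
  rw [abs_div, div_mul_eq_mul_div]
  gcongr
  calc |A (T * t)| ≤ C * (1 + T * t) := hC _ (by positivity)
    _ ≤ |C| * (1 + T * t) := by gcongr; exact le_abs_self C
    _ ≤ |C| * ((1 + T) * (1 + t)) := by gcongr; nlinarith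
    _ = _ := by ring

/-- The weight `exp (-τ)` is admissible in `tendsto_integral_scaledKernel`, and the Laplace
transform of the fractional kernel at `1` is `1` by Euler's integral. Only the eventual
nonnegativity is needed: it anchors the estimate of the averages at high frequencies at the point `z
= 1`. -/
theorem IsRegularlyVarying.tendsto_laplace_one (hA : IsRegularlyVarying A β) (ht : IsTameKernel A)
    (hβ : -1 < β) :
    Tendsto (fun T => ∫ τ in Ioi 0, Real.exp (-1 * τ) * scaledKernel A β T τ) atTop (𝓝 1) := by
  have hΓ : 0 < Real.Gamma (1 + β) := Real.Gamma_pos_of_pos (by linarith)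
  have key := hA.tendsto_integral_scaledKernel ht.continuous hβ (g := fun τ => Real.exp (-1 * τ))
    (by fun_prop) (fun τ => (Real.exp_pos _).le) (fun τ hτ => Real.exp_le_one_iff.2 (by linarith)) ?_
  · have hfi : IntegrableOn (fun τ => Real.exp (-1 * τ) * fracKernel β τ) (Ioi 0) := by
      unfold fracKernel
      simp_rw [← mul_div_assoc]
      exact (integrableOn_exp_mul_rpow hβ one_pos).div_const _
    have hval : ∫ τ in Ioi 0, Real.exp (-1 * τ) * fracKernel β τ = 1 := by
      unfold fracKernel
      simp_rw [← mul_div_assoc]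
      rw [integral_div, div_eq_one_iff_eq hΓ.ne', Real.Gamma_eq_integral (by linarith)]
      simp
    rw [tendsto_iff_norm_sub_tendsto_zero]
    refine squeeze_zero' (Eventually.of_forall fun T => norm_nonneg _) ?_ key
    filter_upwards [eventually_ge_atTop 0] with T hT
    rw [show ∀ x : ℝ, x - 1 = x - ∫ τ in Ioi 0, Real.exp (-1 * τ) * fracKernel β τ by
      rw [hval]; exact fun _ => rfl]
    rw [← integral_sub ((ht.scaled β hT).integrableOn_exp one_pos) hfi]
    refine norm_integral_le_of_norm_le ?_ (Eventually.of_forall fun τ => ?_)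
    · have := (((ht.scaled β hT).integrableOn_exp one_pos).sub hfi).abs
      refine this.congr (Eventually.of_forall fun τ => ?_)
      simp only [Pi.sub_apply]
      rw [← mul_sub, abs_mul, abs_of_pos (Real.exp_pos _)]
    · rw [← mul_sub, norm_mul, Real.norm_of_nonneg (Real.exp_pos _).le, Real.norm_eq_abs]
  · simp_rw [mul_add]
    exact (integrableOn_exp_mul_rpow (by linarith) one_pos).add
      (integrableOn_exp_mul_rpow (by linarith) one_pos)

/-! ### The integrated kernel -/

/-- The integrated kernel, extended to negative times by its value at `0`. -/
noncomputable def kern (a₀ : ℝ) (a : ℝ → ℝ) (t : ℝ) : ℝ := primitive a₀ a (max t 0)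

theorem kern_of_nonneg (a₀ : ℝ) (a : ℝ → ℝ) {t : ℝ} (ht : 0 ≤ t) :
    kern a₀ a t = primitive a₀ a t := by rw [kern, max_eq_left ht]

variable {a₀ : ℝ} {a : ℝ → ℝ}

theorem IsAdmissibleKernel.integrableOn_Ioc (ha : IsAdmissibleKernel a₀ a) (M : ℝ) :
    IntegrableOn a (Ioc 0 M) := by
  obtain ⟨C, hC⟩ := ha.bounded (1 / 2) (by norm_num)
  have h1 : IntegrableOn a (Icc (1 / 2) (max M 1)) := by
    have hsub : Icc (1 / 2 : ℝ) (max M 1) ⊆ Ioi 0 := fun t ht =>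
      lt_of_lt_of_le (by norm_num) ht.1
    refine Integrable.mono' (g := fun _ => C) (by simp) (ha.aestronglyMeasurable.mono_set hsub) ?_
    · filter_upwards [ae_restrict_mem measurableSet_Icc] with t ht
      exact hC t ht.1
  refine (ha.integrable.union h1).mono_set fun t ht => ?_
  rcases lt_or_ge t 1 with h | h
  · exact Or.inl ⟨ht.1, h⟩
  · exact Or.inr ⟨by linarith, ht.2.trans (le_max_left _ _)⟩

/-- The singularity of `a` at `0` contributes a constant to the primitive, and boundedness of `a` on
`[1, ∞)` gives at most linear growth after that. -/
theorem IsAdmissibleKernel.isTameKernel (ha : IsAdmissibleKernel a₀ a) :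
    IsTameKernel (kern a₀ a) := by
  have hii : ∀ M, 0 ≤ M → IntervalIntegrable a volume 0 M := fun M hM =>
    (intervalIntegrable_iff_integrableOn_Ioc_of_le hM).2 (ha.integrableOn_Ioc M)
  constructor
  · unfold kern primitive
    refine continuous_const.add ?_
    have hcont : ∀ M, 0 ≤ M → ContinuousOn (fun t => ∫ s in (0:ℝ)..t, a s) (Icc 0 M) := by
      intro M hM
      have := intervalIntegral.continuousOn_primitive_interval
        (f := a) (μ := volume) (a := 0) (b := M) (by
          rw [uIcc_of_le hM, integrableOn_Icc_iff_integrableOn_Ioc]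
          exact ha.integrableOn_Ioc M)
      rwa [uIcc_of_le hM] at this
    rw [continuous_iff_continuousAt]
    intro t
    have hmaps : MapsTo (fun t : ℝ => max t 0) (Iio (|t| + 1)) (Icc 0 (|t| + 1)) := fun x hx =>
      ⟨le_max_right _ _, max_le (le_of_lt hx) (by positivity)⟩
    exact ((hcont (|t| + 1) (by positivity)).comp (by fun_prop) hmaps).continuousAt
      (Iio_mem_nhds (by linarith [le_abs_self t]))
  · obtain ⟨C, hC⟩ := ha.bounded 1 one_pos
    set I := ∫ s in Ioc 0 1, |a s| with hI
    have hC0 : 0 ≤ C := (abs_nonneg _).trans (hC 1 le_rfl)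
    have hI0 : 0 ≤ I := integral_nonneg fun s => abs_nonneg _
    refine ⟨|a₀| + I + C, fun t ht => ?_⟩
    rw [kern_of_nonneg _ _ ht, primitive]
    have h1 : |∫ s in (0:ℝ)..t, a s| ≤ I + C * t := by
      rw [intervalIntegral.integral_of_le ht]
      calc |∫ s in Ioc 0 t, a s| ≤ ∫ s in Ioc 0 t, |a s| := abs_integral_le_integral_abs
        _ ≤ ∫ s in Ioc 0 1 ∪ Ioc 1 (max t 1), |a s| := by
            refine setIntegral_mono_set ?_ (Eventually.of_forall fun s => abs_nonneg _)
              (Eventually.of_forall fun s hs => ?_)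
            · rw [Ioc_union_Ioc_eq_Ioc zero_le_one (le_max_right _ _)]
              exact (ha.integrableOn_Ioc _).abs
            · rw [Ioc_union_Ioc_eq_Ioc zero_le_one (le_max_right _ _)]
              exact ⟨hs.1, hs.2.trans (le_max_left _ _)⟩
        _ = I + ∫ s in Ioc 1 (max t 1), |a s| := by
            refine setIntegral_union (Ioc_disjoint_Ioc_of_le le_rfl) measurableSet_Ioc
              (ha.integrableOn_Ioc 1).abs ?_
            exact ((ha.integrableOn_Ioc (max t 1)).mono_set
              (Ioc_subset_Ioc_left zero_le_one)).abs
        _ ≤ I + ∫ s in Ioc 1 (max t 1), C := by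
            refine add_le_add le_rfl ?_
            refine setIntegral_mono_on ((ha.integrableOn_Ioc (max t 1)).mono_set
              (Ioc_subset_Ioc_left zero_le_one)).abs (integrableOn_const (by simp))
              measurableSet_Ioc fun s hs => ?_
            exact hC s hs.1.le
        _ ≤ I + C * t := by
            gcongr
            rw [setIntegral_const, smul_eq_mul, mul_comm]
            gcongr
            rw [Measure.real, Real.volume_Ioc, ENNReal.toReal_ofReal (by
              linarith [le_max_right t 1])]
            rcases le_total t 1 with h | h
            · rw [max_eq_right h]; linarith
            · rw [max_eq_left h]; linarith
    calc |a₀ + ∫ s in (0:ℝ)..t, a s| ≤ |a₀| + (I + C * t) := (abs_add_le _ _).trans (by gcongr)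
      _ ≤ _ := by nlinarith [abs_nonneg a₀, mul_nonneg hI0 ht, mul_nonneg (abs_nonneg a₀) ht]

theorem IsRegularlyVarying.kern (hA : IsRegularlyVarying (primitive a₀ a) β) :
    IsRegularlyVarying (kern a₀ a) β := by
  refine ⟨?_, fun τ hτ => (hA.2 τ hτ).congr' ?_⟩
  · filter_upwards [hA.1, eventually_ge_atTop 0] with t ht h0
    rwa [kern_of_nonneg _ _ h0]
  · filter_upwards [eventually_ge_atTop 0] with T hT
    rw [kern_of_nonneg _ _ hT, kern_of_nonneg _ _ (by positivity)]

/-- The properties of the scaling function at large times. -/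
theorem scale_sq (hA : IsRegularlyVarying (primitive a₀ a) β) (hβ : -1 < β) :
    ∀ᶠ T in atTop, 0 < kern a₀ a T ∧ 0 < scale a₀ a β T ∧
      scale a₀ a β T ^ 2 = T * (kern a₀ a T * Real.Gamma (1 + β)) := by
  have hΓ : 0 < Real.Gamma (1 + β) := Real.Gamma_pos_of_pos (by linarith)
  filter_upwards [hA.1, eventually_gt_atTop 0] with T h1 h2
  rw [kern_of_nonneg _ _ h2.le, scale]
  refine ⟨h1, Real.sqrt_pos.2 (by positivity), ?_⟩
  rw [Real.sq_sqrt (by positivity)]; ring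

theorem tendsto_scale (ha : IsAdmissibleKernel a₀ a) (hA : IsRegularlyVarying (primitive a₀ a) β)
    (hβ : -1 < β) : Tendsto (scale a₀ a β) atTop atTop := by
  have hΓ : 0 < Real.Gamma (1 + β) := Real.Gamma_pos_of_pos (by linarith)
  have h := (hA.kern.tendsto_mul_self ha.isTameKernel.continuous hβ).atTop_mul_const hΓ
  refine (Real.tendsto_sqrt_atTop.comp h).congr' ?_
  filter_upwards [eventually_ge_atTop 0] with T hT
  simp [scale, kern_of_nonneg _ _ hT]

/-- At large times the resolvent of the rescaled kernel is the rescaled resolvent. -/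
theorem resolvent_scaledKernel (hA : IsRegularlyVarying (primitive a₀ a) β) (hβ : -1 < β) :
    ∀ᶠ T in atTop, ∀ lam t, resolvent (scaledKernel (kern a₀ a) β T) lam t
      = resolvent (kern a₀ a) (lam / scale a₀ a β T ^ 2) (T * t) := by
  filter_upwards [scale_sq hA hβ, eventually_gt_atTop 0] with T ⟨h1, h2, h3⟩ hT lam t
  have e : scaledKernel (kern a₀ a) β T
      = fun s => (kern a₀ a T * Real.Gamma (1 + β))⁻¹ * kern a₀ a (T * s) := by
    ext s; rw [scaledKernel, div_eq_inv_mul]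
  -- The time change divides the spectral parameter by `T A(T) Γ(1 + β)`, which is `k(T)²` by
  -- definition of the scaling function.
  rw [e, resolvent_scale _ _ hT, h3]
  congr 1
  rw [div_eq_mul_inv, div_eq_mul_inv, mul_inv T, mul_comm T⁻¹]

end SelfSimilar

namespace SelfSimilar

/-! ### Schwartz functions -/

section Schwartz

variable {E : Type*} [NormedAddCommGroup E] [NormedSpace ℝ E]

/-- The supremum of the first Schwartz seminorms. -/
noncomputable def supSeminorm (E : Type*) [NormedAddCommGroup E] [NormedSpace ℝ E] (N : ℕ) :
    Seminorm ℂ 𝓢(E, ℂ) :=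
  (Finset.Iic (N, N)).sup fun m => SchwartzMap.seminorm ℂ m.1 m.2

theorem seminorm_le_supSeminorm {N k l : ℕ} (hk : k ≤ N) (hl : l ≤ N) (φ : 𝓢(E, ℂ)) :
    SchwartzMap.seminorm ℂ k l φ ≤ supSeminorm E N φ := by
  have : (k, l) ∈ Finset.Iic (N, N) := Finset.mem_Iic.2 ⟨hk, hl⟩
  exact Seminorm.le_def.1 (Finset.le_sup (f := fun m : ℕ × ℕ => SchwartzMap.seminorm ℂ m.1 m.2)
    this) φ

theorem supSeminorm_le {N : ℕ} {φ : 𝓢(E, ℂ)} {C : ℝ} (hC : 0 ≤ C)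
    (h : ∀ k ≤ N, ∀ l ≤ N, SchwartzMap.seminorm ℂ k l φ ≤ C) : supSeminorm E N φ ≤ C := by
  refine Seminorm.finset_sup_apply_le hC fun m hm => ?_
  obtain ⟨h1, h2⟩ := Finset.mem_Iic.1 hm
  exact h _ h1 _ h2

/-- Multiplication by a Schwartz function is bounded for each of the norms `supSeminorm`. -/
theorem exists_supSeminorm_mul_le (g : 𝓢(E, ℂ)) (N : ℕ) : ∃ B, 0 ≤ B ∧ ∀ φ ψ : 𝓢(E, ℂ),
    (∀ x, ψ x = g x * φ x) → supSeminorm E N ψ ≤ B * supSeminorm E N φ := by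
  refine ⟨2 ^ N * supSeminorm E N g, by positivity, fun φ ψ h => ?_⟩
  refine supSeminorm_le (by positivity) fun k hk l hl => ?_
  refine SchwartzMap.seminorm_le_bound ℂ k l ψ (by positivity) fun x => ?_
  have he : (ψ : E → ℂ) = fun x => g x * φ x := funext h
  have hs := norm_iteratedFDeriv_mul_le (𝕜 := ℝ) (g.smooth l) (φ.smooth l) x le_rfl
  rw [he]
  calc ‖x‖ ^ k * ‖iteratedFDeriv ℝ l (fun x => g x * φ x) x‖
      ≤ ‖x‖ ^ k * ∑ i ∈ Finset.range (l + 1), (l.choose i : ℝ) * ‖iteratedFDeriv ℝ i g x‖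
          * ‖iteratedFDeriv ℝ (l - i) φ x‖ := by gcongr
    _ = ∑ i ∈ Finset.range (l + 1), (l.choose i : ℝ) * (‖x‖ ^ 0 * ‖iteratedFDeriv ℝ i g x‖)
          * (‖x‖ ^ k * ‖iteratedFDeriv ℝ (l - i) φ x‖) := by
        rw [Finset.mul_sum]; refine Finset.sum_congr rfl fun i _ => ?_; ring
    _ ≤ ∑ i ∈ Finset.range (l + 1), (l.choose i : ℝ) * supSeminorm E N g * supSeminorm E N φ := by
        refine Finset.sum_le_sum fun i hi => ?_
        have hi' : i ≤ l := by simpa [Nat.lt_succ_iff] using hi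
        gcongr
        · exact (SchwartzMap.le_seminorm ℂ 0 i g x).trans
            (seminorm_le_supSeminorm (Nat.zero_le _) (hi'.trans hl) g)
        · exact (SchwartzMap.le_seminorm ℂ k (l - i) φ x).trans
            (seminorm_le_supSeminorm hk ((Nat.sub_le _ _).trans hl) φ)
    _ = 2 ^ l * supSeminorm E N g * supSeminorm E N φ := by
        rw [← Finset.sum_mul, ← Finset.sum_mul]
        congr 2
        exact_mod_cast Nat.sum_range_choose l
    _ ≤ _ := by gcongr; norm_num

/-- Compactly supported functions are dense in the Schwartz space. -/
theorem exists_tendsto_hasCompactSupport [FiniteDimensional ℝ E] (φ : 𝓢(E, ℂ)) :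
    ∃ φs : ℕ → 𝓢(E, ℂ), (∀ m, HasCompactSupport (φs m)) ∧ Tendsto φs atTop (𝓝 φ) := by
  let b : ContDiffBump (0 : E) := ⟨1, 2, one_pos, one_lt_two⟩
  have hbs : HasCompactSupport (fun x => ((b x : ℝ) : ℂ)) :=
    b.hasCompactSupport.comp_left (g := fun r : ℝ => (r : ℂ)) Complex.ofReal_zero
  have hbd : ContDiff ℝ ∞ (fun x => ((b x : ℝ) : ℂ)) :=
    Complex.ofRealCLM.contDiff.comp b.contDiff
  let χ : 𝓢(E, ℂ) := hbs.toSchwartzMap hbd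
  have hχ : ∀ x, χ x = ((b x : ℝ) : ℂ) := fun x => rfl
  let c : ℕ → E → ℂ := fun m x => χ ((m + 1 : ℝ)⁻¹ • x)
  have hcd : ∀ m, ContDiff ℝ ∞ (c m) := fun m => χ.smooth'.comp (contDiff_const_smul _)
  have hcs : ∀ m, HasCompactSupport (c m) := fun m => by
    refine HasCompactSupport.intro (isCompact_closedBall (0 : E) (2 * (m + 1))) fun x hx => ?_
    simp only [c, hχ]
    rw [Complex.ofReal_eq_zero]
    refine b.zero_of_le_dist ?_
    have hm : (0 : ℝ) < m + 1 := by positivity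
    rw [dist_zero_right, norm_smul, norm_inv, Real.norm_of_nonneg hm.le, ← div_eq_inv_mul,
      le_div_iff₀ hm]
    have : ¬ ‖x‖ ≤ 2 * (m + 1) := by simpa using hx
    exact (not_le.1 this).le
  have hc1 : ∀ (m : ℕ) (x : E), ‖x‖ < m + 1 → c m x = 1 := fun m x hx => by
    simp only [c, hχ]
    rw [b.one_of_mem_closedBall]
    · simp
    · have hm : (0 : ℝ) < m + 1 := by positivity
      rw [mem_closedBall_zero_iff, norm_smul, norm_inv, Real.norm_of_nonneg hm.le,
        ← div_eq_inv_mul]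
      exact (div_le_one hm).2 hx.le
  let φs : ℕ → 𝓢(E, ℂ) := fun m =>
    ((hcs m).mul_right (f' := φ)).toSchwartzMap ((hcd m).mul φ.smooth')
  have hφs : ∀ m x, φs m x = c m x * φ x := fun m x => rfl
  refine ⟨φs, fun m => (hcs m).mul_right, ?_⟩
  rw [(schwartz_withSeminorms ℂ E ℂ).tendsto_nhds]
  rintro ⟨k, l⟩ ε hε
  -- One spare power of `‖x‖`: the error vanishes for `‖x‖ < m + 1`, and outside this ball the
  -- additional power yields the factor `1 / (m + 1)`.
  set N := max (k + 1) l with hN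
  set D := (2 : ℝ) ^ l * (1 + supSeminorm E N χ) * supSeminorm E N φ with hD
  have hD0 : 0 ≤ D := by positivity
  have hbound : ∀ m, SchwartzMap.seminorm ℂ k l (φs m - φ) ≤ D / (m + 1) := by
    intro m
    have hm : (0 : ℝ) < m + 1 := by positivity
    refine SchwartzMap.seminorm_le_bound ℂ k l _ (by positivity) fun x => ?_
    have he : ((φs m - φ : 𝓢(E, ℂ)) : E → ℂ) = fun x => (c m x - 1) * φ x := by
      ext x; rw [sub_apply, hφs]; ring
    rw [he]
    rcases lt_or_ge ‖x‖ (m + 1) with hx | hx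
    · have hev : (fun x => (c m x - 1) * φ x) =ᶠ[𝓝 x] fun _ => 0 := by
        filter_upwards [(continuous_norm.tendsto x).eventually_lt_const hx] with y hy
        rw [hc1 m y hy]; simp
      rw [(hev.iteratedFDeriv ℝ l).eq_of_nhds, iteratedFDeriv_fun_zero]
      simp; positivity
    · have hcsub : ContDiff ℝ ∞ fun x => c m x - 1 := (hcd m).sub contDiff_const
      have hs := norm_iteratedFDeriv_mul_le (𝕜 := ℝ) (hcsub.of_le (m := l) (by
        exact_mod_cast le_top)) (φ.smooth l) x le_rfl
      have hci : ∀ i ≤ l, ‖iteratedFDeriv ℝ i (fun x => c m x - 1) x‖ ≤ 1 + supSeminorm E N χ := by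
        intro i hi
        have h1 : ‖iteratedFDeriv ℝ i (c m) x‖ ≤ supSeminorm E N χ := by
          have := congrFun (iteratedFDeriv_comp_const_smul (𝕜 := ℝ) (i := i) ((m + 1 : ℝ)⁻¹)
            (χ.smooth i)) x
          simp only [c]
          rw [this, norm_smul, norm_pow, norm_inv, Real.norm_of_nonneg hm.le]
          have h2 : ((m + 1 : ℝ)⁻¹) ^ i ≤ 1 := pow_le_one₀ (by positivity)
            (inv_le_one_of_one_le₀ (by linarith [(Nat.cast_nonneg m : (0 : ℝ) ≤ m)]))
          refine (mul_le_of_le_one_left (norm_nonneg _) h2).trans ?_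
          have h3 := SchwartzMap.le_seminorm ℂ 0 i χ ((m + 1 : ℝ)⁻¹ • x)
          rw [pow_zero, one_mul] at h3
          exact h3.trans (seminorm_le_supSeminorm (Nat.zero_le _)
            (hi.trans (le_max_right _ _)) χ)
        have h4 : ‖iteratedFDeriv ℝ i (fun _ : E => (1 : ℂ)) x‖ ≤ 1 := by
          rcases Nat.eq_zero_or_pos i with rfl | h
          · simp
          · rw [iteratedFDeriv_const_of_ne h.ne']; simp
        have h5 : iteratedFDeriv ℝ i (fun x => c m x - 1) x
            = iteratedFDeriv ℝ i (c m) x - iteratedFDeriv ℝ i (fun _ : E => (1 : ℂ)) x :=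
          iteratedFDeriv_sub_apply (((hcd m).of_le (m := i) (by exact_mod_cast le_top)).contDiffAt)
            contDiff_const.contDiffAt
        rw [h5]
        refine (norm_sub_le _ _).trans ?_
        linarith
      rw [le_div_iff₀ hm]
      calc ‖x‖ ^ k * ‖iteratedFDeriv ℝ l (fun x => (c m x - 1) * φ x) x‖ * (m + 1)
          ≤ ‖x‖ ^ k * (∑ i ∈ Finset.range (l + 1), (l.choose i : ℝ)
              * ‖iteratedFDeriv ℝ i (fun x => c m x - 1) x‖
              * ‖iteratedFDeriv ℝ (l - i) φ x‖) * ‖x‖ := by gcongr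
        _ = ∑ i ∈ Finset.range (l + 1), (l.choose i : ℝ)
              * ‖iteratedFDeriv ℝ i (fun x => c m x - 1) x‖
              * (‖x‖ ^ (k + 1) * ‖iteratedFDeriv ℝ (l - i) φ x‖) := by
            rw [Finset.mul_sum, Finset.sum_mul]; refine Finset.sum_congr rfl fun i _ => ?_; ring
        _ ≤ ∑ i ∈ Finset.range (l + 1), (l.choose i : ℝ) * (1 + supSeminorm E N χ)
              * supSeminorm E N φ := by
            refine Finset.sum_le_sum fun i hi => ?_
            have hi' : i ≤ l := by simpa [Nat.lt_succ_iff] using hi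
            gcongr
            · exact hci i hi'
            · exact (SchwartzMap.le_seminorm ℂ (k + 1) (l - i) φ x).trans
                (seminorm_le_supSeminorm (le_max_left _ _)
                  ((Nat.sub_le _ _).trans (le_max_right _ _)) φ)
        _ = D := by
            rw [← Finset.sum_mul, ← Finset.sum_mul, hD]
            congr 2
            exact_mod_cast Nat.sum_range_choose l
  have hlim : Tendsto (fun m : ℕ => D / (m + 1 : ℝ)) atTop (𝓝 0) := by
    have := (tendsto_const_div_atTop_nhds_zero_nat D).comp (tendsto_add_atTop_nat 1)
    simpa [Function.comp_def] using this
  filter_upwards [hlim.eventually_lt_const hε] with m hm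
  exact (hbound m).trans_lt hm

/-- Continuity made quantitative. It is applied to the Fourier transform, where one pair of
constants has to serve a whole sequence of test functions. -/
theorem exists_supSeminorm_comp_le {F : Type*} [NormedAddCommGroup F] [NormedSpace ℝ F]
    (L : 𝓢(F, ℂ) →L[ℂ] 𝓢(E, ℂ)) (N : ℕ) :
    ∃ (C : ℝ) (N' : ℕ), 0 ≤ C ∧ ∀ φ, supSeminorm E N (L φ) ≤ C * supSeminorm F N' φ := by
  have hcont : Continuous ((supSeminorm E N).comp L.toLinearMap) := by
    have h1 : Continuous (supSeminorm E N) := by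
      exact Seminorm.continuous_finsetSup fun m _ =>
        (schwartz_withSeminorms ℂ E ℂ).continuous_seminorm m
    exact h1.comp L.continuous
  obtain ⟨s, C, -, hC⟩ := Seminorm.bound_of_continuous (schwartz_withSeminorms ℂ F ℂ) _ hcont
  refine ⟨C, s.sup fun m => max m.1 m.2, C.2, fun φ => ?_⟩
  have h1 := Seminorm.le_def.1 hC φ
  refine h1.trans ?_
  rw [smul_apply, NNReal.smul_def, smul_eq_mul]
  refine mul_le_mul_of_nonneg_left ?_ C.2
  refine Seminorm.finset_sup_apply_le (apply_nonneg _ _) fun m hm => ?_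
  have h2 : max m.1 m.2 ≤ s.sup fun m : ℕ × ℕ => max m.1 m.2 :=
    Finset.le_sup (f := fun m : ℕ × ℕ => max m.1 m.2) hm
  exact seminorm_le_supSeminorm ((le_max_left _ _).trans h2) ((le_max_right _ _).trans h2) φ

end Schwartz

/-! ### Convolutions on the half-line -/

section Conv

variable {K : ℝ → ℝ} {g : ℝ → ℂ} {M B : ℝ}

/-- The convolution `∫₀ᵗ K(s) g(t - s) ds`. -/
noncomputable def volConv (K : ℝ → ℝ) (g : ℝ → ℂ) (t : ℝ) : ℂ :=
  ∫ s in Ioc 0 t, (K s : ℂ) * g (t - s)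

theorem norm_volConv_le {σ t : ℝ} (hK : IntegrableOn K (Ioc 0 M)) (hB : 0 ≤ B) (ht : t ≤ M)
    (hd : ∀ᵐ s, s ∈ Ioo 0 t → ‖g s‖ ≤ B * Real.exp (σ * s)) :
    ‖volConv K g t‖ ≤ B * Real.exp (σ * t) * weightedMass K σ M := by
  have hd' : ∀ᵐ s, s ∈ Ioc 0 t → ‖g (t - s)‖ ≤ B * Real.exp (σ * (t - s)) := by
    have h1 := (Measure.measurePreserving_sub_left volume t).quasiMeasurePreserving.ae hd
    have h2 : ∀ᵐ s : ℝ, s ≠ t := by simp [ae_iff]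
    filter_upwards [h1, h2] with s hs hne hmem
    exact hs ⟨by linarith [lt_of_le_of_ne hmem.2 hne], by linarith [hmem.1]⟩
  have hsub : Ioc 0 t ⊆ Ioc 0 M := Ioc_subset_Ioc_right ht
  have hi := integrableOn_weight hK σ
  calc ‖volConv K g t‖
      ≤ ∫ s in Ioc 0 t, B * Real.exp (σ * t) * (Real.exp (-σ * s) * |K s|) := by
        refine norm_integral_le_of_norm_le ((hi.mono_set hsub).const_mul _) ?_
        rw [ae_restrict_iff' measurableSet_Ioc]
        filter_upwards [hd'] with s hs hmem
        rw [norm_mul, Complex.norm_real, Real.norm_eq_abs]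
        calc |K s| * ‖g (t - s)‖ ≤ |K s| * (B * Real.exp (σ * (t - s))) := by
              gcongr; exact hs hmem
          _ = B * Real.exp (σ * t) * (Real.exp (-σ * s) * |K s|) := by
              rw [show σ * (t - s) = σ * t + -σ * s by ring, Real.exp_add]; ring
    _ = B * Real.exp (σ * t) * ∫ s in Ioc 0 t, Real.exp (-σ * s) * |K s| := by
        rw [integral_const_mul]
    _ ≤ _ := by
        gcongr
        exact setIntegral_mono_set hi (Eventually.of_forall fun s => by positivity)
          (Eventually.of_forall hsub)

/-- The kernel of the convolution on a bounded interval is integrable. -/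
theorem integrable_conv_kernel (hK : IntegrableOn K (Ioc 0 M)) (hg : IntegrableOn g (Ioo 0 M)) :
    Integrable (fun p : ℝ × ℝ => (((Ioc 0 M).indicator K (p.1 - p.2) : ℝ) : ℂ)
      * (Ioo 0 M).indicator g p.2) (volume.prod volume) := by
  have h1 : Integrable (fun s => (((Ioc 0 M).indicator K s : ℝ) : ℂ)) :=
    ((integrable_indicator_iff measurableSet_Ioc).2 hK).ofReal
  have h2 : Integrable ((Ioo 0 M).indicator g) := (integrable_indicator_iff measurableSet_Ioo).2 hg
  have := h2.convolution_integrand (ContinuousLinearMap.mul ℝ ℂ) h1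
  refine this.congr (Eventually.of_forall fun p => ?_)
  simp [mul_comm]

/-- Up to time `M` the half-line convolution is the convolution on the line of the functions cut off
to `(0, M)`; measurability and Fubini's theorem are then those of ordinary convolutions. -/
theorem volConv_eq_integral {t : ℝ} (ht : t ≤ M) :
    volConv K g t = ∫ s, (((Ioc 0 M).indicator K (t - s) : ℝ) : ℂ) * (Ioo 0 M).indicator g s := by
  have h1 : ∫ s, (((Ioc 0 M).indicator K (t - s) : ℝ) : ℂ) * (Ioo 0 M).indicator g s
      = ∫ s, (((Ioc 0 M).indicator K s : ℝ) : ℂ) * (Ioo 0 M).indicator g (t - s) := by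
    rw [← integral_sub_left_eq_self _ volume t]
    simp
  rw [h1, volConv, ← integral_indicator measurableSet_Ioc]
  have h2 : ∀ᵐ s : ℝ, s ≠ t := by simp [ae_iff]
  refine integral_congr_ae ?_
  filter_upwards [h2] with s hne
  by_cases hs : s ∈ Ioc 0 t
  · have h3 : s ∈ Ioc 0 M := ⟨hs.1, hs.2.trans ht⟩
    have h4 : t - s ∈ Ioo 0 M := ⟨by linarith [lt_of_le_of_ne hs.2 hne], by linarith [hs.1]⟩
    rw [indicator_of_mem hs, indicator_of_mem h3, indicator_of_mem h4]
  · rw [indicator_of_notMem hs]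
    by_cases h0 : 0 < s
    · have h4 : t - s ∉ Ioo 0 M := fun h => hs ⟨h0, by linarith [h.1]⟩
      rw [indicator_of_notMem h4, mul_zero]
    · have h4 : s ∉ Ioc 0 M := fun h => h0 h.1
      rw [indicator_of_notMem h4]; simp

theorem integrableOn_volConv (hK : IntegrableOn K (Ioc 0 M)) (hg : IntegrableOn g (Ioo 0 M)) :
    IntegrableOn (volConv K g) (Ioo 0 M) := by
  have := (integrable_conv_kernel hK hg).integral_prod_left
  refine (this.integrableOn (s := Ioo 0 M)).congr_fun (fun t ht => ?_) measurableSet_Ioo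
  exact (volConv_eq_integral ht.2.le).symm

/-- Fubini's theorem for the convolution on the half-line. -/
theorem integral_mul_volConv (hK : IntegrableOn K (Ioc 0 M)) (hg : IntegrableOn g (Ioo 0 M))
    {ψ : ℝ → ℝ} (hψ : Continuous ψ) (hψM : ∀ t, M ≤ t → ψ t = 0) :
    IntegrableOn (fun s => ((∫ t in Ioi s, K (t - s) * ψ t : ℝ) : ℂ) * g s) (Ioo 0 M) ∧
    ∫ t in Ioo 0 M, (ψ t : ℂ) * volConv K g t
      = ∫ s in Ioo 0 M, ((∫ t in Ioi s, K (t - s) * ψ t : ℝ) : ℂ) * g s := by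
  have hker := integrable_conv_kernel hK hg
  obtain ⟨C, hC⟩ := (isCompact_Icc (a := (0 : ℝ)) (b := M)).exists_bound_of_continuousOn
    hψ.continuousOn
  have hbd : Integrable (fun p : ℝ × ℝ => ((Ioo 0 M).indicator (fun t => (ψ t : ℂ)) p.1)
      * ((((Ioc 0 M).indicator K (p.1 - p.2) : ℝ) : ℂ) * (Ioo 0 M).indicator g p.2))
      (volume.prod volume) := by
    refine hker.bdd_mul (c := |C|) ?_ ?_
    · have hm : Measurable ((Ioo 0 M).indicator (fun t => (ψ t : ℂ))) :=
        (by fun_prop : Measurable fun t => (ψ t : ℂ)).indicator measurableSet_Ioo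
      exact (hm.comp measurable_fst).aestronglyMeasurable
    · refine Eventually.of_forall fun p => ?_
      by_cases hp : p.1 ∈ Ioo 0 M
      · rw [indicator_of_mem hp, Complex.norm_real]
        exact (hC _ ⟨hp.1.le, hp.2.le⟩).trans (le_abs_self _)
      · rw [indicator_of_notMem hp, norm_zero]; positivity
  have hswap := integral_integral_swap (f := fun t s : ℝ => ((Ioo 0 M).indicator
    (fun t => (ψ t : ℂ)) t) * ((((Ioc 0 M).indicator K (t - s) : ℝ) : ℂ)
    * (Ioo 0 M).indicator g s)) hbd
  have hL : ∫ t in Ioo 0 M, (ψ t : ℂ) * volConv K g t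
      = ∫ t, ∫ s, ((Ioo 0 M).indicator (fun t => (ψ t : ℂ)) t)
      * ((((Ioc 0 M).indicator K (t - s) : ℝ) : ℂ) * (Ioo 0 M).indicator g s) := by
    rw [← integral_indicator measurableSet_Ioo]
    refine integral_congr_ae (Eventually.of_forall fun t => ?_)
    simp only
    rw [integral_const_mul]
    by_cases ht : t ∈ Ioo 0 M
    · rw [indicator_of_mem ht, indicator_of_mem ht, volConv_eq_integral ht.2.le]
    · rw [indicator_of_notMem ht, indicator_of_notMem ht, zero_mul]
  have hR : ∀ s, ∫ t, ((Ioo 0 M).indicator (fun t => (ψ t : ℂ)) t)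
      * ((((Ioc 0 M).indicator K (t - s) : ℝ) : ℂ) * (Ioo 0 M).indicator g s)
      = (Ioo 0 M).indicator (fun s => ((∫ t in Ioi s, K (t - s) * ψ t : ℝ) : ℂ) * g s) s := by
    intro s
    by_cases hs : s ∈ Ioo 0 M
    · rw [indicator_of_mem hs, indicator_of_mem hs]
      simp_rw [← mul_assoc]
      rw [integral_mul_const]
      congr 1
      refine Eq.trans ?_ (integral_ofReal (𝕜 := ℂ) (f := fun t => K (t - s) * ψ t)
        (μ := volume.restrict (Ioi s)))
      rw [← integral_indicator measurableSet_Ioi]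
      refine integral_congr_ae (Eventually.of_forall fun t => ?_)
      simp only
      by_cases ht : t ∈ Ioi s
      · rw [indicator_of_mem ht]
        by_cases htM : t < M
        · have h1 : t ∈ Ioo 0 M := ⟨hs.1.trans ht, htM⟩
          have h2 : t - s ∈ Ioc 0 M := ⟨by linarith [mem_Ioi.1 ht], by linarith [hs.1]⟩
          rw [indicator_of_mem h1, indicator_of_mem h2]; push_cast; exact mul_comm _ _
        · have h1 : t ∉ Ioo 0 M := fun h => htM h.2
          rw [indicator_of_notMem h1, hψM t (not_lt.1 htM)]; simp
      · have h2 : t - s ∉ Ioc 0 M := fun h => ht (by rw [mem_Ioi]; linarith [h.1])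
        rw [indicator_of_notMem ht, indicator_of_notMem h2]; simp
    · rw [indicator_of_notMem hs, indicator_of_notMem hs]; simp
  refine ⟨?_, ?_⟩
  · rw [← integrable_indicator_iff measurableSet_Ioo]
    exact hbd.integral_prod_right.congr (Eventually.of_forall hR)
  · rw [hL, hswap, ← integral_indicator measurableSet_Ioo]
    exact integral_congr_ae (Eventually.of_forall hR)

end Conv

end SelfSimilar

namespace SelfSimilar

/-! ### From weak solutions to a Volterra equation -/

theorem setIntegral_Ioi_comp_sub (f : ℝ → ℝ) (s : ℝ) :
    ∫ t in Ioi s, f (t - s) = ∫ t in Ioi 0, f t := by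
  have h := (measurePreserving_sub_right (volume : Measure ℝ) s).setIntegral_preimage_emb
    (MeasurableEquiv.subRight s).measurableEmbedding f (Ioi 0)
  rw [← h]
  congr 2
  ext t; simp

theorem setIntegral_Ioi_eq_Ioo {F : Type*} [NormedAddCommGroup F] [NormedSpace ℝ F]
    {f : ℝ → F} {M : ℝ} (hf : ∀ t, M ≤ t → f t = 0) :
    ∫ t in Ioi 0, f t = ∫ t in Ioo 0 M, f t := by
  refine setIntegral_eq_of_subset_of_forall_sdiff_eq_zero measurableSet_Ioi
    (fun t ht => ht.1) fun t ht => hf t ?_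
  by_contra h
  exact ht.2 ⟨ht.1, not_le.1 h⟩

/-- Integration by parts without differentiating anything: convolving `a` with the constant `1`
gives `A - a₀`, and Fubini's theorem moves that convolution to `ψ`. The case `s = 0` is proved first
and then translated. -/
theorem integral_kern_mul {a₀ : ℝ} {a : ℝ → ℝ} (ha : IsAdmissibleKernel a₀ a) {M : ℝ}
    {ψ : ℝ → ℝ} (hψ : Continuous ψ) (hψM : ∀ t, M ≤ t → ψ t = 0) (s : ℝ) :
    a₀ * (∫ t in Ioi s, ψ t) + ∫ t in Ioi s, a (t - s) * ∫ τ in Ioi t, ψ τ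
      = ∫ t in Ioi s, kern a₀ a (t - s) * ψ t := by
  have key : ∀ (χ : ℝ → ℝ) (M : ℝ), Continuous χ → (∀ t, M ≤ t → χ t = 0) →
      a₀ * (∫ t in Ioi 0, χ t) + ∫ t in Ioi 0, a t * ∫ τ in Ioi t, χ τ
        = ∫ t in Ioi 0, kern a₀ a t * χ t := by
    intro χ M hχ hχM
    have haM : IntegrableOn (fun t => (a t : ℂ)) (Ioo 0 M) :=
      ((ha.integrableOn_Ioc M).mono_set Ioo_subset_Ioc_self).ofReal
    have h1 := (integral_mul_volConv (K := fun _ => 1) (g := fun t => (a t : ℂ))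
      (integrableOn_const (by simp)) haM hχ hχM).2
    have h2 : ∀ t ∈ Ioo 0 M, (χ t : ℂ) * volConv (fun _ => 1) (fun t => (a t : ℂ)) t
        = ((kern a₀ a t * χ t - a₀ * χ t : ℝ) : ℂ) := by
      intro t ht
      have h3 : volConv (fun _ => 1) (fun t => (a t : ℂ)) t = ((kern a₀ a t - a₀ : ℝ) : ℂ) := by
        rw [kern_of_nonneg _ _ ht.1.le, primitive, volConv]
        simp only [Complex.ofReal_one, one_mul, add_sub_cancel_left]
        rw [← intervalIntegral.integral_of_le ht.1.le,
          intervalIntegral.integral_comp_sub_left (fun s => (a s : ℂ)) t, sub_self, sub_zero]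
        exact intervalIntegral.integral_ofReal
      rw [h3]; push_cast; ring
    have h4 : ∀ t, M ≤ t → a t * ∫ τ in Ioi t, χ τ = 0 := fun t ht => by
      rw [setIntegral_eq_zero_of_forall_eq_zero (t := Ioi t) fun τ hτ =>
        hχM τ (ht.trans (mem_Ioi.1 hτ).le), mul_zero]
    rw [setIntegral_congr_fun measurableSet_Ioo h2] at h1
    rw [setIntegral_Ioi_eq_Ioo h4, setIntegral_Ioi_eq_Ioo hχM,
      setIntegral_Ioi_eq_Ioo (M := M) (f := fun t => kern a₀ a t * χ t)
        (fun t ht => by rw [hχM t ht, mul_zero])]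
    have h5 : ∫ t in Ioo 0 M, (kern a₀ a t * χ t - a₀ * χ t)
        = ∫ t in Ioo 0 M, (∫ τ in Ioi t, χ τ) * a t := by
      have h6 : (((∫ t in Ioo 0 M, (kern a₀ a t * χ t - a₀ * χ t)) : ℝ) : ℂ)
          = ((∫ t in Ioo 0 M, (∫ τ in Ioi t, χ τ) * a t : ℝ) : ℂ) := by
        refine (integral_complex_ofReal).symm.trans (h1.trans ?_)
        refine Eq.trans ?_ (integral_complex_ofReal)
        refine setIntegral_congr_fun measurableSet_Ioo fun t ht => ?_
        simp
      exact_mod_cast h6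
    have hc : Continuous (kern a₀ a) := ha.isTameKernel.continuous
    have i1 : IntegrableOn (fun t => kern a₀ a t * χ t) (Ioo 0 M) :=
      ((hc.mul hχ).integrableOn_Icc (a := 0) (b := M)).mono_set Ioo_subset_Icc_self
    have i2 : IntegrableOn (fun t => a₀ * χ t) (Ioo 0 M) :=
      ((continuous_const.mul hχ).integrableOn_Icc (a := 0) (b := M)).mono_set Ioo_subset_Icc_self
    rw [integral_sub i1 i2, integral_const_mul] at h5
    rw [show ∫ t in Ioo 0 M, a t * ∫ τ in Ioi t, χ τ = ∫ t in Ioo 0 M, (∫ τ in Ioi t, χ τ) * a t by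
      simp_rw [mul_comm]]
    linarith
  have h := key (fun t => ψ (t + s)) (M - s) (by fun_prop) (fun t ht => hψM _ (by linarith))
  have e1 : ∀ r, ∫ t in Ioi r, ψ (t + s) = ∫ t in Ioi (r + s), ψ t := by
    intro r
    have h := (measurePreserving_add_right (volume : Measure ℝ) s).setIntegral_preimage_emb
      (MeasurableEquiv.addRight s).measurableEmbedding ψ (Ioi (r + s))
    rw [← h]
    congr 2
    ext t; simp
  simp_rw [e1] at h
  rw [← setIntegral_Ioi_comp_sub _ s, ← setIntegral_Ioi_comp_sub _ s, zero_add] at h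
  simpa using h

variable {n : ℕ} {u : ℝ → 𝓢'(Rn n, ℂ)}

theorem IsMeasurableLocallyBounded.exists_bound (hu : IsMeasurableLocallyBounded u) (M : ℝ) :
    ∃ (C : ℝ) (N : ℕ), 0 ≤ C ∧ ∀ t ∈ Icc 0 M, ∀ φ, ‖u t φ‖ ≤ C * supSeminorm (Rn n) N φ := by
  obtain ⟨C, N, h⟩ := hu.bounded M
  refine ⟨|C|, N, abs_nonneg _, fun t ht φ => (h t ht φ).trans ?_⟩
  exact mul_le_mul_of_nonneg_right (le_abs_self C) (apply_nonneg _ _)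

theorem IsMeasurableLocallyBounded.integrableOn (hu : IsMeasurableLocallyBounded u)
    (φ : 𝓢(Rn n, ℂ)) (M : ℝ) : IntegrableOn (fun t => u t φ) (Ioo 0 M) := by
  obtain ⟨C, N, -, h⟩ := hu.exists_bound M
  refine IntegrableOn.of_bound (by simp) ((hu.measurable φ).mono_measure
    (Measure.restrict_mono (fun t ht => ht.1) le_rfl)) (C * supSeminorm (Rn n) N φ) ?_
  exact (ae_restrict_iff' measurableSet_Ioo).2
    (Eventually.of_forall fun t ht => h t ⟨ht.1.le, ht.2.le⟩ φ)

/-- The test function `θ(t) φ(x)`. -/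
noncomputable def tensorTest (θ : ℝ → ℝ) (φ : 𝓢(Rn n, ℂ)) (hθ : ContDiff ℝ ∞ θ)
    (hθs : HasCompactSupport θ) (hφs : HasCompactSupport φ) : SpaceTimeTest n where
  toFun p := (θ p.2 : ℂ) * φ p.1
  smooth := (Complex.ofRealCLM.contDiff.comp (hθ.comp contDiff_snd)).mul
    (φ.smooth'.comp contDiff_fst)
  compact := by
    refine HasCompactSupport.intro (hφs.isCompact.prod hθs.isCompact) fun p hp => ?_
    rw [mem_prod, not_and_or] at hp
    rcases hp with h | h
    · rw [image_eq_zero_of_notMem_tsupport h, mul_zero]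
    · rw [image_eq_zero_of_notMem_tsupport h, Complex.ofReal_zero, zero_mul]

theorem tensorTest_slice (θ : ℝ → ℝ) (φ : 𝓢(Rn n, ℂ)) (hθ : ContDiff ℝ ∞ θ)
    (hθs : HasCompactSupport θ) (hφs : HasCompactSupport φ) (t : ℝ) :
    (tensorTest θ φ hθ hθs hφs).slice t = (θ t : ℂ) • φ := by
  ext x; simp [SpaceTimeTest.slice_apply, tensorTest]

theorem tensorTest_timeDeriv_slice (θ : ℝ → ℝ) (φ : 𝓢(Rn n, ℂ)) (hθ : ContDiff ℝ ∞ θ)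
    (hθs : HasCompactSupport θ) (hφs : HasCompactSupport φ) (t : ℝ) :
    (tensorTest θ φ hθ hθs hφs).timeDeriv.slice t = ((deriv θ t : ℝ) : ℂ) • φ := by
  ext x
  have h1 : HasFDerivAt (tensorTest θ φ hθ hθs hφs).toFun
      (fderiv ℝ (tensorTest θ φ hθ hθs hφs).toFun (x, t)) (x, t) :=
    ((tensorTest θ φ hθ hθs hφs).smooth.differentiable (by simp) (x, t)).hasFDerivAt
  have h2 : HasDerivAt (fun τ : ℝ => (x, τ)) ((0 : Rn n), (1 : ℝ)) t :=
    (hasDerivAt_const t x).prodMk (hasDerivAt_id t)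
  have h3 := h1.comp_hasDerivAt t h2
  have h4 : HasDerivAt (fun τ : ℝ => (θ τ : ℂ) * φ x) (((deriv θ t : ℝ) : ℂ) * φ x) t :=
    ((hθ.differentiable (by simp) t).hasDerivAt.ofReal_comp).mul_const _
  exact h3.unique h4

theorem laplacian_smul (c : ℂ) (φ : 𝓢(Rn n, ℂ)) : Δ (c • φ) = c • Δ φ := by
  rw [← SchwartzMap.laplacianCLM_eq ℂ, ← SchwartzMap.laplacianCLM_eq ℂ, map_smul]

/-- A function with derivative `ψ` on `(-1, ∞)` that vanishes at `+∞` and near `-∞`. -/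
theorem exists_primitive_hasCompactSupport {ψ : ℝ → ℝ} (hψ : ContDiff ℝ ∞ ψ) {M : ℝ}
    (hψM : ∀ t, M ≤ t → ψ t = 0) : ∃ θ : ℝ → ℝ, ContDiff ℝ ∞ θ ∧ HasCompactSupport θ ∧
      (∀ t, 0 ≤ t → deriv θ t = ψ t) ∧ (∀ t, M ≤ t → θ t = 0) ∧
      ∀ t, 0 ≤ t → θ t = - ∫ τ in Ioi t, ψ τ := by
  let F : ℝ → ℝ := fun t => ∫ τ in M..t, ψ τ
  have hFd : ∀ t, HasDerivAt F (ψ t) t := fun t =>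
    intervalIntegral.integral_hasDerivAt_right (hψ.continuous.intervalIntegrable _ _)
      (hψ.continuous.stronglyMeasurableAtFilter _ _) hψ.continuous.continuousAt
  have hFs : ContDiff ℝ ∞ F := by
    rw [contDiff_infty_iff_deriv]
    refine ⟨fun t => (hFd t).differentiableAt, ?_⟩
    rwa [show deriv F = ψ from funext fun t => (hFd t).deriv]
  have hFM : ∀ t, M ≤ t → F t = 0 := fun t ht => by
    refine intervalIntegral.integral_zero_ae (Eventually.of_forall fun τ hτ => hψM τ ?_)
    rw [uIoc_of_le ht] at hτ
    exact hτ.1.le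
  let χ : ℝ → ℝ := fun t => Real.smoothTransition (t + 2)
  have hχs : ContDiff ℝ ∞ χ := Real.smoothTransition.contDiff.comp (contDiff_id.add contDiff_const)
  have hχ1 : ∀ t, -1 ≤ t → χ t = 1 := fun t ht =>
    Real.smoothTransition.one_of_one_le (by linarith)
  have heq : ∀ t, -1 ≤ t → χ t * F t = F t := fun t ht => by rw [hχ1 t ht, one_mul]
  refine ⟨fun t => χ t * F t, hχs.mul hFs, ?_, fun t ht => ?_, fun t ht => ?_, fun t ht => ?_⟩
  · refine HasCompactSupport.intro (isCompact_Icc (a := -2) (b := M)) fun t ht => ?_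
    by_cases h : t < -2
    · have : χ t = 0 := Real.smoothTransition.zero_of_nonpos (by linarith)
      simp only [this, zero_mul]
    · have : M ≤ t := by
        by_contra h'
        exact ht ⟨not_lt.1 h, (not_le.1 h').le⟩
      simp only [hFM t this, mul_zero]
  · have : (fun t => χ t * F t) =ᶠ[𝓝 t] F := by
      filter_upwards [lt_mem_nhds (show (-1 : ℝ) < t by linarith)] with τ hτ
      exact heq τ hτ.le
    rw [this.deriv_eq, (hFd t).deriv]
  · simp only [hFM t ht, mul_zero]
  · change χ t * F t = _
    rw [heq t (by linarith)]
    have h1 : ∫ τ in Ioi t, ψ τ = ∫ τ in Ioc t (max t M), ψ τ := by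
      refine setIntegral_eq_of_subset_of_forall_sdiff_eq_zero measurableSet_Ioi
        (fun τ hτ => hτ.1) fun τ hτ => hψM τ ?_
      by_contra h
      exact hτ.2 ⟨hτ.1, le_max_of_le_right (not_le.1 h).le⟩
    rw [h1, ← intervalIntegral.integral_of_le (le_max_left _ _),
      ← intervalIntegral.integral_symm]
    rcases le_total t M with h | h
    · rw [max_eq_right h]
    · rw [max_eq_left h, intervalIntegral.integral_same, hFM t h]

variable {a₀ : ℝ} {a : ℝ → ℝ} {u₀ : Rn n → ℂ}

/-- The weak formulation tested with products. -/
theorem IsWeakSolution.integral_mul_eq_zero (ha : IsAdmissibleKernel a₀ a)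
    (hu : IsWeakSolution a₀ a u₀ u) {φ : 𝓢(Rn n, ℂ)} (hφ : HasCompactSupport φ)
    {ψ : ℝ → ℝ} (hψ : ContDiff ℝ ∞ ψ) {M : ℝ} (hψM : ∀ t, M ≤ t → ψ t = 0) :
    ∫ t in Ioo 0 M, (ψ t : ℂ) * (u t φ - volConv (kern a₀ a) (fun s => u s (Δ φ)) t
      - ∫ x, u₀ x * φ x) = 0 := by
  -- The time factor is `θ(t) = -∫_t^∞ ψ`. Its derivative `ψ` multiplies `u`, while `θ` itself meets
  -- the kernel, which by `integral_kern_mul` becomes `A` tested with `ψ`.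
  obtain ⟨θ, hθ, hθs, hθd, hθM, hθt⟩ := exists_primitive_hasCompactSupport hψ hψM
  have hw := hu.weak (tensorTest θ φ hθ hθs hφ)
  have hK := ha.isTameKernel.integrableOn_Ioc M
  have hg := hu.family.integrableOn (Δ φ) M
  have hf := hu.family.integrableOn φ M
  obtain ⟨hi, hF⟩ := integral_mul_volConv hK hg hψ.continuous hψM
  obtain ⟨C, hC⟩ := (isCompact_Icc (a := (0 : ℝ)) (b := M)).exists_bound_of_continuousOn
    (hψ.continuous.continuousOn)
  have hbm : ∀ g : ℝ → ℂ, IntegrableOn g (Ioo 0 M) →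
      IntegrableOn (fun t => (ψ t : ℂ) * g t) (Ioo 0 M) := fun g hg => by
    refine Integrable.bdd_mul (c := C) hg
      (Complex.continuous_ofReal.comp hψ.continuous).aestronglyMeasurable ?_
    refine (ae_restrict_iff' measurableSet_Ioo).2 (Eventually.of_forall fun t ht => ?_)
    rw [Complex.norm_real]
    exact hC t ⟨ht.1.le, ht.2.le⟩
  have e1 : ∀ s ∈ Ioi (0 : ℝ), u s ((tensorTest θ φ hθ hθs hφ).timeDeriv.slice s)
      + (a₀ : ℂ) * u s (Δ ((tensorTest θ φ hθ hθs hφ).slice s))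
        + ∫ t in Ioi s, (a (t - s) : ℂ) * u s (Δ ((tensorTest θ φ hθ hθs hφ).slice t))
      = (ψ s : ℂ) * u s φ - ((∫ t in Ioi s, kern a₀ a (t - s) * ψ t : ℝ) : ℂ) * u s (Δ φ) := by
    intro s hs
    have hs' : 0 ≤ s := (mem_Ioi.1 hs).le
    have e2 : ∫ t in Ioi s, (a (t - s) : ℂ) * u s (Δ ((tensorTest θ φ hθ hθs hφ).slice t))
        = -((∫ t in Ioi s, a (t - s) * ∫ τ in Ioi t, ψ τ : ℝ) : ℂ) * u s (Δ φ) := by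
      rw [← Complex.ofReal_neg, ← integral_neg]
      refine Eq.trans ?_ (congrArg (· * u s (Δ φ)) (integral_complex_ofReal))
      rw [← integral_mul_const]
      refine setIntegral_congr_fun measurableSet_Ioi fun t ht => ?_
      simp only [tensorTest_slice, laplacian_smul, map_smul, smul_eq_mul]
      rw [hθt t (hs'.trans (mem_Ioi.1 ht).le)]
      push_cast; ring
    rw [e2, tensorTest_timeDeriv_slice, tensorTest_slice, laplacian_smul, map_smul, map_smul,
      hθd s hs', hθt s hs', ← integral_kern_mul ha hψ.continuous hψM s]
    simp only [smul_eq_mul]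
    push_cast; ring
  have e3 : ∫ x, u₀ x * (tensorTest θ φ hθ hθs hφ).toFun (x, 0)
      = -(∫ t in Ioo 0 M, (ψ t : ℂ)) * ∫ x, u₀ x * φ x := by
    have e4 : (∫ t in Ioo 0 M, (ψ t : ℂ)) = ((∫ t in Ioi 0, ψ t : ℝ) : ℂ) := by
      rw [setIntegral_Ioi_eq_Ioo hψM]; exact integral_ofReal
    rw [e4, ← Complex.ofReal_neg, ← hθt 0 le_rfl, ← integral_const_mul]
    refine integral_congr_ae (Eventually.of_forall fun x => ?_)
    simp only [tensorTest]; ring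
  rw [setIntegral_congr_fun measurableSet_Ioi e1, e3, setIntegral_Ioi_eq_Ioo (M := M)] at hw
  · rw [integral_sub (hbm _ hf) hi, ← hF] at hw
    have hv := hbm _ (integrableOn_volConv hK hg)
    have hc := hbm (fun _ => ∫ x, u₀ x * φ x) (integrableOn_const (by simp))
    have hs : IntegrableOn (fun t => (ψ t : ℂ) * u t φ
        - (ψ t : ℂ) * volConv (kern a₀ a) (fun s => u s (Δ φ)) t) (Ioo 0 M) := (hbm _ hf).sub hv
    simp_rw [mul_sub]
    rw [integral_sub hs hc, integral_sub (hbm _ hf) hv, integral_mul_const, ← hw]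
    ring
  · intro t ht
    rw [hψM t ht, setIntegral_eq_zero_of_forall_eq_zero (t := Ioi t) fun τ hτ => by
      rw [hψM τ (ht.trans (mem_Ioi.1 hτ).le), mul_zero]]
    simp

/-- The fundamental lemma of the calculus of variations on `(0, ∞)`, applied to the locally
integrable defect of the integrated equation. -/
theorem IsWeakSolution.ae_eq_of_hasCompactSupport (ha : IsAdmissibleKernel a₀ a)
    (hu : IsWeakSolution a₀ a u₀ u) {φ : 𝓢(Rn n, ℂ)} (hφ : HasCompactSupport φ) :
    ∀ᵐ t ∂volume.restrict (Ioi (0 : ℝ)), u t φ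
      = (∫ x, u₀ x * φ x) + volConv (kern a₀ a) (fun s => u s (Δ φ)) t := by
  have hi : ∀ M, IntegrableOn (fun t => u t φ - volConv (kern a₀ a) (fun s => u s (Δ φ)) t
      - ∫ x, u₀ x * φ x) (Ioo 0 M) := fun M =>
    ((hu.family.integrableOn φ M).sub (integrableOn_volConv (ha.isTameKernel.integrableOn_Ioc M)
      (hu.family.integrableOn (Δ φ) M))).sub (integrableOn_const (by simp))
  have h := isOpen_Ioi.ae_eq_zero_of_integral_contDiff_smul_eq_zero (U := Ioi (0 : ℝ))
    (μ := volume) (f := fun t => u t φ - volConv (kern a₀ a) (fun s => u s (Δ φ)) t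
      - ∫ x, u₀ x * φ x) ?_ ?_
  · rw [ae_restrict_iff' measurableSet_Ioi]
    filter_upwards [h] with t ht hmem
    linear_combination ht hmem
  · intro t ht
    exact ⟨Ioo 0 (t + 1), mem_nhdsWithin_of_mem_nhds (Ioo_mem_nhds ht (by linarith)), hi _⟩
  · intro ψ hψ hψs hψU
    obtain ⟨R, hR⟩ := hψs.isCompact.isBounded.subset_closedBall 0
    have hψM : ∀ t, |R| + 1 ≤ t → ψ t = 0 := fun t ht => by
      refine image_eq_zero_of_notMem_tsupport fun hmem => ?_
      have := hR hmem
      rw [mem_closedBall_zero_iff, Real.norm_eq_abs] at this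
      linarith [le_abs_self t, le_abs_self R]
    rw [← hu.integral_mul_eq_zero ha hφ hψ hψM, ← setIntegral_eq_integral_of_forall_compl_eq_zero
      (s := Ioo 0 (|R| + 1))]
    · rfl
    · intro t ht
      have : ψ t = 0 := by
        by_cases h0 : 0 < t
        · exact hψM t (by by_contra h; exact ht ⟨h0, not_le.1 h⟩)
        · exact image_eq_zero_of_notMem_tsupport fun hmem => h0 (hψU hmem)
      rw [this, zero_smul]

theorem norm_volConv_sub_tendsto {K : ℝ → ℝ} {t : ℝ} (hK : IntegrableOn K (Ioc 0 t))
    {g : ℝ → ℂ} {gs : ℕ → ℝ → ℂ} {B : ℝ}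
    (hm : ∀ m, AEStronglyMeasurable (gs m) (volume.restrict (Ioi 0)))
    (hb : ∀ m, ∀ s ∈ Icc 0 t, ‖gs m s‖ ≤ B)
    (hg : ∀ s, 0 ≤ s → Tendsto (fun m => gs m s) atTop (𝓝 (g s))) :
    Tendsto (fun m => volConv K (gs m) t) atTop (𝓝 (volConv K g t)) := by
  unfold volConv
  refine tendsto_integral_of_dominated_convergence (fun s => |K s| * B) (fun m => ?_)
    (hK.abs.mul_const _) (fun m => ?_) ?_
  · refine hK.ofReal.aestronglyMeasurable.mul ?_
    have h1 : AEStronglyMeasurable (fun s => gs m (t - s)) (volume.restrict (Iio t)) := by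
      have := (Measure.measurePreserving_sub_left (volume : Measure ℝ) t).restrict_preimage
        (measurableSet_Ioi (a := 0))
      rw [show (fun s => t - s) ⁻¹' Ioi 0 = Iio t by ext; simp] at this
      exact (hm m).comp_measurePreserving this
    rw [← restrict_Ioo_eq_restrict_Ioc]
    exact h1.mono_measure (Measure.restrict_mono (fun s hs => hs.2) le_rfl)
  · refine (ae_restrict_iff' measurableSet_Ioc).2 (Eventually.of_forall fun s hs => ?_)
    rw [norm_mul, Complex.norm_real, Real.norm_eq_abs]
    gcongr
    exact hb m _ ⟨by linarith [hs.2], by linarith [hs.1]⟩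
  · refine (ae_restrict_iff' measurableSet_Ioc).2 (Eventually.of_forall fun s hs => ?_)
    exact (hg _ (by linarith [hs.2])).const_mul _

theorem tendsto_integral_mul (hu₀ : Integrable u₀) {φs : ℕ → 𝓢(Rn n, ℂ)} {φ : 𝓢(Rn n, ℂ)}
    (h : Tendsto φs atTop (𝓝 φ)) :
    Tendsto (fun m => ∫ x, u₀ x * φs m x) atTop (𝓝 (∫ x, u₀ x * φ x)) := by
  have h0 := ((schwartz_withSeminorms ℂ (Rn n) ℂ).continuous_seminorm (0, 0)).tendsto 0
  have h1 : Tendsto (fun m => SchwartzMap.seminorm ℂ 0 0 (φs m - φ)) atTop (𝓝 0) := by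
    have := h0.comp ((tendsto_sub_nhds_zero_iff).2 h)
    simpa [SchwartzMap.schwartzSeminormFamily_apply, Function.comp_def] using this
  have hb : ∀ (ψ : 𝓢(Rn n, ℂ)) x, ‖ψ x‖ ≤ SchwartzMap.seminorm ℂ 0 0 ψ := fun ψ x =>
    SchwartzMap.norm_le_seminorm ℂ ψ x
  have hint : ∀ ψ : 𝓢(Rn n, ℂ), Integrable fun x => u₀ x * ψ x := fun ψ =>
    hu₀.mul_bdd ψ.continuous.aestronglyMeasurable (Eventually.of_forall (hb ψ))
  rw [← tendsto_sub_nhds_zero_iff]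
  refine squeeze_zero_norm (a := fun m => (∫ x, ‖u₀ x‖) * SchwartzMap.seminorm ℂ 0 0 (φs m - φ))
    (fun m => ?_) (by simpa using h1.const_mul (∫ x, ‖u₀ x‖))
  rw [← integral_sub (hint _) (hint _), ← integral_mul_const]
  refine norm_integral_le_of_norm_le (hu₀.norm.mul_const _) (Eventually.of_forall fun x => ?_)
  rw [← mul_sub, norm_mul]
  gcongr
  exact hb (φs m - φ) x

theorem exists_supSeminorm_le_of_tendsto {φs : ℕ → 𝓢(Rn n, ℂ)} {φ : 𝓢(Rn n, ℂ)}
    (h : Tendsto φs atTop (𝓝 φ)) (N : ℕ) : ∃ B, ∀ m, supSeminorm (Rn n) N (φs m) ≤ B := by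
  have h0 : Continuous (supSeminorm (Rn n) N) := Seminorm.continuous_finsetSup fun m _ =>
    (schwartz_withSeminorms ℂ (Rn n) ℂ).continuous_seminorm m
  obtain ⟨B, hB⟩ := ((h0.tendsto _).comp h).bddAbove_range
  exact ⟨B, fun m => hB ⟨m, rfl⟩⟩

/-- A weak solution satisfies the integrated (Volterra) form of the equation. -/
theorem IsWeakSolution.ae_eq (ha : IsAdmissibleKernel a₀ a) (hu₀ : Integrable u₀)
    (hu : IsWeakSolution a₀ a u₀ u) (φ : 𝓢(Rn n, ℂ)) :
    ∀ᵐ t ∂volume.restrict (Ioi (0 : ℝ)), u t φ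
      = (∫ x, u₀ x * φ x) + volConv (kern a₀ a) (fun s => u s (Δ φ)) t := by
  -- The approximating sequence is countable, so its exceptional null sets can be united; at each
  -- remaining time the limit is taken by the common seminorm bound on `[0, t]`.
  obtain ⟨φs, hφs, hlim⟩ := exists_tendsto_hasCompactSupport φ
  have hlim' : Tendsto (fun m => Δ (φs m)) atTop (𝓝 (Δ φ)) := by
    simp_rw [← SchwartzMap.laplacianCLM_eq ℂ]
    exact ((LineDeriv.laplacianCLM ℂ (Rn n) 𝓢(Rn n, ℂ)).continuous.tendsto φ).comp hlim
  filter_upwards [ae_all_iff.2 fun m => hu.ae_eq_of_hasCompactSupport ha (hφs m)] with t ht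
  have h1 : Tendsto (fun m => u t (φs m)) atTop (𝓝 (u t φ)) :=
    ((u t).continuous.tendsto φ).comp hlim
  refine tendsto_nhds_unique h1 ?_
  simp_rw [ht]
  obtain ⟨C, N, hC, hb⟩ := hu.family.exists_bound t
  obtain ⟨B, hB⟩ := exists_supSeminorm_le_of_tendsto hlim' N
  refine (tendsto_integral_mul hu₀ hlim).add (norm_volConv_sub_tendsto (B := C * B)
    (ha.isTameKernel.integrableOn_Ioc t) (fun m => hu.family.measurable _) (fun m s hs => ?_)
    fun s _ => ((u s).continuous.tendsto _).comp hlim')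
  exact (hb s hs _).trans (mul_le_mul_of_nonneg_left (hB m) hC)

end SelfSimilar

namespace SelfSimilar

/-! ### The Fourier transform of a weak solution -/

/-- A chain of convolution equations with geometrically bounded terms has the trivial solution. -/
theorem ae_eq_zero_of_volConv_chain {K : ℝ → ℝ} {M B D : ℝ} (hK : IntegrableOn K (Ioc 0 M))
    (hB : 0 < B) (hD : 0 ≤ D) {y : ℕ → ℝ → ℂ}
    (hy : ∀ m, ∀ᵐ t ∂volume.restrict (Ioo 0 M), y m t = -volConv K (y (m + 1)) t)
    (hb : ∀ m, ∀ᵐ t ∂volume.restrict (Ioo 0 M), ‖y m t‖ ≤ D * B ^ m) :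
    ∀ᵐ t ∂volume.restrict (Ioo 0 M), y 0 t = 0 := by
  -- Passing from `y m` to `y (m + 1)` costs a factor `B`, and convolution with a kernel of weighted
  -- mass `1 / (2 B)` gains twice that, so `k` passages leave `(1 / 2) ^ k`.
  obtain ⟨σ, hσ, hq⟩ := exists_weightedMass_le hK (show (0 : ℝ) < 1 / (2 * B) by positivity)
  have key : ∀ k m : ℕ, ∀ᵐ t ∂volume.restrict (Ioo 0 M),
      ‖y m t‖ ≤ D * B ^ m * (1 / 2) ^ k * Real.exp (σ * t) := by
    intro k
    induction k with
    | zero =>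
      intro m
      filter_upwards [hb m, ae_restrict_mem measurableSet_Ioo] with t ht hmem
      have h1 : 1 ≤ Real.exp (σ * t) := Real.one_le_exp (mul_nonneg hσ hmem.1.le)
      rw [pow_zero, mul_one]
      exact ht.trans (le_mul_of_one_le_right (by positivity) h1)
    | succ k ih =>
      intro m
      have h1 := (ae_restrict_iff' measurableSet_Ioo).1 (ih (m + 1))
      filter_upwards [hy m, ae_restrict_mem measurableSet_Ioo] with t ht hmem
      rw [ht, norm_neg]
      refine (norm_volConv_le (M := M) (σ := σ) (B := D * B ^ (m + 1) * (1 / 2) ^ k) hK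
        (by positivity) hmem.2.le ?_).trans ?_
      · filter_upwards [h1] with s hs hs'
        exact hs ⟨hs'.1, hs'.2.trans hmem.2⟩
      · calc D * B ^ (m + 1) * (1 / 2) ^ k * Real.exp (σ * t) * weightedMass K σ M
            ≤ D * B ^ (m + 1) * (1 / 2) ^ k * Real.exp (σ * t) * (1 / (2 * B)) := by gcongr
          _ = D * B ^ m * (1 / 2) ^ (k + 1) * Real.exp (σ * t) := by
              field_simp; ring
  filter_upwards [ae_all_iff.2 fun k => key k 0] with t ht
  have hlim : Tendsto (fun k : ℕ => D * B ^ 0 * (1 / 2 : ℝ) ^ k * Real.exp (σ * t)) atTop (𝓝 0) := by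
    have := ((tendsto_pow_atTop_nhds_zero_of_lt_one (r := (1 / 2 : ℝ)) (by norm_num)
      (by norm_num)).const_mul (D * B ^ 0)).mul_const (Real.exp (σ * t))
    simpa using this
  exact norm_le_zero_iff.1 (ge_of_tendsto' hlim ht)

/-- For merely integrable functions the convolution integrals converge only for almost every `t`,
and linearity holds exactly there. -/
theorem volConv_sub_ae {K : ℝ → ℝ} {M : ℝ} (hK : IntegrableOn K (Ioc 0 M)) {f g : ℝ → ℂ}
    (hf : IntegrableOn f (Ioo 0 M)) (hg : IntegrableOn g (Ioo 0 M)) :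
    ∀ᵐ t ∂volume.restrict (Ioo 0 M),
      volConv K (fun s => f s - g s) t = volConv K f t - volConv K g t := by
  filter_upwards [ae_restrict_of_ae (integrable_conv_kernel hK hf).prod_right_ae,
    ae_restrict_of_ae (integrable_conv_kernel hK hg).prod_right_ae,
    ae_restrict_mem measurableSet_Ioo] with t h1 h2 ht
  rw [volConv_eq_integral ht.2.le, volConv_eq_integral ht.2.le, volConv_eq_integral ht.2.le,
    ← integral_sub h1 h2]
  refine integral_congr_ae (Eventually.of_forall fun s => ?_)
  simp only
  rw [← mul_sub]
  congr 1
  by_cases hs : s ∈ Ioo 0 M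
  · simp only [indicator_of_mem hs]
  · simp only [indicator_of_notMem hs, sub_zero]

/-- The resolvent equation, integrated against a function of the spectral parameter. -/
theorem integral_resolvent_mul {K : ℝ → ℝ} (hK : ∀ M, IntegrableOn K (Ioc 0 M)) {X : Type*}
    [MeasurableSpace X] {μ : Measure X} [SFinite μ] {lam : X → ℝ} (hlam : Measurable lam)
    {f : X → ℂ} (hf : Integrable f μ) {Λ : ℝ} (hΛ : ∀ x, f x ≠ 0 → |lam x| ≤ Λ) (t : ℝ) :
    Integrable (fun x => (resolvent K (lam x) t : ℂ) * f x) μ ∧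
    ∫ x, (resolvent K (lam x) t : ℂ) * f x ∂μ = ∫ x, f x ∂μ
      - volConv K (fun s => ∫ x, (resolvent K (lam x) s : ℂ) * ((lam x : ℂ) * f x) ∂μ) t := by
  obtain ⟨σ, hσ, hq⟩ := exists_sigma hK |Λ| |t|
  rw [abs_abs] at hq
  have hr : ∀ x s, f x ≠ 0 → |s| ≤ |t| → |resolvent K (lam x) s| ≤ 2 * Real.exp (σ * |t|) :=
    fun x s hx hs => (abs_resolvent_le hK hσ hq ((hΛ x hx).trans (le_abs_self Λ))
      ((le_abs_self s).trans hs)).trans (by gcongr)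
  have hm : Measurable fun p : X × ℝ => resolvent K (lam p.1) p.2 :=
    (continuous_resolvent hK).measurable.comp ((hlam.comp measurable_fst).prodMk measurable_snd)
  have hint1 : Integrable (fun x => (resolvent K (lam x) t : ℂ) * f x) μ := by
    refine (hf.norm.const_mul (2 * Real.exp (σ * |t|))).mono' ?_ (Eventually.of_forall fun x => ?_)
    · exact (Complex.measurable_ofReal.comp (hm.comp
        (measurable_id.prodMk measurable_const))).aestronglyMeasurable.mul hf.aestronglyMeasurable
    · rw [norm_mul, Complex.norm_real, Real.norm_eq_abs]
      by_cases hx : f x = 0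
      · simp [hx]
      · gcongr
        exact hr x t hx le_rfl
  refine ⟨hint1, ?_⟩
  have hprod : Integrable (fun p : X × ℝ => (K p.2 : ℂ) * ((resolvent K (lam p.1) (t - p.2) : ℂ)
      * ((lam p.1 : ℂ) * f p.1))) (μ.prod (volume.restrict (Ioc 0 t))) := by
    have h1 : Integrable (fun p : X × ℝ => f p.1 * (K p.2 : ℂ))
        (μ.prod (volume.restrict (Ioc 0 t))) := hf.mul_prod (hK t).ofReal
    refine (h1.norm.const_mul (2 * Real.exp (σ * |t|) * |Λ|)).mono' ?_ ?_
    · have h2 : AEStronglyMeasurable (fun p : X × ℝ => (K p.2 : ℂ))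
          (μ.prod (volume.restrict (Ioc 0 t))) :=
        (hK t).ofReal.aestronglyMeasurable.comp_snd
      have h3 : AEStronglyMeasurable (fun p : X × ℝ => f p.1)
          (μ.prod (volume.restrict (Ioc 0 t))) := hf.aestronglyMeasurable.comp_fst
      refine h2.mul (AEStronglyMeasurable.mul ?_ (AEStronglyMeasurable.mul ?_ h3))
      · exact (Complex.measurable_ofReal.comp (hm.comp (measurable_fst.prodMk
          (measurable_const.sub measurable_snd)))).aestronglyMeasurable
      · exact (Complex.measurable_ofReal.comp
          (hlam.comp measurable_fst)).aestronglyMeasurable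
    · have h4 : ∀ᵐ p ∂(μ.prod (volume.restrict (Ioc 0 t))), p.2 ∈ Ioc 0 t :=
        Measure.quasiMeasurePreserving_snd.ae (ae_restrict_mem measurableSet_Ioc)
      filter_upwards [h4] with p hp
      by_cases hx : f p.1 = 0
      · simp [hx]
      · simp only [norm_mul, Complex.norm_real, Real.norm_eq_abs]
        have h5 : |t - p.2| ≤ |t| := by
          rw [abs_of_nonneg (by linarith [hp.2]), abs_of_nonneg (by linarith [hp.1, hp.2])]
          linarith [hp.1]
        have h6 := hr p.1 (t - p.2) hx h5
        have h7 := (hΛ p.1 hx).trans (le_abs_self Λ)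
        calc |K p.2| * (|resolvent K (lam p.1) (t - p.2)| * (|lam p.1| * ‖f p.1‖))
            ≤ |K p.2| * (2 * Real.exp (σ * |t|) * (|Λ| * ‖f p.1‖)) := by gcongr
          _ = _ := by ring
  have hswap := integral_integral_swap (f := fun x s => (K s : ℂ)
    * ((resolvent K (lam x) (t - s) : ℂ) * ((lam x : ℂ) * f x))) hprod
  have hinner : ∀ x, ∫ s in Ioc 0 t, (K s : ℂ) * ((resolvent K (lam x) (t - s) : ℂ)
      * ((lam x : ℂ) * f x)) = f x - (resolvent K (lam x) t : ℂ) * f x := by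
    intro x
    rw [resolvent_eq hK (lam x) t]
    push_cast
    rw [← integral_complex_ofReal]
    simp_rw [← mul_assoc]
    rw [integral_mul_const, integral_mul_const]
    push_cast
    ring
  simp_rw [hinner] at hswap
  rw [integral_sub hf hint1] at hswap
  have : volConv K (fun s => ∫ x, (resolvent K (lam x) s : ℂ) * ((lam x : ℂ) * f x) ∂μ) t
      = ∫ s in Ioc 0 t, ∫ x, (K s : ℂ) * ((resolvent K (lam x) (t - s) : ℂ)
        * ((lam x : ℂ) * f x)) ∂μ := by
    simp_rw [integral_const_mul]; rfl
  rw [this, ← hswap]; ring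

/-- The symbol `4π²|ξ|²` of `-Δ`. -/
noncomputable def symb {n : ℕ} (ξ : Rn n) : ℝ := (2 * Real.pi) ^ 2 * ‖ξ‖ ^ 2

variable {n : ℕ}

theorem symb_nonneg (ξ : Rn n) : 0 ≤ symb ξ := by unfold symb; positivity

theorem continuous_symb : Continuous (symb : Rn n → ℝ) := by unfold symb; fun_prop

theorem symb_smul (c : ℝ) (ξ : Rn n) : symb (c • ξ) = c ^ 2 * symb ξ := by
  unfold symb
  rw [norm_smul, mul_pow ‖c‖, Real.norm_eq_abs, sq_abs]; ring

theorem hasTemperateGrowth_symb :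
    (fun ξ : Rn n => (symb ξ : ℂ)).HasTemperateGrowth := by
  unfold symb
  have h : (fun ξ : Rn n => ((2 * Real.pi) ^ 2 * ‖ξ‖ ^ 2 : ℝ)).HasTemperateGrowth := by fun_prop
  exact Complex.ofRealCLM.hasTemperateGrowth.comp h

/-- Multiplication by the symbol of `-Δ`. -/
noncomputable def symbMul (n : ℕ) : 𝓢(Rn n, ℂ) →L[ℂ] 𝓢(Rn n, ℂ) :=
  SchwartzMap.smulLeftCLM ℂ fun ξ => (symb ξ : ℂ)

theorem symbMul_apply (ψ : 𝓢(Rn n, ℂ)) (ξ : Rn n) : symbMul n ψ ξ = (symb ξ : ℂ) * ψ ξ := by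
  rw [symbMul, SchwartzMap.smulLeftCLM_apply_apply hasTemperateGrowth_symb, smul_eq_mul]

theorem apply_laplacian_fourier (U : 𝓢'(Rn n, ℂ)) (ψ : 𝓢(Rn n, ℂ)) :
    U (Δ (𝓕 ψ)) = -U (𝓕 (symbMul n ψ)) := by
  rw [← TemperedDistribution.laplacian_apply_apply,
    TemperedDistribution.laplacian_eq_fourierMultiplierCLM]
  have h : symbMul n ψ = ((2 * Real.pi) ^ 2 : ℝ) •
      SchwartzMap.smulLeftCLM ℂ (fun x : Rn n => Complex.ofReal (‖x‖ ^ 2)) ψ := by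
    ext ξ
    have hg : (fun x : Rn n => Complex.ofReal (‖x‖ ^ 2)).HasTemperateGrowth :=
      Complex.ofRealCLM.hasTemperateGrowth.comp
        (by fun_prop : (fun x : Rn n => ‖x‖ ^ 2).HasTemperateGrowth)
    rw [symbMul_apply, smul_apply, SchwartzMap.smulLeftCLM_apply_apply hg, symb]
    simp; ring
  rw [h, show (((2 * Real.pi) ^ 2 : ℝ) •
      SchwartzMap.smulLeftCLM ℂ (fun x : Rn n => Complex.ofReal (‖x‖ ^ 2)) ψ)
      = (((2 * Real.pi) ^ 2 : ℝ) : ℂ) •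
      SchwartzMap.smulLeftCLM ℂ (fun x : Rn n => Complex.ofReal (‖x‖ ^ 2)) ψ from by
        ext; simp, FourierTransform.fourier_smul, map_smul]
  rw [show ∀ V : 𝓢'(Rn n, ℂ), (-(2 * Real.pi) ^ 2 • V) (𝓕 ψ)
    = -((((2 * Real.pi) ^ 2 : ℝ) : ℂ) • V (𝓕 ψ)) from fun V => by simp,
    TemperedDistribution.fourierMultiplierCLM_apply_apply, FourierTransform.fourierInv_fourier_eq]

theorem integral_mul_fourier {u₀ : Rn n → ℂ} (hu₀ : Integrable u₀) (ψ : 𝓢(Rn n, ℂ)) :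
    ∫ x, u₀ x * (𝓕 ψ) x = ∫ ξ, 𝓕 u₀ ξ * ψ ξ := by
  have := VectorFourier.integral_fourierIntegral_smul_eq_flip (μ := volume) (ν := volume)
    (L := innerₗ (Rn n)) Real.continuous_fourierChar continuous_inner hu₀ ψ.integrable
  simpa using! this.symm

theorem norm_fourier_le {u₀ : Rn n → ℂ} (ξ : Rn n) : ‖𝓕 u₀ ξ‖ ≤ ∫ x, ‖u₀ x‖ :=
  VectorFourier.norm_fourierIntegral_le_integral_norm _ _ _ _ _

theorem continuous_fourier_of_integrable {u₀ : Rn n → ℂ} (hu₀ : Integrable u₀) :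
    Continuous (𝓕 u₀) :=
  VectorFourier.fourierIntegral_continuous Real.continuous_fourierChar
    (by exact continuous_inner) hu₀

/-- The spectral side of a weak solution, on a bounded time interval. -/
theorem IsWeakSolution.fourier_ae_eq_Ioo {u : ℝ → 𝓢'(Rn n, ℂ)} {a₀ : ℝ} {a : ℝ → ℝ}
    {u₀ : Rn n → ℂ} (ha : IsAdmissibleKernel a₀ a) (hu₀ : Integrable u₀)
    (hu : IsWeakSolution a₀ a u₀ u) {ψ : 𝓢(Rn n, ℂ)} (hψ : HasCompactSupport ψ) (M : ℝ) :
    ∀ᵐ t ∂volume.restrict (Ioo 0 M), u t (𝓕 ψ)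
      = ∫ ξ, (resolvent (kern a₀ a) (symb ξ) t : ℂ) * (𝓕 u₀ ξ * ψ ξ) := by
  have hK := ha.isTameKernel.integrableOn_Ioc
  set K := kern a₀ a with hKdef
  obtain ⟨R, hR⟩ := hψ.isCompact.isBounded.subset_closedBall 0
  have hψ0 : ∀ ξ, ψ ξ ≠ 0 → ‖ξ‖ ≤ |R| := fun ξ h => by
    have := hR (subset_tsupport _ h)
    rw [mem_closedBall_zero_iff] at this
    exact this.trans (le_abs_self R)
  -- A bump function that equals `1` on the support of `ψ`. On that support the symbol agrees with
  -- the fixed Schwartz function `g`, so all Schwartz seminorms of the iterates grow at most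
  -- geometrically.
  let b : ContDiffBump (0 : Rn n) := ⟨|R| + 1, |R| + 2, by positivity, by linarith⟩
  have hbs : HasCompactSupport (fun x => ((symb x * b x : ℝ) : ℂ)) :=
    (b.hasCompactSupport.mul_left (f := symb)).comp_left (g := fun r : ℝ => (r : ℂ))
      Complex.ofReal_zero
  have hbd : ContDiff ℝ ∞ (fun x : Rn n => ((symb x * b x : ℝ) : ℂ)) := by
    refine Complex.ofRealCLM.contDiff.comp (ContDiff.mul ?_ b.contDiff)
    exact contDiff_const.mul (contDiff_norm_sq ℝ)
  let g : 𝓢(Rn n, ℂ) := hbs.toSchwartzMap hbd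
  let ψs : ℕ → 𝓢(Rn n, ℂ) := fun m => ((symbMul n)^[m]) ψ
  have hψs : ∀ m ξ, ψs (m + 1) ξ = (symb ξ : ℂ) * ψs m ξ := fun m ξ => by
    simp only [ψs, Function.iterate_succ_apply', symbMul_apply]
  have hψs0 : ∀ m ξ, ψs m ξ ≠ 0 → ‖ξ‖ ≤ |R| := by
    intro m
    induction m with
    | zero => exact hψ0
    | succ m ih => intro ξ h; rw [hψs] at h; exact ih ξ (right_ne_zero_of_mul h)
  have hψg : ∀ m ξ, ψs (m + 1) ξ = g ξ * ψs m ξ := fun m ξ => by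
    rw [hψs]
    by_cases h : ψs m ξ = 0
    · simp [h]
    · have h1 : b ξ = 1 := b.one_of_mem_closedBall (by
        rw [mem_closedBall_zero_iff]; exact (hψs0 m ξ h).trans (by simp [b]))
      change _ = ((symb ξ * b ξ : ℝ) : ℂ) * _
      rw [h1, mul_one]
  have hbound : ∀ N, ∃ B, 0 ≤ B ∧ ∀ m, supSeminorm (Rn n) N (ψs m)
      ≤ supSeminorm (Rn n) N ψ * B ^ m := by
    intro N
    obtain ⟨B, hB, h⟩ := exists_supSeminorm_mul_le g N
    refine ⟨B, hB, fun m => ?_⟩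
    induction m with
    | zero => simp [ψs]
    | succ m ih =>
      refine (h _ _ (hψg m)).trans ?_
      calc B * supSeminorm (Rn n) N (ψs m) ≤ B * (supSeminorm (Rn n) N ψ * B ^ m) := by gcongr
        _ = _ := by ring
  -- the distributional side
  obtain ⟨C, N, hC, hu1⟩ := hu.family.exists_bound M
  -- Local boundedness of the family provides a single order `N` on `[0, M]`; this is what makes the
  -- bounds on `u t (𝓕 (ψs m))` geometric in `m`, uniformly in `t`.
  obtain ⟨C', N', hC', hF⟩ := exists_supSeminorm_comp_le
    (FourierTransform.fourierCLM ℂ 𝓢(Rn n, ℂ)) N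
  obtain ⟨B, hB, hB1⟩ := hbound N'
  -- the explicit side
  set Λ := (2 * Real.pi) ^ 2 * |R| ^ 2 with hΛ
  have hΛ0 : 0 ≤ Λ := by positivity
  have hsymb : ∀ m ξ, ψs m ξ ≠ 0 → |symb ξ| ≤ Λ := fun m ξ h => by
    rw [abs_of_nonneg (symb_nonneg ξ), symb, hΛ]
    gcongr
    exact hψs0 m ξ h
  obtain ⟨σ, hσ, hq⟩ := exists_sigma hK Λ M
  rw [abs_of_nonneg hΛ0] at hq
  have hint : ∀ m, Integrable fun ξ => 𝓕 u₀ ξ * ψs m ξ := fun m =>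
    (ψs m).integrable.bdd_mul (continuous_fourier_of_integrable hu₀).aestronglyMeasurable
      (Eventually.of_forall norm_fourier_le)
  have hpsi : ∀ m, ∫ ξ, ‖𝓕 u₀ ξ * ψs m ξ‖ ≤ (∫ ξ, ‖𝓕 u₀ ξ * ψ ξ‖) * Λ ^ m := by
    intro m
    induction m with
    | zero => simp [ψs]
    | succ m ih =>
      calc ∫ ξ, ‖𝓕 u₀ ξ * ψs (m + 1) ξ‖ ≤ ∫ ξ, Λ * ‖𝓕 u₀ ξ * ψs m ξ‖ := by
            refine integral_mono (hint _).norm ((hint m).norm.const_mul _) fun ξ => ?_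
            simp only [hψs, norm_mul, Complex.norm_real, Real.norm_eq_abs]
            by_cases h : ψs m ξ = 0
            · simp [h]
            · calc ‖𝓕 u₀ ξ‖ * (|symb ξ| * ‖ψs m ξ‖) ≤ ‖𝓕 u₀ ξ‖ * (Λ * ‖ψs m ξ‖) := by
                    gcongr; exact hsymb m ξ h
                _ = _ := by ring
        _ = Λ * ∫ ξ, ‖𝓕 u₀ ξ * ψs m ξ‖ := integral_const_mul _ _
        _ ≤ Λ * ((∫ ξ, ‖𝓕 u₀ ξ * ψ ξ‖) * Λ ^ m) := by gcongr
        _ = _ := by ring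
  let G : ℕ → ℝ → ℂ := fun m t => ∫ ξ, (resolvent K (symb ξ) t : ℂ) * (𝓕 u₀ ξ * ψs m ξ)
  have hne : ∀ m ξ, 𝓕 u₀ ξ * ψs m ξ ≠ 0 → |symb ξ| ≤ Λ := fun m ξ h =>
    hsymb m ξ (right_ne_zero_of_mul h)
  have hGint := fun m t => (integral_resolvent_mul hK continuous_symb.measurable (hint m)
    (hne m) t).1
  have hG : ∀ m t, G m t = (∫ ξ, 𝓕 u₀ ξ * ψs m ξ) - volConv K (G (m + 1)) t := fun m t => by
    have := (integral_resolvent_mul hK continuous_symb.measurable (hint m) (hne m) t).2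
    simp only [G]
    rw [this]
    congr 2
    funext s
    refine integral_congr_ae (Eventually.of_forall fun ξ => ?_)
    simp only [hψs]; ring
  have hGb : ∀ m, ∀ t ∈ Ioo 0 M, ‖G m t‖
      ≤ 2 * Real.exp (σ * M) * (∫ ξ, ‖𝓕 u₀ ξ * ψ ξ‖) * Λ ^ m := fun m t ht => by
    calc ‖G m t‖ ≤ ∫ ξ, 2 * Real.exp (σ * M) * ‖𝓕 u₀ ξ * ψs m ξ‖ := by
          refine norm_integral_le_of_norm_le ((hint m).norm.const_mul _)
            (Eventually.of_forall fun ξ => ?_)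
          rw [norm_mul, Complex.norm_real, Real.norm_eq_abs]
          by_cases h : 𝓕 u₀ ξ * ψs m ξ = 0
          · simp [h]
          · gcongr
            refine (abs_resolvent_le hK hσ hq (hne m ξ h) ht.2.le).trans ?_
            rw [abs_of_pos ht.1]
            gcongr
            exact ht.2.le
      _ = 2 * Real.exp (σ * M) * ∫ ξ, ‖𝓕 u₀ ξ * ψs m ξ‖ := integral_const_mul _ _
      _ ≤ 2 * Real.exp (σ * M) * ((∫ ξ, ‖𝓕 u₀ ξ * ψ ξ‖) * Λ ^ m) := by gcongr; exact hpsi m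
      _ = _ := by ring
  have hVi : ∀ m, IntegrableOn (fun s => u s (𝓕 (ψs m))) (Ioo 0 M) := fun m =>
    hu.family.integrableOn _ M
  have hGi : ∀ m, IntegrableOn (G m) (Ioo 0 M) := fun m => by
    refine IntegrableOn.of_bound (by simp) ?_ _ ((ae_restrict_iff' measurableSet_Ioo).2
      (Eventually.of_forall (hGb m)))
    have hcont : Continuous (Function.uncurry fun (t : ℝ) (ξ : Rn n) =>
        (resolvent K (symb ξ) t : ℂ) * (𝓕 u₀ ξ * ψs m ξ)) := by
      refine (Complex.continuous_ofReal.comp ((continuous_resolvent hK).comp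
        ((continuous_symb.comp continuous_snd).prodMk continuous_fst))).mul ?_
      exact ((continuous_fourier_of_integrable hu₀).comp continuous_snd).mul
        ((ψs m).continuous.comp continuous_snd)
    exact hcont.stronglyMeasurable.integral_prod_right.aestronglyMeasurable
  -- Both sides have the same initial value and satisfy the same chain of equations, in which each
  -- application of the Laplacian advances the index by one; hence their differences form a
  -- homogeneous chain.
  have hchain := ae_eq_zero_of_volConv_chain (K := K) (M := M) (B := max (max B Λ) 1)
    (D := C * C' * supSeminorm (Rn n) N' ψ + 2 * Real.exp (σ * M) * (∫ ξ, ‖𝓕 u₀ ξ * ψ ξ‖))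
    (y := fun m t => u t (𝓕 (ψs m)) - G m t) (hK M) (by positivity) (by positivity) ?_ ?_
  · filter_upwards [hchain] with t ht
    exact sub_eq_zero.1 ht
  · intro m
    have h1 := ae_restrict_of_ae_restrict_of_subset (s := Ioo 0 M) (fun t ht => ht.1)
      (hu.ae_eq ha hu₀ (𝓕 (ψs m)))
    filter_upwards [h1, volConv_sub_ae (hK M) (hVi (m + 1)) (hGi (m + 1))] with t ht hsub
    have h2 : (fun s => u s (Δ (𝓕 (ψs m)))) = fun s => -u s (𝓕 (ψs (m + 1))) := by
      funext s
      rw [apply_laplacian_fourier]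
      simp only [ψs, Function.iterate_succ_apply']
    have h3 : volConv K (fun s => -u s (𝓕 (ψs (m + 1)))) t
        = -volConv K (fun s => u s (𝓕 (ψs (m + 1)))) t := by
      unfold volConv
      rw [← integral_neg]
      refine integral_congr_ae (Eventually.of_forall fun s => ?_)
      simp only [mul_neg]
    rw [hsub, ht, h2, h3, hG m t, integral_mul_fourier hu₀]
    ring
  · intro m
    filter_upwards [ae_restrict_mem measurableSet_Ioo] with t ht
    refine (norm_sub_le _ _).trans ?_
    rw [add_mul]
    have h1 : B ≤ max (max B Λ) 1 := le_max_of_le_left (le_max_left _ _)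
    have h2 : Λ ≤ max (max B Λ) 1 := le_max_of_le_left (le_max_right _ _)
    refine add_le_add ?_ ((hGb m t ht).trans (by gcongr))
    calc ‖u t (𝓕 (ψs m))‖ ≤ C * supSeminorm (Rn n) N (𝓕 (ψs m)) := hu1 t ⟨ht.1.le, ht.2.le⟩ _
      _ ≤ C * (C' * supSeminorm (Rn n) N' (ψs m)) := by gcongr; exact hF (ψs m)
      _ ≤ C * (C' * (supSeminorm (Rn n) N' ψ * B ^ m)) := by gcongr; exact hB1 m
      _ = C * C' * supSeminorm (Rn n) N' ψ * B ^ m := by ring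
      _ ≤ _ := by gcongr

theorem ae_restrict_Ioi_of_forall_Ioo {p : ℝ → Prop}
    (h : ∀ M : ℝ, ∀ᵐ t ∂volume.restrict (Ioo 0 M), p t) :
    ∀ᵐ t ∂volume.restrict (Ioi (0 : ℝ)), p t := by
  have h1 := ae_all_iff.2 fun m : ℕ => (ae_restrict_iff' measurableSet_Ioo).1 (h m)
  rw [ae_restrict_iff' measurableSet_Ioi]
  filter_upwards [h1] with t ht hmem
  obtain ⟨m, hm⟩ := exists_nat_gt t
  exact ht m ⟨hmem, hm⟩

/-- The spatial Fourier transform of a weak solution is `ξ ↦ r(4π²|ξ|², t) 𝓕 u₀(ξ)`, tested with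
compactly supported functions. -/
theorem IsWeakSolution.fourier_ae_eq {u : ℝ → 𝓢'(Rn n, ℂ)} {a₀ : ℝ} {a : ℝ → ℝ}
    {u₀ : Rn n → ℂ} (ha : IsAdmissibleKernel a₀ a) (hu₀ : Integrable u₀)
    (hu : IsWeakSolution a₀ a u₀ u) {ψ : 𝓢(Rn n, ℂ)} (hψ : HasCompactSupport ψ) :
    ∀ᵐ t ∂volume.restrict (Ioi (0 : ℝ)), (𝓕 (u t)) ψ
      = ∫ ξ, (resolvent (kern a₀ a) (symb ξ) t : ℂ) * 𝓕 u₀ ξ * ψ ξ :=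
  ae_restrict_Ioi_of_forall_Ioo fun M => by
    filter_upwards [hu.fourier_ae_eq_Ioo ha hu₀ hψ M] with t ht
    simp_rw [TemperedDistribution.fourier_apply, ht, mul_assoc]

end SelfSimilar

namespace SelfSimilar

/-! ### Fourier representations and Sobolev norms -/

variable {n : ℕ}

/-- The Sobolev weight `(1 + |ξ|²)^{s/2}`. -/
noncomputable def wt (s : ℝ) (ξ : Rn n) : ℝ := (1 + ‖ξ‖ ^ 2) ^ (s / 2)

theorem wt_pos (s : ℝ) (ξ : Rn n) : 0 < wt s ξ := Real.rpow_pos_of_pos (by positivity) _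

theorem continuous_wt (s : ℝ) : Continuous (wt s : Rn n → ℝ) := by
  unfold wt
  exact Continuous.rpow_const (by fun_prop) fun ξ => Or.inl (by positivity)

theorem wt_neg_mul (s : ℝ) (ξ : Rn n) : wt (-s) ξ * wt s ξ = 1 := by
  unfold wt
  rw [← Real.rpow_add (by positivity), show -s / 2 + s / 2 = 0 by ring, Real.rpow_zero]

theorem hasTemperateGrowth_wt (s : ℝ) : (fun ξ : Rn n => (wt s ξ : ℂ)).HasTemperateGrowth :=
  Complex.ofRealCLM.hasTemperateGrowth.comp
    (Function.hasTemperateGrowth_one_add_norm_sq_rpow (Rn n) (s / 2))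

/-- Multiplication by the Sobolev weight. -/
noncomputable def wtMul (n : ℕ) (s : ℝ) : 𝓢(Rn n, ℂ) →L[ℂ] 𝓢(Rn n, ℂ) :=
  SchwartzMap.smulLeftCLM ℂ fun ξ => (wt s ξ : ℂ)

theorem wtMul_apply (s : ℝ) (ψ : 𝓢(Rn n, ℂ)) (ξ : Rn n) : wtMul n s ψ ξ = (wt s ξ : ℂ) * ψ ξ := by
  rw [wtMul, SchwartzMap.smulLeftCLM_apply_apply (hasTemperateGrowth_wt s), smul_eq_mul]

/-- The weighted function `(1 + |ξ|²)^{s/2} m(ξ)`. -/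
noncomputable def wtd (s : ℝ) (m : Rn n → ℂ) (ξ : Rn n) : ℂ := (wt s ξ : ℂ) * m ξ

theorem wtd_neg_wtd (s : ℝ) (m : Rn n → ℂ) : wtd (-s) (wtd s m) = m := by
  ext ξ
  rw [wtd, wtd, ← mul_assoc, ← Complex.ofReal_mul, wt_neg_mul, Complex.ofReal_one, one_mul]

theorem wtd_wtd_neg (s : ℝ) (m : Rn n → ℂ) : wtd s (wtd (-s) m) = m := by
  simpa using wtd_neg_wtd (-s) m

theorem aestronglyMeasurable_wtd {s : ℝ} {m : Rn n → ℂ} (hm : AEStronglyMeasurable m) :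
    AEStronglyMeasurable (wtd s m) :=
  (Complex.continuous_ofReal.comp (continuous_wt s)).aestronglyMeasurable.mul hm

theorem aestronglyMeasurable_of_wtd {s : ℝ} {m : Rn n → ℂ}
    (hm : AEStronglyMeasurable (wtd s m)) : AEStronglyMeasurable m := by
  rw [← wtd_neg_wtd s m]; exact aestronglyMeasurable_wtd hm

/-- Pairing of a weighted `L²` function with a Schwartz function. -/
theorem exists_integral_norm_mul_le (s : ℝ) (φ : 𝓢(Rn n, ℂ)) :
    ∃ C : ℝ, 0 ≤ C ∧ ∀ m : Rn n → ℂ, MemLp (wtd s m) 2 →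
      Integrable (fun ξ => m ξ * φ ξ) ∧
      ∫ ξ, ‖m ξ * φ ξ‖ ≤ (eLpNorm (wtd s m) 2 volume).toReal * C := by
  have hφ : MemLp (wtMul n (-s) φ) 2 := SchwartzMap.memLp _ _ _
  refine ⟨(eLpNorm (wtMul n (-s) φ) 2 volume).toReal, ENNReal.toReal_nonneg, fun m hm => ?_⟩
  have he : ∀ ξ, m ξ * φ ξ = wtd s m ξ * wtMul n (-s) φ ξ := by
    intro ξ
    rw [wtMul_apply, wtd]
    have := congrArg (fun r : ℝ => (r : ℂ)) (wt_neg_mul s ξ)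
    push_cast at this
    linear_combination (-m ξ * φ ξ) * this
  simp_rw [he]
  have hi : Integrable fun ξ => wtd s m ξ * wtMul n (-s) φ ξ := hm.integrable_mul hφ
  refine ⟨hi, ?_⟩
  have h1 := eLpNorm_smul_le_mul_eLpNorm (p := 2) (q := 2) (r := 1) (μ := volume)
    hφ.aestronglyMeasurable hm.aestronglyMeasurable
  rw [eLpNorm_one_eq_lintegral_enorm] at h1
  rw [integral_norm_eq_lintegral_enorm hi.aestronglyMeasurable, ← ENNReal.toReal_mul]
  exact ENNReal.toReal_mono (ENNReal.mul_ne_top hm.eLpNorm_ne_top hφ.eLpNorm_ne_top) h1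

/-- `m` is the Fourier transform of `U` (with Mathlib's normalization). -/
def FourierRep (U : 𝓢'(Rn n, ℂ)) (m : Rn n → ℂ) : Prop :=
  ∀ φ : 𝓢(Rn n, ℂ), Integrable (fun ξ => m ξ * φ ξ) ∧ (𝓕 U) φ = ∫ ξ, m ξ * φ ξ

/-- It suffices to test with a bump function that is `1` near the given point. -/
theorem FourierRep.locallyIntegrable {U : 𝓢'(Rn n, ℂ)} {m : Rn n → ℂ} (h : FourierRep U m) :
    LocallyIntegrable m := by
  intro ξ
  let b : ContDiffBump ξ := ⟨1, 2, one_pos, one_lt_two⟩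
  have hbs : HasCompactSupport (fun x => ((b x : ℝ) : ℂ)) :=
    b.hasCompactSupport.comp_left (g := fun r : ℝ => (r : ℂ)) Complex.ofReal_zero
  have hbd : ContDiff ℝ ∞ (fun x => ((b x : ℝ) : ℂ)) :=
    Complex.ofRealCLM.contDiff.comp b.contDiff
  refine ⟨Metric.closedBall ξ 1, Metric.closedBall_mem_nhds _ one_pos, ?_⟩
  refine ((h (hbs.toSchwartzMap hbd)).1.integrableOn (s := Metric.closedBall ξ 1)).congr_fun
    (fun η hη => ?_) Metric.isClosed_closedBall.measurableSet
  change m η * ((b η : ℝ) : ℂ) = m η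
  rw [b.one_of_mem_closedBall hη]; simp

theorem FourierRep.ae_eq {U : 𝓢'(Rn n, ℂ)} {m m' : Rn n → ℂ} (h : FourierRep U m)
    (h' : FourierRep U m') : m =ᵐ[volume] m' := by
  refine ae_eq_of_integral_contDiff_smul_eq h.locallyIntegrable h'.locallyIntegrable
    fun g hg hgs => ?_
  have hbs : HasCompactSupport (fun x => ((g x : ℝ) : ℂ)) :=
    hgs.comp_left (g := fun r : ℝ => (r : ℂ)) Complex.ofReal_zero
  have hbd : ContDiff ℝ ∞ (fun x => ((g x : ℝ) : ℂ)) := Complex.ofRealCLM.contDiff.comp hg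
  have h1 := (h (hbs.toSchwartzMap hbd)).2.symm.trans (h' (hbs.toSchwartzMap hbd)).2
  simpa [mul_comm, Complex.real_smul] using! h1

theorem FourierRep.congr {U : 𝓢'(Rn n, ℂ)} {m m' : Rn n → ℂ} (h : FourierRep U m)
    (hm : m =ᵐ[volume] m') : FourierRep U m' := fun φ => by
  have he : (fun ξ => m ξ * φ ξ) =ᵐ[volume] fun ξ => m' ξ * φ ξ := by
    filter_upwards [hm] with ξ hξ; rw [hξ]
  exact ⟨(h φ).1.congr he, (h φ).2.trans (integral_congr_ae he)⟩

theorem FourierRep.eq {U U' : 𝓢'(Rn n, ℂ)} {m : Rn n → ℂ} (h : FourierRep U m)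
    (h' : FourierRep U' m) : U = U' := by
  have : 𝓕 U = 𝓕 U' := by
    ext φ; rw [(h φ).2, (h' φ).2]
  have h2 := congrArg (fun V : 𝓢'(Rn n, ℂ) => (𝓕⁻ V : 𝓢'(Rn n, ℂ))) this
  simpa using h2

theorem FourierRep.sub {U U' : 𝓢'(Rn n, ℂ)} {m m' : Rn n → ℂ} (h : FourierRep U m)
    (h' : FourierRep U' m') : FourierRep (U - U') fun ξ => m ξ - m' ξ := fun φ => by
  simp_rw [sub_mul]
  refine ⟨(h φ).1.sub (h' φ).1, ?_⟩
  rw [integral_sub (h φ).1 (h' φ).1, ← (h φ).2, ← (h' φ).2, TemperedDistribution.fourier_apply]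
  rfl

theorem FourierRep.const_smul {U : 𝓢'(Rn n, ℂ)} {m : Rn n → ℂ} (c : ℂ) (h : FourierRep U m) :
    FourierRep (c • U) fun ξ => c * m ξ := fun φ => by
  simp_rw [mul_assoc]
  refine ⟨(h φ).1.const_mul c, ?_⟩
  rw [integral_const_mul, ← (h φ).2]
  rfl

theorem FourierRep.zero : FourierRep (0 : 𝓢'(Rn n, ℂ)) fun _ => 0 := fun φ => by
  simp only [zero_mul, integral_zero]
  exact ⟨integrable_zero _ _ _, rfl⟩

theorem fourier_besselPotential_apply (s : ℝ) (U : 𝓢'(Rn n, ℂ)) (φ : 𝓢(Rn n, ℂ)) :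
    (𝓕 (TemperedDistribution.besselPotential (Rn n) ℂ s U)) φ = (𝓕 U) (wtMul n s φ) := by
  rw [TemperedDistribution.fourier_besselPotential_eq_smulLeftCLM_fourier_apply,
    TemperedDistribution.smulLeftCLM_apply_apply]
  rfl

theorem wtMul_wtMul_neg (s : ℝ) (φ : 𝓢(Rn n, ℂ)) : wtMul n s (wtMul n (-s) φ) = φ := by
  ext ξ
  rw [wtMul_apply, wtMul_apply, ← mul_assoc, ← Complex.ofReal_mul, mul_comm (wt s ξ), wt_neg_mul,
    Complex.ofReal_one, one_mul]

/-- A tempered distribution in `H^s` has a Fourier transform in the weighted `L²` space. -/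
theorem fourierRep_of_besselPotential_eq {s : ℝ} {U : 𝓢'(Rn n, ℂ)}
    {f : Lp ℂ 2 (volume : Measure (Rn n))}
    (h : TemperedDistribution.besselPotential (Rn n) ℂ s U = (f : 𝓢'(Rn n, ℂ))) :
    FourierRep U (wtd (-s) (𝓕 f : Lp ℂ 2 (volume : Measure (Rn n)))) := by
  intro φ
  obtain ⟨C, -, hC⟩ := exists_integral_norm_mul_le s φ
  have hm := hC (wtd (-s) (𝓕 f : Lp ℂ 2 (volume : Measure (Rn n))))
    (by rw [wtd_wtd_neg]; exact Lp.memLp _)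
  refine ⟨hm.1, ?_⟩
  rw [← wtMul_wtMul_neg s φ, ← fourier_besselPotential_apply, h,
    Lp.fourier_toTemperedDistribution_eq, Lp.toTemperedDistribution_apply]
  refine integral_congr_ae (Eventually.of_forall fun ξ => ?_)
  simp only [wtMul_wtMul_neg, wtMul_apply, wtd, smul_eq_mul]
  ring

/-- The Bessel potential multiplies the Fourier transform by the weight, so a square integrable
weighted symbol exhibits the required `L²` representative by Plancherel. -/
theorem FourierRep.besselPotential_eq {s : ℝ} {U : 𝓢'(Rn n, ℂ)} {m : Rn n → ℂ}
    (h : FourierRep U m) (hm : MemLp (wtd s m) 2) :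
    TemperedDistribution.besselPotential (Rn n) ℂ s U
      = ((𝓕⁻ (hm.toLp _) : Lp ℂ 2 (volume : Measure (Rn n))) : 𝓢'(Rn n, ℂ)) := by
  rw [← Lp.fourierInv_toTemperedDistribution_eq]
  suffices h2 : 𝓕 (TemperedDistribution.besselPotential (Rn n) ℂ s U)
      = ((hm.toLp _ : Lp ℂ 2 (volume : Measure (Rn n))) : 𝓢'(Rn n, ℂ)) by
    have h3 := congrArg (fun V : 𝓢'(Rn n, ℂ) => (𝓕⁻ V : 𝓢'(Rn n, ℂ))) h2
    simpa only [FourierTransform.fourierInv_fourier_eq] using h3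
  ext φ
  rw [fourier_besselPotential_apply, (h _).2, Lp.toTemperedDistribution_apply]
  refine integral_congr_ae ?_
  filter_upwards [hm.coeFn_toLp] with ξ hξ
  rw [hξ, wtMul_apply, wtd, smul_eq_mul]; ring

/-- The Sobolev norm is the weighted `L²` norm of the Fourier transform. -/
theorem FourierRep.eSobolevNorm_eq {U : 𝓢'(Rn n, ℂ)} {m : Rn n → ℂ} (h : FourierRep U m) (s : ℝ) :
    eSobolevNorm s U = eLpNorm (wtd s m) 2 volume := by
  have hmeas : AEStronglyMeasurable (wtd s m) :=
    aestronglyMeasurable_wtd h.locallyIntegrable.aestronglyMeasurable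
  refine le_antisymm ?_ ?_
  · by_cases hm : eLpNorm (wtd s m) 2 volume = ⊤
    · rw [hm]; exact le_top
    · have hL : MemLp (wtd s m) 2 := ⟨hmeas, lt_top_iff_ne_top.2 hm⟩
      have h1 : eSobolevNorm s U
          ≤ ‖(𝓕⁻ (hL.toLp _) : Lp ℂ 2 (volume : Measure (Rn n)))‖ₑ :=
        iInf₂_le_of_le (α := ℝ≥0∞) (𝓕⁻ (hL.toLp _) : Lp ℂ 2 (volume : Measure (Rn n)))
          (h.besselPotential_eq hL) le_rfl
      refine h1.trans_eq ?_
      rw [← ofReal_norm, ← Lp.norm_fourier_eq, FourierTransform.fourier_fourierInv_eq,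
        Lp.norm_toLp, ENNReal.ofReal_toReal hm]
  · rw [eSobolevNorm]
    refine le_iInf₂ (α := ℝ≥0∞) fun f hf => ?_
    have h1 := h.ae_eq (fourierRep_of_besselPotential_eq hf)
    have h2 : wtd s m =ᵐ[volume] (𝓕 f : Lp ℂ 2 (volume : Measure (Rn n))) := by
      filter_upwards [h1] with ξ hξ
      rw [wtd, hξ]
      exact congrFun (wtd_wtd_neg s _) ξ
    rw [eLpNorm_congr_ae h2, ← Lp.enorm_def, ← ofReal_norm, Lp.norm_fourier_eq, ofReal_norm]

theorem exists_fourierRep {s : ℝ} {U : 𝓢'(Rn n, ℂ)} (h : eSobolevNorm s U ≠ ⊤) :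
    ∃ m : Rn n → ℂ, FourierRep U m ∧ MemLp (wtd s m) 2 := by
  have : ∃ f : Lp ℂ 2 (volume : Measure (Rn n)),
      TemperedDistribution.besselPotential (Rn n) ℂ s U = (f : 𝓢'(Rn n, ℂ)) := by
    by_contra! hne
    refine h ?_
    rw [eSobolevNorm]
    simp [hne]
  obtain ⟨f, hf⟩ := this
  exact ⟨_, fourierRep_of_besselPotential_eq hf, by rw [wtd_wtd_neg]; exact Lp.memLp _⟩

theorem exists_fourierRep_of_memSobolev {s : ℝ} {U : 𝓢'(Rn n, ℂ)}
    (h : TemperedDistribution.MemSobolev s 2 U) :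
    ∃ m : Rn n → ℂ, FourierRep U m ∧ MemLp (wtd s m) 2 := by
  obtain ⟨f, hf⟩ := h
  exact ⟨_, fourierRep_of_besselPotential_eq hf, by rw [wtd_wtd_neg]; exact Lp.memLp _⟩

/-- Every function in the weighted `L²` space is the Fourier transform of a distribution. -/
theorem exists_distribution_of_memLp {s : ℝ} {m : Rn n → ℂ} (hm : MemLp (wtd s m) 2) :
    ∃ U : 𝓢'(Rn n, ℂ), FourierRep U m := by
  let f : Lp ℂ 2 (volume : Measure (Rn n)) := 𝓕⁻ (hm.toLp _)
  refine ⟨TemperedDistribution.besselPotential (Rn n) ℂ (-s) (f : 𝓢'(Rn n, ℂ)), ?_⟩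
  have h1 := fourierRep_of_besselPotential_eq (s := s)
    (U := TemperedDistribution.besselPotential (Rn n) ℂ (-s) (f : 𝓢'(Rn n, ℂ))) (f := f)
    ((TemperedDistribution.besselPotential_neg_apply_eq_iff s _ _).1 rfl)
  refine h1.congr ?_
  have h2 : (𝓕 f : Lp ℂ 2 (volume : Measure (Rn n))) = hm.toLp _ :=
    FourierTransform.fourier_fourierInv_eq _
  rw [h2]
  filter_upwards [hm.coeFn_toLp] with ξ hξ
  rw [wtd, hξ]
  exact congrFun (wtd_neg_wtd s m) ξ

theorem hasFourierTransform_of_fourierRep {U : 𝓢'(Rn n, ℂ)} {m : Rn n → ℂ}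
    (h : FourierRep U fun ξ => m ((2 * Real.pi) • ξ)) : HasFourierTransform U m := h

/-! ### Dilations -/

/-- The dilated test function `ψ(c ·)`. -/
noncomputable def dilTest (c : ℝ) (hc : c ≠ 0) : 𝓢(Rn n, ℂ) →L[ℂ] 𝓢(Rn n, ℂ) :=
  SchwartzMap.compCLMOfContinuousLinearEquiv ℂ
    (ContinuousLinearEquiv.smulLeft (R₁ := ℝ) (M₁ := Rn n) (Units.mk0 c hc))

theorem dilTest_apply {c : ℝ} (hc : c ≠ 0) (φ : 𝓢(Rn n, ℂ)) (x : Rn n) :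
    dilTest c hc φ x = φ (c • x) := rfl

theorem dilate_apply {c : ℝ} (hc : c ≠ 0) (U : 𝓢'(Rn n, ℂ)) (φ : 𝓢(Rn n, ℂ)) :
    dilate c U φ = U (dilTest c⁻¹ (inv_ne_zero hc) φ) := by
  rw [dilate, dif_pos hc]; rfl

theorem dilate_inv_dilate {c : ℝ} (hc : c ≠ 0) (U : 𝓢'(Rn n, ℂ)) :
    dilate c⁻¹ (dilate c U) = U := by
  ext φ
  rw [dilate_apply (inv_ne_zero hc), dilate_apply hc]
  congr 1
  ext x
  simp [dilTest_apply, smul_smul, hc]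

theorem dilate_dilate {b c : ℝ} (hb : b ≠ 0) (hc : c ≠ 0) (U : 𝓢'(Rn n, ℂ)) :
    dilate b (dilate c U) = dilate (b * c) U := by
  ext φ
  rw [dilate_apply hb, dilate_apply hc, dilate_apply (mul_ne_zero hb hc)]
  congr 1
  ext x
  simp [dilTest_apply, smul_smul, mul_comm]

theorem fourier_dilTest {c : ℝ} (hc : 0 < c) (φ : 𝓢(Rn n, ℂ)) :
    dilTest c⁻¹ (inv_ne_zero hc.ne') (𝓕 φ) = 𝓕 ((c ^ n : ℂ) • dilTest c hc.ne' φ) := by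
  ext ξ
  rw [dilTest_apply, SchwartzMap.fourier_coe, SchwartzMap.fourier_coe, Real.fourier_eq,
    Real.fourier_eq]
  have h := Measure.integral_comp_smul (volume : Measure (Rn n))
    (fun v => Real.fourierChar (-(inner ℝ v (c⁻¹ • ξ))) • φ v) c
  rw [finrank_euclideanSpace_fin, abs_of_pos (by positivity)] at h
  have h2 : ∀ x : Rn n, inner ℝ (c • x) (c⁻¹ • ξ) = inner ℝ x ξ := fun x => by
    rw [real_inner_smul_left, real_inner_smul_right, ← mul_assoc, mul_inv_cancel₀ hc.ne', one_mul]
  simp_rw [h2] at h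
  have h3 : ∫ v, Real.fourierChar (-(inner ℝ v (c⁻¹ • ξ))) • φ v
      = (c ^ n : ℂ) • ∫ x, Real.fourierChar (-(inner ℝ x ξ)) • φ (c • x) := by
    rw [h, smul_eq_mul, Complex.real_smul]
    push_cast
    rw [← mul_assoc, mul_inv_cancel₀ (by exact_mod_cast (pow_pos hc n).ne'), one_mul]
  rw [h3, ← integral_smul]
  refine integral_congr_ae (Eventually.of_forall fun x => ?_)
  simp only [smul_apply, dilTest_apply, smul_eq_mul, Circle.smul_def]
  ring

theorem FourierRep.dilate {U : 𝓢'(Rn n, ℂ)} {m : Rn n → ℂ} (h : FourierRep U m) {c : ℝ}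
    (hc : 0 < c) : FourierRep (SelfSimilar.dilate c U) fun ξ => m (c⁻¹ • ξ) := by
  intro φ
  have h1 := h ((c ^ n : ℂ) • dilTest c hc.ne' φ)
  have he : (fun ξ => m ξ * ((c ^ n : ℂ) • dilTest c hc.ne' φ) ξ)
      = fun ξ => (c ^ n : ℂ) * (m (c⁻¹ • (c • ξ)) * φ (c • ξ)) := by
    ext ξ
    rw [smul_smul, inv_mul_cancel₀ hc.ne', one_smul, smul_apply, dilTest_apply, smul_eq_mul]; ring
  rw [he] at h1
  have hcn : (c ^ n : ℂ) ≠ 0 := by exact_mod_cast (pow_pos hc n).ne'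
  constructor
  · have h2 := (integrable_const_mul_iff (isUnit_iff_ne_zero.2 hcn) _).1 h1.1
    exact (integrable_comp_smul_iff (volume : Measure (Rn n))
      (fun ξ => m (c⁻¹ • ξ) * φ ξ) hc.ne').1 h2
  · rw [TemperedDistribution.fourier_apply, dilate_apply hc.ne', fourier_dilTest hc,
      ← TemperedDistribution.fourier_apply, h1.2, integral_const_mul,
      Measure.integral_comp_smul (volume : Measure (Rn n)) (fun ξ => m (c⁻¹ • ξ) * φ ξ) c,
      finrank_euclideanSpace_fin, abs_of_pos (by positivity), Complex.real_smul, ← mul_assoc]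
    push_cast
    rw [mul_inv_cancel₀ hcn, one_mul]

/-! ### A determining sequence of test functions -/

/-- The equations hold for almost every time, with a null set that depends on the test function; a
countable determining family removes this dependence. For each radius, the test functions supported
in that ball are separable for uniform convergence on compact sets, and with a fixed bounded support
such convergence passes through the integral against a locally integrable function. -/
theorem exists_determining_seq (n : ℕ) : ∃ D : ℕ → 𝓢(Rn n, ℂ), (∀ k, HasCompactSupport (D k)) ∧
    ∀ f : Rn n → ℂ, LocallyIntegrable f → (∀ k, ∫ ξ, f ξ * D k ξ = 0) → f =ᵐ[volume] 0 := by
  let S : ℕ → Set C(Rn n, ℂ) := fun R => {g | ∃ ψ : 𝓢(Rn n, ℂ),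
    (∀ x, (R : ℝ) < ‖x‖ → ψ x = 0) ∧ ∀ x, g x = ψ x}
  have hne : ∀ R, Nonempty (S R) := fun R => ⟨⟨0, 0, by simp, by simp⟩⟩
  let d : ∀ R, ℕ → S R := fun R => TopologicalSpace.denseSeq (S R)
  have hd : ∀ R, DenseRange (d R) := fun R => TopologicalSpace.denseRange_denseSeq (S R)
  choose ψ hψ0 hψ using fun R k => (d R k).2
  -- The index encodes the pair of a radius and a position in the dense sequence for that radius.
  refine ⟨fun k => ψ k.unpair.1 k.unpair.2, fun k => ?_, fun f hf h => ?_⟩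
  · refine HasCompactSupport.intro (isCompact_closedBall (0 : Rn n) (k.unpair.1 : ℝ))
      fun x hx => hψ0 _ _ x ?_
    simpa using hx
  · have hall : ∀ R k, ∫ ξ, f ξ * ψ R k ξ = 0 := fun R k => by
      simpa using h (Nat.pair R k)
    refine ae_eq_zero_of_integral_contDiff_smul_eq_zero hf fun g hg hgs => ?_
    have hbs : HasCompactSupport (fun x => ((g x : ℝ) : ℂ)) :=
      hgs.comp_left (g := fun r : ℝ => (r : ℂ)) Complex.ofReal_zero
    have hbd : ContDiff ℝ ∞ (fun x => ((g x : ℝ) : ℂ)) := Complex.ofRealCLM.contDiff.comp hg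
    obtain ⟨r, hr⟩ := hgs.isCompact.isBounded.subset_closedBall 0
    obtain ⟨R, hR⟩ := exists_nat_ge r
    have hg0 : ∀ x, (R : ℝ) < ‖x‖ → g x = 0 := fun x hx => by
      refine image_eq_zero_of_notMem_tsupport fun hmem => ?_
      have := hr hmem
      rw [mem_closedBall_zero_iff] at this
      linarith
    let G : S R := ⟨⟨fun x => ((g x : ℝ) : ℂ), hbd.continuous⟩, hbs.toSchwartzMap hbd,
      fun x hx => by change ((g x : ℝ) : ℂ) = 0; rw [hg0 x hx]; simp, fun x => rfl⟩
    obtain ⟨φ, hφr, hφ⟩ := mem_closure_iff_seq_limit.1 (hd R G)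
    have hφ' : Tendsto (fun k => (φ k : C(Rn n, ℂ))) atTop (𝓝 (G : C(Rn n, ℂ))) :=
      (continuous_subtype_val.tendsto G).comp hφ
    have hun := (ContinuousMap.tendsto_iff_forall_isCompact_tendstoUniformlyOn.1 hφ')
      (Metric.closedBall 0 (R : ℝ)) (isCompact_closedBall _ _)
    have hφ0 : ∀ k, ∫ ξ, f ξ * (φ k : C(Rn n, ℂ)) ξ = 0 := fun k => by
      obtain ⟨i, hi⟩ := hφr k
      rw [← hi]
      simp_rw [hψ]
      exact hall R i
    have hφs : ∀ k x, (R : ℝ) < ‖x‖ → (φ k : C(Rn n, ℂ)) x = 0 := fun k x hx => by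
      obtain ⟨i, hi⟩ := hφr k
      rw [← hi, hψ]
      exact hψ0 R i x hx
    have hfR : IntegrableOn f (Metric.closedBall 0 (R : ℝ)) :=
      hf.integrableOn_isCompact (isCompact_closedBall _ _)
    have hlim : Tendsto (fun k => ∫ ξ in Metric.closedBall 0 (R : ℝ), f ξ * (φ k : C(Rn n, ℂ)) ξ)
        atTop (𝓝 (∫ ξ in Metric.closedBall 0 (R : ℝ), f ξ * (G : C(Rn n, ℂ)) ξ)) := by
      obtain ⟨C, hC⟩ := (isCompact_closedBall (0 : Rn n) (R : ℝ)).exists_bound_of_continuousOn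
        (G : C(Rn n, ℂ)).continuous.continuousOn
      refine tendsto_integral_filter_of_dominated_convergence (fun ξ => ‖f ξ‖ * (C + 1)) ?_ ?_
        (hfR.norm.mul_const _) ?_
      · exact Eventually.of_forall fun k => hfR.aestronglyMeasurable.mul
          (φ k : C(Rn n, ℂ)).continuous.aestronglyMeasurable
      · filter_upwards [Metric.tendstoUniformlyOn_iff.1 hun 1 one_pos] with k hk
        refine (ae_restrict_iff' Metric.isClosed_closedBall.measurableSet).2
          (Eventually.of_forall fun ξ hξ => ?_)
        rw [norm_mul]
        gcongr
        have h1 := hk ξ hξ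
        rw [dist_comm, dist_eq_norm] at h1
        have h2 := hC ξ hξ
        calc ‖(φ k : C(Rn n, ℂ)) ξ‖ = ‖(G : C(Rn n, ℂ)) ξ
              + ((φ k : C(Rn n, ℂ)) ξ - (G : C(Rn n, ℂ)) ξ)‖ := by rw [add_sub_cancel]
          _ ≤ C + 1 := (norm_add_le _ _).trans (by linarith)
      · refine (ae_restrict_iff' Metric.isClosed_closedBall.measurableSet).2
          (Eventually.of_forall fun ξ hξ => ?_)
        exact (hun.tendsto_at hξ).const_mul _
    have hsub : ∀ G : C(Rn n, ℂ), (∀ x, (R : ℝ) < ‖x‖ → G x = 0) →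
        ∫ ξ in Metric.closedBall 0 (R : ℝ), f ξ * G ξ = ∫ ξ, f ξ * G ξ := fun G hG =>
      setIntegral_eq_integral_of_forall_compl_eq_zero fun x hx => by
        rw [hG x (by simpa using hx), mul_zero]
    have hG0 : ∀ x, (R : ℝ) < ‖x‖ → (G : C(Rn n, ℂ)) x = 0 := fun x hx => by
      change ((g x : ℝ) : ℂ) = 0
      rw [hg0 x hx]; simp
    simp_rw [fun k => hsub _ (hφs k), hφ0] at hlim
    rw [hsub _ hG0] at hlim
    have h3 := tendsto_nhds_unique hlim tendsto_const_nhds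
    calc ∫ x, g x • f x = ∫ ξ, f ξ * (G : C(Rn n, ℂ)) ξ := by
          refine integral_congr_ae (Eventually.of_forall fun x => ?_)
          change g x • f x = f x * ((g x : ℝ) : ℂ)
          rw [Complex.real_smul, mul_comm]
      _ = 0 := h3

/-- If the Fourier transforms of the weak solution are functions at all, they are the explicit
ones. -/
theorem IsWeakSolution.ae_fourierRep {u : ℝ → 𝓢'(Rn n, ℂ)} {a₀ : ℝ} {a : ℝ → ℝ}
    {u₀ : Rn n → ℂ} (ha : IsAdmissibleKernel a₀ a) (hu₀ : Integrable u₀)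
    (hu : IsWeakSolution a₀ a u₀ u) :
    ∀ᵐ t ∂volume.restrict (Ioi (0 : ℝ)), (∃ m, FourierRep (u t) m) →
      FourierRep (u t) fun ξ => (resolvent (kern a₀ a) (symb ξ) t : ℂ) * 𝓕 u₀ ξ := by
  obtain ⟨D, hDs, hD⟩ := exists_determining_seq n
  filter_upwards [ae_all_iff.2 fun k => hu.fourier_ae_eq ha hu₀ (hDs k)] with t ht
  rintro ⟨m, hm⟩
  have hc : Continuous fun ξ => (resolvent (kern a₀ a) (symb ξ) t : ℂ) * 𝓕 u₀ ξ :=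
    (Complex.continuous_ofReal.comp ((continuous_resolvent ha.isTameKernel.integrableOn_Ioc).comp
      (continuous_symb.prodMk continuous_const))).mul (continuous_fourier_of_integrable hu₀)
  refine hm.congr ?_
  have h0 := hD (fun ξ => m ξ - (resolvent (kern a₀ a) (symb ξ) t : ℂ) * 𝓕 u₀ ξ)
    (hm.locallyIntegrable.sub hc.locallyIntegrable) fun k => ?_
  · filter_upwards [h0] with ξ hξ
    exact sub_eq_zero.1 hξ
  · simp_rw [sub_mul]
    rw [integral_sub (hm (D k)).1, ← (hm (D k)).2, ht k, sub_self]
    exact (hc.mul (D k).continuous).integrable_of_hasCompactSupport ((hDs k).mul_left)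

end SelfSimilar

namespace SelfSimilar

/-! ### Injectivity of fractional integration -/

theorem continuous_fracKernel_max {p : ℝ} (hp : 0 < p) (x : ℝ) :
    Continuous fun t => fracKernel p (max (x - t) 0) := by
  unfold fracKernel
  refine Continuous.div_const (Continuous.rpow_const (by fun_prop) fun t => Or.inr hp.le) _

/-- The semigroup property of fractional integration, read backwards in time from `M`: the adjoint
operator maps powers of `M - t` to powers of `M - s`. -/
theorem integral_fracKernel_tail {β p : ℝ} (hβ : -1 < β) (hp : 0 < p) {M s : ℝ} (hs : s < M) :
    ∫ t in Ioi s, fracKernel β (t - s) * fracKernel p (max (M - t) 0)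
      = fracKernel (β + p + 1) (M - s) := by
  rw [← fracKernel_conv hβ (by linarith) (by linarith : 0 < M - s)]
  have h := setIntegral_Ioi_comp_sub
    (fun t => fracKernel β t * fracKernel p (max (M - s - t) 0)) s
  simp only [sub_sub_sub_cancel_right] at h
  rw [h]
  have h0 : fracKernel p 0 = 0 := by rw [fracKernel, Real.zero_rpow hp.ne', zero_div]
  rw [setIntegral_eq_of_subset_of_forall_sdiff_eq_zero measurableSet_Ioi
    (fun t ht => ht.1 : Ioc 0 (M - s) ⊆ Ioi 0) fun t ht => ?_]
  · refine setIntegral_congr_fun measurableSet_Ioc fun t ht => ?_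
    rw [max_eq_left (by linarith [ht.2])]
  · have : M - s ≤ t := by
      by_contra h
      exact ht.2 ⟨ht.1, (not_le.1 h).le⟩
    rw [max_eq_right (by linarith), h0, mul_zero]

/-- By the Weierstrass theorem `(M - s) ^ 3 * q s` is orthogonal to all continuous functions, hence
zero, and the factor does not vanish on the interval. The moments below `3` are spared because the
application produces only powers high enough for its auxiliary kernel to be continuous. -/
theorem ae_eq_zero_of_integral_pow_eq_zero {M : ℝ} {q : ℝ → ℂ} (hq : IntegrableOn q (Ioo 0 M))
    (h : ∀ m : ℕ, 3 ≤ m → ∫ s in Ioo 0 M, (((M - s) ^ m : ℝ) : ℂ) * q s = 0) :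
    ∀ᵐ s ∂volume.restrict (Ioo 0 M), q s = 0 := by
  have hb : ∀ g : ℝ → ℝ, Continuous g → IntegrableOn (fun s => (g s : ℂ) * q s) (Ioo 0 M) := by
    intro g hg
    obtain ⟨C, hC⟩ := (isCompact_Icc (a := (0 : ℝ)) (b := M)).exists_bound_of_continuousOn
      hg.continuousOn
    refine Integrable.bdd_mul (c := C) hq
      (Complex.continuous_ofReal.comp hg).aestronglyMeasurable ?_
    refine (ae_restrict_iff' measurableSet_Ioo).2 (Eventually.of_forall fun t ht => ?_)
    rw [Complex.norm_real]
    exact hC t ⟨ht.1.le, ht.2.le⟩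
  have hpoly : ∀ P : Polynomial ℝ,
      ∫ s in Ioo 0 M, ((P.eval (M - s) * (M - s) ^ 3 : ℝ) : ℂ) * q s = 0 := by
    intro P
    induction P using Polynomial.induction_on' with
    | add p r hp hr =>
      have e : ∀ s, (((p + r).eval (M - s) * (M - s) ^ 3 : ℝ) : ℂ) * q s
          = ((p.eval (M - s) * (M - s) ^ 3 : ℝ) : ℂ) * q s
            + ((r.eval (M - s) * (M - s) ^ 3 : ℝ) : ℂ) * q s := fun s => by
        rw [Polynomial.eval_add]; push_cast; ring
      simp_rw [e]
      rw [integral_add (hb (fun s => p.eval (M - s) * (M - s) ^ 3) (by fun_prop))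
        (hb (fun s => r.eval (M - s) * (M - s) ^ 3) (by fun_prop)), hp, hr, add_zero]
    | monomial k c =>
      have e : ∀ s, (((Polynomial.monomial k c).eval (M - s) * (M - s) ^ 3 : ℝ) : ℂ) * q s
          = (c : ℂ) * ((((M - s) ^ (k + 3) : ℝ) : ℂ) * q s) := fun s => by
        rw [Polynomial.eval_monomial]; push_cast; ring
      simp_rw [e]
      rw [integral_const_mul, h _ (by omega), mul_zero]
  have hcont : ∀ g : ℝ → ℝ, Continuous g →
      ∫ s in Ioo 0 M, ((g s * (M - s) ^ 3 : ℝ) : ℂ) * q s = 0 := by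
    intro g hg
    set I := ∫ s in Ioo 0 M, ‖(((M - s) ^ 3 : ℝ) : ℂ) * q s‖ with hI
    have hI0 : 0 ≤ I := integral_nonneg fun _ => norm_nonneg _
    have hle : ∀ ε > 0, ‖∫ s in Ioo 0 M, ((g s * (M - s) ^ 3 : ℝ) : ℂ) * q s‖ ≤ ε * I := by
      intro ε hε
      obtain ⟨P, hP⟩ := exists_polynomial_near_of_continuousOn 0 M (fun s => g (M - s))
        (by fun_prop) ε hε
      rw [← sub_zero (∫ s in Ioo 0 M, ((g s * (M - s) ^ 3 : ℝ) : ℂ) * q s), ← hpoly P,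
        ← integral_sub (hb (fun s => g s * (M - s) ^ 3) (by fun_prop))
          (hb (fun s => P.eval (M - s) * (M - s) ^ 3) (by fun_prop)), hI, ← integral_const_mul]
      refine norm_integral_le_of_norm_le ((hb (fun s => (M - s) ^ 3) (by fun_prop)).norm.const_mul _)
        ((ae_restrict_iff' measurableSet_Ioo).2 (Eventually.of_forall fun s hs => ?_))
      have h1 := hP (M - s) ⟨by linarith [hs.2], by linarith [hs.1]⟩
      rw [sub_sub_cancel, abs_sub_comm] at h1
      have e : ((g s * (M - s) ^ 3 : ℝ) : ℂ) * q s
          - ((P.eval (M - s) * (M - s) ^ 3 : ℝ) : ℂ) * q s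
          = ((g s - P.eval (M - s) : ℝ) : ℂ) * ((((M - s) ^ 3 : ℝ) : ℂ) * q s) := by
        push_cast; ring
      rw [e, norm_mul, Complex.norm_real, Real.norm_eq_abs]
      exact mul_le_mul_of_nonneg_right h1.le (norm_nonneg _)
    refine norm_le_zero_iff.1 (le_of_forall_pos_le_add fun ε hε => ?_)
    refine (hle (ε / (I + 1)) (by positivity)).trans ?_
    rw [zero_add, div_mul_eq_mul_div, div_le_iff₀ (by positivity)]
    nlinarith
  have h3 := isOpen_Ioo.ae_eq_zero_of_integral_contDiff_smul_eq_zero (U := Ioo 0 M) (μ := volume)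
    (f := fun s => (((M - s) ^ 3 : ℝ) : ℂ) * q s)
    (hb (fun s => (M - s) ^ 3) (by fun_prop)).locallyIntegrableOn ?_
  · rw [ae_restrict_iff' measurableSet_Ioo]
    filter_upwards [h3] with s hs hmem
    have h4 : (((M - s) ^ 3 : ℝ) : ℂ) ≠ 0 := by
      exact_mod_cast (pow_pos (sub_pos.2 hmem.2) 3).ne'
    exact (mul_eq_zero.1 (hs hmem)).resolve_left h4
  · intro g hg _ hgU
    rw [← hcont g hg.continuous, ← setIntegral_eq_integral_of_forall_compl_eq_zero (s := Ioo 0 M)]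
    · refine setIntegral_congr_fun measurableSet_Ioo fun s _ => ?_
      simp only [Complex.real_smul]
      push_cast; ring
    · intro s hs
      rw [image_eq_zero_of_notMem_tsupport fun hmem => hs (hgU hmem), zero_smul]

theorem ae_eq_zero_of_volConv_fracKernel {β M : ℝ} (hβ : β ∈ Ioc (-1 : ℝ) 1) {q : ℝ → ℂ}
    (hq : IntegrableOn q (Ioo 0 M))
    (h : ∀ᵐ t ∂volume.restrict (Ioo 0 M), volConv (fracKernel β) q t = 0) :
    ∀ᵐ s ∂volume.restrict (Ioo 0 M), q s = 0 := by
  refine ae_eq_zero_of_integral_pow_eq_zero hq fun m hm => ?_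
  have hm' : (3 : ℝ) ≤ m := by exact_mod_cast hm
  -- The auxiliary kernel has exponent `m - β - 1`, chosen so that its composition with fractional
  -- integration of order `1 + β` is the power `m`. It is positive since `β ≤ 1` and `m ≥ 3`.
  have hp : 0 < (m : ℝ) - β - 1 := by linarith [hβ.2]
  have h1 := (integral_mul_volConv (integrableOn_fracKernel hβ.1 M) hq
    (continuous_fracKernel_max hp M) (fun t ht => by
      rw [max_eq_right (by linarith), fracKernel, Real.zero_rpow hp.ne', zero_div])).2
  have h2 : ∫ t in Ioo 0 M, (fracKernel ((m : ℝ) - β - 1) (max (M - t) 0) : ℂ)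
      * volConv (fracKernel β) q t = 0 := by
    rw [integral_eq_zero_of_ae]
    filter_upwards [h] with t ht
    rw [ht, mul_zero]; rfl
  rw [h2] at h1
  have hΓ : Real.Gamma (1 + m) ≠ 0 := (Real.Gamma_pos_of_pos (by positivity)).ne'
  have h3 : ∀ s ∈ Ioo 0 M, (((M - s) ^ m : ℝ) : ℂ) * q s = (Real.Gamma (1 + m) : ℂ)
      * (((∫ t in Ioi s, fracKernel β (t - s) * fracKernel ((m : ℝ) - β - 1) (max (M - t) 0) : ℝ)
        : ℂ) * q s) := fun s hs => by
    rw [integral_fracKernel_tail hβ.1 hp hs.2,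
      show β + ((m : ℝ) - β - 1) + 1 = m by ring, fracKernel, Real.rpow_natCast, ← mul_assoc,
      ← Complex.ofReal_mul, mul_div_cancel₀ _ hΓ]
  rw [setIntegral_congr_fun measurableSet_Ioo h3, integral_const_mul, ← h1, mul_zero]

/-! ### Limits of convolutions -/

/-- With the kernel fixed this is dominated convergence; exchanging the kernel costs its `L¹`
distance times the common bound on the functions. -/
theorem tendsto_volConv {K : ℝ → ℝ} {Ks : ℕ → ℝ → ℝ} {M C : ℝ}
    (hK : IntegrableOn K (Ioc 0 M)) (hKs : ∀ᶠ j in atTop, IntegrableOn (Ks j) (Ioc 0 M))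
    (hlim : Tendsto (fun j => ∫ s in Ioc 0 M, |Ks j s - K s|) atTop (𝓝 0))
    {g : ℝ → ℂ} {gs : ℕ → ℝ → ℂ}
    (hm : ∀ j, AEStronglyMeasurable (gs j) (volume.restrict (Ioo 0 M)))
    (hb : ∀ᶠ j in atTop, ∀ᵐ t ∂volume.restrict (Ioo 0 M), ‖gs j t‖ ≤ C)
    (hg : ∀ᵐ t ∂volume.restrict (Ioo 0 M), Tendsto (fun j => gs j t) atTop (𝓝 (g t)))
    {t : ℝ} (ht : t ∈ Ioo 0 M) :
    Tendsto (fun j => volConv (Ks j) (gs j) t) atTop (𝓝 (volConv K g t)) := by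
  have hsub : Ioc 0 t ⊆ Ioc 0 M := Ioc_subset_Ioc_right ht.2.le
  have hrefl : ∀ {p : ℝ → Prop}, (∀ᵐ s ∂volume.restrict (Ioo 0 M), p s) →
      ∀ᵐ s ∂volume.restrict (Ioc 0 t), p (t - s) := fun {p} hp => by
    have h1 := (Measure.measurePreserving_sub_left volume t).quasiMeasurePreserving.ae
      ((ae_restrict_iff' measurableSet_Ioo).1 hp)
    rw [← restrict_Ioo_eq_restrict_Ioc, ae_restrict_iff' measurableSet_Ioo]
    filter_upwards [h1] with s hs hmem
    exact hs ⟨by linarith [hmem.2], by linarith [hmem.1, ht.2]⟩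
  have hm' : ∀ j, AEStronglyMeasurable (fun s => gs j (t - s)) (volume.restrict (Ioc 0 t)) := by
    intro j
    have h1 : AEStronglyMeasurable (fun s => gs j (t - s))
        (volume.restrict (Ioo (t - M) t)) := by
      have := (Measure.measurePreserving_sub_left (volume : Measure ℝ) t).restrict_preimage
        (measurableSet_Ioo (a := 0) (b := M))
      rw [show (fun s => t - s) ⁻¹' Ioo 0 M = Ioo (t - M) t by
        ext s; simp only [mem_preimage, mem_Ioo]
        constructor <;> rintro ⟨h1, h2⟩ <;> constructor <;> linarith] at this
      exact (hm j).comp_measurePreserving this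
    rw [← restrict_Ioo_eq_restrict_Ioc]
    have h2 : Ioo 0 t ⊆ Ioo (t - M) t := fun s hs => ⟨by linarith [hs.1, ht.2], hs.2⟩
    exact h1.mono_measure (Measure.restrict_mono h2 le_rfl)
  -- the fixed kernel
  have h1 : Tendsto (fun j => volConv K (gs j) t) atTop (𝓝 (volConv K g t)) := by
    unfold volConv
    refine tendsto_integral_filter_of_dominated_convergence (fun s => |K s| * C)
      (Eventually.of_forall fun j => ?_) ?_ ((hK.mono_set hsub).abs.mul_const _) ?_
    · exact (hK.mono_set hsub).ofReal.aestronglyMeasurable.mul (hm' j)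
    · filter_upwards [hb] with j hj
      filter_upwards [hrefl hj] with s hs
      rw [norm_mul, Complex.norm_real, Real.norm_eq_abs]
      gcongr
    · filter_upwards [hrefl hg] with s hs
      exact hs.const_mul _
  have h2 : Tendsto (fun j => volConv (Ks j) (gs j) t - volConv K (gs j) t) atTop (𝓝 0) := by
    refine squeeze_zero_norm' (a := fun j => C * ∫ s in Ioc 0 M, |Ks j s - K s|) ?_
      (by simpa using hlim.const_mul C)
    filter_upwards [hb, hKs] with j hj hKj
    have hC : 0 ≤ C := by
      have hne : (volume.restrict (Ioo 0 M)) ≠ 0 := by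
        rw [Ne, Measure.restrict_eq_zero, Real.volume_Ioo]
        simp [ht.1.trans ht.2]
      have : (ae (volume.restrict (Ioo 0 M))).NeBot := ae_neBot.2 hne
      obtain ⟨s, hs⟩ := hj.exists
      exact (norm_nonneg _).trans hs
    have hi : ∀ {L : ℝ → ℝ}, IntegrableOn L (Ioc 0 M) →
        IntegrableOn (fun s => (L s : ℂ) * gs j (t - s)) (Ioc 0 t) := fun {L} hL =>
      (hL.mono_set hsub).ofReal.mul_bdd (c := C) (hm' j) (hrefl hj)
    unfold volConv
    rw [← integral_sub (hi hKj) (hi hK)]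
    calc ‖∫ s in Ioc 0 t, ((Ks j s : ℂ) * gs j (t - s) - (K s : ℂ) * gs j (t - s))‖
        ≤ ∫ s in Ioc 0 t, C * |Ks j s - K s| := by
          refine norm_integral_le_of_norm_le (((hKj.sub hK).mono_set hsub).abs.const_mul _) ?_
          filter_upwards [hrefl hj] with s hs
          rw [← sub_mul, ← Complex.ofReal_sub, norm_mul, Complex.norm_real, Real.norm_eq_abs,
            mul_comm]
          gcongr
      _ = C * ∫ s in Ioc 0 t, |Ks j s - K s| := integral_const_mul _ _
      _ ≤ _ := by
          have hi' : IntegrableOn (fun s => |Ks j s - K s|) (Ioc 0 M) := (hKj.sub hK).abs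
          refine mul_le_mul_of_nonneg_left ?_ hC
          exact setIntegral_mono_set hi' (Eventually.of_forall fun s => abs_nonneg _)
            (Eventually.of_forall hsub)
  simpa using h2.add h1

/-! ### Weighted `L²` norms and dilations -/

variable {n : ℕ}

theorem exists_wt_smul_le (s : ℝ) {b B : ℝ} (hb : 0 < b) : ∃ D : ℝ, 0 ≤ D ∧
    ∀ ρ ∈ Icc b B, ∀ η : Rn n, wt s (ρ • η) ≤ D * wt s η := by
  -- The two summands serve the two signs of `s`.
  refine ⟨(max 1 (B ^ 2)) ^ (s / 2) + (min 1 (b ^ 2)) ^ (s / 2), by positivity,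
    fun ρ hρ η => ?_⟩
  have hρ0 : 0 < ρ := hb.trans_le hρ.1
  unfold wt
  rw [norm_smul, mul_pow, Real.norm_of_nonneg hρ0.le, add_mul]
  have hlo : min 1 (b ^ 2) * (1 + ‖η‖ ^ 2) ≤ 1 + ρ ^ 2 * ‖η‖ ^ 2 := by
    have h1 : min 1 (b ^ 2) ≤ ρ ^ 2 := (min_le_right _ _).trans (by gcongr; exact hρ.1)
    have h2 : min 1 (b ^ 2) ≤ 1 := min_le_left _ _
    nlinarith [sq_nonneg ‖η‖]
  have hhi : 1 + ρ ^ 2 * ‖η‖ ^ 2 ≤ max 1 (B ^ 2) * (1 + ‖η‖ ^ 2) := by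
    have h1 : ρ ^ 2 ≤ max 1 (B ^ 2) := le_trans (by gcongr; exact hρ.2) (le_max_right _ _)
    have h2 : 1 ≤ max 1 (B ^ 2) := le_max_left _ _
    nlinarith [sq_nonneg ‖η‖]
  have hmin : 0 < min 1 (b ^ 2) := lt_min one_pos (by positivity)
  rcases le_total 0 s with hs | hs
  · refine (Real.rpow_le_rpow (by positivity) hhi (by linarith)).trans ?_
    rw [Real.mul_rpow (by positivity) (by positivity)]
    exact le_add_of_nonneg_right (by positivity)
  · refine (Real.rpow_le_rpow_of_nonpos (by positivity) hlo (by linarith)).trans ?_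
    rw [Real.mul_rpow hmin.le (by positivity)]
    exact le_add_of_nonneg_left (by positivity)

theorem eLpNorm_comp_smul {ρ : ℝ} (hρ : 0 < ρ) (g : Rn n → ℂ) :
    eLpNorm (fun ξ => g (ρ⁻¹ • ξ)) 2 volume
      = (ENNReal.ofReal (ρ ^ n)) ^ (1 / 2 : ℝ) * eLpNorm g 2 volume := by
  have h1 : MeasurableEmbedding fun ξ : Rn n => ρ⁻¹ • ξ :=
    (Homeomorph.smulOfNeZero ρ⁻¹ (inv_ne_zero hρ.ne')).measurableEmbedding
  have h2 := h1.eLpNorm_map_measure (g := g) (p := 2) (μ := volume)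
  rw [Measure.map_addHaar_smul volume (inv_ne_zero hρ.ne'), finrank_euclideanSpace_fin] at h2
  rw [show (fun ξ => g (ρ⁻¹ • ξ)) = g ∘ fun ξ => ρ⁻¹ • ξ from rfl, ← h2,
    eLpNorm_smul_measure_of_ne_zero]
  · simp [abs_of_pos hρ]
  · simp [abs_of_pos hρ]; positivity

theorem exists_eLpNorm_dilate_le (s : ℝ) {b B : ℝ} (hb : 0 < b) : ∃ D : ℝ≥0,
    ∀ ρ ∈ Icc b B, ∀ m : Rn n → ℂ, eLpNorm (wtd s fun ξ => m (ρ⁻¹ • ξ)) 2 volume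
      ≤ D * eLpNorm (wtd s m) 2 volume := by
  obtain ⟨D, hD, h⟩ := exists_wt_smul_le (n := n) s (B := B) hb
  refine ⟨Real.toNNReal D * (Real.toNNReal (B ^ n)) ^ (1 / 2 : ℝ), fun ρ hρ m => ?_⟩
  have hρ0 : 0 < ρ := hb.trans_le hρ.1
  have h1 : eLpNorm (wtd s fun ξ => m (ρ⁻¹ • ξ)) 2 volume
      ≤ ENNReal.ofReal D * eLpNorm (fun ξ => wtd s m (ρ⁻¹ • ξ)) 2 volume := by
    refine eLpNorm_le_mul_eLpNorm_of_ae_le_mul (Eventually.of_forall fun ξ => ?_) 2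
    rw [wtd, wtd, norm_mul, norm_mul, Complex.norm_real, Complex.norm_real,
      Real.norm_of_nonneg (wt_pos _ _).le, Real.norm_of_nonneg (wt_pos _ _).le, ← mul_assoc]
    gcongr
    have := h ρ hρ (ρ⁻¹ • ξ)
    rwa [smul_inv_smul₀ hρ0.ne'] at this
  rw [eLpNorm_comp_smul hρ0] at h1
  refine h1.trans ?_
  rw [← mul_assoc, ENNReal.coe_mul, ENNReal.coe_rpow_of_nonneg _ (by norm_num)]
  gcongr
  · exact le_rfl
  · exact ENNReal.ofReal_le_ofReal (by gcongr; exact hρ.2)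

/-- Fatou's lemma. It is how norm bounds along the sequence survive when only pointwise convergence
of the symbols is known. -/
theorem eLpNorm_le_of_tendsto {f : ℕ → Rn n → ℂ} {g : Rn n → ℂ} {C : ℝ≥0∞}
    (hf : ∀ j, AEStronglyMeasurable (f j) volume)
    (hlim : ∀ᵐ ξ, Tendsto (fun j => f j ξ) atTop (𝓝 (g ξ)))
    (hb : ∀ᶠ j in atTop, eLpNorm (f j) 2 volume ≤ C) : eLpNorm g 2 volume ≤ C := by
  refine (Lp.eLpNorm_lim_le_liminf_eLpNorm hf g hlim).trans ?_
  exact liminf_le_of_frequently_le' hb.frequently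

theorem tendsto_eLpNorm_dilate_of_hasCompactSupport (s : ℝ) {g' : Rn n → ℂ} (hg'c : Continuous g')
    (hg's : HasCompactSupport g') {ρ : ℕ → ℝ} {c : ℝ} (hc : 0 < c) (hρ : Tendsto ρ atTop (𝓝 c)) :
    Tendsto (fun j => eLpNorm (wtd s fun ξ => g' ((ρ j)⁻¹ • ξ) - g' (c⁻¹ • ξ)) 2 volume)
      atTop (𝓝 0) := by
  have hρI : ∀ᶠ j in atTop, ρ j ∈ Icc (c / 2) (2 * c) :=
    hρ.eventually (Icc_mem_nhds (by linarith) (by linarith))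
  obtain ⟨R, hR⟩ := hg's.isCompact.isBounded.subset_closedBall 0
  obtain ⟨G, hG⟩ := hg'c.bounded_above_of_compact_support hg's
  set R₁ := 2 * c * |R| with hR₁
  obtain ⟨W, hW⟩ := (isCompact_closedBall (0 : Rn n) R₁).exists_bound_of_continuousOn
    (continuous_wt s).continuousOn
  have h0 : ∀ r ∈ Icc (c / 2) (2 * c), ∀ ξ : Rn n, ξ ∉ Metric.closedBall 0 R₁ →
      g' (r⁻¹ • ξ) = 0 := fun r hr ξ hξ => by
    have hr0 : 0 < r := by linarith [hr.1]
    refine image_eq_zero_of_notMem_tsupport fun hmem => hξ ?_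
    have h1 := hR hmem
    rw [mem_closedBall_zero_iff, norm_smul, norm_inv, Real.norm_of_nonneg hr0.le,
      ← div_eq_inv_mul, div_le_iff₀ hr0] at h1
    rw [mem_closedBall_zero_iff, hR₁]
    calc ‖ξ‖ ≤ R * r := h1
      _ ≤ |R| * (2 * c) := by
          gcongr
          · exact le_abs_self R
          · exact hr.2
      _ = _ := by ring
  have hcI : c ∈ Icc (c / 2) (2 * c) := ⟨by linarith, by linarith⟩
  have hlin : Tendsto (fun j => ∫⁻ ξ, ‖wtd s (fun ξ => g' ((ρ j)⁻¹ • ξ) - g' (c⁻¹ • ξ)) ξ‖ₑ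
      ^ (2 : ℝ)) atTop (𝓝 (∫⁻ _ : Rn n, 0)) := by
    refine tendsto_lintegral_filter_of_dominated_convergence
      ((Metric.closedBall (0 : Rn n) R₁).indicator fun _ => ENNReal.ofReal (|W| * (2 * G)) ^ (2 : ℝ))
      (Eventually.of_forall fun j => ?_) ?_ ?_ ?_
    · have : Continuous (wtd s fun ξ => g' ((ρ j)⁻¹ • ξ) - g' (c⁻¹ • ξ)) := by
        unfold wtd
        have := continuous_wt (n := n) s
        fun_prop
      exact (this.enorm.measurable).pow_const _
    · filter_upwards [hρI] with j hj
      refine Eventually.of_forall fun ξ => ?_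
      by_cases hξ : ξ ∈ Metric.closedBall (0 : Rn n) R₁
      · rw [indicator_of_mem hξ, ← ofReal_norm]
        gcongr
        rw [wtd, norm_mul, Complex.norm_real]
        have h3 := (norm_sub_le (g' ((ρ j)⁻¹ • ξ)) (g' (c⁻¹ • ξ))).trans
          (add_le_add (hG _) (hG _))
        have h4 := (hW ξ hξ).trans (le_abs_self W)
        rw [two_mul]
        gcongr
      · rw [wtd, h0 _ hj ξ hξ, h0 c hcI ξ hξ]
        simp
    · rw [lintegral_indicator Metric.isClosed_closedBall.measurableSet, lintegral_const]
      refine ENNReal.mul_ne_top (ENNReal.rpow_ne_top_of_nonneg (by norm_num) ENNReal.ofReal_ne_top) ?_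
      rw [Measure.restrict_apply_univ]
      exact measure_closedBall_lt_top.ne
    · refine Eventually.of_forall fun ξ => ?_
      have h5 : Tendsto (fun j => wtd s (fun ξ => g' ((ρ j)⁻¹ • ξ) - g' (c⁻¹ • ξ)) ξ) atTop
          (𝓝 (wtd s (fun ξ => g' (c⁻¹ • ξ) - g' (c⁻¹ • ξ)) ξ)) := by
        refine Tendsto.const_mul _ (Tendsto.sub_const ?_ _)
        exact (hg'c.tendsto _).comp ((hρ.inv₀ hc.ne').smul_const ξ)
      have h6 := (((continuous_enorm.tendsto _).comp h5).ennrpow_const (2 : ℝ))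
      simpa [wtd, Function.comp_def] using h6
  have h7 := hlin.ennrpow_const (1 / 2 : ℝ)
  rw [lintegral_zero, ENNReal.zero_rpow_of_pos (by norm_num)] at h7
  refine h7.congr fun j => ?_
  rw [eLpNorm_eq_lintegral_rpow_enorm_toReal (by simp) (by simp)]
  simp

theorem aestronglyMeasurable_comp_smul {f : Rn n → ℂ} (hf : AEStronglyMeasurable f) {r : ℝ}
    (hr : r ≠ 0) : AEStronglyMeasurable fun ξ => f (r⁻¹ • ξ) :=
  hf.comp_quasiMeasurePreserving (Measure.quasiMeasurePreserving_smul volume (inv_ne_zero hr))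

theorem eLpNorm_dilate_sub_le {s : ℝ} {m g : Rn n → ℂ} (hm : AEStronglyMeasurable m)
    (hg : AEStronglyMeasurable g) {r c : ℝ} (hr : r ≠ 0) (hc : c ≠ 0) {δ : ℝ≥0∞}
    (h1 : eLpNorm (wtd s fun ξ => m (r⁻¹ • ξ) - g (r⁻¹ • ξ)) 2 volume ≤ δ)
    (h2 : eLpNorm (wtd s fun ξ => m (c⁻¹ • ξ) - g (c⁻¹ • ξ)) 2 volume ≤ δ) :
    eLpNorm (wtd s fun ξ => m (r⁻¹ • ξ) - m (c⁻¹ • ξ)) 2 volume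
      ≤ δ + eLpNorm (wtd s fun ξ => g (r⁻¹ • ξ) - g (c⁻¹ • ξ)) 2 volume + δ := by
  have hmr := aestronglyMeasurable_comp_smul hm hr
  have hmc := aestronglyMeasurable_comp_smul hm hc
  have hgr := aestronglyMeasurable_comp_smul hg hr
  have hgc := aestronglyMeasurable_comp_smul hg hc
  have he : (wtd s fun ξ => m (r⁻¹ • ξ) - m (c⁻¹ • ξ))
      = ((wtd s fun ξ => m (r⁻¹ • ξ) - g (r⁻¹ • ξ))
        + wtd s fun ξ => g (r⁻¹ • ξ) - g (c⁻¹ • ξ))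
        - wtd s fun ξ => m (c⁻¹ • ξ) - g (c⁻¹ • ξ) := by
    ext ξ; simp only [wtd, Pi.add_apply, Pi.sub_apply]; ring
  have m1 : AEStronglyMeasurable (wtd s fun ξ => m (r⁻¹ • ξ) - g (r⁻¹ • ξ)) :=
    aestronglyMeasurable_wtd (hmr.sub hgr)
  have m2 : AEStronglyMeasurable (wtd s fun ξ => g (r⁻¹ • ξ) - g (c⁻¹ • ξ)) :=
    aestronglyMeasurable_wtd (hgr.sub hgc)
  have m3 : AEStronglyMeasurable (wtd s fun ξ => m (c⁻¹ • ξ) - g (c⁻¹ • ξ)) :=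
    aestronglyMeasurable_wtd (hmc.sub hgc)
  rw [he]
  refine (eLpNorm_sub_le (m1.add m2) m3 (by norm_num)).trans ?_
  refine add_le_add ?_ h2
  exact (eLpNorm_add_le m1 m2 (by norm_num)).trans (add_le_add h1 le_rfl)

/-- Dilations act strongly continuously on the weighted `L²` space. -/
theorem tendsto_eLpNorm_dilate {s : ℝ} {m : Rn n → ℂ} (hm : MemLp (wtd s m) 2) {ρ : ℕ → ℝ} {c : ℝ}
    (hc : 0 < c) (hρ : Tendsto ρ atTop (𝓝 c)) :
    Tendsto (fun j => eLpNorm (wtd s fun ξ => m ((ρ j)⁻¹ • ξ) - m (c⁻¹ • ξ)) 2 volume)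
      atTop (𝓝 0) := by
  obtain ⟨D, hD⟩ := exists_eLpNorm_dilate_le (n := n) s (b := c / 2) (B := 2 * c) (by positivity)
  have hρI : ∀ᶠ j in atTop, ρ j ∈ Icc (c / 2) (2 * c) :=
    hρ.eventually (Icc_mem_nhds (by linarith) (by linarith))
  rw [ENNReal.tendsto_nhds_zero]
  intro ε hε
  rcases eq_or_ne ε ⊤ with rfl | hεt
  · exact Eventually.of_forall fun _ => le_top
  -- The budget: the approximation error is dilated twice, each time at the cost of a factor `D`,
  -- and the approximant itself moves by at most `δ`.
  set δ : ℝ≥0∞ := ε / (2 * D + 1) with hδ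
  have hδ0 : δ ≠ 0 := by
    rw [hδ]
    refine ENNReal.div_ne_zero.2 ⟨hε.ne', ?_⟩
    exact ENNReal.add_ne_top.2 ⟨ENNReal.mul_ne_top (by simp) ENNReal.coe_ne_top, by simp⟩
  obtain ⟨g, hgs, hgd, hgc, -⟩ := hm.exists_hasCompactSupport_eLpNorm_sub_le (by simp) hδ0
  set g' := wtd (-s) g with hg'
  have hgg' : wtd s g' = g := wtd_wtd_neg s g
  have hg'c : Continuous g' :=
    (Complex.continuous_ofReal.comp (continuous_wt (-s))).mul hgc
  have hg's : HasCompactSupport g' := hgs.mul_left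
  have hdiff : wtd s (fun ξ => m ξ - g' ξ) = wtd s m - g := by
    rw [← hgg']; ext ξ; simp only [wtd, Pi.sub_apply]; ring
  have hmm : AEStronglyMeasurable m := aestronglyMeasurable_of_wtd hm.aestronglyMeasurable
  have key := tendsto_eLpNorm_dilate_of_hasCompactSupport s hg'c hg's hc hρ
  have b1 : ∀ r ∈ Icc (c / 2) (2 * c),
      eLpNorm (wtd s fun ξ => m (r⁻¹ • ξ) - g' (r⁻¹ • ξ)) 2 volume ≤ D * δ := fun r hr => by
    refine (hD r hr fun η => m η - g' η).trans ?_
    rw [hdiff]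
    exact mul_le_mul_right hgd _
  filter_upwards [hρI, (ENNReal.tendsto_nhds_zero.1 key) δ (pos_iff_ne_zero.2 hδ0)] with j hj h2
  have h1 := eLpNorm_dilate_sub_le hmm hg'c.aestronglyMeasurable (by linarith [hj.1] : ρ j ≠ 0)
    hc.ne' (b1 _ hj) (b1 c ⟨by linarith, by linarith⟩)
  calc _ ≤ D * δ + δ + D * δ := h1.trans (by gcongr)
    _ = (2 * D + 1) * δ := by ring
    _ ≤ ε := by rw [hδ]; exact ENNReal.mul_div_le

end SelfSimilar

namespace SelfSimilar

/-! ### Rescaled weak solutions on the Fourier side -/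

theorem ae_Ioi_comp_mul {p : ℝ → Prop} (h : ∀ᵐ t ∂volume.restrict (Ioi (0 : ℝ)), p t) {T : ℝ}
    (hT : 0 < T) : ∀ᵐ t ∂volume.restrict (Ioi (0 : ℝ)), p (T * t) := by
  have h1 := (Measure.quasiMeasurePreserving_smul (volume : Measure ℝ) hT.ne').ae
    ((ae_restrict_iff' measurableSet_Ioi).1 h)
  rw [ae_restrict_iff' measurableSet_Ioi]
  filter_upwards [h1] with t ht hmem
  exact ht (mul_pos hT hmem)

theorem ae_Ioo_of_comp_mul {p : ℝ → Prop} {M T : ℝ} (hT : 0 < T)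
    (h : ∀ᵐ t ∂volume.restrict (Ioo 0 M), p (T * t)) :
    ∀ᵐ t ∂volume.restrict (Ioo 0 (T * M)), p t := by
  have h1 := (Measure.quasiMeasurePreserving_smul (volume : Measure ℝ) (inv_ne_zero hT.ne')).ae
    ((ae_restrict_iff' measurableSet_Ioo).1 h)
  rw [ae_restrict_iff' measurableSet_Ioo]
  filter_upwards [h1] with t ht hmem
  simp only [smul_eq_mul] at ht
  rw [mul_inv_cancel_left₀ hT.ne'] at ht
  refine ht ⟨mul_pos (inv_pos.2 hT) hmem.1, ?_⟩
  rw [inv_mul_lt_iff₀ hT]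
  exact hmem.2

theorem ae_eventually_of_eventually_ae {X : Type*} [MeasurableSpace X] {μ : Measure X}
    {p : ℕ → X → Prop} (h : ∀ᶠ j in atTop, ∀ᵐ x ∂μ, p j x) : ∀ᵐ x ∂μ, ∀ᶠ j in atTop, p j x := by
  obtain ⟨J, hJ⟩ := eventually_atTop.1 h
  have : ∀ᵐ x ∂μ, ∀ j, J ≤ j → p j x :=
    ae_all_iff.2 fun j => by
      by_cases hj : J ≤ j
      · filter_upwards [hJ j hj] with x hx _ using hx
      · exact Eventually.of_forall fun x h => absurd h hj
  filter_upwards [this] with x hx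
  exact eventually_atTop.2 ⟨J, hx⟩

theorem ae_Ioo_of_ae_Ioi {p : ℝ → Prop} (h : ∀ᵐ t ∂volume.restrict (Ioi (0 : ℝ)), p t) (M : ℝ) :
    ∀ᵐ t ∂volume.restrict (Ioo 0 M), p t :=
  ae_restrict_of_ae_restrict_of_subset (fun _ ht => ht.1) h

variable {n : ℕ} {u : ℝ → 𝓢'(Rn n, ℂ)} {a₀ : ℝ} {a : ℝ → ℝ} {u₀ : Rn n → ℂ} {β : ℝ}

/-- The spatial Fourier transform of `u(·, t)` is the explicit function, for almost every `t`. -/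
def HasExplicitFourier (a₀ : ℝ) (a : ℝ → ℝ) (u₀ : Rn n → ℂ) (u : ℝ → 𝓢'(Rn n, ℂ)) : Prop :=
  ∀ᵐ t ∂volume.restrict (Ioi (0 : ℝ)),
    FourierRep (u t) fun ξ => (resolvent (kern a₀ a) (symb ξ) t : ℂ) * 𝓕 u₀ ξ

/-- A bound in `H^s` for the rescaled solution on `(0, 1)` makes the Fourier transform of `u t` a
function for almost every `t < T j`, after undoing the dilation. Since `T j → ∞` all times are
reached, and such functions have already been identified. -/
theorem IsWeakSolution.hasExplicitFourier (ha : IsAdmissibleKernel a₀ a) (hu₀ : Integrable u₀)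
    (hu : IsWeakSolution a₀ a u₀ u) {s : ℝ} {κ T : ℕ → ℝ} (hκ : ∀ᶠ j in atTop, 0 < κ j)
    (hT : Tendsto T atTop atTop) {C : ℝ≥0}
    (hb : ∀ᶠ j in atTop, ∀ᵐ t ∂volume.restrict (Ioo (0 : ℝ) 1),
      eSobolevNorm s (dilate (κ j) (u (T j * t))) ≤ C) : HasExplicitFourier a₀ a u₀ u := by
  have h1 : ∀ᵐ t ∂volume.restrict (Ioi (0 : ℝ)), ∃ m, FourierRep (u t) m := by
    refine ae_restrict_Ioi_of_forall_Ioo fun M => ?_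
    obtain ⟨j, hj, hκj, hTj⟩ := (hb.and (hκ.and (hT.eventually_ge_atTop (max M 1)))).exists
    have hT0 : 0 < T j := lt_of_lt_of_le one_pos ((le_max_right _ _).trans hTj)
    have h2 : ∀ᵐ t ∂volume.restrict (Ioo 0 (T j * 1)), ∃ m, FourierRep (u t) m := by
      refine ae_Ioo_of_comp_mul hT0 ?_
      filter_upwards [hj] with t ht
      obtain ⟨m, hm, -⟩ := exists_fourierRep (ht.trans_lt ENNReal.coe_lt_top).ne
      have h3 := hm.dilate (inv_pos.2 hκj)
      rw [dilate_inv_dilate hκj.ne'] at h3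
      exact ⟨_, h3⟩
    rw [mul_one] at h2
    exact ae_restrict_of_ae_restrict_of_subset
      (Ioo_subset_Ioo_right ((le_max_left _ _).trans hTj)) h2
  filter_upwards [h1, hu.ae_fourierRep ha hu₀] with t ht h2
  exact h2 ht

/-- The Fourier transform of the rescaled solution. -/
noncomputable def prof (a₀ : ℝ) (a : ℝ → ℝ) (β : ℝ) (u₀ : Rn n → ℂ) (κ T t : ℝ) (ξ : Rn n) : ℂ :=
  (resolvent (scaledKernel (kern a₀ a) β T) ((scale a₀ a β T / κ) ^ 2 * symb ξ) t : ℂ)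
    * 𝓕 u₀ (κ⁻¹ • ξ)

theorem HasExplicitFourier.prof (h : HasExplicitFourier a₀ a u₀ u)
    (hA : IsRegularlyVarying (primitive a₀ a) β) (hβ : -1 < β) :
    ∀ᶠ T in atTop, ∀ᵐ t ∂volume.restrict (Ioi (0 : ℝ)), ∀ κ : ℝ, 0 < κ →
      FourierRep (dilate κ (u (T * t))) (SelfSimilar.prof a₀ a β u₀ κ T t) := by
  filter_upwards [resolvent_scaledKernel hA hβ, scale_sq hA hβ, eventually_gt_atTop 0]
    with T hr ⟨_, hs, _⟩ hT
  filter_upwards [ae_Ioi_comp_mul h hT] with t ht κ hκ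
  have h1 := ht.dilate hκ
  have e : SelfSimilar.prof a₀ a β u₀ κ T t = fun ξ => (resolvent (kern a₀ a) (symb (κ⁻¹ • ξ))
      (T * t) : ℂ) * 𝓕 u₀ (κ⁻¹ • ξ) := by
    ext ξ
    rw [SelfSimilar.prof, hr, symb_smul]
    congr 3
    field_simp
  rw [e]; exact h1

theorem fourier_zero (u₀ : Rn n → ℂ) : 𝓕 u₀ 0 = ∫ x, u₀ x := by
  rw [Real.fourier_eq]; simp

theorem continuous_prof (ha : IsAdmissibleKernel a₀ a) (hu₀ : Integrable u₀) (β κ : ℝ) {T : ℝ}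
    (hT : 0 ≤ T) : Continuous fun p : ℝ × Rn n => prof a₀ a β u₀ κ T p.1 p.2 := by
  have h1 := continuous_resolvent (ha.isTameKernel.scaled β hT).integrableOn_Ioc
  have h2 := continuous_symb (n := n)
  refine (Complex.continuous_ofReal.comp (h1.comp (g := fun p : ℝ × ℝ => _)
    (f := fun p : ℝ × Rn n => ((scale a₀ a β T / κ) ^ 2 * symb p.2, p.1)) (by fun_prop))).mul ?_
  exact (continuous_fourier_of_integrable hu₀).comp (by fun_prop)

/-- The spectral parameter moves with `j`, so pointwise convergence of the resolvents would not
suffice; their convergence is uniform for bounded parameters, and the limiting resolvent is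
continuous. The factor `𝓕 u₀` is evaluated at points tending to `0`. -/
theorem tendsto_prof (ha : IsAdmissibleKernel a₀ a) (hu₀ : Integrable u₀)
    (hA : IsRegularlyVarying (primitive a₀ a) β) (hβ : -1 < β) {ι : Type*} {l : Filter ι}
    {κ T : ι → ℝ} (hκ : Tendsto κ l atTop) (hT : Tendsto T l atTop) {c : ℝ}
    (hc : Tendsto (fun j => scale a₀ a β (T j) / κ j) l (𝓝 c)) {t : ℝ} (ht : 0 ≤ t) (ξ : Rn n) :
    Tendsto (fun j => prof a₀ a β u₀ (κ j) (T j) t ξ) l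
      (𝓝 ((∫ x, u₀ x) * (resolvent (fracKernel β) (c ^ 2 * symb ξ) t : ℂ))) := by
  have h0 : Tendsto (fun j => 𝓕 u₀ ((κ j)⁻¹ • ξ)) l (𝓝 (∫ x, u₀ x)) := by
    rw [← fourier_zero]
    refine ((continuous_fourier_of_integrable hu₀).tendsto 0).comp ?_
    simpa using (tendsto_inv_atTop_zero.comp hκ).smul_const ξ
  rw [mul_comm]
  refine Tendsto.mul ?_ h0
  refine (Complex.continuous_ofReal.tendsto _).comp ?_
  have hlam : Tendsto (fun j => (scale a₀ a β (T j) / κ j) ^ 2 * symb ξ) l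
      (𝓝 (c ^ 2 * symb ξ)) := (hc.pow 2).mul_const _
  have h1 : Tendsto (fun j => resolvent (fracKernel β)
      ((scale a₀ a β (T j) / κ j) ^ 2 * symb ξ) t) l
      (𝓝 (resolvent (fracKernel β) (c ^ 2 * symb ξ) t)) :=
    ((continuous_resolvent (integrableOn_fracKernel hβ)).tendsto (c ^ 2 * symb ξ, t)).comp
      (hlam.prodMk_nhds tendsto_const_nhds)
  have h2 : Tendsto (fun j => resolvent (scaledKernel (kern a₀ a) β (T j))
      ((scale a₀ a β (T j) / κ j) ^ 2 * symb ξ) t - resolvent (fracKernel β)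
      ((scale a₀ a β (T j) / κ j) ^ 2 * symb ξ) t) l (𝓝 0) := by
    rw [Metric.tendsto_nhds]
    intro ε hε
    have h3 := tendsto_resolvent (l := l) (integrableOn_fracKernel hβ)
      (Kι := fun j => scaledKernel (kern a₀ a) β (T j))
      ((hT.eventually_ge_atTop 0).mono fun j hj =>
        (ha.isTameKernel.scaled β hj).integrableOn_Ioc) (c ^ 2 * symb ξ + 1) t
      ((hA.kern.tendsto_scaledKernel_Ioc ha.isTameKernel.continuous hβ t).comp hT)
      (show 0 < ε / 2 by positivity)
    filter_upwards [h3, hlam.eventually_le_const (lt_add_one _)] with j hj hle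
    rw [dist_zero_right, Real.norm_eq_abs]
    have := hj _ ⟨mul_nonneg (sq_nonneg _) (symb_nonneg ξ), hle⟩ t ⟨ht, le_rfl⟩
    linarith
  simpa using h2.add h1

/-! ### Convergence in Sobolev spaces on the Fourier side -/

theorem exists_norm_fourier_apply_le (s : ℝ) (φ : 𝓢(Rn n, ℂ)) : ∃ C : ℝ, 0 ≤ C ∧
    ∀ U : 𝓢'(Rn n, ℂ), eSobolevNorm s U ≠ ⊤ → ‖(𝓕 U) φ‖ ≤ (eSobolevNorm s U).toReal * C := by
  obtain ⟨C, hC, h⟩ := exists_integral_norm_mul_le s φ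
  refine ⟨C, hC, fun U hU => ?_⟩
  obtain ⟨m, hm, hmL⟩ := exists_fourierRep hU
  rw [(hm φ).2, hm.eSobolevNorm_eq s]
  exact (norm_integral_le_integral_norm _).trans (h m hmL).2

theorem tendsto_fourier_apply {s : ℝ} {V : ℕ → 𝓢'(Rn n, ℂ)} {V' : 𝓢'(Rn n, ℂ)}
    (h : Tendsto (fun j => eSobolevNorm s (V j - V')) atTop (𝓝 0)) (φ : 𝓢(Rn n, ℂ)) :
    Tendsto (fun j => (𝓕 (V j)) φ) atTop (𝓝 ((𝓕 V') φ)) := by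
  obtain ⟨C, hC, hb⟩ := exists_norm_fourier_apply_le s φ
  rw [← tendsto_sub_nhds_zero_iff]
  have h1 := ((ENNReal.tendsto_toReal ENNReal.zero_ne_top).comp h).mul_const C
  simp only [ENNReal.toReal_zero, zero_mul] at h1
  refine squeeze_zero_norm' ?_ h1
  filter_upwards [h.eventually_lt_const ENNReal.zero_lt_top] with j hj
  exact hb _ hj.ne

theorem eLpNorm_le_of_tendsto_of_eventually {f : ℕ → Rn n → ℂ} {g : Rn n → ℂ} {C : ℝ≥0∞}
    (hf : ∀ᶠ j in atTop, AEStronglyMeasurable (f j) volume)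
    (hlim : ∀ᵐ ξ, Tendsto (fun j => f j ξ) atTop (𝓝 (g ξ)))
    (hb : ∀ᶠ j in atTop, eLpNorm (f j) 2 volume ≤ C) : eLpNorm g 2 volume ≤ C := by
  obtain ⟨J, hJ⟩ := eventually_atTop.1 hf
  refine eLpNorm_le_of_tendsto (f := fun j => f (j + J)) (fun j => hJ _ (Nat.le_add_left _ _)) ?_
    ((tendsto_add_atTop_nat J).eventually hb)
  filter_upwards [hlim] with ξ hξ
  exact hξ.comp (tendsto_add_atTop_nat J)

/-- The limit in `H^s` and the pointwise limit of the symbols coincide: by Fatou's lemma, the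
weighted norm of their difference is below every positive number. -/
theorem fourierRep_of_tendsto {s : ℝ} {V : ℕ → 𝓢'(Rn n, ℂ)} {V' : 𝓢'(Rn n, ℂ)}
    {m : ℕ → Rn n → ℂ} {m' : Rn n → ℂ} (hV : ∀ᶠ j in atTop, FourierRep (V j) (m j))
    (hV' : TemperedDistribution.MemSobolev s 2 V')
    (h : Tendsto (fun j => eSobolevNorm s (V j - V')) atTop (𝓝 0))
    (hm : ∀ᵐ ξ, Tendsto (fun j => m j ξ) atTop (𝓝 (m' ξ))) :
    FourierRep V' m' ∧ MemLp (wtd s m') 2 := by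
  obtain ⟨m₁, hm₁, hm₁L⟩ := exists_fourierRep_of_memSobolev hV'
  have hsub : ∀ᶠ j in atTop, FourierRep (V j - V') fun ξ => m j ξ - m₁ ξ :=
    hV.mono fun j hj => hj.sub hm₁
  have h0 : eLpNorm (wtd s fun ξ => m' ξ - m₁ ξ) 2 volume ≤ 0 := by
    refine le_of_forall_gt fun C hC => ?_
    obtain ⟨C', hC', hC'C⟩ := exists_between hC
    refine lt_of_le_of_lt (eLpNorm_le_of_tendsto_of_eventually
      (f := fun j => wtd s fun ξ => m j ξ - m₁ ξ) (C := C') ?_ ?_ ?_) hC'C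
    · exact hsub.mono fun j hj => aestronglyMeasurable_wtd hj.locallyIntegrable.aestronglyMeasurable
    · filter_upwards [hm] with ξ hξ
      exact (hξ.sub_const _).const_mul _
    · filter_upwards [hsub, h.eventually_lt_const hC'] with j hj hlt
      rw [← hj.eSobolevNorm_eq s]; exact hlt.le
  have hmeas : AEStronglyMeasurable m' := by
    obtain ⟨J, hJ⟩ := eventually_atTop.1 hV
    refine aestronglyMeasurable_of_tendsto_ae atTop (f := fun j => m (j + J))
      (fun j => (hJ _ (Nat.le_add_left _ _)).locallyIntegrable.aestronglyMeasurable) ?_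
    filter_upwards [hm] with ξ hξ
    exact hξ.comp (tendsto_add_atTop_nat J)
  have he : m₁ =ᵐ[volume] m' := by
    have h1 := (eLpNorm_eq_zero_iff (aestronglyMeasurable_wtd (s := s)
      (hmeas.sub hm₁.locallyIntegrable.aestronglyMeasurable)) (by simp)).1 (le_antisymm h0 bot_le)
    filter_upwards [h1] with ξ hξ
    have h2 : (wt s ξ : ℂ) * (m' ξ - m₁ ξ) = 0 := hξ
    have h3 : (wt s ξ : ℂ) ≠ 0 := by exact_mod_cast (wt_pos s ξ).ne'
    exact (sub_eq_zero.1 ((mul_eq_zero.1 h2).resolve_left h3)).symm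
  refine ⟨hm₁.congr he, hm₁L.ae_eq ?_⟩
  filter_upwards [he] with ξ hξ
  rw [wtd, wtd, hξ]

end SelfSimilar

namespace SelfSimilar

/-! ### Identification of the limit along a sequence of times -/

variable {n : ℕ} {u : ℝ → 𝓢'(Rn n, ℂ)} {a₀ : ℝ} {a : ℝ → ℝ} {u₀ : Rn n → ℂ} {β s : ℝ}
  {κ T : ℕ → ℝ} {u_inf : ℝ → 𝓢'(Rn n, ℂ)}

/-- The solution `u`, rescaled in space by `κ j` and in time by `T j`, converges to `u_inf`. -/
structure IsLimitAlong (a₀ : ℝ) (a : ℝ → ℝ) (β : ℝ) (u₀ : Rn n → ℂ) (u : ℝ → 𝓢'(Rn n, ℂ)) (s : ℝ)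
    (κ T : ℕ → ℝ) (u_inf : ℝ → 𝓢'(Rn n, ℂ)) : Prop where
  admissible : IsAdmissibleKernel a₀ a
  integrable : Integrable u₀
  regVar : IsRegularlyVarying (primitive a₀ a) β
  index : β ∈ Ioc (-1 : ℝ) 1
  space : Tendsto κ atTop atTop
  time : Tendsto T atTop atTop
  fourier : HasExplicitFourier a₀ a u₀ u
  mem : ∀ᵐ t ∂volume.restrict (Ioi (0 : ℝ)), TemperedDistribution.MemSobolev s 2 (u_inf t)
  conv : TendstoAEBoundedly s (fun j t => dilate (κ j) (u (T j * t))) u_inf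

namespace IsLimitAlong

theorem comp (h : IsLimitAlong a₀ a β u₀ u s κ T u_inf) {ns : ℕ → ℕ} (hns : Tendsto ns atTop atTop) :
    IsLimitAlong a₀ a β u₀ u s (κ ∘ ns) (T ∘ ns) u_inf where
  admissible := h.admissible
  integrable := h.integrable
  regVar := h.regVar
  index := h.index
  space := h.space.comp hns
  time := h.time.comp hns
  fourier := h.fourier
  mem := h.mem
  conv := by
    refine ⟨?_, fun M => ?_⟩
    · filter_upwards [h.conv.1] with t ht using ht.comp hns
    · obtain ⟨C, hC⟩ := h.conv.2 M
      exact ⟨C, hns.eventually hC⟩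

theorem eventually_fourierRep (h : IsLimitAlong a₀ a β u₀ u s κ T u_inf) :
    ∀ᶠ j in atTop, ∀ᵐ t ∂volume.restrict (Ioi (0 : ℝ)),
      FourierRep (dilate (κ j) (u (T j * t))) (prof a₀ a β u₀ (κ j) (T j) t) := by
  filter_upwards [h.time.eventually (h.fourier.prof h.regVar h.index.1),
    h.space.eventually_gt_atTop 0] with j hj hκ
  filter_upwards [hj] with t ht using ht _ hκ

theorem fourierRep (h : IsLimitAlong a₀ a β u₀ u s κ T u_inf) {c : ℝ}
    (hc : Tendsto (fun j => scale a₀ a β (T j) / κ j) atTop (𝓝 c)) :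
    ∀ᵐ t ∂volume.restrict (Ioi (0 : ℝ)),
      FourierRep (u_inf t) (fun ξ => (∫ x, u₀ x) * (resolvent (fracKernel β) (c ^ 2 * symb ξ) t : ℂ))
      ∧ MemLp (wtd s fun ξ : Rn n => (∫ x, u₀ x) * (resolvent (fracKernel β) (c ^ 2 * symb ξ) t : ℂ)) 2 := by
  filter_upwards [ae_eventually_of_eventually_ae h.eventually_fourierRep, h.mem, h.conv.1,
    ae_restrict_mem measurableSet_Ioi] with t h1 h2 h3 h4
  exact fourierRep_of_tendsto h1 h2 h3 (Eventually.of_forall fun ξ =>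
    tendsto_prof h.admissible h.integrable h.regVar h.index.1 h.space h.time hc (le_of_lt h4) ξ)

/-- The scaled Volterra equation for the Fourier transform of the rescaled solution. -/
theorem volConv_prof (ha : IsAdmissibleKernel a₀ a) (hu₀ : Integrable u₀) (β : ℝ) {k S : ℝ}
    (hS : 0 ≤ S) (φ : 𝓢(Rn n, ℂ)) (hφ : HasCompactSupport φ) (t : ℝ) :
    (((scale a₀ a β S / k) ^ 2 : ℝ) : ℂ) * volConv (scaledKernel (kern a₀ a) β S)
      (fun τ => ∫ ξ, prof a₀ a β u₀ k S τ ξ * symbMul n φ ξ) t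
      = (∫ ξ, 𝓕 u₀ (k⁻¹ • ξ) * φ ξ) - ∫ ξ, prof a₀ a β u₀ k S t ξ * φ ξ := by
  have hF : Continuous fun ξ => 𝓕 u₀ (k⁻¹ • ξ) * φ ξ :=
    ((continuous_fourier_of_integrable hu₀).comp (continuous_const_smul _)).mul φ.continuous
  obtain ⟨B, hB⟩ := hφ.isCompact.exists_bound_of_continuousOn
    (f := fun ξ => (scale a₀ a β S / k) ^ 2 * symb ξ)
    (continuous_const.mul continuous_symb).continuousOn
  have h := (integral_resolvent_mul (ha.isTameKernel.scaled β hS).integrableOn_Ioc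
    (lam := fun ξ : Rn n => (scale a₀ a β S / k) ^ 2 * symb ξ)
    (f := fun ξ => 𝓕 u₀ (k⁻¹ • ξ) * φ ξ) (μ := volume)
    (continuous_const.mul continuous_symb).measurable
    (hF.integrable_of_hasCompactSupport hφ.mul_left)
    (Λ := B) (fun ξ hξ => hB ξ (subset_tsupport _ (right_ne_zero_of_mul hξ))) t).2
  have e1 : ∀ τ, ∫ ξ, prof a₀ a β u₀ k S τ ξ * φ ξ
      = ∫ ξ, (resolvent (scaledKernel (kern a₀ a) β S) ((scale a₀ a β S / k) ^ 2 * symb ξ) τ : ℂ)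
        * (𝓕 u₀ (k⁻¹ • ξ) * φ ξ) := fun τ => by
    congr 1; ext ξ; rw [prof, mul_assoc]
  rw [e1, h, sub_sub_cancel, volConv, volConv, ← integral_const_mul]
  congr 1; ext τ
  rw [mul_left_comm, ← integral_const_mul]
  congr 2; ext ξ
  rw [symbMul_apply, prof]
  push_cast; ring

theorem ae_norm_apply_le (h : IsLimitAlong a₀ a β u₀ u s κ T u_inf) (M : ℝ) (φ : 𝓢(Rn n, ℂ)) :
    ∃ C : ℝ, ∀ᶠ j in atTop, ∀ᵐ t ∂volume.restrict (Ioo 0 M),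
      ‖∫ ξ, prof a₀ a β u₀ (κ j) (T j) t ξ * φ ξ‖ ≤ C := by
  obtain ⟨C, hC⟩ := h.conv.2 M
  obtain ⟨D, hD, hb⟩ := exists_norm_fourier_apply_le s φ
  refine ⟨C * D, ?_⟩
  filter_upwards [hC, h.eventually_fourierRep] with j h1 h2
  filter_upwards [h1, ae_Ioo_of_ae_Ioi h2 M] with t h3 h4
  rw [← (h4 φ).2]
  refine (hb _ (h3.trans_lt ENNReal.coe_lt_top).ne).trans ?_
  gcongr
  exact ENNReal.toReal_mono ENNReal.coe_ne_top h3

theorem ae_tendsto_apply (h : IsLimitAlong a₀ a β u₀ u s κ T u_inf) (φ : 𝓢(Rn n, ℂ)) :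
    ∀ᵐ t ∂volume.restrict (Ioi (0 : ℝ)),
      Tendsto (fun j => ∫ ξ, prof a₀ a β u₀ (κ j) (T j) t ξ * φ ξ) atTop
        (𝓝 ((𝓕 (u_inf t)) φ)) := by
  filter_upwards [ae_eventually_of_eventually_ae h.eventually_fourierRep, h.conv.1] with t h1 h2
  refine (tendsto_fourier_apply h2 φ).congr' ?_
  filter_upwards [h1] with j hj
  exact (hj φ).2

theorem aestronglyMeasurable_apply (ha : IsAdmissibleKernel a₀ a) (hu₀ : Integrable u₀) (β : ℝ)
    {k S : ℝ} (hS : 0 ≤ S) (φ : 𝓢(Rn n, ℂ)) :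
    StronglyMeasurable fun t => ∫ ξ, prof a₀ a β u₀ k S t ξ * φ ξ := by
  have : StronglyMeasurable fun p : ℝ × Rn n => prof a₀ a β u₀ k S p.1 p.2 * φ p.2 :=
    ((continuous_prof ha hu₀ β k hS).mul (φ.continuous.comp continuous_snd)).stronglyMeasurable
  exact this.integral_prod_right'

/-- If the ratio of the scalings tends to infinity, division of the scaled Volterra equation by its
square kills the right-hand side, which converges. The left-hand side converges to the fractional
integral of the limit tested with the symbol times `φ`, and fractional integration is injective. -/
theorem ae_fourier_symbMul_eq_zero (h : IsLimitAlong a₀ a β u₀ u s κ T u_inf)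
    (hρ : Tendsto (fun j => scale a₀ a β (T j) / κ j) atTop atTop) (φ : 𝓢(Rn n, ℂ))
    (hφ : HasCompactSupport φ) (M : ℝ) :
    ∀ᵐ t ∂volume.restrict (Ioo 0 M), (𝓕 (u_inf t)) (symbMul n φ) = 0 := by
  obtain ⟨J, hJ⟩ := eventually_atTop.1 (h.time.eventually_ge_atTop 0)
  have hadd := tendsto_add_atTop_nat J
  -- Dropping finitely many terms makes all times nonnegative, so that every term of the sequence,
  -- not only the late ones, has a continuous kernel and measurable pairings.
  wlog hJ0 : J = 0 generalizing κ T J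
  · exact this (h.comp hadd) (hρ.comp hadd) 0 (fun j _ => hJ _ (Nat.le_add_left _ _))
      (tendsto_add_atTop_nat 0) rfl
  subst hJ0
  have hT0 : ∀ j, 0 ≤ T j := fun j => hJ j (Nat.zero_le _)
  obtain ⟨C, hC⟩ := h.ae_norm_apply_le M (symbMul n φ)
  have hm : ∀ j, AEStronglyMeasurable
      (fun t => ∫ ξ, prof a₀ a β u₀ (κ j) (T j) t ξ * symbMul n φ ξ)
      (volume.restrict (Ioo 0 M)) := fun j =>
    (aestronglyMeasurable_apply h.admissible h.integrable β (hT0 j) _).aestronglyMeasurable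
  have hlim := ae_Ioo_of_ae_Ioi (h.ae_tendsto_apply (symbMul n φ)) M
  have hq : IntegrableOn (fun t => (𝓕 (u_inf t)) (symbMul n φ)) (Ioo 0 M) := by
    refine Integrable.of_bound (aestronglyMeasurable_of_tendsto_ae atTop hm hlim) C ?_
    filter_upwards [hlim, ae_eventually_of_eventually_ae hC] with t h1 h2
    exact le_of_tendsto h1.norm h2
  refine ae_eq_zero_of_volConv_fracKernel h.index hq ?_
  filter_upwards [ae_restrict_mem measurableSet_Ioo, ae_Ioo_of_ae_Ioi (h.ae_tendsto_apply φ) M]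
    with t ht hP
  have h1 := tendsto_volConv (integrableOn_fracKernel h.index.1 M)
    (Ks := fun j => scaledKernel (kern a₀ a) β (T j))
    (Eventually.of_forall fun j => (h.admissible.isTameKernel.scaled β (hT0 j)).integrableOn_Ioc M)
    ((h.regVar.kern.tendsto_scaledKernel_Ioc h.admissible.isTameKernel.continuous
      h.index.1 M).comp h.time) hm hC hlim ht
  refine tendsto_nhds_unique h1 ?_
  have h2 : ∀ᶠ j in atTop, (((scale a₀ a β (T j) / κ j) ^ 2 : ℝ) : ℂ)⁻¹ *
      ((∫ ξ, 𝓕 u₀ ((κ j)⁻¹ • ξ) * φ ξ) - ∫ ξ, prof a₀ a β u₀ (κ j) (T j) t ξ * φ ξ)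
      = volConv (scaledKernel (kern a₀ a) β (T j))
      (fun τ => ∫ ξ, prof a₀ a β u₀ (κ j) (T j) τ ξ * symbMul n φ ξ) t := by
    filter_upwards [hρ.eventually_gt_atTop 0] with j hj
    rw [← volConv_prof h.admissible h.integrable β (hT0 j) φ hφ t, inv_mul_cancel_left₀]
    exact_mod_cast (pow_pos hj 2).ne'
  refine Tendsto.congr' h2 ?_
  have h3 : Tendsto (fun j => (((scale a₀ a β (T j) / κ j) ^ 2 : ℝ) : ℂ)⁻¹) atTop (𝓝 0) := by
    have := tendsto_inv_atTop_zero.comp ((tendsto_pow_atTop two_ne_zero).comp hρ)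
    simpa [Function.comp_def] using (Complex.continuous_ofReal.tendsto 0).comp this
  have h4 : Tendsto (fun j => ∫ ξ, prof a₀ a β u₀ (κ j) (T j) t ξ * φ ξ) atTop _ := hP
  have h5 : Tendsto (fun j => ∫ ξ, 𝓕 u₀ ((κ j)⁻¹ • ξ) * φ ξ) atTop
      (𝓝 (∫ ξ, 𝓕 u₀ 0 * φ ξ)) := by
    refine tendsto_integral_of_dominated_convergence (fun ξ => (∫ x, ‖u₀ x‖) * ‖φ ξ‖)
      (fun j => (((continuous_fourier_of_integrable h.integrable).comp
        (continuous_const_smul _)).mul φ.continuous).aestronglyMeasurable)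
      (φ.integrable.norm.const_mul _) (fun j => Eventually.of_forall fun ξ => ?_)
      (Eventually.of_forall fun ξ => ?_)
    · rw [norm_mul]
      exact mul_le_mul_of_nonneg_right (norm_fourier_le _) (norm_nonneg _)
    · refine Tendsto.mul_const _ (((continuous_fourier_of_integrable h.integrable).tendsto 0).comp ?_)
      simpa using (tendsto_inv_atTop_zero.comp h.space).smul_const ξ
  simpa using h3.mul (h5.sub h4)

/-- The symbol vanishes only at the origin, a null set because `n ≥ 1`. -/
theorem eq_zero_of_forall_symbMul (hn : 1 ≤ n) {V : 𝓢'(Rn n, ℂ)} {m : Rn n → ℂ}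
    (hV : FourierRep V m) {D : ℕ → 𝓢(Rn n, ℂ)}
    (hD : ∀ f : Rn n → ℂ, LocallyIntegrable f → (∀ k, ∫ ξ, f ξ * D k ξ = 0) → f =ᵐ[volume] 0)
    (h0 : ∀ k, (𝓕 V) (symbMul n (D k)) = 0) : V = 0 := by
  have : Nonempty (Fin n) := ⟨⟨0, hn⟩⟩
  have hloc : LocallyIntegrable fun ξ => (symb ξ : ℂ) * m ξ := by
    rw [← locallyIntegrableOn_univ]
    exact (locallyIntegrableOn_univ.2 hV.locallyIntegrable).continuousOn_mul
      (Complex.continuous_ofReal.comp continuous_symb).continuousOn isOpen_univ.isLocallyClosed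
  have h1 := hD _ hloc fun k => by
    rw [← h0 k, (hV _).2]
    congr 1; ext ξ
    rw [symbMul_apply]; ring
  refine hV.eq (FourierRep.zero.congr ?_)
  have h2 : ∀ᵐ ξ : Rn n, ξ ≠ 0 := by
    rw [ae_iff]; simp
  filter_upwards [h1, h2] with ξ h3 h4
  have h5 : (symb ξ : ℂ) ≠ 0 := by
    have : 0 < symb ξ := by unfold symb; have := norm_pos_iff.2 h4; positivity
    exact_mod_cast this.ne'
  exact ((mul_eq_zero.1 h3).resolve_left h5).symm

theorem ae_eq_zero_of_tendsto_atTop (hn : 1 ≤ n) (h : IsLimitAlong a₀ a β u₀ u s κ T u_inf)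
    (hρ : Tendsto (fun j => scale a₀ a β (T j) / κ j) atTop atTop) :
    ∀ᵐ t ∂volume.restrict (Ioi (0 : ℝ)), u_inf t = 0 := by
  obtain ⟨D, hDc, hD⟩ := exists_determining_seq n
  have h1 : ∀ᵐ t ∂volume.restrict (Ioi (0 : ℝ)), ∀ k, (𝓕 (u_inf t)) (symbMul n (D k)) = 0 :=
    ae_all_iff.2 fun k => ae_restrict_Ioi_of_forall_Ioo fun M =>
      h.ae_fourier_symbMul_eq_zero hρ (D k) (hDc k) M
  filter_upwards [h1, h.mem] with t h2 h3
  obtain ⟨m, hm, -⟩ := exists_fourierRep_of_memSobolev h3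
  exact eq_zero_of_forall_symbMul hn hm hD h2

end IsLimitAlong

end SelfSimilar

namespace SelfSimilar

/-! ### The limit of the ratio of the two scalings -/

variable {n : ℕ} {u : ℝ → 𝓢'(Rn n, ℂ)} {a₀ : ℝ} {a : ℝ → ℝ} {u₀ : Rn n → ℂ} {β s : ℝ}
  {κ T : ℕ → ℝ} {u_inf : ℝ → 𝓢'(Rn n, ℂ)}

theorem integral_fourierInv (φ : 𝓢(Rn n, ℂ)) : ∫ ξ, (𝓕⁻ φ : 𝓢(Rn n, ℂ)) ξ = φ 0 := by
  have h : (𝓕 (𝓕⁻ φ : 𝓢(Rn n, ℂ))) 0 = φ 0 := by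
    rw [FourierTransform.fourier_fourierInv_eq]
  rw [← h, SchwartzMap.fourier_coe, fourier_zero]

theorem FourierRep.apply_eq {U : 𝓢'(Rn n, ℂ)} {m : Rn n → ℂ} (h : FourierRep U m) (φ : 𝓢(Rn n, ℂ)) :
    U φ = ∫ ξ, m ξ * (𝓕⁻ φ : 𝓢(Rn n, ℂ)) ξ := by
  rw [← (h _).2, TemperedDistribution.fourier_apply, FourierTransform.fourier_fourierInv_eq]

/-- A constant Fourier transform means a multiple of the Dirac mass at `0`, by Fourier inversion at
the origin. -/
theorem FourierRep.dsupport_subset {U : 𝓢'(Rn n, ℂ)} {c : ℂ} (h : FourierRep U fun _ => c) :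
    Distribution.dsupport U ⊆ {0} := by
  intro x hx
  by_contra hx0
  refine (Distribution.notMem_dsupport_iff x).2 ⟨{0}ᶜ, fun φ hφ => ?_, isOpen_compl_singleton, hx0⟩ hx
  have h0 : φ 0 = 0 := by
    by_contra hne
    exact hφ (subset_tsupport _ (Function.mem_support.2 hne)) rfl
  rw [h.apply_eq, integral_const_mul, integral_fourierInv, h0, mul_zero]

theorem exists_symb_eq (hn : 1 ≤ n) {x : ℝ} (hx : 0 ≤ x) : ∃ ξ : Rn n, symb ξ = x := by
  have : Nonempty (Fin n) := ⟨⟨0, hn⟩⟩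
  obtain ⟨ξ, hξ⟩ := exists_norm_eq (Rn n) (c := √x / (2 * Real.pi)) (by positivity)
  refine ⟨ξ, ?_⟩
  rw [symb, hξ, div_pow, Real.sq_sqrt hx]
  field_simp

theorem integral_fracKernel_pos {β t : ℝ} (hβ : -1 < β) (ht : 0 < t) :
    0 < ∫ s in Ioc 0 t, fracKernel β s := by
  have h := integrableOn_fracKernel hβ t
  rw [setIntegral_pos_iff_support_of_nonneg_ae]
  · refine lt_of_lt_of_le ?_ (measure_mono (s := Ioc 0 t) fun s hs => ⟨?_, hs⟩)
    · simpa using ht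
    · exact (div_pos (Real.rpow_pos_of_pos hs.1 _) (Real.Gamma_pos_of_pos (by linarith))).ne'
  · filter_upwards [ae_restrict_mem measurableSet_Ioc] with s hs
    exact (div_pos (Real.rpow_pos_of_pos hs.1 _) (Real.Gamma_pos_of_pos (by linarith))).le
  · exact h

/-- A resolvent that is identically `1` would force the integral of the positive kernel to vanish in
the resolvent equation. -/
theorem resolvent_fracKernel_ne_one {β : ℝ} (hβ : -1 < β) :
    ¬ ∀ᵐ t ∂volume.restrict (Ioi (0 : ℝ)), resolvent (fracKernel β) 1 t = 1 := by
  intro h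
  have hc := continuous_resolvent_right (integrableOn_fracKernel hβ) 1
  have h1 : EqOn (resolvent (fracKernel β) 1) (fun _ => 1) (Ioi 0) :=
    Measure.eqOn_open_of_ae_eq h isOpen_Ioi hc.continuousOn continuousOn_const
  have h2 := resolvent_eq (integrableOn_fracKernel hβ) 1 1
  simp only [h1 (show (0 : ℝ) < 1 by norm_num)] at h2
  have h3 : ∫ s in Ioc 0 1, fracKernel β s * resolvent (fracKernel β) 1 (1 - s)
      = ∫ s in Ioc 0 1, fracKernel β s := by
    refine setIntegral_congr_fun measurableSet_Ioc fun s hs => ?_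
    rcases hs.2.eq_or_lt with rfl | hlt
    · simp only [sub_self, resolvent_zero_right, mul_one]
    · rw [h1 (show (0 : ℝ) < 1 - s by linarith), mul_one]
  rw [h3] at h2
  have := integral_fracKernel_pos hβ one_pos
  linarith

/-- The profile determines the scaling. -/
theorem eq_one_of_comp_mul_eq {f : ℝ → ℝ} (hf : Continuous f) (h0 : f 0 = 1) {b c : ℝ} (hb : 0 < b)
    (hbc : b < c) (h : ∀ x, 0 ≤ x → f (b * x) = f (c * x)) {x : ℝ} (hx : 0 ≤ x) : f x = 1 := by
  have hc := hb.trans hbc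
  -- Invariance under the contraction `x ↦ (b / c) x` carries every value to the value at `0`.
  have h1 : ∀ k : ℕ, f ((b / c) ^ k * x) = f x := by
    intro k
    induction k with
    | zero => simp
    | succ k ih =>
      rw [← ih]
      have := h ((b / c) ^ k * x / c) (by positivity)
      rw [mul_div_cancel₀ _ hc.ne'] at this
      rw [← this]
      congr 1
      rw [pow_succ]; ring
  have h2 : Tendsto (fun k : ℕ => f ((b / c) ^ k * x)) atTop (𝓝 (f (0 * x))) :=
    (hf.tendsto _).comp ((tendsto_pow_atTop_nhds_zero_of_lt_one (by positivity)
      ((div_lt_one hc).2 hbc)).mul_const x)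
  rw [zero_mul, h0] at h2
  exact tendsto_nhds_unique (tendsto_const_nhds.congr fun k => (h1 k).symm) h2

namespace IsLimitAlong

theorem integral_ne_zero (h : IsLimitAlong a₀ a β u₀ u s κ T u_inf) (hnt : IsNontrivial u_inf) {c : ℝ}
    (hc : Tendsto (fun j => scale a₀ a β (T j) / κ j) atTop (𝓝 c)) : ∫ x, u₀ x ≠ 0 := by
  intro h0
  refine hnt.1 ?_
  filter_upwards [h.fourierRep hc] with t ht
  have := ht.1
  simp only [h0, zero_mul] at this
  exact this.eq FourierRep.zero

theorem limit_ne_zero (h : IsLimitAlong a₀ a β u₀ u s κ T u_inf) (hnt : IsNontrivial u_inf) {c : ℝ}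
    (hc : Tendsto (fun j => scale a₀ a β (T j) / κ j) atTop (𝓝 c)) : c ≠ 0 := by
  rintro rfl
  refine hnt.2 ?_
  filter_upwards [h.fourierRep hc] with t ht
  have := ht.1
  simp only [ne_eq, OfNat.ofNat_ne_zero, not_false_eq_true, zero_pow, zero_mul,
    resolvent_zero_left, Complex.ofReal_one, mul_one] at this
  exact this.dsupport_subset

theorem ratio_nonneg (h : IsLimitAlong a₀ a β u₀ u s κ T u_inf) :
    ∀ᶠ j in atTop, 0 ≤ scale a₀ a β (T j) / κ j := by
  filter_upwards [h.space.eventually_gt_atTop 0] with j hj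
  exact div_nonneg (Real.sqrt_nonneg _) hj.le

/-- Both sequences lead to the same `u_inf`, so two limiting ratios yield the same profile at two
different scales. A profile invariant under a nontrivial scaling is constant, which the
Mittag-Leffler profile is not. Distinct sequences are allowed so that two subsequences can be
compared. -/
theorem not_lt_limit (hn : 1 ≤ n) {κ' T' : ℕ → ℝ} (h : IsLimitAlong a₀ a β u₀ u s κ T u_inf)
    (h' : IsLimitAlong a₀ a β u₀ u s κ' T' u_inf) (hnt : IsNontrivial u_inf) {c c' : ℝ} (hc0 : 0 < c)
    (hc : Tendsto (fun j => scale a₀ a β (T j) / κ j) atTop (𝓝 c))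
    (hc' : Tendsto (fun j => scale a₀ a β (T' j) / κ' j) atTop (𝓝 c')) : ¬ c < c' := by
  intro hlt
  have hU := h.integral_ne_zero hnt hc
  refine resolvent_fracKernel_ne_one h.index.1 ?_
  have hcr := continuous_resolvent (integrableOn_fracKernel h.index.1)
  filter_upwards [h.fourierRep hc, h'.fourierRep hc'] with t h1 h2
  have hcx : Continuous fun x => resolvent (fracKernel β) x t :=
    hcr.comp (g := fun p : ℝ × ℝ => _) (f := fun x : ℝ => (x, t)) (by fun_prop)
  have hcont : ∀ b : ℝ, Continuous fun ξ : Rn n =>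
      (∫ x, u₀ x) * (resolvent (fracKernel β) (b ^ 2 * symb ξ) t : ℂ) := fun b =>
    continuous_const.mul (Complex.continuous_ofReal.comp
      (hcx.comp (continuous_const.mul continuous_symb)))
  have h3 := (Continuous.ae_eq_iff_eq volume (hcont c) (hcont c')).1 (h1.1.ae_eq h2.1)
  refine eq_one_of_comp_mul_eq hcx (resolvent_zero_left _ _) (pow_pos hc0 2)
    (pow_lt_pow_left₀ hlt hc0.le two_ne_zero) (fun x hx => ?_) zero_le_one
  obtain ⟨ξ, rfl⟩ := exists_symb_eq hn hx
  exact_mod_cast mul_left_cancel₀ hU (congrFun h3 ξ)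

/-- In the compact space `[0, ∞]` the ratios have a convergent subsequence. Its limit is not `∞`,
since `u_inf` is not zero, and not `0`, since `u_inf` is not supported at the origin. -/
theorem exists_subseq (hn : 1 ≤ n) (h : IsLimitAlong a₀ a β u₀ u s κ T u_inf)
    (hnt : IsNontrivial u_inf) : ∃ ns : ℕ → ℕ, StrictMono ns ∧ ∃ c : ℝ, 0 < c ∧
      Tendsto (fun j => scale a₀ a β (T (ns j)) / κ (ns j)) atTop (𝓝 c) := by
  obtain ⟨L, ns, hns, hL⟩ := CompactSpace.tendsto_subseq
    fun j => ENNReal.ofReal (scale a₀ a β (T j) / κ j)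
  have h' := h.comp hns.tendsto_atTop
  have hLtop : L ≠ ⊤ := by
    rintro rfl
    have := ENNReal.tendsto_ofReal_nhds_top.1 hL
    exact hnt.1 (h'.ae_eq_zero_of_tendsto_atTop hn this)
  have h1 : Tendsto (fun j => scale a₀ a β (T (ns j)) / κ (ns j)) atTop (𝓝 L.toReal) := by
    refine ((ENNReal.tendsto_toReal hLtop).comp hL).congr' ?_
    filter_upwards [h'.ratio_nonneg] with j hj
    exact ENNReal.toReal_ofReal hj
  exact ⟨ns, hns, L.toReal, lt_of_le_of_ne ENNReal.toReal_nonneg (h'.limit_ne_zero hnt h1).symm, h1⟩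

theorem exists_limit (hn : 1 ≤ n) (h : IsLimitAlong a₀ a β u₀ u s κ T u_inf)
    (hnt : IsNontrivial u_inf) : ∃ c : ℝ, 0 < c ∧
      Tendsto (fun j => scale a₀ a β (T j) / κ j) atTop (𝓝 c) := by
  obtain ⟨ns, hns, c, hc0, hc⟩ := h.exists_subseq hn hnt
  refine ⟨c, hc0, tendsto_of_subseq_tendsto fun ms hms => ?_⟩
  obtain ⟨ps, hps, c', hc'0, hc'⟩ := (h.comp hms).exists_subseq hn hnt
  have h1 := h.comp hns.tendsto_atTop
  have h2 := (h.comp hms).comp hps.tendsto_atTop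
  have e : c' = c := le_antisymm (not_lt.1 (not_lt_limit hn h1 h2 hnt hc0 hc hc'))
    (not_lt.1 (not_lt_limit hn h2 h1 hnt hc'0 hc' hc))
  exact ⟨ps, e ▸ hc'⟩

end IsLimitAlong

end SelfSimilar

namespace SelfSimilar

/-! ### The limiting family -/

variable {n : ℕ} {u : ℝ → 𝓢'(Rn n, ℂ)} {a₀ : ℝ} {a : ℝ → ℝ} {u₀ : Rn n → ℂ} {β s : ℝ}
  {κ T : ℕ → ℝ} {u_inf : ℝ → 𝓢'(Rn n, ℂ)}

/-- A set of full measure is dense. This extends bounds known for almost every time to all times,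
including the endpoint `0`. -/
theorem exists_seq_of_ae_Ioo {p : ℝ → Prop} {M t : ℝ} (hM : 0 < M)
    (h : ∀ᵐ τ ∂volume.restrict (Ioo 0 M), p τ) (ht : t ∈ Icc 0 M) :
    ∃ τ : ℕ → ℝ, (∀ i, p (τ i)) ∧ Tendsto τ atTop (𝓝 t) := by
  change ∃ τ : ℕ → ℝ, (∀ i, τ i ∈ {τ | p τ}) ∧ Tendsto τ atTop (𝓝 t)
  rw [← mem_closure_iff_seq_limit]
  rw [mem_closure_iff]
  intro U hU htU
  rw [← closure_Ioo hM.ne] at ht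
  have hne := (mem_closure_iff.1 ht) U hU htU
  have hpos : 0 < volume (U ∩ Ioo 0 M) := (hU.inter isOpen_Ioo).measure_pos _ hne
  by_contra hcon
  rw [ae_restrict_iff' measurableSet_Ioo] at h
  refine hpos.ne' (measure_mono_null (fun τ hτ => ?_) h)
  intro hp
  exact hcon ⟨τ, hτ.1, hp hτ.2⟩

/-- The Mittag-Leffler profile as a function of the frequency, in Mathlib's normalization. -/
noncomputable def mlProfile (β t : ℝ) (ξ : Rn n) : ℂ := (resolvent (fracKernel β) (symb ξ) t : ℂ)

theorem mlProfile_eq (hβ : -1 < β) {t : ℝ} (ht : 0 ≤ t) (ξ : Rn n) : mlProfile β t ξ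
    = mittagLeffler (1 + β) ((-(‖(2 * Real.pi) • ξ‖ ^ 2 * t ^ (1 + β)) : ℝ) : ℂ) := by
  rw [mlProfile, ← mittagLeffler_eq_resolvent hβ _ ht]
  congr 4
  rw [symb, norm_smul, Real.norm_of_nonneg (by positivity)]; ring

theorem continuous_mlProfile (hβ : -1 < β) : Continuous fun p : ℝ × Rn n => mlProfile β p.1 p.2 :=
  Complex.continuous_ofReal.comp ((continuous_resolvent (integrableOn_fracKernel hβ)).comp
    (g := fun q : ℝ × ℝ => resolvent (fracKernel β) q.1 q.2) (f := fun p : ℝ × Rn n => (symb p.2, p.1))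
    ((continuous_symb.comp continuous_snd).prodMk continuous_fst))

theorem continuous_mlProfile_right (hβ : -1 < β) (t : ℝ) :
    Continuous (mlProfile β t : Rn n → ℂ) :=
  (continuous_mlProfile hβ).comp (g := fun q : ℝ × Rn n => mlProfile β q.1 q.2)
    (f := fun ξ : Rn n => (t, ξ)) (continuous_const.prodMk continuous_id)

theorem continuous_mlProfile_left (hβ : -1 < β) (ξ : Rn n) : Continuous fun t => mlProfile β t ξ :=
  Complex.continuous_ofReal.comp (continuous_resolvent_right (integrableOn_fracKernel hβ) _)

theorem eLpNorm_wtd_const_mul (s : ℝ) (c : ℂ) (m : Rn n → ℂ) :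
    eLpNorm (wtd s fun ξ => c * m ξ) 2 volume = ‖c‖ₑ * eLpNorm (wtd s m) 2 volume := by
  rw [← eLpNorm_const_smul]
  congr 1; ext ξ
  simp only [wtd, Pi.smul_apply, smul_eq_mul]; ring

namespace IsLimitAlong

theorem ae_eLpNorm_limit_le (h : IsLimitAlong a₀ a β u₀ u s κ T u_inf) {c : ℝ}
    (hc : Tendsto (fun j => scale a₀ a β (T j) / κ j) atTop (𝓝 c)) (M : ℝ) : ∃ C : ℝ≥0,
    ∀ᵐ t ∂volume.restrict (Ioo 0 M), eLpNorm (wtd s fun ξ : Rn n => (∫ x, u₀ x) *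
      (resolvent (fracKernel β) (c ^ 2 * symb ξ) t : ℂ)) 2 volume ≤ C := by
  obtain ⟨C, hC⟩ := h.conv.2 M
  refine ⟨C, ?_⟩
  filter_upwards [ae_eventually_of_eventually_ae hC, ae_restrict_mem measurableSet_Ioo,
    ae_Ioo_of_ae_Ioi (ae_eventually_of_eventually_ae h.eventually_fourierRep) M] with t h1 h2 h3
  refine eLpNorm_le_of_tendsto_of_eventually
    (f := fun j => wtd s (prof a₀ a β u₀ (κ j) (T j) t)) ?_ ?_ ?_
  · exact h3.mono fun j hj => aestronglyMeasurable_wtd hj.locallyIntegrable.aestronglyMeasurable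
  · exact Eventually.of_forall fun ξ => (tendsto_prof h.admissible h.integrable h.regVar
      h.index.1 h.space h.time hc h2.1.le ξ).const_mul _
  · filter_upwards [h1, h3] with j h4 h5
    rwa [← h5.eSobolevNorm_eq s]

/-- For almost every time the bound is inherited from `u_inf`, after division by the nonzero `U₀`
and dilation by `c`. Continuity of the profile in time and Fatou's lemma extend it to every time. -/
theorem exists_eLpNorm_mlProfile_le (h : IsLimitAlong a₀ a β u₀ u s κ T u_inf)
    (hnt : IsNontrivial u_inf) {c : ℝ} (hc0 : 0 < c)
    (hc : Tendsto (fun j => scale a₀ a β (T j) / κ j) atTop (𝓝 c)) (M : ℝ) : ∃ C : ℝ≥0,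
    ∀ t ∈ Icc 0 M, eLpNorm (wtd s (mlProfile β t : Rn n → ℂ)) 2 volume ≤ C := by
  have hU := h.integral_ne_zero hnt hc
  -- The maximum guarantees an interval of positive length, in whose closure `[0, M]` lies.
  obtain ⟨C, hC⟩ := h.ae_eLpNorm_limit_le hc (max M 1)
  obtain ⟨D, hD⟩ := exists_eLpNorm_dilate_le (n := n) s (b := c) (B := c) hc0
  refine ⟨‖(∫ x, u₀ x)⁻¹‖₊ * (D * C), fun t ht => ?_⟩
  have h1 : ∀ᵐ τ ∂volume.restrict (Ioo 0 (max M 1)),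
      eLpNorm (wtd s (mlProfile β τ : Rn n → ℂ)) 2 volume ≤ (‖(∫ x, u₀ x)⁻¹‖₊ * (D * C) : ℝ≥0) := by
    filter_upwards [hC] with τ hτ
    have e : (mlProfile β τ : Rn n → ℂ) = fun ξ => (∫ x, u₀ x)⁻¹ * ((∫ x, u₀ x) *
        (resolvent (fracKernel β) (c ^ 2 * symb (c⁻¹ • ξ)) τ : ℂ)) := by
      ext ξ
      rw [inv_mul_cancel_left₀ hU, mlProfile, symb_smul, inv_pow,
        mul_inv_cancel_left₀ (pow_pos hc0 2).ne']
    rw [e, eLpNorm_wtd_const_mul, ENNReal.coe_mul, ENNReal.coe_mul]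
    refine mul_le_mul' le_rfl ?_
    refine (hD c ⟨le_rfl, le_rfl⟩ fun ξ => (∫ x, u₀ x) *
        (resolvent (fracKernel β) (c ^ 2 * symb ξ) τ : ℂ)).trans ?_
    exact mul_le_mul' le_rfl hτ
  obtain ⟨τ, hτ, hlim⟩ := exists_seq_of_ae_Ioo (lt_max_of_lt_right one_pos) h1
    ⟨ht.1, ht.2.trans (le_max_left _ _)⟩
  refine eLpNorm_le_of_tendsto (f := fun i => wtd s (mlProfile β (τ i))) (fun i => ?_) ?_
    (Eventually.of_forall hτ)
  · exact aestronglyMeasurable_wtd (continuous_mlProfile_right h.index.1 _).aestronglyMeasurable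
  · refine Eventually.of_forall fun ξ => Tendsto.const_mul _ ?_
    exact ((continuous_mlProfile_left h.index.1 ξ).tendsto t).comp hlim

/-- That the Mittag-Leffler profile defines a tempered distribution is read off from its weighted
`L²` bound; asymptotics of Mittag-Leffler functions are not needed. -/
theorem exists_family (h : IsLimitAlong a₀ a β u₀ u s κ T u_inf)
    (hnt : IsNontrivial u_inf) {c : ℝ} (hc0 : 0 < c)
    (hc : Tendsto (fun j => scale a₀ a β (T j) / κ j) atTop (𝓝 c)) :
    ∃ w : ℝ → 𝓢'(Rn n, ℂ), ∀ t, 0 ≤ t → FourierRep (w t) (mlProfile β t) := by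
  have : ∀ t : ℝ, ∃ U : 𝓢'(Rn n, ℂ), 0 ≤ t → FourierRep U (mlProfile β t) := fun t => by
    by_cases ht : 0 ≤ t
    · obtain ⟨C, hC⟩ := h.exists_eLpNorm_mlProfile_le hnt hc0 hc t
      obtain ⟨U, hU⟩ := exists_distribution_of_memLp (s := s) (m := mlProfile β t (n := n))
        ⟨aestronglyMeasurable_wtd (continuous_mlProfile_right h.index.1 t).aestronglyMeasurable,
          (hC t ⟨ht, le_rfl⟩).trans_lt ENNReal.coe_lt_top⟩
      exact ⟨U, fun _ => hU⟩
    · exact ⟨0, fun h => absurd h ht⟩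
  choose w hw using this
  exact ⟨w, hw⟩

end IsLimitAlong

theorem isMittagLefflerFamily_of_fourierRep (hβ : -1 < β) {w : ℝ → 𝓢'(Rn n, ℂ)}
    (hw : ∀ t, 0 ≤ t → FourierRep (w t) (mlProfile β t)) : IsMittagLefflerFamily (1 + β) w := by
  intro t ht
  have h := hw t ht
  rw [show (mlProfile β t : Rn n → ℂ) = _ from funext (mlProfile_eq hβ ht)] at h
  exact h

namespace IsLimitAlong

theorem smul_eq_dilate (h : IsLimitAlong a₀ a β u₀ u s κ T u_inf) {c : ℝ} (hc0 : 0 < c)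
    (hc : Tendsto (fun j => scale a₀ a β (T j) / κ j) atTop (𝓝 c)) {w : ℝ → 𝓢'(Rn n, ℂ)}
    (hw : ∀ t, 0 ≤ t → FourierRep (w t) (mlProfile β t)) :
    ∀ᵐ t ∂volume.restrict (Ioi (0 : ℝ)), (∫ x, u₀ x) • w t = dilate c (u_inf t) := by
  filter_upwards [h.fourierRep hc, ae_restrict_mem measurableSet_Ioi] with t h1 ht
  refine ((hw t (le_of_lt ht)).const_smul (∫ x, u₀ x)).eq ((h1.1.dilate hc0).congr ?_)
  refine Eventually.of_forall fun ξ => ?_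
  simp only
  rw [mlProfile, symb_smul, inv_pow, mul_inv_cancel_left₀ (pow_pos hc0 2).ne']

theorem eSobolevNorm_dilate_le {V : 𝓢'(Rn n, ℂ)} {m : Rn n → ℂ} (hV : FourierRep V m) {b B : ℝ}
    (hb : 0 < b) {D : ℝ≥0} (hD : ∀ ρ ∈ Icc b B, ∀ m : Rn n → ℂ,
      eLpNorm (wtd s fun ξ => m (ρ⁻¹ • ξ)) 2 volume ≤ D * eLpNorm (wtd s m) 2 volume) {ρ : ℝ}
    (hρ : ρ ∈ Icc b B) : eSobolevNorm s (dilate ρ V) ≤ D * eSobolevNorm s V := by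
  rw [hV.eSobolevNorm_eq, (hV.dilate (hb.trans_le hρ.1)).eSobolevNorm_eq]
  exact hD ρ hρ m

theorem eventually_dilate_eq (h : IsLimitAlong a₀ a β u₀ u s κ T u_inf) {c : ℝ} (hc0 : 0 < c)
    (hc : Tendsto (fun j => scale a₀ a β (T j) / κ j) atTop (𝓝 c)) :
    ∀ᶠ j in atTop, scale a₀ a β (T j) / κ j ∈ Icc (c / 2) (2 * c) ∧ ∀ V : 𝓢'(Rn n, ℂ),
      dilate (scale a₀ a β (T j)) V = dilate (scale a₀ a β (T j) / κ j) (dilate (κ j) V) := by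
  filter_upwards [h.space.eventually_gt_atTop 0,
    hc.eventually (Icc_mem_nhds (by linarith : c / 2 < c) (by linarith : c < 2 * c))] with j h1 h2
  refine ⟨h2, fun V => ?_⟩
  have h3 : scale a₀ a β (T j) / κ j ≠ 0 := (lt_of_lt_of_le (by linarith) h2.1).ne'
  rw [dilate_dilate h3 h1.ne']
  congr 1
  field_simp

/-- Dilation by `k` is dilation by `k₀` followed by dilation by the ratio `ρ`, which tends to `c`.
The error splits into the dilated difference of the given sequence from `u_inf`, where dilations by
ratios near `c` are uniformly bounded, and the difference of two dilations of the fixed `u_inf`,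
where they are strongly continuous. -/
theorem tendstoAEBoundedly_scale (h : IsLimitAlong a₀ a β u₀ u s κ T u_inf) {c : ℝ} (hc0 : 0 < c)
    (hc : Tendsto (fun j => scale a₀ a β (T j) / κ j) atTop (𝓝 c)) {w : ℝ → 𝓢'(Rn n, ℂ)}
    (hw : ∀ t, 0 ≤ t → FourierRep (w t) (mlProfile β t)) :
    TendstoAEBoundedly s (fun j t => rescale u (scale a₀ a β) (T j) t)
      (fun t => (∫ x, u₀ x) • w t) := by
  obtain ⟨D, hD⟩ := exists_eLpNorm_dilate_le (n := n) s (b := c / 2) (B := 2 * c) (by linarith)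
  have hev := h.eventually_dilate_eq (c := c) hc0 hc
  refine ⟨?_, fun M => ?_⟩
  · filter_upwards [h.smul_eq_dilate hc0 hc hw, h.fourierRep hc, h.conv.1,
      ae_eventually_of_eventually_ae h.eventually_fourierRep] with t h1 h2 h3 h4
    rw [h1]
    set m : Rn n → ℂ := fun ξ => (∫ x, u₀ x) * (resolvent (fracKernel β) (c ^ 2 * symb ξ) t : ℂ)
    have h5 := tendsto_eLpNorm_dilate h2.2 hc0 hc
    have h6 : Tendsto (fun j => D * eSobolevNorm s (dilate (κ j) (u (T j * t)) - u_inf t)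
        + eLpNorm (wtd s fun ξ => m ((scale a₀ a β (T j) / κ j)⁻¹ • ξ) - m (c⁻¹ • ξ)) 2 volume)
        atTop (𝓝 0) := by
      have := (ENNReal.Tendsto.const_mul h3 (Or.inr (ENNReal.coe_ne_top (r := D)))).add h5
      rwa [mul_zero, add_zero] at this
    refine tendsto_of_tendsto_of_tendsto_of_le_of_le' tendsto_const_nhds h6
      (Eventually.of_forall fun _ => bot_le) ?_
    filter_upwards [hev, h4] with j hj hrep
    set ρ := scale a₀ a β (T j) / κ j
    have hρ : 0 < ρ := lt_of_lt_of_le (by linarith) hj.1.1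
    rw [rescale, hj.2]
    have r1 := (hrep.dilate hρ).sub (h2.1.dilate hc0)
    have r2 := (hrep.sub h2.1).dilate hρ
    rw [r1.eSobolevNorm_eq]
    have r3 := eSobolevNorm_dilate_le (hrep.sub h2.1) (by linarith) hD hj.1
    rw [r2.eSobolevNorm_eq] at r3
    refine le_trans ?_ (add_le_add r3 le_rfl)
    have m1 := aestronglyMeasurable_wtd (s := s) r2.locallyIntegrable.aestronglyMeasurable
    have m2 := aestronglyMeasurable_wtd (s := s)
      ((h2.1.dilate hρ).sub (h2.1.dilate hc0)).locallyIntegrable.aestronglyMeasurable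
    refine le_trans (le_of_eq ?_) (eLpNorm_add_le m1 m2 (by norm_num))
    congr 1; ext ξ
    simp only [wtd, Pi.add_apply]; ring
  · obtain ⟨C, hC⟩ := h.conv.2 M
    refine ⟨D * C, ?_⟩
    filter_upwards [hev, hC, h.eventually_fourierRep] with j h1 h2 h3
    filter_upwards [h2, ae_Ioo_of_ae_Ioi h3 M] with t h4 h5
    rw [rescale, h1.2, ENNReal.coe_mul]
    exact (eSobolevNorm_dilate_le h5 (by linarith) hD h1.1).trans (mul_le_mul' le_rfl h4)

end IsLimitAlong

end SelfSimilar

namespace SelfSimilar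

/-! ### The fractional equation for the limiting family -/

variable {n : ℕ} {β : ℝ} {w : ℝ → 𝓢'(Rn n, ℂ)}

theorem apply_laplacian_of_fourierRep {U : 𝓢'(Rn n, ℂ)} {m : Rn n → ℂ} (h : FourierRep U m)
    (φ : 𝓢(Rn n, ℂ)) : U (Δ φ) = -∫ ξ, m ξ * symbMul n (𝓕⁻ φ) ξ := by
  have h1 := apply_laplacian_fourier U (𝓕⁻ φ)
  rw [FourierTransform.fourier_fourierInv_eq] at h1
  rw [h1, ← TemperedDistribution.fourier_apply, (h _).2]

theorem integrable_prod_mlProfile (hβ : -1 < β) {s : ℝ} {t : ℝ} {C : ℝ≥0}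
    (hC : ∀ τ ∈ Icc 0 t, eLpNorm (wtd s (mlProfile β τ : Rn n → ℂ)) 2 volume ≤ C)
    (ψ : 𝓢(Rn n, ℂ)) : Integrable
      (fun p : ℝ × Rn n => (fracKernel β p.1 : ℂ) * (mlProfile β (t - p.1) p.2 * ψ p.2))
      ((volume.restrict (Ioc 0 t)).prod volume) := by
  have hK := integrableOn_fracKernel hβ t
  have hcont : Continuous fun p : ℝ × Rn n => mlProfile β (t - p.1) p.2 * ψ p.2 :=
    ((continuous_mlProfile hβ).comp (g := fun q : ℝ × Rn n => mlProfile β q.1 q.2)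
      (f := fun p : ℝ × Rn n => (t - p.1, p.2)) (by fun_prop)).mul
      (ψ.continuous.comp continuous_snd)
  have hm : AEStronglyMeasurable
      (fun p : ℝ × Rn n => (fracKernel β p.1 : ℂ) * (mlProfile β (t - p.1) p.2 * ψ p.2))
      ((volume.restrict (Ioc 0 t)).prod volume) :=
    (Complex.continuous_ofReal.comp_aestronglyMeasurable hK.aestronglyMeasurable).comp_fst.mul
      hcont.aestronglyMeasurable
  obtain ⟨D, hD, hb⟩ := exists_integral_norm_mul_le s ψ
  have hE : ∀ τ ∈ Ioc 0 t, Integrable (fun ξ => mlProfile β (t - τ) ξ * ψ ξ) ∧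
      ∫ ξ, ‖mlProfile β (t - τ) ξ * ψ ξ‖ ≤ C * D := fun τ hτ => by
    have h1 : t - τ ∈ Icc 0 t := ⟨by linarith [hτ.2], by linarith [hτ.1]⟩
    have h2 := hb (mlProfile β (t - τ)) ⟨aestronglyMeasurable_wtd
      (continuous_mlProfile_right hβ _).aestronglyMeasurable, (hC _ h1).trans_lt ENNReal.coe_lt_top⟩
    refine ⟨h2.1, h2.2.trans ?_⟩
    gcongr
    exact ENNReal.toReal_mono ENNReal.coe_ne_top (hC _ h1)
  refine (integrable_prod_iff hm).2 ⟨?_, ?_⟩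
  · filter_upwards [ae_restrict_mem measurableSet_Ioc] with τ hτ
    exact (hE τ hτ).1.const_mul _
  · refine Integrable.mono' (hK.norm.mul_const (C * D)) hm.norm.integral_prod_right' ?_
    filter_upwards [ae_restrict_mem measurableSet_Ioc] with τ hτ
    rw [Real.norm_of_nonneg (integral_nonneg fun _ => norm_nonneg _)]
    simp only [norm_mul (fracKernel β τ : ℂ)]
    rw [integral_const_mul, Complex.norm_real]
    exact mul_le_mul_of_nonneg_left (hE τ hτ).2 (norm_nonneg _)

/-- The resolvent equation of the fractional kernel, integrated against `ψ` in frequency; the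
uniform weighted bound is what allows the integrals in time and frequency to be exchanged. -/
theorem integral_mlProfile_mul (hβ : -1 < β) {s : ℝ} {t : ℝ} {C : ℝ≥0}
    (hC : ∀ τ ∈ Icc 0 t, eLpNorm (wtd s (mlProfile β τ : Rn n → ℂ)) 2 volume ≤ C)
    (ψ : 𝓢(Rn n, ℂ)) : ∫ ξ, mlProfile β t ξ * ψ ξ
      = (∫ ξ, ψ ξ) - volConv (fracKernel β) (fun τ => ∫ ξ, mlProfile β τ ξ * symbMul n ψ ξ) t := by
  have hint := integrable_prod_mlProfile hβ hC (symbMul n ψ)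
  have h1 : ∀ ξ : Rn n, mlProfile β t ξ * ψ ξ = ψ ξ
      - ∫ τ in Ioc 0 t, (fracKernel β τ : ℂ) * (mlProfile β (t - τ) ξ * symbMul n ψ ξ) := by
    intro ξ
    have h2 : ∫ τ in Ioc 0 t, (fracKernel β τ : ℂ) * (mlProfile β (t - τ) ξ * symbMul n ψ ξ)
        = ((∫ τ in Ioc 0 t, fracKernel β τ * resolvent (fracKernel β) (symb ξ) (t - τ) : ℝ) : ℂ)
          * ((symb ξ : ℂ) * ψ ξ) := by
      rw [← integral_complex_ofReal, ← integral_mul_const]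
      congr 1; ext τ
      rw [symbMul_apply, mlProfile]
      push_cast; ring
    rw [h2, mlProfile, resolvent_eq (integrableOn_fracKernel hβ)]
    push_cast; ring
  simp only [h1]
  have hs : Integrable fun ξ : Rn n =>
      ∫ τ in Ioc 0 t, (fracKernel β τ : ℂ) * (mlProfile β (t - τ) ξ * symbMul n ψ ξ) :=
    hint.integral_prod_right
  rw [integral_sub ψ.integrable hs, volConv, ← integral_integral_swap
    (f := fun τ ξ => (fracKernel β τ : ℂ) * (mlProfile β (t - τ) ξ * symbMul n ψ ξ)) hint]
  congr 1
  congr 1; ext τ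
  rw [integral_const_mul]

theorem isFractionalFundamentalSolution_of_fourierRep (hβ : -1 < β)
    (hw : ∀ t, 0 ≤ t → FourierRep (w t) (mlProfile β t)) {s : ℝ} (hb : ∀ M : ℝ, ∃ C : ℝ≥0,
      ∀ t ∈ Icc 0 M, eLpNorm (wtd s (mlProfile β t : Rn n → ℂ)) 2 volume ≤ C) :
    IsFractionalFundamentalSolution β w := by
  intro t ht φ
  obtain ⟨C, hC⟩ := hb t
  set ψ : 𝓢(Rn n, ℂ) := 𝓕⁻ φ with hψ
  set G : ℝ → ℂ := fun τ => ∫ ξ, mlProfile β τ ξ * symbMul n ψ ξ with hG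
  set f : ℝ → ℂ := fun τ => (fracKernel β τ : ℂ) * G (t - τ) with hf
  have hfi : IntegrableOn f (Ioc 0 t) := by
    refine (integrable_prod_mlProfile hβ hC (symbMul n ψ)).integral_prod_left.congr ?_
    refine Eventually.of_forall fun τ => ?_
    simp only [hf, hG, integral_const_mul]
  have hfI : IntervalIntegrable f volume 0 t := (intervalIntegrable_iff_integrableOn_Ioc_of_le ht).2 hfi
  have hfI' : IntervalIntegrable (fun τ => f (t - τ)) volume 0 t := by
    simpa using (hfI.comp_sub_left t).symm
  have e : ∀ τ ∈ Icc 0 t, (((t - τ) ^ β / Real.Gamma (1 + β) : ℝ) : ℂ) * w τ (Δ φ) = -f (t - τ) := by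
    intro τ hτ
    rw [apply_laplacian_of_fourierRep (hw τ hτ.1), hf]
    simp only [fracKernel, sub_sub_cancel, hG, mul_neg]
    rfl
  constructor
  · refine hfI'.neg.congr ?_
    intro τ hτ
    rw [uIoc_of_le ht] at hτ
    exact (e τ ⟨hτ.1.le, hτ.2⟩).symm
  · have h1 : ∫ τ in (0 : ℝ)..t, (((t - τ) ^ β / Real.Gamma (1 + β) : ℝ) : ℂ) * w τ (Δ φ)
        = ∫ τ in (0 : ℝ)..t, -f (t - τ) := by
      refine intervalIntegral.integral_congr fun τ hτ => ?_
      rw [uIcc_of_le ht] at hτ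
      exact e τ hτ
    rw [h1, intervalIntegral.integral_neg, intervalIntegral.integral_comp_sub_left, sub_self,
      sub_zero, sub_neg_eq_add, intervalIntegral.integral_of_le ht, (hw t ht).apply_eq,
      integral_mlProfile_mul hβ hC, integral_fourierInv]
    simp only [volConv, hf, hG, hψ, sub_add_cancel]

/-! ### Locally uniform convergence of the Fourier transforms -/

variable {u : ℝ → 𝓢'(Rn n, ℂ)} {a₀ : ℝ} {a : ℝ → ℝ} {u₀ : Rn n → ℂ}

theorem eventually_norm_resolvent_sub_le (ha : IsAdmissibleKernel a₀ a)
    (hA : IsRegularlyVarying (primitive a₀ a) β) (hβ : -1 < β) (R M : ℝ) {ε : ℝ} (hε : 0 < ε) :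
    ∀ᶠ T in atTop, ∀ t ∈ Icc 0 M, ∀ η : Rn n, ‖η‖ ≤ R →
      ‖((resolvent (scaledKernel (kern a₀ a) β T) (symb η) t : ℝ) : ℂ) - mlProfile β t η‖ ≤ ε := by
  have h3 := tendsto_resolvent (l := atTop) (integrableOn_fracKernel hβ)
    (Kι := fun T => scaledKernel (kern a₀ a) β T)
    ((eventually_ge_atTop 0).mono fun j hj =>
      (ha.isTameKernel.scaled β hj).integrableOn_Ioc) ((2 * Real.pi) ^ 2 * R ^ 2) M
    (hA.kern.tendsto_scaledKernel_Ioc ha.isTameKernel.continuous hβ M) hε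
  filter_upwards [h3] with T h t ht η hη
  rw [mlProfile, ← Complex.ofReal_sub, Complex.norm_real, Real.norm_eq_abs]
  refine h _ ⟨symb_nonneg η, ?_⟩ t ht
  unfold symb
  have := norm_nonneg η
  gcongr

theorem eventually_norm_fourier_sub_le (ha : IsAdmissibleKernel a₀ a) (hu₀ : Integrable u₀)
    (hA : IsRegularlyVarying (primitive a₀ a) β) (hβ : -1 < β) (R : ℝ) {ε : ℝ} (hε : 0 < ε) :
    ∀ᶠ T in atTop, ∀ η : Rn n, ‖η‖ ≤ R →
      ‖𝓕 u₀ ((scale a₀ a β T)⁻¹ • η) - ∫ x, u₀ x‖ ≤ ε := by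
  have hc := (continuous_fourier_of_integrable hu₀).tendsto 0
  rw [fourier_zero] at hc
  obtain ⟨δ, hδ, h⟩ := Metric.tendsto_nhds_nhds.1 hc ε hε
  have h1 := (tendsto_inv_atTop_zero.comp (tendsto_scale ha hA hβ)).mul_const (max R 0)
  rw [zero_mul] at h1
  filter_upwards [h1.eventually_lt_const hδ] with T hT η hη
  rw [← dist_eq_norm]
  refine (h ?_).le
  have hs : 0 ≤ (scale a₀ a β T)⁻¹ := inv_nonneg.2 (Real.sqrt_nonneg _)
  rw [dist_zero_right, norm_smul, Real.norm_of_nonneg hs]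
  refine lt_of_le_of_lt ?_ hT
  exact mul_le_mul_of_nonneg_left (hη.trans (le_max_left _ _)) hs

/-- With `κ = k(T)` the ratio in the profile is `1`, so the spectral parameter does not move. The
difference of the two products splits into an error of the resolvent times the bounded `𝓕 u₀` and an
error of `𝓕 u₀` near `0` times the bounded limit profile. -/
theorem eventually_norm_prof_sub_le (ha : IsAdmissibleKernel a₀ a) (hu₀ : Integrable u₀)
    (hA : IsRegularlyVarying (primitive a₀ a) β) (hβ : -1 < β) (R M : ℝ) {ε : ℝ} (hε : 0 < ε) :
    ∀ᶠ T in atTop, ∀ t ∈ Icc 0 M, ∀ η : Rn n, ‖η‖ ≤ R →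
      ‖prof a₀ a β u₀ (scale a₀ a β T) T t η - (∫ x, u₀ x) * mlProfile β t η‖ ≤ ε := by
  obtain ⟨B, hB⟩ := ((isCompact_Icc (a := (0 : ℝ)) (b := M)).prod
    (isCompact_closedBall (0 : Rn n) R)).exists_bound_of_continuousOn
    (continuous_mlProfile (n := n) hβ).continuousOn
  set I := ∫ x, ‖u₀ x‖
  have hI : 0 ≤ I := integral_nonneg fun _ => norm_nonneg _
  have hε1 : 0 < ε / (2 * (I + 1)) := by positivity
  have hε2 : 0 < ε / (2 * (|B| + 1)) := by positivity
  filter_upwards [eventually_norm_resolvent_sub_le ha hA hβ R M hε1,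
    eventually_norm_fourier_sub_le ha hu₀ hA hβ R hε2, scale_sq hA hβ] with T h1 h2 h3 t ht η hη
  have e : prof a₀ a β u₀ (scale a₀ a β T) T t η - (∫ x, u₀ x) * mlProfile β t η
      = 𝓕 u₀ ((scale a₀ a β T)⁻¹ • η) *
        (((resolvent (scaledKernel (kern a₀ a) β T) (symb η) t : ℝ) : ℂ) - mlProfile β t η)
        + (𝓕 u₀ ((scale a₀ a β T)⁻¹ • η) - ∫ x, u₀ x) * mlProfile β t η := by
    rw [prof, div_self h3.2.1.ne', one_pow, one_mul]; ring
  rw [e]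
  refine (norm_add_le _ _).trans ?_
  rw [norm_mul, norm_mul]
  have h4 : ‖mlProfile β t η‖ ≤ |B| := (hB (t, η) ⟨ht, by simpa using hη⟩).trans (le_abs_self B)
  calc _ ≤ I * (ε / (2 * (I + 1))) + ε / (2 * (|B| + 1)) * |B| :=
        add_le_add (mul_le_mul (norm_fourier_le _) (h1 t ht η hη) (norm_nonneg _) hI)
          (mul_le_mul (h2 η hη) h4 (norm_nonneg _) hε2.le)
    _ = ε / 2 * (I / (I + 1)) + ε / 2 * (|B| / (|B| + 1)) := by field_simp
    _ ≤ ε / 2 * 1 + ε / 2 * 1 := by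
        have := abs_nonneg B
        gcongr
        · exact (div_le_one (by positivity)).2 (by linarith)
        · exact (div_le_one (by positivity)).2 (by linarith)
    _ = ε := by ring

theorem continuous_prof_right (ha : IsAdmissibleKernel a₀ a) (hu₀ : Integrable u₀) (β κ : ℝ) {T : ℝ}
    (hT : 0 ≤ T) (t : ℝ) : Continuous (prof a₀ a β u₀ κ T t) :=
  (continuous_prof ha hu₀ β κ hT).comp (g := fun q : ℝ × Rn n => prof a₀ a β u₀ κ T q.1 q.2)
    (f := fun ξ : Rn n => (t, ξ)) (continuous_const.prodMk continuous_id)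

theorem HasExplicitFourier.fourierTendstoLocallyUniformly (h : HasExplicitFourier a₀ a u₀ u)
    (ha : IsAdmissibleKernel a₀ a) (hu₀ : Integrable u₀)
    (hA : IsRegularlyVarying (primitive a₀ a) β) (hβ : -1 < β) :
    FourierTendstoLocallyUniformly (fun S t => rescale u (scale a₀ a β) S t)
      (fun t ξ => (∫ x, u₀ x) * mittagLeffler (1 + β) ((-(‖ξ‖ ^ 2 * t ^ (1 + β)) : ℝ) : ℂ)) := by
  intro R M ε hε
  have hpi : (0 : ℝ) < 2 * Real.pi := by positivity
  filter_upwards [h.prof hA hβ, scale_sq hA hβ, eventually_ge_atTop 0,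
    eventually_norm_prof_sub_le (n := n) ha hu₀ hA hβ ((2 * Real.pi)⁻¹ * R) M hε] with T h1 h2 hT h3
  filter_upwards [ae_Ioo_of_ae_Ioi h1 M, ae_restrict_mem measurableSet_Ioo] with t h4 ht
  refine ⟨fun ξ => SelfSimilar.prof a₀ a β u₀ (scale a₀ a β T) T t ((2 * Real.pi)⁻¹ • ξ), ?_, ?_, ?_⟩
  · exact (continuous_prof_right ha hu₀ β (scale a₀ a β T) hT t).comp (continuous_const_smul _)
  · have h5 := h4 _ h2.2.1
    refine hasFourierTransform_of_fourierRep ?_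
    simp only [inv_smul_smul₀ hpi.ne']
    exact h5
  · intro ξ hξ
    have h6 := h3 t ⟨ht.1.le, ht.2.le⟩ ((2 * Real.pi)⁻¹ • ξ) (by
      rw [norm_smul, Real.norm_of_nonneg (by positivity)]; gcongr)
    rw [mlProfile_eq hβ ht.1.le, smul_inv_smul₀ hpi.ne'] at h6
    exact h6

end SelfSimilar

namespace SelfSimilar

/-! ### The Laplace transform of the kernel -/

/-- The Laplace transform. -/
noncomputable def lap (K : ℝ → ℝ) (z : ℂ) : ℂ := ∫ t in Ioi (0 : ℝ), Complex.exp (-z * t) * (K t : ℂ)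

variable {K : ℝ → ℝ}

theorem norm_cexp_neg_mul (z : ℂ) (t : ℝ) : ‖Complex.exp (-z * t)‖ = Real.exp (-z.re * t) := by
  rw [Complex.norm_exp]; simp

theorem IsTameKernel.integrableOn_cexp (hK : IsTameKernel K) {z : ℂ} (hz : 0 < z.re) :
    IntegrableOn (fun t : ℝ => Complex.exp (-z * t) * (K t : ℂ)) (Ioi 0) := by
  have hc := hK.continuous
  refine Integrable.mono (hK.integrableOn_exp hz)
    (by fun_prop : Continuous fun t : ℝ => Complex.exp (-z * t) * (K t : ℂ)).aestronglyMeasurable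
    (Eventually.of_forall fun t => le_of_eq ?_)
  rw [norm_mul, norm_mul, norm_cexp_neg_mul, Complex.norm_real, Real.norm_of_nonneg (Real.exp_pos _).le]

theorem IsTameKernel.hasDerivAt_lap (hK : IsTameKernel K) {z : ℂ} (hz : 0 < z.re) :
    HasDerivAt (lap K) (∫ t in Ioi (0 : ℝ), -(t : ℂ) * Complex.exp (-z * t) * (K t : ℂ)) z := by
  have hc := hK.continuous
  have hs : {w : ℂ | z.re / 2 < w.re} ∈ 𝓝 z :=
    (isOpen_lt continuous_const Complex.continuous_re).mem_nhds (by simp; linarith)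
  refine (hasDerivAt_integral_of_dominated_loc_of_deriv_le hs
    (F := fun w t => Complex.exp (-w * t) * (K t : ℂ))
    (F' := fun w t => -(t : ℂ) * Complex.exp (-w * t) * (K t : ℂ))
    -- Half of the decay rate survives in a neighbourhood of `z`; a quarter of it absorbs the factor
    -- `t` and the other quarter keeps the kernel integrable.
    (bound := fun t => 4 / z.re * ‖Real.exp (-(z.re / 4) * t) * K t‖) ?_ ?_ ?_ ?_ ?_ ?_).2
  · exact Eventually.of_forall fun w => (by fun_prop : Continuous fun t : ℝ =>
      Complex.exp (-w * t) * (K t : ℂ)).aestronglyMeasurable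
  · exact hK.integrableOn_cexp hz
  · exact (by fun_prop : Continuous fun t : ℝ =>
      -(t : ℂ) * Complex.exp (-z * t) * (K t : ℂ)).aestronglyMeasurable
  · filter_upwards [ae_restrict_mem measurableSet_Ioi] with t ht w hw
    have ht0 : 0 < t := ht
    have hw' : z.re / 2 < w.re := hw
    rw [norm_mul, norm_mul, norm_mul, norm_cexp_neg_mul, Complex.norm_real, norm_neg,
      Complex.norm_real, Real.norm_of_nonneg ht0.le, Real.norm_of_nonneg (Real.exp_pos _).le,
      ← mul_assoc]
    refine mul_le_mul_of_nonneg_right ?_ (norm_nonneg _)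
    have h1 : z.re / 4 * t ≤ Real.exp (z.re / 4 * t) := by
      linarith [Real.add_one_le_exp (z.re / 4 * t)]
    have h2 : t ≤ 4 / z.re * Real.exp (z.re / 4 * t) := by
      rw [div_mul_eq_mul_div, le_div_iff₀ hz]; linarith
    calc t * Real.exp (-w.re * t)
        ≤ 4 / z.re * Real.exp (z.re / 4 * t) * Real.exp (-(z.re / 2) * t) := by
          refine mul_le_mul h2 (Real.exp_le_exp.2 ?_) (Real.exp_pos _).le (by positivity)
          nlinarith
      _ = 4 / z.re * Real.exp (-(z.re / 4) * t) := by
          rw [mul_assoc, ← Real.exp_add]; congr 2; ring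
  · exact ((hK.integrableOn_exp (by linarith : 0 < z.re / 4)).norm).const_mul _
  · refine Eventually.of_forall fun t w _ => ?_
    have h1 : HasDerivAt (fun w : ℂ => -w * (t : ℂ)) (-(t : ℂ)) w := by
      simpa using ((hasDerivAt_id w).neg.mul_const (t : ℂ))
    simpa [mul_comm, mul_assoc, mul_left_comm] using (h1.cexp.mul_const (K t : ℂ))

theorem isOpen_re_pos : IsOpen {z : ℂ | 0 < z.re} := isOpen_lt continuous_const Complex.continuous_re

theorem IsTameKernel.differentiableOn_lap (hK : IsTameKernel K) :
    DifferentiableOn ℂ (lap K) {z : ℂ | 0 < z.re} := fun _ hz =>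
  (hK.hasDerivAt_lap hz).differentiableAt.differentiableWithinAt

/-- The point `1 + 2 π i y` of the line of integration. -/
noncomputable def lineAt (y : ℝ) : ℂ := 1 + 2 * Real.pi * y * Complex.I

theorem lineAt_re (y : ℝ) : (lineAt y).re = 1 := by simp [lineAt]

theorem continuous_lineAt : Continuous lineAt := by unfold lineAt; fun_prop

theorem one_le_norm_lineAt (y : ℝ) : 1 ≤ ‖lineAt y‖ := by
  have := Complex.abs_re_le_norm (lineAt y)
  rwa [lineAt_re, abs_one] at this

theorem lineAt_ne_zero (y : ℝ) : lineAt y ≠ 0 := fun h => by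
  have := one_le_norm_lineAt y; rw [h, norm_zero] at this; linarith

theorem IsTameKernel.continuous_lap_lineAt (hK : IsTameKernel K) :
    Continuous fun y => lap K (lineAt y) := by
  have h := hK.differentiableOn_lap.continuousOn
  rw [← continuousOn_univ]
  exact h.comp continuous_lineAt.continuousOn fun y _ => by
    change 0 < (lineAt y).re; rw [lineAt_re]; exact one_pos

/-- The Riemann–Lebesgue lemma: on the line `Re z = 1` the Laplace transform is the Fourier
transform of `exp (-t) * K t` on the half-line. -/
theorem tendsto_lap_lineAt (K : ℝ → ℝ) :
    Tendsto (fun y => lap K (lineAt y)) (cocompact ℝ) (𝓝 0) := by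
  have h := Real.tendsto_integral_exp_smul_cocompact
    ((Ioi (0 : ℝ)).indicator fun t : ℝ => (Real.exp (-t) * K t : ℂ))
  refine h.congr fun y => ?_
  rw [lap, ← integral_indicator measurableSet_Ioi]
  congr 1; ext t
  by_cases ht : t ∈ Ioi (0 : ℝ)
  · rw [indicator_of_mem ht, indicator_of_mem ht, Circle.smul_def, smul_eq_mul, Real.fourierChar_apply,
      ← mul_assoc, Complex.ofReal_exp, ← Complex.exp_add]
    congr 2
    rw [lineAt]; push_cast; ring
  · rw [indicator_of_notMem ht, indicator_of_notMem ht, smul_zero]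

/-- The resolvent does not grow exponentially, along a sequence of times and in the mean. -/
def IsSubexponential (K : ℝ → ℝ) (lam : ℝ) : Prop :=
  ∀ δ > 0, ∀ ε > 0, ∃ᶠ S in atTop, Real.exp (-δ * S) * ∫ t in Ioc 0 S, |resolvent K lam t| < ε

/-- The convolution theorem on a finite interval. The truncation leaves the transform of `K` cut off
at `S - s` instead of a product; the cut is estimated afterwards by the tail of `K`. -/
theorem integral_cexp_mul_volConv {g : ℝ → ℂ} {S : ℝ} (hK : IntegrableOn K (Ioc 0 S))
    (hg : IntegrableOn g (Ioo 0 S)) (z : ℂ) :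
    ∫ t in Ioo 0 S, Complex.exp (-z * t) * volConv K g t
      = ∫ s in Ioo 0 S, Complex.exp (-z * s) * g s
        * ∫ τ in Ioo 0 (S - s), Complex.exp (-z * τ) * (K τ : ℂ) := by
  have hker := integrable_conv_kernel hK hg
  have hce : Continuous fun t : ℝ => Complex.exp (-z * t) := by fun_prop
  obtain ⟨C, hC⟩ := (isCompact_Icc (a := (0 : ℝ)) (b := S)).exists_bound_of_continuousOn
    hce.continuousOn
  have hbd : Integrable (fun p : ℝ × ℝ => ((Ioo 0 S).indicator (fun t : ℝ => Complex.exp (-z * t)) p.1)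
      * ((((Ioc 0 S).indicator K (p.1 - p.2) : ℝ) : ℂ) * (Ioo 0 S).indicator g p.2))
      (volume.prod volume) := by
    refine hker.bdd_mul (c := |C|) ?_ ?_
    · exact ((hce.measurable.indicator measurableSet_Ioo).comp measurable_fst).aestronglyMeasurable
    · refine Eventually.of_forall fun p => ?_
      by_cases hp : p.1 ∈ Ioo 0 S
      · rw [indicator_of_mem hp]
        exact (hC _ ⟨hp.1.le, hp.2.le⟩).trans (le_abs_self _)
      · rw [indicator_of_notMem hp, norm_zero]; positivity
  have hswap := integral_integral_swap (f := fun t s : ℝ => ((Ioo 0 S).indicator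
    (fun t : ℝ => Complex.exp (-z * t)) t) * ((((Ioc 0 S).indicator K (t - s) : ℝ) : ℂ)
    * (Ioo 0 S).indicator g s)) hbd
  have hL : ∫ t in Ioo 0 S, Complex.exp (-z * t) * volConv K g t
      = ∫ t, ∫ s, ((Ioo 0 S).indicator (fun t : ℝ => Complex.exp (-z * t)) t)
      * ((((Ioc 0 S).indicator K (t - s) : ℝ) : ℂ) * (Ioo 0 S).indicator g s) := by
    rw [← integral_indicator measurableSet_Ioo]
    refine integral_congr_ae (Eventually.of_forall fun t => ?_)
    simp only
    rw [integral_const_mul]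
    by_cases ht : t ∈ Ioo 0 S
    · rw [indicator_of_mem ht, indicator_of_mem ht, volConv_eq_integral ht.2.le]
    · rw [indicator_of_notMem ht, indicator_of_notMem ht, zero_mul]
  rw [hL, hswap, ← integral_indicator measurableSet_Ioo]
  refine integral_congr_ae (Eventually.of_forall fun s => ?_)
  simp only
  by_cases hs : s ∈ Ioo 0 S
  · rw [indicator_of_mem hs, indicator_of_mem hs]
    simp_rw [← mul_assoc]
    rw [integral_mul_const, ← integral_add_right_eq_self _ s, mul_comm, mul_comm (Complex.exp _),
      mul_assoc]
    congr 1
    rw [← integral_indicator measurableSet_Ioo, ← integral_const_mul]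
    refine integral_congr_ae (Eventually.of_forall fun τ => ?_)
    simp only [add_sub_cancel_right]
    by_cases hτ : τ ∈ Ioo 0 (S - s)
    · have h1 : τ + s ∈ Ioo 0 S := ⟨by linarith [hτ.1, hs.1], by linarith [hτ.2]⟩
      have h2 : τ ∈ Ioc 0 S := ⟨hτ.1, by linarith [hτ.2, hs.1]⟩
      rw [indicator_of_mem hτ, indicator_of_mem h1, indicator_of_mem h2, ← mul_assoc,
        ← Complex.exp_add]
      congr 2; push_cast; ring
    · rw [indicator_of_notMem hτ, mul_zero]
      by_cases h0 : 0 < τ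
      · have h1 : τ + s ∉ Ioo 0 S := fun h => hτ ⟨h0, by linarith [h.2]⟩
        rw [indicator_of_notMem h1, zero_mul]
      · have h2 : τ ∉ Ioc 0 S := fun h => h0 h.1
        rw [indicator_of_notMem h2]; simp
  · rw [indicator_of_notMem hs, indicator_of_notMem hs]; simp

/-- The truncated Laplace transform of the resolvent. -/
noncomputable def truncLap (K : ℝ → ℝ) (lam S : ℝ) (z : ℂ) : ℂ :=
  ∫ t in Ioo 0 S, Complex.exp (-z * t) * (resolvent K lam t : ℂ)

theorem integral_cexp_neg {z : ℂ} (hz : z ≠ 0) {S : ℝ} (hS : 0 ≤ S) :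
    ∫ t in Ioo 0 S, Complex.exp (-z * t) = (1 - Complex.exp (-z * S)) / z := by
  rw [← integral_Ioc_eq_integral_Ioo, ← intervalIntegral.integral_of_le hS,
    integral_exp_mul_complex (neg_ne_zero.2 hz)]
  simp only [Complex.ofReal_zero, mul_zero, Complex.exp_zero]
  field_simp; ring

theorem IsTameKernel.norm_tail_le (hK : IsTameKernel K) {z : ℂ} (hz : 0 < z.re) {x : ℝ} (hx : 0 ≤ x) :
    ‖lap K z - ∫ τ in Ioo 0 x, Complex.exp (-z * τ) * (K τ : ℂ)‖
      ≤ Real.exp (-(z.re / 2) * x) * ∫ τ in Ioi 0, ‖Real.exp (-(z.re / 2) * τ) * K τ‖ := by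
  have hi := hK.integrableOn_cexp hz
  have hi2 : IntegrableOn (fun τ => ‖Real.exp (-(z.re / 2) * τ) * K τ‖) (Ioi 0) :=
    (hK.integrableOn_exp (by linarith : 0 < z.re / 2)).norm
  have h1 : lap K z = (∫ τ in Ioc 0 x, Complex.exp (-z * τ) * (K τ : ℂ))
      + ∫ τ in Ioi x, Complex.exp (-z * τ) * (K τ : ℂ) := by
    rw [lap, ← setIntegral_union Ioc_disjoint_Ioi_same measurableSet_Ioi
      (hi.mono_set Ioc_subset_Ioi_self) (hi.mono_set (Ioi_subset_Ioi hx)), Ioc_union_Ioi_eq_Ioi hx]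
  rw [h1, integral_Ioc_eq_integral_Ioo, add_sub_cancel_left, ← integral_const_mul]
  refine (norm_integral_le_of_norm_le (g := fun τ => Real.exp (-(z.re / 2) * x) *
    ‖Real.exp (-(z.re / 2) * τ) * K τ‖)
    ((hi2.mono_set (Ioi_subset_Ioi hx)).const_mul (Real.exp (-(z.re / 2) * x))) ?_).trans ?_
  · filter_upwards [ae_restrict_mem measurableSet_Ioi] with τ hτ
    have hτ' : x < τ := hτ
    rw [norm_mul, norm_cexp_neg_mul, Complex.norm_real, norm_mul,
      Real.norm_of_nonneg (Real.exp_pos _).le, ← mul_assoc, ← Real.exp_add]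
    gcongr
    nlinarith
  · exact setIntegral_mono_set (hi2.const_mul _)
      (Eventually.of_forall fun τ => mul_nonneg (Real.exp_pos _).le (norm_nonneg _))
      (Eventually.of_forall (Ioi_subset_Ioi hx))

theorem resolvent_eq_volConv (hK : ∀ M, IntegrableOn K (Ioc 0 M)) (lam t : ℝ) :
    (resolvent K lam t : ℂ) = 1 - lam * volConv K (fun s => (resolvent K lam s : ℂ)) t := by
  rw [resolvent_eq hK lam t, volConv]
  push_cast
  rw [← integral_complex_ofReal]
  congr 3; ext s; push_cast; rfl

/-- The weighted mass that controls the error of the truncated Laplace transform. -/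
noncomputable def tailMass (K : ℝ → ℝ) (c : ℝ) : ℝ := ∫ τ in Ioi 0, ‖Real.exp (-(c / 2) * τ) * K τ‖

/-- The transformed resolvent equation with its two truncation errors: the one of the constant `1`,
and the tails of `K` beyond `S - s` weighted with the resolvent. Half of the exponential decay pays
for the integrability of the tail; the other half survives in front of the integral of the
resolvent. -/
theorem IsTameKernel.norm_truncLap_sub_le (hK : IsTameKernel K) (lam : ℝ) {z : ℂ} (hz : 0 < z.re)
    {S : ℝ} (hS : 0 ≤ S) : ‖truncLap K lam S z * (1 + lam * lap K z) - 1 / z‖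
      ≤ Real.exp (-z.re * S) / ‖z‖ + |lam| * tailMass K z.re
        * (Real.exp (-(z.re / 2) * S) * ∫ t in Ioc 0 S, |resolvent K lam t|) := by
  have hKi := hK.integrableOn_Ioc
  unfold tailMass
  set J := ∫ τ in Ioi 0, ‖Real.exp (-(z.re / 2) * τ) * K τ‖
  have hJ : 0 ≤ J := integral_nonneg fun _ => norm_nonneg _
  have hz0 : z ≠ 0 := fun h => by simp [h] at hz
  have hrc := continuous_resolvent_right hKi lam
  set r : ℝ → ℂ := fun t => (resolvent K lam t : ℂ) with hr
  have hrcc : Continuous r := Complex.continuous_ofReal.comp hrc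
  have hri : IntegrableOn r (Ioo 0 S) :=
    (hrcc.integrableOn_Icc).mono_set Ioo_subset_Icc_self
  have hce : Continuous fun t : ℝ => Complex.exp (-z * t) := by fun_prop
  have hvi : IntegrableOn (fun t : ℝ => Complex.exp (-z * t) * (lam * volConv K r t)) (Ioo 0 S) := by
    have h1 : Continuous fun t : ℝ => (lam : ℂ) * volConv K r t := by
      have : (fun t : ℝ => (lam : ℂ) * volConv K r t) = fun t => 1 - r t := by
        funext t; simp only [hr]; rw [resolvent_eq_volConv hKi lam t, sub_sub_cancel]
      rw [this]; fun_prop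
    exact ((hce.mul h1).integrableOn_Icc).mono_set Ioo_subset_Icc_self
  have hei : IntegrableOn (fun t : ℝ => Complex.exp (-z * t)) (Ioo 0 S) :=
    (hce.integrableOn_Icc).mono_set Ioo_subset_Icc_self
  have h1 : truncLap K lam S z = (1 - Complex.exp (-z * S)) / z
      - lam * ∫ s in Ioo 0 S, Complex.exp (-z * s) * r s
        * ∫ τ in Ioo 0 (S - s), Complex.exp (-z * τ) * (K τ : ℂ) := by
    rw [← integral_cexp_mul_volConv (hKi S) hri, ← integral_cexp_neg hz0 hS, ← integral_const_mul]
    simp only [mul_left_comm (lam : ℂ)]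
    rw [← integral_sub hei hvi, truncLap]
    congr 1; funext t
    rw [resolvent_eq_volConv hKi lam t, mul_sub, mul_one]
  have hRi : IntegrableOn (fun s : ℝ => Complex.exp (-z * s) * r s) (Ioo 0 S) :=
    ((hce.mul hrcc).integrableOn_Icc).mono_set Ioo_subset_Icc_self
  have hti : IntegrableOn (fun s : ℝ => Complex.exp (-z * s) * r s
        * ∫ τ in Ioo 0 (S - s), Complex.exp (-z * τ) * (K τ : ℂ)) (Ioo 0 S) := by
    have hcK := hK.continuous
    have hf : ∀ x y : ℝ, IntervalIntegrable (fun τ : ℝ => Complex.exp (-z * τ) * (K τ : ℂ)) volume x y :=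
      fun x y => (by fun_prop : Continuous fun τ : ℝ =>
        Complex.exp (-z * τ) * (K τ : ℂ)).intervalIntegrable x y
    have hp := intervalIntegral.continuous_primitive hf 0
    have hc2 : Continuous fun s : ℝ => Complex.exp (-z * s) * r s
        * ∫ τ in (0 : ℝ)..(S - s), Complex.exp (-z * τ) * (K τ : ℂ) :=
      (hce.mul hrcc).mul (hp.comp (continuous_const.sub continuous_id))
    refine ((hc2.integrableOn_Icc (a := 0) (b := S)).mono_set Ioo_subset_Icc_self).congr_fun
      (fun s hs => ?_) measurableSet_Ioo
    simp only
    rw [intervalIntegral.integral_of_le (by linarith [hs.2]), integral_Ioc_eq_integral_Ioo]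
  have h2 : truncLap K lam S z * (1 + lam * lap K z) - 1 / z
      = -(Complex.exp (-z * S) / z) + lam * ∫ s in Ioo 0 S, Complex.exp (-z * s) * r s *
        (lap K z - ∫ τ in Ioo 0 (S - s), Complex.exp (-z * τ) * (K τ : ℂ)) := by
    have h3 : ∫ s in Ioo 0 S, Complex.exp (-z * s) * r s *
        (lap K z - ∫ τ in Ioo 0 (S - s), Complex.exp (-z * τ) * (K τ : ℂ))
        = truncLap K lam S z * lap K z - ∫ s in Ioo 0 S, Complex.exp (-z * s) * r s
        * ∫ τ in Ioo 0 (S - s), Complex.exp (-z * τ) * (K τ : ℂ) := by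
      simp only [mul_sub]
      rw [integral_sub (hRi.mul_const _) hti, integral_mul_const]
      rfl
    rw [h3, mul_sub]
    linear_combination h1
  rw [h2]
  refine (norm_add_le _ _).trans (add_le_add (le_of_eq ?_) ?_)
  · rw [norm_neg, norm_div, norm_cexp_neg_mul]
  · rw [norm_mul, Complex.norm_real, Real.norm_eq_abs, mul_assoc]
    refine mul_le_mul_of_nonneg_left ?_ (abs_nonneg _)
    rw [integral_Ioc_eq_integral_Ioo, ← mul_assoc, ← integral_const_mul]
    have habs : IntegrableOn (fun t => |resolvent K lam t|) (Ioo 0 S) :=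
      (hrc.abs.integrableOn_Icc).mono_set Ioo_subset_Icc_self
    refine norm_integral_le_of_norm_le (habs.const_mul _) ?_
    filter_upwards [ae_restrict_mem measurableSet_Ioo] with s hs
    rw [norm_mul, norm_mul, norm_cexp_neg_mul, hr, Complex.norm_real, Real.norm_eq_abs]
    calc _ ≤ Real.exp (-z.re * s) * |resolvent K lam s| *
          (Real.exp (-(z.re / 2) * (S - s)) * J) := by
          gcongr
          exact hK.norm_tail_le hz (by linarith [hs.2])
      _ = J * (Real.exp (-z.re * s) * Real.exp (-(z.re / 2) * (S - s))) * |resolvent K lam s| := by ring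
      _ ≤ J * Real.exp (-(z.re / 2) * S) * |resolvent K lam s| := by
          rw [← Real.exp_add]
          gcongr
          nlinarith [hs.1]

end SelfSimilar

namespace SelfSimilar

/-! ### Absence of zeros of the symbol, and Laplace inversion. -/

variable {n : ℕ} {K : ℝ → ℝ}

theorem IsSubexponential.exists_small {lam : ℝ} (h : IsSubexponential K lam) {c : ℝ} (hc : 0 < c)
    (C D M : ℝ) {ε : ℝ} (hε : 0 < ε) : ∃ S, 0 ≤ S ∧ M ≤ S ∧
      D * Real.exp (-c * S) + C * (Real.exp (-(c / 2) * S) * ∫ t in Ioc 0 S, |resolvent K lam t|)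
        < ε := by
  have h1 : Tendsto (fun S => D * Real.exp (-c * S)) atTop (𝓝 0) := by
    have := (Real.tendsto_exp_neg_atTop_nhds_zero.comp (tendsto_id.const_mul_atTop hc)).const_mul D
    simpa [Function.comp_def] using this
  obtain ⟨S, h2, h3, h4, h5⟩ := ((h (c / 2) (by positivity) (ε / (2 * (|C| + 1)))
    (by positivity)).and_eventually ((h1.eventually_lt_const (half_pos hε)).and
      ((eventually_ge_atTop 0).and (eventually_ge_atTop M)))).exists
  refine ⟨S, h4, h5, ?_⟩
  set X := Real.exp (-(c / 2) * S) * ∫ t in Ioc 0 S, |resolvent K lam t|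
  have hX : 0 ≤ X := mul_nonneg (Real.exp_pos _).le (integral_nonneg fun _ => abs_nonneg _)
  have h6 : C * X ≤ (|C| + 1) * (ε / (2 * (|C| + 1))) :=
    mul_le_mul (by linarith [le_abs_self C]) h2.le hX (by positivity)
  have h7 : (|C| + 1) * (ε / (2 * (|C| + 1))) = ε / 2 := by field_simp
  linarith

/-- At a zero the left-hand side of the truncated equation would be the fixed nonzero number `1 /
z`, whereas its error becomes arbitrarily small along suitable times `S`. -/
theorem IsSubexponential.one_add_mul_lap_ne_zero {lam : ℝ} (h : IsSubexponential K lam)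
    (hK : IsTameKernel K) {z : ℂ} (hz : 0 < z.re) : 1 + lam * lap K z ≠ 0 := by
  intro h0
  have hz0 : z ≠ 0 := fun h => by simp [h] at hz
  have hn : 0 < ‖1 / z‖ := norm_pos_iff.2 (one_div_ne_zero hz0)
  obtain ⟨S, hS, -, hlt⟩ := h.exists_small hz (|lam| * tailMass K z.re) (1 / ‖z‖) 0 hn
  have := hK.norm_truncLap_sub_le lam hz hS
  rw [h0, mul_zero, zero_sub, norm_neg, div_eq_mul_one_div (Real.exp _),
    mul_comm (Real.exp _) (1 / ‖z‖)] at this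
  linarith

theorem IsSubexponential.comp_mul {K' : ℝ → ℝ} {lam lam' T : ℝ} (h : IsSubexponential K lam)
    (hT : 0 < T) (hr : ∀ t, resolvent K' lam' t = resolvent K lam (T * t)) :
    IsSubexponential K' lam' := by
  intro δ hδ ε hε
  have h1 : Tendsto (fun S => S / T) atTop atTop := tendsto_id.atTop_div_const hT
  have h2 := (h (δ / T) (by positivity) (T * ε) (by positivity)).and_eventually
    (eventually_ge_atTop 0)
  refine h1.frequently (h2.mono fun S ⟨hS, hS0⟩ => ?_)
  have h3 : ∫ t in Ioc 0 (S / T), |resolvent K' lam' t| = T⁻¹ * ∫ t in Ioc 0 S, |resolvent K lam t| := by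
    simp only [hr]
    rw [← intervalIntegral.integral_of_le (by positivity), ← intervalIntegral.integral_of_le hS0,
      intervalIntegral.integral_comp_mul_left (fun t => |resolvent K lam t|) hT.ne']
    simp [mul_div_cancel₀ _ hT.ne']
  rw [h3, show -δ * (S / T) = -(δ / T) * S by ring]
  rw [mul_left_comm, inv_mul_lt_iff₀ hT]
  exact hS

/-- The symbol of the resolvent has no zero in the right half-plane. -/
theorem one_add_symb_mul_lap_ne_zero (hK : IsTameKernel K) {h : Rn n → ℂ} (hh : Continuous h)
    (hs : ∀ᵐ ξ, h ξ ≠ 0 → IsSubexponential K (symb ξ)) {ξ₀ : Rn n} (hξ₀ : h ξ₀ ≠ 0) {z₀ : ℂ}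
    (hz₀ : 0 < z₀.re) : 1 + symb ξ₀ * lap K z₀ ≠ 0 := by
  intro h0
  have hU : {z : ℂ | 0 < z.re} ∈ 𝓝 z₀ := isOpen_re_pos.mem_nhds hz₀
  have hsy : (symb ξ₀ : ℂ) ≠ 0 := fun h1 => by rw [h1] at h0; simp at h0
  have hsy' : symb ξ₀ ≠ 0 := by exact_mod_cast hsy
  have hL0 : lap K z₀ = -(symb ξ₀ : ℂ)⁻¹ := by field_simp; linear_combination h0
  have han : AnalyticOnNhd ℂ (lap K) {z : ℂ | 0 < z.re} :=
    hK.differentiableOn_lap.analyticOnNhd isOpen_re_pos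
  -- The open mapping theorem. If the transform is constant, it is zero by its decay on the line `Re
  -- z = 1`, and there is no zero of the symbol. Otherwise its values cover a neighbourhood of `-1 /
  -- symb ξ₀`, so all frequencies near `ξ₀` have zeros too, and a set of positive measure would
  -- violate the hypothesis.
  rcases (han z₀ hz₀).eventually_constant_or_nhds_le_map_nhds with hc | hm
  · have heq := han.eqOn_of_preconnected_of_eventuallyEq (analyticOnNhd_const (v := lap K z₀))
      (convex_halfSpace_re_gt 0).isPreconnected hz₀ hc
    have h1 : Tendsto (fun _ : ℝ => lap K z₀) (cocompact ℝ) (𝓝 0) := by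
      refine (tendsto_lap_lineAt K).congr fun y => heq ?_
      change 0 < (lineAt y).re
      rw [lineAt_re]; exact one_pos
    have h2 := tendsto_nhds_unique h1 tendsto_const_nhds
    rw [← h2] at h0; simp at h0
  · have h1 : ∀ᶠ w in 𝓝 (lap K z₀), ∃ z : ℂ, 0 < z.re ∧ lap K z = w :=
      hm (mem_map.2 (mem_of_superset hU fun z hz => ⟨z, hz, rfl⟩))
    have h2 : Tendsto (fun ξ : Rn n => -(symb ξ : ℂ)⁻¹) (𝓝 ξ₀) (𝓝 (lap K z₀)) := by
      rw [hL0]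
      exact ((Complex.continuous_ofReal.comp continuous_symb).tendsto ξ₀).inv₀ hsy |>.neg
    have h3 : ∀ᶠ ξ in 𝓝 ξ₀, ¬ (h ξ ≠ 0 → IsSubexponential K (symb ξ)) := by
      filter_upwards [h2.eventually h1, hh.continuousAt.eventually_ne hξ₀,
        continuous_symb.continuousAt.eventually_ne hsy'] with ξ ⟨z, hz, hzw⟩ h4 h5 h6
      refine (h6 h4).one_add_mul_lap_ne_zero hK hz ?_
      have h7 : (symb ξ : ℂ) ≠ 0 := by exact_mod_cast h5
      rw [hzw]; field_simp; simp
    exact (Measure.measure_pos_of_mem_nhds volume h3).ne' (by simpa [ae_iff] using hs)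

/-- For large `|y|` the transform is small by the Riemann–Lebesgue lemma, which gives the bound `1 /
2`; the remaining pairs of a frequency and a `y` form a compact set without zeros. The constant
depends on the kernel and is used only qualitatively. -/
theorem exists_le_norm_one_add_symb_mul_lap (hK : IsTameKernel K) {Q : Set (Rn n)} (hQ : IsCompact Q)
    (hne : ∀ ξ ∈ Q, ∀ z : ℂ, 0 < z.re → 1 + symb ξ * lap K z ≠ 0) :
    ∃ δ > 0, ∀ ξ ∈ Q, ∀ y, δ ≤ ‖1 + symb ξ * lap K (lineAt y)‖ := by
  obtain ⟨B, hB⟩ := hQ.exists_bound_of_continuousOn (continuous_symb (n := n)).continuousOn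
  have hB1 : 0 < 2 * (|B| + 1) := by positivity
  obtain ⟨W, hW, hWL⟩ := (hasBasis_cocompact.eventually_iff).1
    ((tendsto_lap_lineAt K).norm.eventually_lt_const
      (show ‖(0 : ℂ)‖ < 1 / (2 * (|B| + 1)) by rw [norm_zero]; positivity))
  have hcont : Continuous fun p : Rn n × ℝ => ‖1 + (symb p.1 : ℂ) * lap K (lineAt p.2)‖ :=
    (continuous_const.add ((Complex.continuous_ofReal.comp (continuous_symb.comp continuous_fst)).mul
      (hK.continuous_lap_lineAt.comp continuous_snd))).norm
  obtain ⟨δ, hδ, hδle⟩ := (hQ.prod hW).exists_forall_le' (f := fun p : Rn n × ℝ =>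
    ‖1 + (symb p.1 : ℂ) * lap K (lineAt p.2)‖) hcont.continuousOn (a := 0) fun p hp =>
      norm_pos_iff.2 (hne _ hp.1 _ (by rw [lineAt_re]; exact one_pos))
  refine ⟨min δ (1 / 2), lt_min hδ (by norm_num), fun ξ hξ y => ?_⟩
  by_cases hy : y ∈ W
  · exact (min_le_left _ _).trans (hδle (ξ, y) ⟨hξ, hy⟩)
  · refine (min_le_right _ _).trans ?_
    have h1 := hWL hy
    have h2 : ‖(symb ξ : ℂ) * lap K (lineAt y)‖ ≤ 1 / 2 := by
      rw [norm_mul, Complex.norm_real]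
      calc _ ≤ (|B| + 1) * (1 / (2 * (|B| + 1))) :=
            mul_le_mul (by linarith [hB ξ hξ, le_abs_self B]) h1.le (norm_nonneg _) (by positivity)
        _ = 1 / 2 := by field_simp
    have h3 := norm_sub_le (1 + (symb ξ : ℂ) * lap K (lineAt y)) ((symb ξ : ℂ) * lap K (lineAt y))
    rw [add_sub_cancel_right, norm_one] at h3
    linarith

theorem integral_resolvent_mul_eq_integral_truncLap (hK : IsTameKernel K) (lam : ℝ) {Θ ψ : ℝ → ℂ}
    (hΘ : Integrable Θ) (S : ℝ)
    (hψ : ∀ t ∈ Ioo 0 S, ψ t = ∫ y, Θ y * Complex.exp (-lineAt y * t)) :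
    ∫ t in Ioo 0 S, (resolvent K lam t : ℂ) * ψ t = ∫ y, Θ y * truncLap K lam S (lineAt y) := by
  have hrc := Complex.continuous_ofReal.comp (continuous_resolvent_right hK.integrableOn_Ioc lam)
  have hri : IntegrableOn (fun t => (resolvent K lam t : ℂ)) (Ioo 0 S) :=
    (hrc.integrableOn_Icc).mono_set Ioo_subset_Icc_self
  have hint : Integrable (fun p : ℝ × ℝ => Complex.exp (-lineAt p.2 * p.1)
      * ((resolvent K lam p.1 : ℂ) * Θ p.2)) ((volume.restrict (Ioo 0 S)).prod volume) := by
    refine (hri.mul_prod hΘ).bdd_mul (c := 1) ?_ ?_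
    · have := continuous_lineAt
      exact (by fun_prop : Continuous fun p : ℝ × ℝ =>
        Complex.exp (-lineAt p.2 * p.1)).aestronglyMeasurable
    · have h1 : ∀ᵐ p : ℝ × ℝ ∂(volume.restrict (Ioo 0 S)).prod volume, 0 < p.1 := by
        have h2 : ∀ᵐ t ∂volume.restrict (Ioo 0 S), 0 < t := by
          filter_upwards [ae_restrict_mem measurableSet_Ioo] with t ht using ht.1
        exact Measure.quasiMeasurePreserving_fst.ae h2
      filter_upwards [h1] with p hp
      rw [norm_cexp_neg_mul, lineAt_re]
      exact Real.exp_le_one_iff.2 (by linarith)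
  calc ∫ t in Ioo 0 S, (resolvent K lam t : ℂ) * ψ t
      = ∫ t in Ioo 0 S, ∫ y, Complex.exp (-lineAt y * t) * ((resolvent K lam t : ℂ) * Θ y) := by
        refine setIntegral_congr_fun measurableSet_Ioo fun t ht => ?_
        rw [hψ t ht, ← integral_const_mul]
        congr 1; ext y; ring
    _ = ∫ y, ∫ t in Ioo 0 S, Complex.exp (-lineAt y * t) * ((resolvent K lam t : ℂ) * Θ y) :=
        integral_integral_swap (f := fun t y : ℝ => Complex.exp (-lineAt y * t)
          * ((resolvent K lam t : ℂ) * Θ y)) hint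
    _ = _ := by
        congr 1; ext y
        rw [truncLap, ← integral_const_mul]
        congr 1; ext t; ring

theorem IsTameKernel.continuous_truncLap_lineAt (hK : IsTameKernel K) (lam S : ℝ) :
    Continuous fun y => truncLap K lam S (lineAt y) := by
  have hrc := Complex.continuous_ofReal.comp (continuous_resolvent_right hK.integrableOn_Ioc lam)
  have h1 : Continuous fun p : ℝ × ℝ => Complex.exp (-lineAt p.1 * p.2) * (resolvent K lam p.2 : ℂ) :=
    (by have := continuous_lineAt; fun_prop : Continuous fun p : ℝ × ℝ =>
      Complex.exp (-lineAt p.1 * p.2)).mul (hrc.comp continuous_snd)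
  have h2 : (fun y => truncLap K lam S (lineAt y)) = fun y => ∫ t in Icc 0 S,
      Complex.exp (-lineAt y * t) * (resolvent K lam t : ℂ) := by
    funext y; rw [truncLap, integral_Icc_eq_integral_Ioo]
  rw [h2]
  exact continuous_parametric_integral_of_continuous h1 isCompact_Icc

/-- Laplace inversion for the resolvent. -/
theorem integral_resolvent_mul_eq (hK : IsTameKernel K) {lam : ℝ} (hlam : IsSubexponential K lam)
    {δ : ℝ} (hδ : 0 < δ) (hδle : ∀ y, δ ≤ ‖1 + lam * lap K (lineAt y)‖) {Θ ψ : ℝ → ℂ}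
    (hΘ : Integrable Θ) {M : ℝ} (hψM : ∀ t, M ≤ t → ψ t = 0)
    (hψ : ∀ t, ψ t = ∫ y, Θ y * Complex.exp (-lineAt y * t)) :
    ∫ t in Ioo 0 M, (resolvent K lam t : ℂ) * ψ t
      = ∫ y, Θ y * (1 / (lineAt y * (1 + lam * lap K (lineAt y)))) := by
  have hne : ∀ y, 1 + lam * lap K (lineAt y) ≠ 0 := fun y h => by
    have := hδle y; rw [h, norm_zero] at this; linarith
  have hd : ∀ {S}, 0 ≤ S → ∀ y, ‖truncLap K lam S (lineAt y)
      - 1 / (lineAt y * (1 + lam * lap K (lineAt y)))‖ ≤ (1 * Real.exp (-1 * S) + |lam| * tailMass K 1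
        * (Real.exp (-(1 / 2) * S) * ∫ t in Ioc 0 S, |resolvent K lam t|)) / δ := by
    intro S hS y
    have h1 := hK.norm_truncLap_sub_le lam (z := lineAt y) (by rw [lineAt_re]; exact one_pos) hS
    rw [lineAt_re] at h1
    have h2 : truncLap K lam S (lineAt y) - 1 / (lineAt y * (1 + lam * lap K (lineAt y)))
        = (truncLap K lam S (lineAt y) * (1 + lam * lap K (lineAt y)) - 1 / lineAt y)
          / (1 + lam * lap K (lineAt y)) := by
      have := hne y
      have := lineAt_ne_zero y
      field_simp
    rw [h2, norm_div]
    refine div_le_div₀ ?_ (h1.trans (add_le_add ?_ le_rfl)) hδ (hδle y)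
    · exact (norm_nonneg _).trans (h1.trans (add_le_add (by
        rw [one_mul]; exact div_le_self (Real.exp_pos _).le (one_le_norm_lineAt y)) le_rfl))
    · rw [one_mul]; exact div_le_self (Real.exp_pos _).le (one_le_norm_lineAt y)
  have hL := hK.continuous_lap_lineAt
  have hGc : Continuous fun y => 1 / (lineAt y * (1 + lam * lap K (lineAt y))) :=
    continuous_const.div (continuous_lineAt.mul (continuous_const.add (continuous_const.mul hL)))
      fun y => mul_ne_zero (lineAt_ne_zero y) (hne y)
  have hGi : Integrable fun y => Θ y * (1 / (lineAt y * (1 + lam * lap K (lineAt y)))) := by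
    refine hΘ.mul_bdd (c := 1 / δ) hGc.aestronglyMeasurable (Eventually.of_forall fun y => ?_)
    rw [norm_div, norm_mul, norm_one]
    refine one_div_le_one_div_of_le hδ ?_
    exact (hδle y).trans (le_mul_of_one_le_left (norm_nonneg _) (one_le_norm_lineAt y))
  refine eq_of_forall_dist_le fun ε hε => ?_
  set I := ∫ y, ‖Θ y‖
  have hI : 0 ≤ I := integral_nonneg fun _ => norm_nonneg _
  -- The truncation time comes from the sequence along which the resolvent is small in the mean.
  -- Beyond `M` the test function vanishes, so truncation at `S ≥ M` does not change the left-hand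
  -- side.
  obtain ⟨S, hS, hMS, hlt⟩ := hlam.exists_small one_pos (|lam| * tailMass K 1) 1 M
    (show 0 < ε * δ / (I + 1) by positivity)
  have h3 : ∫ t in Ioo 0 M, (resolvent K lam t : ℂ) * ψ t
      = ∫ t in Ioo 0 S, (resolvent K lam t : ℂ) * ψ t := by
    refine (setIntegral_eq_of_subset_of_forall_sdiff_eq_zero measurableSet_Ioo
      (Ioo_subset_Ioo_right hMS) fun t ht => ?_).symm
    rw [hψM t (not_lt.1 fun h => ht.2 ⟨ht.1.1, h⟩), mul_zero]
  have hTi : Integrable fun y => Θ y * truncLap K lam S (lineAt y) := by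
    have h4 : Integrable fun y => Θ y * (truncLap K lam S (lineAt y)
        - 1 / (lineAt y * (1 + lam * lap K (lineAt y)))) :=
      hΘ.mul_bdd ((hK.continuous_truncLap_lineAt lam S).sub hGc).aestronglyMeasurable
        (Eventually.of_forall (hd hS))
    refine (h4.add hGi).congr (Eventually.of_forall fun y => ?_)
    simp only [Pi.add_apply]; ring
  rw [h3, integral_resolvent_mul_eq_integral_truncLap hK lam hΘ S fun t _ => hψ t, dist_eq_norm,
    ← integral_sub hTi hGi]
  refine (norm_integral_le_of_norm_le (hΘ.norm.mul_const (ε / (I + 1))) (Eventually.of_forall fun y => ?_)).trans ?_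
  · rw [← mul_sub, norm_mul]
    refine mul_le_mul_of_nonneg_left ((hd hS y).trans ?_) (norm_nonneg _)
    rw [div_le_iff₀ hδ]
    exact hlt.le.trans (le_of_eq (by ring))
  · rw [integral_mul_const, mul_div_assoc', div_le_iff₀ (by positivity)]
    change I * ε ≤ _
    nlinarith

end SelfSimilar

namespace SelfSimilar

/-! ### Uniform bounds for averages of the symbol of the resolvent -/

variable {n : ℕ} {K : ℝ → ℝ}

/-- A radial weight that vanishes on the unit ball. -/
noncomputable def radWt (ξ : Rn n) : ℝ :=
  if 1 ≤ ‖ξ‖ then (1 + ‖ξ‖) ^ (-((n : ℝ) + 2)) else 0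

theorem radWt_nonneg (ξ : Rn n) : 0 ≤ radWt ξ := by
  unfold radWt; split_ifs <;> positivity

theorem measurable_radWt : Measurable (radWt : Rn n → ℝ) := by
  unfold radWt
  exact Measurable.ite (measurableSet_le measurable_const measurable_norm) (by fun_prop)
    measurable_const

theorem integrable_radWt : Integrable (radWt : Rn n → ℝ) := by
  have h : Integrable (fun ξ : Rn n => (1 + ‖ξ‖) ^ (-((n : ℝ) + 2))) :=
    integrable_one_add_norm (by simp)
  refine h.mono' measurable_radWt.aestronglyMeasurable (Eventually.of_forall fun ξ => ?_)
  rw [Real.norm_of_nonneg (radWt_nonneg ξ), radWt]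
  split_ifs
  · exact le_rfl
  · positivity

theorem integrableOn_mul_comp_sq {F : ℝ → ℝ} (hF : IntegrableOn F (Ioi 0)) {c : ℝ} (hc : 0 < c) :
    IntegrableOn (fun y => y * F (c * y ^ 2)) (Ioi 0) ∧
      ∫ y in Ioi 0, y * F (c * y ^ 2) = (2 * c)⁻¹ * ∫ x in Ioi 0, F x := by
  have h1 : IntegrableOn (fun x => F (c * x)) (Ioi 0) := by
    have := (integrableOn_Ioi_comp_mul_left_iff F 0 hc).2 (by rwa [mul_zero])
    exact this
  have h2 := (integrableOn_Ioi_comp_rpow_iff (fun x => F (c * x)) (p := 2) two_ne_zero).2 h1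
  have h3 := integral_comp_rpow_Ioi (fun x => F (c * x)) (p := 2) two_ne_zero
  have e : ∀ y ∈ Ioi (0 : ℝ), (|(2 : ℝ)| * y ^ ((2 : ℝ) - 1)) • F (c * y ^ (2 : ℝ))
      = 2 * (y * F (c * y ^ 2)) := fun y _ => by
    rw [abs_two, show (2 : ℝ) - 1 = 1 by norm_num, Real.rpow_one, Real.rpow_two, smul_eq_mul, mul_assoc]
  constructor
  · have h4 := (h2.congr_fun e measurableSet_Ioi).const_mul 2⁻¹
    refine h4.congr (Eventually.of_forall fun y => ?_)
    simp
  · rw [setIntegral_congr_fun measurableSet_Ioi e, integral_const_mul,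
      integral_comp_mul_left_Ioi F 0 hc, mul_zero, smul_eq_mul] at h3
    rw [mul_inv, mul_assoc, ← h3]; ring

/-- In polar coordinates, with `x = 4π² y²` and hence `dx` proportional to `y dy`, the claim is that
`y ^ (n - 1)` times the weight is at most `y`. For `y ≥ 1` the decay of the weight ensures this;
near `0` it could fail for `n = 1`, and so the weight vanishes there. -/
theorem exists_integral_radWt_mul_le (hn : 1 ≤ n) : ∃ C : ℝ, 0 ≤ C ∧ ∀ F : ℝ → ℝ, (∀ x, 0 ≤ F x) →
    Measurable F → IntegrableOn F (Ioi 0) →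
      Integrable (fun ξ : Rn n => radWt ξ * F (symb ξ)) ∧
      ∫ ξ : Rn n, radWt ξ * F (symb ξ) ≤ C * ∫ x in Ioi 0, F x := by
  have : Nonempty (Fin n) := ⟨⟨0, hn⟩⟩
  have hc : (0 : ℝ) < (2 * Real.pi) ^ 2 := by positivity
  refine ⟨n * (volume : Measure (Rn n)).real (Metric.ball 0 1) * (2 * (2 * Real.pi) ^ 2)⁻¹,
    by positivity, fun F hF0 hFm hF => ?_⟩
  set f : ℝ → ℝ := fun y => (if 1 ≤ y then (1 + y) ^ (-((n : ℝ) + 2)) else 0)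
    * F ((2 * Real.pi) ^ 2 * y ^ 2) with hf
  obtain ⟨hGi, hG⟩ := integrableOn_mul_comp_sq hF hc
  have hfm : Measurable f := by
    refine Measurable.mul ?_ (hFm.comp (by fun_prop))
    exact Measurable.ite (measurableSet_le measurable_const measurable_id) (by fun_prop) measurable_const
  have hle : ∀ y ∈ Ioi (0 : ℝ), 0 ≤ y ^ (n - 1) • f y ∧
      y ^ (n - 1) • f y ≤ y * F ((2 * Real.pi) ^ 2 * y ^ 2) := by
    intro y hy
    have hy0 : 0 < y := hy
    rw [hf, smul_eq_mul]
    simp only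
    have hFy := hF0 ((2 * Real.pi) ^ 2 * y ^ 2)
    rw [← mul_assoc]
    split_ifs with h1
    · refine ⟨by positivity, mul_le_mul_of_nonneg_right ?_ hFy⟩
      have h2 : y ^ (n - 1) ≤ (1 + y) ^ ((n : ℝ) + 2) := by
        rw [← Real.rpow_natCast]
        calc y ^ ((n - 1 : ℕ) : ℝ) ≤ (1 + y) ^ ((n - 1 : ℕ) : ℝ) :=
              Real.rpow_le_rpow hy0.le (by linarith) (by positivity)
          _ ≤ (1 + y) ^ ((n : ℝ) + 2) := by
              refine Real.rpow_le_rpow_of_exponent_le (by linarith) ?_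
              have : ((n - 1 : ℕ) : ℝ) ≤ n := by exact_mod_cast Nat.sub_le n 1
              linarith
      rw [Real.rpow_neg (by positivity), ← div_eq_mul_inv]
      exact ((div_le_one (by positivity)).2 h2).trans h1
    · rw [mul_zero, zero_mul]
      exact ⟨le_rfl, by positivity⟩
  have hdim : Module.finrank ℝ (Rn n) = n := by simp
  have hint : IntegrableOn (fun y : ℝ => y ^ (n - 1) • f y) (Ioi 0) := by
    refine Integrable.mono' hGi (by fun_prop : Measurable fun y : ℝ =>
      y ^ (n - 1) • f y).aestronglyMeasurable ?_
    filter_upwards [ae_restrict_mem measurableSet_Ioi] with y hy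
    rw [Real.norm_of_nonneg (hle y hy).1]; exact (hle y hy).2
  have e : (fun ξ : Rn n => radWt ξ * F (symb ξ)) = fun ξ => f ‖ξ‖ := by
    funext ξ; rw [hf, radWt, symb]
  rw [e]
  refine ⟨(integrable_fun_norm_addHaar volume).2 (by rw [hdim]; exact hint), ?_⟩
  rw [integral_fun_norm_addHaar volume f, hdim, nsmul_eq_mul, smul_eq_mul, mul_assoc, mul_assoc]
  refine mul_le_mul_of_nonneg_left (mul_le_mul_of_nonneg_left ?_ (by positivity)) (by positivity)
  rw [← hG]
  exact setIntegral_mono_on hint hGi measurableSet_Ioi fun y hy => (hle y hy).2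

/-- The imaginary part of `L / (1 + x L)`. -/
theorem im_div_one_add_mul (L : ℂ) (x : ℝ) :
    (L / (1 + x * L)).im = L.im / Complex.normSq (1 + x * L) := by
  rw [Complex.div_im]
  simp only [Complex.add_re, Complex.one_re, Complex.mul_re, Complex.ofReal_re, Complex.ofReal_im,
    Complex.add_im, Complex.one_im, Complex.mul_im]
  ring

/-- As a function of `x` the integrand is a translated and rescaled copy of `1 / (1 + x²)` with
total mass `π` on the line, whatever the complex number `L`. This independence of `L` is the source
of all uniformity in the kernel. -/
theorem integral_poisson_le (L : ℂ) :
    IntegrableOn (fun x : ℝ => |L.im| / Complex.normSq (1 + x * L)) (Ioi 0) ∧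
      ∫ x in Ioi (0 : ℝ), |L.im| / Complex.normSq (1 + x * L) ≤ Real.pi := by
  by_cases hb : L.im = 0
  · simp only [hb, abs_zero, zero_div]
    exact ⟨integrableOn_zero, by simp [Real.pi_pos.le]⟩
  have hb0 : 0 < |L.im| := abs_pos.2 hb
  set N := Complex.normSq L with hN
  have hNeq : N = L.re ^ 2 + L.im ^ 2 := by rw [hN, Complex.normSq_apply]; ring
  have hb2 : |L.im| ^ 2 = L.im ^ 2 := sq_abs _
  have hN0 : 0 < N := by rw [hNeq]; positivity
  set g := N / |L.im| with hg
  have hg0 : 0 < g := div_pos hN0 hb0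
  have e : ∀ x : ℝ, |L.im| / Complex.normSq (1 + x * L)
      = g * (1 + (g * (x + L.re / N)) ^ 2)⁻¹ := by
    intro x
    have h1 : Complex.normSq (1 + x * L) = 1 + 2 * x * L.re + x ^ 2 * N := by
      rw [hNeq, Complex.normSq_apply]
      simp only [Complex.add_re, Complex.one_re, Complex.mul_re, Complex.ofReal_re,
        Complex.ofReal_im, Complex.add_im, Complex.one_im, Complex.mul_im]
      ring
    have h2 : 1 + (g * (x + L.re / N)) ^ 2
        = N / |L.im| ^ 2 * (1 + 2 * x * L.re + x ^ 2 * N) := by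
      rw [hg]
      field_simp
      rw [hb2]
      have : L.im ^ 2 = N - L.re ^ 2 := by rw [hNeq]; ring
      rw [this]; ring
    rw [h2, h1, hg, mul_inv, inv_div]
    field_simp
  have h3 : Integrable (fun x : ℝ => g * (1 + (g * (x + L.re / N)) ^ 2)⁻¹) := by
    refine Integrable.const_mul ?_ g
    exact ((integrable_inv_one_add_sq.comp_mul_left' hg0.ne').comp_add_right (L.re / N))
  have h4 : ∫ x : ℝ, g * (1 + (g * (x + L.re / N)) ^ 2)⁻¹ = Real.pi := by
    rw [integral_const_mul, integral_add_right_eq_self (fun x : ℝ => (1 + (g * x) ^ 2)⁻¹),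
      Measure.integral_comp_mul_left (fun x : ℝ => (1 + x ^ 2)⁻¹), integral_univ_inv_one_add_sq,
      abs_of_pos (inv_pos.2 hg0), smul_eq_mul, mul_inv_cancel_left₀ hg0.ne']
  simp only [e]
  refine ⟨h3.integrableOn, ?_⟩
  rw [← h4]
  exact setIntegral_le_integral h3 (Eventually.of_forall fun x => by positivity)

/-- A holomorphic function on the right half-plane with bounded imaginary part grows at most
quadratically on the line `Re z = 1`. -/
theorem norm_lineAt_le_of_abs_im_le {Q : ℂ → ℂ} (hQ : DifferentiableOn ℂ Q {z | 0 < z.re}) {M : ℝ}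
    (hM : 0 < M) (him : ∀ z : ℂ, 0 < z.re → |(Q z).im| ≤ M) (h1 : ‖Q 1‖ ≤ M) (y : ℝ) :
    ‖Q (lineAt y)‖ ≤ 8 * M * (1 + (Real.pi * y) ^ 2) := by
  have hre : ∀ w ∈ Metric.ball (0 : ℂ) 1, 1 - w ≠ 0 ∧ 0 < ((1 + w) / (1 - w)).re := by
    intro w hw
    have hw1 : ‖w‖ < 1 := by simpa using hw
    have h0 : 1 - w ≠ 0 := fun h => by
      rw [← sub_eq_zero.1 h, norm_one] at hw1; exact lt_irrefl _ hw1
    refine ⟨h0, ?_⟩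
    have h2 : ((1 + w) / (1 - w)).re = (1 - Complex.normSq w) / Complex.normSq (1 - w) := by
      rw [Complex.div_re, Complex.normSq_apply w]
      simp only [Complex.add_re, Complex.one_re, Complex.sub_re, Complex.add_im, Complex.one_im,
        Complex.sub_im]
      ring
    rw [h2]
    refine div_pos ?_ (Complex.normSq_pos.2 h0)
    rw [Complex.normSq_eq_norm_sq]
    nlinarith [norm_nonneg w]
  -- The Cayley transform carries the disc to the half-plane and `0` to `1`; multiplication by `i`
  -- turns the bound on the imaginary part into the bound on the real part required by the
  -- Borel–Carathéodory theorem.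
  set F : ℂ → ℂ := fun w => Complex.I * Q ((1 + w) / (1 - w)) with hF
  have hFd : DifferentiableOn ℂ F (Metric.ball 0 1) := by
    refine DifferentiableOn.const_mul (hQ.comp ?_ fun w hw => (hre w hw).2) _
    intro w hw
    have := (hre w hw).1
    exact ((differentiableAt_const 1).add differentiableAt_id).div
      ((differentiableAt_const 1).sub differentiableAt_id) this |>.differentiableWithinAt
  have hFm : MapsTo F (Metric.ball 0 1) {z | z.re ≤ M} := by
    intro w hw
    have h2 := him _ (hre w hw).2
    change (F w).re ≤ M
    rw [hF]
    simp only [Complex.mul_re, Complex.I_re, Complex.I_im, zero_mul, one_mul, zero_sub]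
    linarith [neg_abs_le (Q ((1 + w) / (1 - w))).im]
  -- The point of the line is `1 + 2 p`, and its preimage in the disc is `w = p / (1 + p)`. The
  -- distance of `w` to the circle, comparable to `1 / (1 + (π y)²)`, gives the quadratic growth.
  set p : ℂ := Real.pi * y * Complex.I with hp
  have hpn : ‖p‖ ^ 2 = (Real.pi * y) ^ 2 := by
    rw [hp, norm_mul, Complex.norm_I, mul_one, ← Complex.ofReal_mul, Complex.norm_real,
      Real.norm_eq_abs, sq_abs]
  have h1p : ‖1 + p‖ ^ 2 = 1 + (Real.pi * y) ^ 2 := by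
    rw [← Complex.normSq_eq_norm_sq, Complex.normSq_apply, hp]
    simp; ring
  have h1p0 : 1 + p ≠ 0 := fun h => by
    rw [h, norm_zero] at h1p; nlinarith [sq_nonneg (Real.pi * y)]
  set w := p / (1 + p) with hw
  have hwn : ‖w‖ ^ 2 = (Real.pi * y) ^ 2 / (1 + (Real.pi * y) ^ 2) := by
    rw [hw, norm_div, div_pow, hpn, h1p]
  have hw1 : 1 - ‖w‖ ^ 2 = (1 + (Real.pi * y) ^ 2)⁻¹ := by
    rw [hwn]; field_simp; ring
  have hpos : (0 : ℝ) < (1 + (Real.pi * y) ^ 2)⁻¹ := by positivity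
  have hwlt : ‖w‖ < 1 := by nlinarith [norm_nonneg w]
  have hwz : (1 + w) / (1 - w) = lineAt y := by
    have : 1 - w = 1 / (1 + p) := by rw [hw]; field_simp; ring
    have h1w : 1 + w = (1 + 2 * p) / (1 + p) := by rw [hw]; field_simp; ring
    rw [h1w, this, div_div_div_cancel_right₀ h1p0, div_one, lineAt, hp]
    ring
  have hmain := Complex.borelCaratheodory hM hFd hFm one_pos (z := w) (by simpa using hwlt)
  have e1 : ‖F w‖ = ‖Q (lineAt y)‖ := by rw [hF]; simp [hwz]
  have e2 : ‖F 0‖ = ‖Q 1‖ := by rw [hF]; simp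
  rw [e1, e2] at hmain
  refine hmain.trans ?_
  have h3 : (1 + (Real.pi * y) ^ 2)⁻¹ ≤ 2 * (1 - ‖w‖) := by rw [← hw1]; nlinarith [norm_nonneg w]
  have h4 : 0 < 1 - ‖w‖ := by linarith
  have h5 : 1 / (1 - ‖w‖) ≤ 2 * (1 + (Real.pi * y) ^ 2) := by
    rw [div_le_iff₀ h4]
    have : (1 + (Real.pi * y) ^ 2) * (1 + (Real.pi * y) ^ 2)⁻¹ = 1 := mul_inv_cancel₀ (by positivity)
    have h6 := mul_le_mul_of_nonneg_left h3 (show 0 ≤ 1 + (Real.pi * y) ^ 2 by positivity)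
    rw [this] at h6
    linarith
  calc 2 * M * ‖w‖ / (1 - ‖w‖) + ‖Q 1‖ * (1 + ‖w‖) / (1 - ‖w‖)
      = (2 * M * ‖w‖ + ‖Q 1‖ * (1 + ‖w‖)) * (1 / (1 - ‖w‖)) := by ring
    _ ≤ (2 * M * 1 + M * 2) * (2 * (1 + (Real.pi * y) ^ 2)) := by
        gcongr
        linarith
    _ = _ := by ring

end SelfSimilar

namespace SelfSimilar

/-! ### Holomorphic averages over the frequencies. -/

variable {n : ℕ} {K : ℝ → ℝ}

theorem measurable_div_one_add_symb_mul (l : ℂ) :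
    Measurable fun ξ : Rn n => l / (1 + (symb ξ : ℂ) * l) := by
  have := (continuous_symb (n := n)).measurable
  fun_prop

/-- On the compact set the denominators stay bounded away from zero for `l` near `l₀`, so
differentiation under the integral is justified. Composition with the Laplace transform then makes
the averages holomorphic in `z`. -/
theorem differentiableAt_average {Q : Set (Rn n)} (hQ : IsCompact Q) {l₀ : ℂ}
    (hne : ∀ ξ ∈ Q, 1 + (symb ξ : ℂ) * l₀ ≠ 0) {m : Rn n → ℂ} (hm : Integrable m)
    (hmQ : ∀ ξ, ξ ∉ Q → m ξ = 0) :
    Integrable (fun ξ => m ξ * (l₀ / (1 + (symb ξ : ℂ) * l₀))) ∧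
      DifferentiableAt ℂ (fun l => ∫ ξ, m ξ * (l / (1 + (symb ξ : ℂ) * l))) l₀ := by
  have hcs : Continuous fun ξ : Rn n => (symb ξ : ℂ) := Complex.continuous_ofReal.comp continuous_symb
  obtain ⟨δ, hδ, hδle⟩ := hQ.exists_forall_le' (f := fun ξ : Rn n => ‖1 + (symb ξ : ℂ) * l₀‖)
    (continuous_const.add (hcs.mul continuous_const)).norm.continuousOn (a := 0)
    fun ξ hξ => norm_pos_iff.2 (hne ξ hξ)
  obtain ⟨B, hB⟩ := hQ.exists_bound_of_continuousOn (continuous_symb (n := n)).continuousOn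
  have hr : 0 < δ / (2 * (|B| + 1)) := by positivity
  have hlow : ∀ l ∈ Metric.ball l₀ (δ / (2 * (|B| + 1))), ∀ ξ ∈ Q,
      δ / 2 ≤ ‖1 + (symb ξ : ℂ) * l‖ := by
    intro l hl ξ hξ
    have h1 : ‖(symb ξ : ℂ) * (l - l₀)‖ ≤ δ / 2 := by
      rw [norm_mul, Complex.norm_real]
      rw [Metric.mem_ball, dist_eq_norm] at hl
      calc _ ≤ (|B| + 1) * (δ / (2 * (|B| + 1))) :=
            mul_le_mul (by linarith [hB ξ hξ, le_abs_self B]) hl.le (norm_nonneg _) (by positivity)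
        _ = δ / 2 := by field_simp
    have h2 := norm_sub_le (1 + (symb ξ : ℂ) * l) ((symb ξ : ℂ) * (l - l₀))
    rw [show 1 + (symb ξ : ℂ) * l - (symb ξ : ℂ) * (l - l₀) = 1 + (symb ξ : ℂ) * l₀ by ring] at h2
    linarith [hδle ξ hξ]
  have hmeas : ∀ l : ℂ, AEStronglyMeasurable (fun ξ => m ξ * (l / (1 + (symb ξ : ℂ) * l))) volume :=
    fun l => hm.aestronglyMeasurable.mul (measurable_div_one_add_symb_mul l).aestronglyMeasurable
  have hint : Integrable (fun ξ => m ξ * (l₀ / (1 + (symb ξ : ℂ) * l₀))) := by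
    refine (hm.norm.mul_const (‖l₀‖ / δ)).mono' (hmeas l₀) (Eventually.of_forall fun ξ => ?_)
    by_cases hξ : ξ ∈ Q
    · rw [norm_mul, norm_div]
      gcongr
      exact hδle ξ hξ
    · rw [hmQ ξ hξ]; simp
  refine ⟨hint, ?_⟩
  refine (hasDerivAt_integral_of_dominated_loc_of_deriv_le (Metric.ball_mem_nhds l₀ hr)
    (F := fun l ξ => m ξ * (l / (1 + (symb ξ : ℂ) * l)))
    (F' := fun l ξ => m ξ * (1 / (1 + (symb ξ : ℂ) * l) ^ 2))
    (bound := fun ξ => ‖m ξ‖ * (1 / (δ / 2) ^ 2)) (Eventually.of_forall hmeas) hint ?_ ?_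
    (hm.norm.mul_const _) ?_).2.differentiableAt
  · refine hm.aestronglyMeasurable.mul (Measurable.aestronglyMeasurable ?_)
    have := hcs.measurable
    fun_prop
  · refine Eventually.of_forall fun ξ l hl => ?_
    by_cases hξ : ξ ∈ Q
    · rw [norm_mul, norm_div, norm_one, norm_pow]
      have := hlow l hl ξ hξ
      gcongr
    · rw [hmQ ξ hξ]; simp
  · refine Eventually.of_forall fun ξ l hl => ?_
    by_cases hξ : ξ ∈ Q
    · refine HasDerivAt.const_mul _ ?_
      have h0 : 1 + (symb ξ : ℂ) * l ≠ 0 := by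
        rw [← norm_pos_iff]; linarith [hlow l hl ξ hξ]
      have h1 : HasDerivAt (fun l : ℂ => 1 + (symb ξ : ℂ) * l) (symb ξ : ℂ) l := by
        simpa using ((hasDerivAt_id l).const_mul (symb ξ : ℂ)).const_add 1
      have h2 := (hasDerivAt_id l).div h1 h0
      refine h2.congr_deriv ?_
      simp only [id]
      congr 1; ring
    · simp only [hmQ ξ hξ, zero_mul]
      exact hasDerivAt_const _ _

/-- The Laplace transform at `1`, as a real number. -/
theorem lap_one (K : ℝ → ℝ) :
    lap K 1 = ((∫ τ in Ioi 0, Real.exp (-1 * τ) * K τ : ℝ) : ℂ) := by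
  rw [lap, ← integral_complex_ofReal]
  congr 1; ext t; push_cast; ring

theorem norm_div_one_add_mul_le {l x : ℝ} (hl : 0 ≤ l) (hx : 1 ≤ x) :
    ‖(l : ℂ) / (1 + (x : ℂ) * l)‖ ≤ 1 := by
  have e : (l : ℂ) / (1 + (x : ℂ) * l) = ((l / (1 + x * l) : ℝ) : ℂ) := by push_cast; ring
  have h0 : 0 < 1 + x * l := by positivity
  rw [e, Complex.norm_real, Real.norm_of_nonneg (by positivity), div_le_one h0]
  nlinarith

theorem one_le_symb {ξ : Rn n} (h : 1 ≤ ‖ξ‖) : 1 ≤ symb ξ := by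
  unfold symb
  have h1 : 1 ≤ (2 * Real.pi) ^ 2 := one_le_pow₀ (by linarith [Real.pi_gt_three])
  exact one_le_mul_of_one_le_of_one_le h1 (one_le_pow₀ h)

/-- The average of `L / (1 + x L)` is holomorphic in the right half-plane. As `m` is real, its
imaginary part is controlled by the Poisson-type integral, and its value at `z = 1` by the
nonnegativity of `L` there, which makes the quotient at most `1` for `x ≥ 1`. Neither bound depends
on the kernel or on the compact set, so the resulting quadratic growth does not either. -/
theorem exists_norm_average_real_le (hn : 1 ≤ n) : ∃ C : ℝ, 0 < C ∧ ∀ K : ℝ → ℝ, IsTameKernel K →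
    0 ≤ ∫ τ in Ioi 0, Real.exp (-1 * τ) * K τ → ∀ Q : Set (Rn n), IsCompact Q →
    (∀ ξ ∈ Q, ∀ z : ℂ, 0 < z.re → 1 + (symb ξ : ℂ) * lap K z ≠ 0) → ∀ m : Rn n → ℝ, Measurable m →
    (∀ ξ, ξ ∉ Q → m ξ = 0) → ∀ B : ℝ, 0 < B → (∀ ξ, |m ξ| ≤ B * radWt ξ) → ∀ y : ℝ,
    ‖∫ ξ, (m ξ : ℂ) * (lap K (lineAt y) / (1 + (symb ξ : ℂ) * lap K (lineAt y)))‖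
      ≤ C * B * (1 + (Real.pi * y) ^ 2) := by
  obtain ⟨C, hC, hrad⟩ := exists_integral_radWt_mul_le hn
  set I := ∫ ξ : Rn n, radWt ξ
  have hI : 0 ≤ I := integral_nonneg radWt_nonneg
  refine ⟨8 * (C * Real.pi + I + 1), by positivity,
    fun K hK hK1 Q hQ hne m hmm hmQ B hB hmB y => ?_⟩
  have hmi : Integrable m :=
    (integrable_radWt.const_mul B).mono' hmm.aestronglyMeasurable (Eventually.of_forall hmB)
  have hmc : Integrable fun ξ => (m ξ : ℂ) := hmi.ofReal
  have hmQ' : ∀ ξ, ξ ∉ Q → (m ξ : ℂ) = 0 := fun ξ hξ => by rw [hmQ ξ hξ, Complex.ofReal_zero]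
  set F : ℂ → ℂ := fun z => ∫ ξ, (m ξ : ℂ) * (lap K z / (1 + (symb ξ : ℂ) * lap K z)) with hF
  have hM : 0 < B * (C * Real.pi + I + 1) := by positivity
  have hgoal := norm_lineAt_le_of_abs_im_le (Q := F) ?_ hM ?_ ?_ y
  · exact hgoal.trans (le_of_eq (by ring))
  · intro z hz
    have h1 := (differentiableAt_average hQ (fun ξ hξ => hne ξ hξ z hz) hmc hmQ').2
    exact (h1.comp z (hK.hasDerivAt_lap hz).differentiableAt).differentiableWithinAt
  · intro z hz
    set L := lap K z
    have hi := (differentiableAt_average hQ (fun ξ hξ => hne ξ hξ z hz) hmc hmQ').1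
    obtain ⟨hPi, hP⟩ := integral_poisson_le L
    have hPm : Measurable fun x : ℝ => |L.im| / Complex.normSq (1 + x * L) := by fun_prop
    obtain ⟨hr1, hr2⟩ := hrad (fun x => |L.im| / Complex.normSq (1 + x * L))
      (fun x => div_nonneg (abs_nonneg _) (Complex.normSq_nonneg _)) hPm hPi
    have e : (F z).im = ∫ ξ, m ξ * (L.im / Complex.normSq (1 + (symb ξ : ℂ) * L)) := by
      have h1 := Complex.imCLM.integral_comp_comm hi
      change ∫ ξ, ((m ξ : ℂ) * (L / (1 + (symb ξ : ℂ) * L))).im = (F z).im at h1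
      rw [← h1]
      congr 1; ext ξ
      rw [Complex.im_ofReal_mul, im_div_one_add_mul]
    rw [e, ← Real.norm_eq_abs]
    calc _ ≤ ∫ ξ : Rn n, B * (radWt ξ * (|L.im| / Complex.normSq (1 + (symb ξ : ℂ) * L))) := by
          refine norm_integral_le_of_norm_le (hr1.const_mul B) (Eventually.of_forall fun ξ => ?_)
          rw [Real.norm_eq_abs, abs_mul, abs_div, abs_of_nonneg (Complex.normSq_nonneg _), ← mul_assoc]
          exact mul_le_mul_of_nonneg_right (hmB ξ)
            (div_nonneg (abs_nonneg _) (Complex.normSq_nonneg _))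
      _ ≤ B * (C * Real.pi) := by
          rw [integral_const_mul]
          exact mul_le_mul_of_nonneg_left (hr2.trans (mul_le_mul_of_nonneg_left hP hC)) hB.le
      _ ≤ _ := by
          refine mul_le_mul_of_nonneg_left ?_ hB.le
          linarith
  · calc ‖F 1‖ ≤ ∫ ξ : Rn n, B * radWt ξ := by
          refine norm_integral_le_of_norm_le (integrable_radWt.const_mul B)
            (Eventually.of_forall fun ξ => ?_)
          rw [norm_mul, Complex.norm_real, Real.norm_eq_abs]
          by_cases hξ : 1 ≤ ‖ξ‖
          · rw [lap_one]
            exact (mul_le_of_le_one_right (abs_nonneg _)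
              (norm_div_one_add_mul_le hK1 (one_le_symb hξ))).trans (hmB ξ)
          · have h0 : m ξ = 0 := by
              have := hmB ξ
              rw [radWt, if_neg hξ, mul_zero] at this
              exact abs_nonpos_iff.1 this
            rw [h0, abs_zero, zero_mul]
            exact mul_nonneg hB.le (radWt_nonneg ξ)
      _ ≤ B * (C * Real.pi + I + 1) := by
          rw [integral_const_mul]
          refine mul_le_mul_of_nonneg_left ?_ hB.le
          have : 0 ≤ C * Real.pi := by positivity
          change I ≤ _
          linarith

/-- Separate application to the real and imaginary parts of the weight. -/
theorem exists_norm_average_le (hn : 1 ≤ n) : ∃ C : ℝ, 0 < C ∧ ∀ K : ℝ → ℝ, IsTameKernel K →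
    0 ≤ ∫ τ in Ioi 0, Real.exp (-1 * τ) * K τ → ∀ Q : Set (Rn n), IsCompact Q →
    (∀ ξ ∈ Q, ∀ z : ℂ, 0 < z.re → 1 + (symb ξ : ℂ) * lap K z ≠ 0) → ∀ m : Rn n → ℂ, Measurable m →
    (∀ ξ, ξ ∉ Q → m ξ = 0) → ∀ B : ℝ, 0 < B → (∀ ξ, ‖m ξ‖ ≤ B * radWt ξ) → ∀ y : ℝ,
    ‖∫ ξ, m ξ * (lap K (lineAt y) / (1 + (symb ξ : ℂ) * lap K (lineAt y)))‖
      ≤ C * B * (1 + (Real.pi * y) ^ 2) := by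
  obtain ⟨C, hC, h⟩ := exists_norm_average_real_le hn
  refine ⟨2 * C, by positivity, fun K hK hK1 Q hQ hne m hmm hmQ B hB hmB y => ?_⟩
  have hz : 0 < (lineAt y).re := by rw [lineAt_re]; exact one_pos
  have hmi : Integrable m :=
    (integrable_radWt.const_mul B).mono' hmm.aestronglyMeasurable (Eventually.of_forall hmB)
  have h1 := h K hK hK1 Q hQ hne (fun ξ => (m ξ).re) (Complex.measurable_re.comp hmm)
    (fun ξ hξ => by rw [hmQ ξ hξ, Complex.zero_re]) B hB
    (fun ξ => (Complex.abs_re_le_norm _).trans (hmB ξ)) y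
  have h2 := h K hK hK1 Q hQ hne (fun ξ => (m ξ).im) (Complex.measurable_im.comp hmm)
    (fun ξ hξ => by rw [hmQ ξ hξ, Complex.zero_im]) B hB
    (fun ξ => (Complex.abs_im_le_norm _).trans (hmB ξ)) y
  have i1 := (differentiableAt_average hQ (fun ξ hξ => hne ξ hξ _ hz)
    (m := fun ξ => ((m ξ).re : ℂ)) hmi.re.ofReal
    (fun ξ hξ => by rw [hmQ ξ hξ]; simp)).1
  have i2 := (differentiableAt_average hQ (fun ξ hξ => hne ξ hξ _ hz)
    (m := fun ξ => ((m ξ).im : ℂ)) hmi.im.ofReal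
    (fun ξ hξ => by rw [hmQ ξ hξ]; simp)).1
  set L := lap K (lineAt y)
  have e : ∫ ξ, m ξ * (L / (1 + (symb ξ : ℂ) * L))
      = (∫ ξ, ((m ξ).re : ℂ) * (L / (1 + (symb ξ : ℂ) * L)))
        + Complex.I * ∫ ξ, ((m ξ).im : ℂ) * (L / (1 + (symb ξ : ℂ) * L)) := by
    rw [← integral_const_mul, ← integral_add i1 (i2.const_mul _)]
    congr 1; ext ξ
    conv_lhs => rw [← Complex.re_add_im (m ξ)]
    ring
  rw [e]
  refine (norm_add_le _ _).trans ?_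
  rw [norm_mul, Complex.norm_I, one_mul]
  linarith

end SelfSimilar

namespace SelfSimilar

/-! ### The contribution of high frequencies -/

variable {n : ℕ} {K : ℝ → ℝ}

theorem integrable_inv_sq_one_add_sq : Integrable fun y : ℝ => ((1 + y ^ 2) ^ 2)⁻¹ := by
  refine integrable_inv_one_add_sq.mono' (by fun_prop : Measurable fun y : ℝ =>
    ((1 + y ^ 2) ^ 2)⁻¹).aestronglyMeasurable (Eventually.of_forall fun y => ?_)
  rw [Real.norm_of_nonneg (by positivity)]
  have h1 : 1 ≤ 1 + y ^ 2 := by nlinarith [sq_nonneg y]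
  exact inv_anti₀ (by positivity) (le_self_pow₀ h1 two_ne_zero)

theorem integrable_sq_mul_inv_sq (c : ℝ) :
    Integrable fun y : ℝ => ((1 + y ^ 2) ^ 2)⁻¹ * (c * (1 + (Real.pi * y) ^ 2)) := by
  refine (integrable_inv_one_add_sq.const_mul (|c| * Real.pi ^ 2)).mono' (by fun_prop :
    Measurable fun y : ℝ => ((1 + y ^ 2) ^ 2)⁻¹ * (c * (1 + (Real.pi * y) ^ 2))).aestronglyMeasurable
    (Eventually.of_forall fun y => ?_)
  have h0 : 0 < 1 + y ^ 2 := by positivity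
  rw [norm_mul, norm_mul, Real.norm_of_nonneg (by positivity : 0 ≤ ((1 + y ^ 2) ^ 2)⁻¹),
    Real.norm_of_nonneg (by positivity : 0 ≤ 1 + (Real.pi * y) ^ 2), Real.norm_eq_abs]
  have h1 : 1 + (Real.pi * y) ^ 2 ≤ Real.pi ^ 2 * (1 + y ^ 2) := by
    have : 1 ≤ Real.pi ^ 2 := one_le_pow₀ (by linarith [Real.pi_gt_three])
    nlinarith
  calc ((1 + y ^ 2) ^ 2)⁻¹ * (|c| * (1 + (Real.pi * y) ^ 2))
      ≤ ((1 + y ^ 2) ^ 2)⁻¹ * (|c| * (Real.pi ^ 2 * (1 + y ^ 2))) := by gcongr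
    _ = _ := by field_simp

/-- A rapidly decaying density for the representation of a family of test functions as Laplace
integrals on the line `Re z = 1`. -/
structure IsDecaying (D : ℝ) (Θ : Rn n → ℝ → ℂ) : Prop where
  continuous : Continuous fun p : Rn n × ℝ => Θ p.1 p.2
  bound : ∀ ξ y, ‖Θ ξ y‖ ≤ D * (1 + ‖ξ‖) ^ (-((n : ℝ) + 5)) * ((1 + y ^ 2) ^ 2)⁻¹

namespace IsDecaying

variable {D : ℝ} {Θ : Rn n → ℝ → ℂ}

theorem nonneg (h : IsDecaying D Θ) : 0 ≤ D := by
  have := (norm_nonneg _).trans (h.bound 0 0)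
  simpa using this

theorem norm_le (h : IsDecaying D Θ) (ξ : Rn n) (y : ℝ) : ‖Θ ξ y‖ ≤ D * ((1 + y ^ 2) ^ 2)⁻¹ := by
  refine (h.bound ξ y).trans ?_
  refine mul_le_mul_of_nonneg_right (mul_le_of_le_one_right h.nonneg ?_) (by positivity)
  exact Real.rpow_le_one_of_one_le_of_nonpos (by linarith [norm_nonneg ξ])
    (by have : (0 : ℝ) ≤ n := by positivity
        linarith)

theorem integrable (h : IsDecaying D Θ) (ξ : Rn n) : Integrable (Θ ξ) := by
  refine (integrable_inv_sq_one_add_sq.const_mul D).mono' ?_ (Eventually.of_forall (h.norm_le ξ))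
  exact (h.continuous.comp (continuous_const.prodMk continuous_id)).aestronglyMeasurable

/-- The exponent `n + 5` is distributed as follows: `2` compensates the symbol, `n + 2` goes into
the radial weight, and the last power becomes the gain `1 / R`. -/
theorem norm_mul_symb_le (h : IsDecaying D Θ) {R : ℝ} (hR : 1 ≤ R) {ξ : Rn n} (hξ : R ≤ ‖ξ‖) (y : ℝ) :
    ‖Θ ξ y‖ * symb ξ ≤ D * ((2 * Real.pi) ^ 2 / R) * ((1 + y ^ 2) ^ 2)⁻¹ * radWt ξ := by
  have h1 : 1 ≤ ‖ξ‖ := hR.trans hξ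
  have hD := h.nonneg
  have hs : symb ξ ≤ (2 * Real.pi) ^ 2 * (1 + ‖ξ‖) ^ (2 : ℝ) := by
    rw [symb, Real.rpow_two]; gcongr; linarith
  have h2 : (1 + ‖ξ‖) ^ (-((n : ℝ) + 5)) * (1 + ‖ξ‖) ^ (2 : ℝ)
      = (1 + ‖ξ‖)⁻¹ * (1 + ‖ξ‖) ^ (-((n : ℝ) + 2)) := by
    rw [← Real.rpow_neg_one, ← Real.rpow_add (by positivity), ← Real.rpow_add (by positivity)]
    congr 1; ring
  have h3 : (1 + ‖ξ‖)⁻¹ ≤ 1 / R := by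
    rw [one_div]; exact inv_anti₀ (by linarith) (by linarith)
  rw [radWt, if_pos h1]
  calc ‖Θ ξ y‖ * symb ξ ≤ (D * (1 + ‖ξ‖) ^ (-((n : ℝ) + 5)) * ((1 + y ^ 2) ^ 2)⁻¹)
        * ((2 * Real.pi) ^ 2 * (1 + ‖ξ‖) ^ (2 : ℝ)) :=
        mul_le_mul (h.bound ξ y) hs (symb_nonneg ξ) (by positivity)
    _ = D * (2 * Real.pi) ^ 2 * ((1 + y ^ 2) ^ 2)⁻¹
        * ((1 + ‖ξ‖) ^ (-((n : ℝ) + 5)) * (1 + ‖ξ‖) ^ (2 : ℝ)) := by ring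
    _ = D * (2 * Real.pi) ^ 2 * ((1 + y ^ 2) ^ 2)⁻¹
        * ((1 + ‖ξ‖)⁻¹ * (1 + ‖ξ‖) ^ (-((n : ℝ) + 2))) := by rw [h2]
    _ ≤ D * (2 * Real.pi) ^ 2 * ((1 + y ^ 2) ^ 2)⁻¹
        * ((1 / R) * (1 + ‖ξ‖) ^ (-((n : ℝ) + 2))) := by gcongr
    _ = _ := by ring

end IsDecaying

/-- The Laplace transform of the resolvent on the line `Re z = 1`. -/
noncomputable def resSymb (K : ℝ → ℝ) (ξ : Rn n) (y : ℝ) : ℂ :=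
  1 / (lineAt y * (1 + symb ξ * lap K (lineAt y)))

theorem measurable_resSymb (hK : IsTameKernel K) :
    Measurable fun p : Rn n × ℝ => resSymb K p.1 p.2 := by
  have h1 : Measurable fun p : Rn n × ℝ => (symb p.1 : ℂ) :=
    (Complex.continuous_ofReal.comp (continuous_symb.comp continuous_fst)).measurable
  have h2 : Measurable fun p : Rn n × ℝ => lap K (lineAt p.2) :=
    (hK.continuous_lap_lineAt.comp continuous_snd).measurable
  have h3 : Measurable fun p : Rn n × ℝ => lineAt p.2 :=
    (continuous_lineAt.comp continuous_snd).measurable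
  exact measurable_const.div (h3.mul (measurable_const.add (h1.mul h2)))

theorem norm_resSymb_le {δ : ℝ} (hδ : 0 < δ) {ξ : Rn n} {y : ℝ}
    (h : δ ≤ ‖1 + symb ξ * lap K (lineAt y)‖) : ‖resSymb K ξ y‖ ≤ 1 / δ := by
  rw [resSymb, norm_div, norm_mul, norm_one]
  exact one_div_le_one_div_of_le hδ
    (h.trans (le_mul_of_one_le_left (norm_nonneg _) (one_le_norm_lineAt y)))

variable {D I : ℝ} {Θ : Rn n → ℝ → ℂ} {h : Rn n → ℂ} {Q : Set (Rn n)}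

theorem integrable_prod_resSymb (hK : IsTameKernel K) (hΘ : IsDecaying D Θ) (hh : Continuous h)
    (hI : ∀ ξ, ‖h ξ‖ ≤ I) (hQ : IsCompact Q) {δ : ℝ} (hδ : 0 < δ)
    (hδle : ∀ ξ ∈ Q, ∀ y, δ ≤ ‖1 + symb ξ * lap K (lineAt y)‖) :
    Integrable (fun p : Rn n × ℝ => h p.1 * (Θ p.1 p.2 * resSymb K p.1 p.2))
      ((volume.restrict Q).prod volume) := by
  have : IsFiniteMeasure (volume.restrict Q) := ⟨by simpa using hQ.measure_lt_top⟩
  have hI0 : 0 ≤ I := (norm_nonneg _).trans (hI 0)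
  have hdom : Integrable (fun p : Rn n × ℝ => I * (D * (1 / δ)) * ((1 + p.2 ^ 2) ^ 2)⁻¹)
      ((volume.restrict Q).prod volume) :=
    (integrable_const (I * (D * (1 / δ)))).mul_prod integrable_inv_sq_one_add_sq
  refine hdom.mono' ?_ ?_
  · exact ((hh.comp continuous_fst).aestronglyMeasurable).mul
      (hΘ.continuous.aestronglyMeasurable.mul (measurable_resSymb hK).aestronglyMeasurable)
  · have hmem : ∀ᵐ p : Rn n × ℝ ∂(volume.restrict Q).prod volume, p.1 ∈ Q :=
      Measure.quasiMeasurePreserving_fst.ae (ae_restrict_mem hQ.measurableSet)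
    filter_upwards [hmem] with p hp
    rw [norm_mul, norm_mul]
    calc _ ≤ I * ((D * ((1 + p.2 ^ 2) ^ 2)⁻¹) * (1 / δ)) :=
          mul_le_mul (hI _) (mul_le_mul (hΘ.norm_le _ _) (norm_resSymb_le hδ (hδle _ hp _))
            (norm_nonneg _) (mul_nonneg hΘ.nonneg (by positivity))) (by positivity) hI0
      _ = _ := by ring

/-- The spatial average of the symbol at a fixed point of the line. -/
theorem exists_norm_setIntegral_resSymb_le (hn : 1 ≤ n) : ∃ C : ℝ, 0 < C ∧ ∀ K : ℝ → ℝ,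
    IsTameKernel K → 0 ≤ ∫ τ in Ioi 0, Real.exp (-1 * τ) * K τ → ∀ Q : Set (Rn n), IsCompact Q →
    (∀ ξ ∈ Q, ∀ z : ℂ, 0 < z.re → 1 + (symb ξ : ℂ) * lap K z ≠ 0) → ∀ R : ℝ, 1 ≤ R →
    (∀ ξ ∈ Q, R ≤ ‖ξ‖) → ∀ (D I : ℝ), 0 < D → 0 < I → ∀ (Θ : Rn n → ℝ → ℂ), IsDecaying D Θ →
    ∀ h : Rn n → ℂ, Continuous h → (∀ ξ, ‖h ξ‖ ≤ I) → ∀ y : ℝ,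
    ‖∫ ξ in Q, h ξ * (Θ ξ y * resSymb K ξ y)‖
      ≤ (I * D / R) * (((1 + y ^ 2) ^ 2)⁻¹ * (C * (1 + (Real.pi * y) ^ 2))) := by
  obtain ⟨C, hC, hav⟩ := exists_norm_average_le (n := n) hn
  set W := ∫ ξ : Rn n, radWt ξ
  have hW : 0 ≤ W := integral_nonneg radWt_nonneg
  refine ⟨(2 * Real.pi) ^ 2 * (W + C), by positivity,
    fun K hK hK1 Q hQ hne R hR hQR D I hD hI Θ hΘ h hh hhI y => ?_⟩
  have hR0 : 0 < R := by linarith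
  set B := I * (D * ((2 * Real.pi) ^ 2 / R) * ((1 + y ^ 2) ^ 2)⁻¹) with hB
  have hB0 : 0 < B := by positivity
  set L := lap K (lineAt y) with hL
  have hΘc : Continuous fun ξ => Θ ξ y := hΘ.continuous.comp (continuous_id.prodMk continuous_const)
  set m : Rn n → ℂ := Q.indicator fun ξ => h ξ * Θ ξ y * (symb ξ : ℂ) with hm
  set p : Rn n → ℂ := Q.indicator fun ξ => h ξ * Θ ξ y with hp
  have hmm : Measurable m :=
    ((hh.mul hΘc).mul (Complex.continuous_ofReal.comp continuous_symb)).measurable.indicator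
      hQ.measurableSet
  have hpm : Measurable p := (hh.mul hΘc).measurable.indicator hQ.measurableSet
  have hmb : ∀ ξ, ‖m ξ‖ ≤ B * radWt ξ := by
    intro ξ
    by_cases hξ : ξ ∈ Q
    · rw [hm, indicator_of_mem hξ, norm_mul, norm_mul, Complex.norm_real,
        Real.norm_of_nonneg (symb_nonneg ξ), mul_assoc, hB, mul_assoc I]
      exact mul_le_mul (hhI ξ) (hΘ.norm_mul_symb_le hR (hQR ξ hξ) y)
        (mul_nonneg (norm_nonneg _) (symb_nonneg _)) hI.le
    · rw [hm, indicator_of_notMem hξ, norm_zero]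
      exact mul_nonneg hB0.le (radWt_nonneg ξ)
  have hpb : ∀ ξ, ‖p ξ‖ ≤ B * radWt ξ := by
    intro ξ
    refine le_trans ?_ (hmb ξ)
    by_cases hξ : ξ ∈ Q
    · rw [hp, hm, indicator_of_mem hξ, indicator_of_mem hξ, norm_mul _ (symb ξ : ℂ),
        Complex.norm_real, Real.norm_of_nonneg (symb_nonneg ξ)]
      exact le_mul_of_one_le_right (norm_nonneg _) (one_le_symb (hR.trans (hQR ξ hξ)))
    · rw [hp, hm, indicator_of_notMem hξ, indicator_of_notMem hξ]
  have hmQ : ∀ ξ, ξ ∉ Q → m ξ = 0 := fun ξ hξ => indicator_of_notMem hξ _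
  have hmi : Integrable m :=
    (integrable_radWt.const_mul B).mono' hmm.aestronglyMeasurable (Eventually.of_forall hmb)
  have hpi : Integrable p :=
    (integrable_radWt.const_mul B).mono' hpm.aestronglyMeasurable (Eventually.of_forall hpb)
  have hz : 0 < (lineAt y).re := by rw [lineAt_re]; exact one_pos
  have hmL := (differentiableAt_average hQ (fun ξ hξ => hne ξ hξ _ hz) hmi hmQ).1
  -- Since `1 / (1 + λ L) = 1 - λ L / (1 + λ L)`, the average of the symbol reduces to the averages
  -- already estimated, with the factor `λ` moved into the weight `m`.
  have e : ∫ ξ in Q, h ξ * (Θ ξ y * resSymb K ξ y) = (lineAt y)⁻¹ * ((∫ ξ, p ξ)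
      - ∫ ξ, m ξ * (L / (1 + (symb ξ : ℂ) * L))) := by
    rw [← integral_sub hpi hmL, ← integral_const_mul, ← integral_indicator hQ.measurableSet]
    congr 1; funext ξ
    by_cases hξ : ξ ∈ Q
    · rw [indicator_of_mem hξ, hp, hm, indicator_of_mem hξ, indicator_of_mem hξ, resSymb, ← hL]
      have h1 : 1 + (symb ξ : ℂ) * L ≠ 0 := hne ξ hξ _ hz
      have h2 := lineAt_ne_zero y
      field_simp
      ring
    · rw [indicator_of_notMem hξ, hp, hm, indicator_of_notMem hξ, indicator_of_notMem hξ]; simp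
  have h1 : ‖∫ ξ, p ξ‖ ≤ B * W := by
    refine (norm_integral_le_of_norm_le (integrable_radWt.const_mul B)
      (Eventually.of_forall hpb)).trans (le_of_eq ?_)
    rw [integral_const_mul]
  have h2 := hav K hK hK1 Q hQ hne m hmm hmQ B hB0 hmb y
  rw [e, norm_mul, norm_inv]
  have h3 : ‖(∫ ξ, p ξ) - ∫ ξ, m ξ * (L / (1 + (symb ξ : ℂ) * L))‖
      ≤ B * W + C * B * (1 + (Real.pi * y) ^ 2) := (norm_sub_le _ _).trans (add_le_add h1 h2)
  have h4 : ‖lineAt y‖⁻¹ ≤ 1 := inv_le_one_of_one_le₀ (one_le_norm_lineAt y)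
  calc _ ≤ 1 * (B * W + C * B * (1 + (Real.pi * y) ^ 2)) :=
        mul_le_mul h4 h3 (norm_nonneg _) zero_le_one
    _ ≤ B * ((W + C) * (1 + (Real.pi * y) ^ 2)) := by
        have h5 : B * W ≤ B * W * (1 + (Real.pi * y) ^ 2) :=
          le_mul_of_one_le_right (by positivity) (by nlinarith [sq_nonneg (Real.pi * y)])
        linarith
    _ = _ := by rw [hB]; field_simp

end SelfSimilar

namespace SelfSimilar

/-! ### The tail estimate for resolvents, uniform in the kernel. -/

variable {n : ℕ}

/-- The high-frequency estimate on a compact set of frequencies. -/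
theorem exists_norm_setIntegral_resolvent_le (hn : 1 ≤ n) : ∃ C : ℝ, 0 < C ∧ ∀ K : ℝ → ℝ,
    IsTameKernel K → 0 ≤ ∫ τ in Ioi 0, Real.exp (-1 * τ) * K τ → ∀ h : Rn n → ℂ, Continuous h →
    (∀ᵐ ξ, h ξ ≠ 0 → IsSubexponential K (symb ξ)) → ∀ I : ℝ, 0 < I → (∀ ξ, ‖h ξ‖ ≤ I) →
    ∀ D : ℝ, 0 < D → ∀ Θ : Rn n → ℝ → ℂ, IsDecaying D Θ → ∀ (M : ℝ) (ψ : Rn n → ℝ → ℂ),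
    (∀ ξ t, M ≤ t → ψ ξ t = 0) → (∀ ξ t, ψ ξ t = ∫ y, Θ ξ y * Complex.exp (-lineAt y * t)) →
    ∀ R : ℝ, 1 ≤ R → ∀ Q : Set (Rn n), IsCompact Q → (∀ ξ ∈ Q, R ≤ ‖ξ‖ ∧ h ξ ≠ 0) →
    ‖∫ ξ in Q, h ξ * ∫ t in Ioo 0 M, (resolvent K (symb ξ) t : ℂ) * ψ ξ t‖ ≤ C * (I * D / R) := by
  obtain ⟨C, hC, hb⟩ := exists_norm_setIntegral_resSymb_le (n := n) hn
  set W := ∫ y : ℝ, ((1 + y ^ 2) ^ 2)⁻¹ * (C * (1 + (Real.pi * y) ^ 2))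
  have hW : 0 ≤ W := integral_nonneg fun y => by positivity
  refine ⟨W + 1, by positivity, fun K hK hK1 h hh hs I hI hhI D hD Θ hΘ M ψ hψM hψ R hR Q hQ hQh => ?_⟩
  have hR0 : 0 < R := by linarith
  have hne : ∀ ξ ∈ Q, ∀ z : ℂ, 0 < z.re → 1 + (symb ξ : ℂ) * lap K z ≠ 0 :=
    fun ξ hξ z hz => one_add_symb_mul_lap_ne_zero hK hh hs (hQh ξ hξ).2 hz
  obtain ⟨δ, hδ, hδle⟩ := exists_le_norm_one_add_symb_mul_lap hK hQ hne
  have e : ∫ ξ in Q, h ξ * ∫ t in Ioo 0 M, (resolvent K (symb ξ) t : ℂ) * ψ ξ t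
      = ∫ ξ in Q, ∫ y, h ξ * (Θ ξ y * resSymb K ξ y) := by
    refine integral_congr_ae ?_
    -- Laplace inversion needs the growth hypothesis at the frequency itself, hence only almost
    -- every `ξ`; absence of zeros is known for every `ξ` in `Q`.
    filter_upwards [ae_restrict_of_ae hs, ae_restrict_mem hQ.measurableSet] with ξ h1 h2
    rw [integral_resolvent_mul_eq hK (h1 (hQh ξ h2).2) hδ (hδle ξ h2) (hΘ.integrable ξ)
      (hψM ξ) (hψ ξ), ← integral_const_mul]
    rfl
  rw [e, integral_integral_swap (f := fun ξ y => h ξ * (Θ ξ y * resSymb K ξ y))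
    (integrable_prod_resSymb hK hΘ hh hhI hQ hδ hδle)]
  refine (norm_integral_le_of_norm_le ((integrable_sq_mul_inv_sq C).const_mul (I * D / R))
    (Eventually.of_forall fun y => hb K hK hK1 Q hQ hne R hR (fun ξ hξ => (hQh ξ hξ).1) D I hD hI Θ
      hΘ h hh hhI y)).trans ?_
  rw [integral_const_mul, mul_comm]
  refine mul_le_mul_of_nonneg_right ?_ (by positivity)
  change W ≤ W + 1
  linarith

/-- The high-frequency estimate. -/
theorem exists_norm_integral_resolvent_le (hn : 1 ≤ n) : ∃ C : ℝ, 0 < C ∧ ∀ K : ℝ → ℝ,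
    IsTameKernel K → 0 ≤ ∫ τ in Ioi 0, Real.exp (-1 * τ) * K τ → ∀ h : Rn n → ℂ, Continuous h →
    (∀ᵐ ξ, h ξ ≠ 0 → IsSubexponential K (symb ξ)) → ∀ I : ℝ, 0 < I → (∀ ξ, ‖h ξ‖ ≤ I) →
    ∀ D : ℝ, 0 < D → ∀ Θ : Rn n → ℝ → ℂ, IsDecaying D Θ → ∀ (M : ℝ) (ψ : Rn n → ℝ → ℂ),
    (∀ ξ t, M ≤ t → ψ ξ t = 0) → (∀ ξ t, ψ ξ t = ∫ y, Θ ξ y * Complex.exp (-lineAt y * t)) →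
    Integrable (fun p : ℝ × Rn n => (resolvent K (symb p.2) p.1 : ℂ) * h p.2 * ψ p.2 p.1)
      ((volume.restrict (Ioo 0 M)).prod volume) → ∀ R : ℝ, 1 ≤ R →
    ‖∫ t in Ioo 0 M, ∫ ξ in {ξ | R ≤ ‖ξ‖}, (resolvent K (symb ξ) t : ℂ) * h ξ * ψ ξ t‖
      ≤ C * (I * D / R) := by
  obtain ⟨C, hC, hb⟩ := exists_norm_setIntegral_resolvent_le (n := n) hn
  refine ⟨C, hC, fun K hK hK1 h hh hs I hI hhI D hD Θ hΘ M ψ hψM hψ hint R hR => ?_⟩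
  set J : Rn n → ℂ := fun ξ => h ξ * ∫ t in Ioo 0 M, (resolvent K (symb ξ) t : ℂ) * ψ ξ t with hJ
  have hSm : MeasurableSet {ξ : Rn n | R ≤ ‖ξ‖} := measurableSet_le measurable_const measurable_norm
  have hJe : ∀ ξ, J ξ = ∫ t in Ioo 0 M, (resolvent K (symb ξ) t : ℂ) * h ξ * ψ ξ t := fun ξ => by
    rw [hJ]; simp only
    rw [← integral_const_mul]
    congr 1; ext t; ring
  have hint' : Integrable (fun p : ℝ × Rn n => (resolvent K (symb p.2) p.1 : ℂ) * h p.2 * ψ p.2 p.1)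
      ((volume.restrict (Ioo 0 M)).prod (volume.restrict {ξ : Rn n | R ≤ ‖ξ‖})) :=
    hint.mono_measure (Measure.prod_mono le_rfl Measure.restrict_le_self)
  have hJi : IntegrableOn J {ξ : Rn n | R ≤ ‖ξ‖} :=
    hint'.integral_prod_right.congr (Eventually.of_forall fun ξ => (hJe ξ).symm)
  rw [integral_integral_swap (f := fun t ξ => (resolvent K (symb ξ) t : ℂ) * h ξ * ψ ξ t) hint']
  simp only [← hJe]
  -- Zeros of the symbol are excluded only where `h` does not vanish, so this set is exhausted by
  -- compact sets. The bound does not depend on the compact set, and where `h = 0` the integrand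
  -- vanishes.
  set Q : ℕ → Set (Rn n) := fun k => {ξ | R ≤ ‖ξ‖} ∩ {ξ | ‖ξ‖ ≤ k ∧ 1 / ((k : ℝ) + 1) ≤ ‖h ξ‖} with hQ
  have hQc : ∀ k, IsCompact (Q k) := fun k => by
    refine (isCompact_closedBall (0 : Rn n) k).of_isClosed_subset ?_ fun ξ hξ => by
      simpa using hξ.2.1
    exact (isClosed_le continuous_const continuous_norm).inter
      ((isClosed_le continuous_norm continuous_const).inter (isClosed_le continuous_const hh.norm))
  have hQh : ∀ k, ∀ ξ ∈ Q k, R ≤ ‖ξ‖ ∧ h ξ ≠ 0 := fun k ξ hξ =>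
    ⟨hξ.1, norm_pos_iff.1 (lt_of_lt_of_le (by positivity) hξ.2.2)⟩
  have hQmono : Monotone Q := fun k l hkl ξ hξ => by
    have hkl' : (k : ℝ) ≤ l := by exact_mod_cast hkl
    refine ⟨hξ.1, hξ.2.1.trans hkl', le_trans ?_ hξ.2.2⟩
    exact one_div_le_one_div_of_le (by positivity) (by linarith)
  have hsub : ⋃ k, Q k ⊆ {ξ : Rn n | R ≤ ‖ξ‖} := iUnion_subset fun k ξ hξ => hξ.1
  have hlim := tendsto_setIntegral_of_monotone (fun k => (hQc k).measurableSet) hQmono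
    (hJi.mono_set hsub)
  have he : ∫ ξ in ⋃ k, Q k, J ξ = ∫ ξ in {ξ : Rn n | R ≤ ‖ξ‖}, J ξ := by
    refine (setIntegral_eq_of_subset_of_forall_sdiff_eq_zero hSm hsub fun ξ hξ => ?_).symm
    have h0 : h ξ = 0 := by
      by_contra hne
      obtain ⟨k, hk⟩ := exists_nat_gt (max ‖ξ‖ (1 / ‖h ξ‖))
      refine hξ.2 (mem_iUnion.2 ⟨k, hξ.1, (le_max_left _ _).trans hk.le, ?_⟩)
      have h1 := norm_pos_iff.2 hne
      have h2 : 1 / ‖h ξ‖ < k := (le_max_right _ _).trans_lt hk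
      rw [div_le_iff₀ (by positivity)]
      rw [div_lt_iff₀ h1] at h2
      nlinarith
    rw [hJ]; simp only
    rw [h0, zero_mul]
  rw [he] at hlim
  exact le_of_tendsto hlim.norm (Eventually.of_forall fun k =>
    hb K hK hK1 h hh hs I hI hhI D hD Θ hΘ M ψ hψM hψ R hR (Q k) (hQc k) (hQh k))

end SelfSimilar

namespace SelfSimilar

/-! ### Growth of the Fourier transform of the solution -/

variable {n : ℕ} {u : ℝ → 𝓢'(Rn n, ℂ)} {a₀ : ℝ} {a : ℝ → ℝ} {u₀ : Rn n → ℂ} {β s : ℝ}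
  {κ T : ℕ → ℝ} {u_inf : ℝ → 𝓢'(Rn n, ℂ)}

theorem wt_mono {s s' : ℝ} (h : s ≤ s') (ξ : Rn n) : wt s ξ ≤ wt s' ξ :=
  Real.rpow_le_rpow_of_exponent_le (by nlinarith [sq_nonneg ‖ξ‖]) (by linarith)

theorem wt_add (s s' : ℝ) (ξ : Rn n) : wt (s + s') ξ = wt s ξ * wt s' ξ := by
  unfold wt
  rw [← Real.rpow_add (by positivity)]
  congr 1; ring

theorem exists_lintegral_enorm_mul_wt_le (n : ℕ) (s : ℝ) : ∃ N : ℝ, 0 ≤ N ∧ ∃ C : ℝ≥0,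
    ∀ m : Rn n → ℂ, AEStronglyMeasurable m →
      ∫⁻ ξ, ‖m ξ‖ₑ * ENNReal.ofReal (wt (-N) ξ) ≤ C * eLpNorm (wtd s m) 2 volume := by
  -- Large enough for the weight of order `-N - s` to be square integrable; the bound is then the
  -- Cauchy–Schwarz inequality.
  set N : ℝ := |s| + n + 1 with hN
  have hL : MemLp (fun ξ : Rn n => wt (-N - s) ξ) 2 := by
    rw [memLp_two_iff_integrable_sq (continuous_wt _).aestronglyMeasurable]
    have h1 : (Module.finrank ℝ (Rn n) : ℝ) < 2 * (N + s) := by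
      rw [finrank_euclideanSpace_fin, hN]
      have := neg_abs_le s
      have : (0 : ℝ) ≤ n := by positivity
      linarith
    refine (integrable_rpow_neg_one_add_norm_sq (E := Rn n) (μ := volume) h1).congr
      (Eventually.of_forall fun ξ => ?_)
    simp only
    rw [wt, ← Real.rpow_mul_natCast (by positivity)]
    congr 1; push_cast; ring
  refine ⟨N, by positivity, (eLpNorm (fun ξ : Rn n => wt (-N - s) ξ) 2 volume).toNNReal,
    fun m hm => ?_⟩
  rw [ENNReal.coe_toNNReal hL.2.ne]
  refine le_trans (le_of_eq ?_) (eLpNorm_smul_le_mul_eLpNorm (r := 1)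
    (aestronglyMeasurable_wtd (s := s) hm) hL.1)
  rw [eLpNorm_one_eq_lintegral_enorm]
  refine lintegral_congr fun ξ => ?_
  rw [Pi.smul_apply', enorm_smul, wtd, enorm_mul, ← ofReal_norm (wt (-N - s) ξ),
    ← ofReal_norm ((wt s ξ : ℂ)), Complex.norm_real, Real.norm_of_nonneg (wt_pos _ _).le,
    Real.norm_of_nonneg (wt_pos _ _).le, ← mul_assoc, ← ENNReal.ofReal_mul (wt_pos _ _).le,
    ← wt_add, mul_comm]
  congr 3; ring

/-- With the order lowered to `-|s|`, undoing a dilation by `k ≥ 1` costs at most the power `k ^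
|s|`; the Jacobian only helps. -/
theorem eLpNorm_wtd_le_comp_smul (s : ℝ) {k : ℝ} (hk : 1 ≤ k) (m : Rn n → ℂ) :
    eLpNorm (wtd (-|s|) m) 2 volume
      ≤ ENNReal.ofReal (k ^ |s|) * eLpNorm (wtd s fun ξ => m (k⁻¹ • ξ)) 2 volume := by
  have hk0 : 0 < k := by linarith
  have h1 : eLpNorm (wtd (-|s|) m) 2 volume ≤ ENNReal.ofReal (k ^ |s|) *
      eLpNorm (fun η => wtd s (fun ξ => m (k⁻¹ • ξ)) (k⁻¹⁻¹ • η)) 2 volume := by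
    refine eLpNorm_le_mul_eLpNorm_of_ae_le_mul (Eventually.of_forall fun ξ => ?_) 2
    rw [wtd, wtd, norm_mul, norm_mul, Complex.norm_real, Complex.norm_real,
      Real.norm_of_nonneg (wt_pos _ _).le, Real.norm_of_nonneg (wt_pos _ _).le, ← mul_assoc,
      inv_inv, inv_smul_smul₀ hk0.ne']
    refine mul_le_mul_of_nonneg_right ?_ (norm_nonneg _)
    refine le_trans ?_ (mul_le_mul_of_nonneg_left (wt_mono (neg_abs_le s) (k • ξ)) (by positivity))
    unfold wt
    rw [norm_smul, mul_pow, Real.norm_of_nonneg hk0.le]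
    have h2 : 1 + k ^ 2 * ‖ξ‖ ^ 2 ≤ k ^ 2 * (1 + ‖ξ‖ ^ 2) := by nlinarith
    have h3 := Real.rpow_le_rpow_of_nonpos (by positivity) h2
      (by linarith [abs_nonneg s] : -|s| / 2 ≤ 0)
    refine le_trans (le_of_eq ?_) (mul_le_mul_of_nonneg_left h3 (by positivity))
    rw [Real.mul_rpow (by positivity) (by positivity), ← Real.rpow_natCast k 2,
      ← Real.rpow_mul hk0.le, ← mul_assoc, ← Real.rpow_add hk0]
    norm_num [mul_div_cancel₀]
  refine h1.trans ?_
  rw [eLpNorm_comp_smul (inv_pos.2 hk0)]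
  gcongr
  refine mul_le_of_le_one_left' (ENNReal.rpow_le_one ?_ (by norm_num))
  exact ENNReal.ofReal_le_one.2 (pow_le_one₀ (by positivity) (inv_le_one_of_one_le₀ hk))

namespace IsLimitAlong

/-- The bound on the rescaled solution over the unit time interval, transferred back to the original
variables: a bound on all of `(0, T j)` that is polynomial in the spatial scale. -/
theorem exists_eLpNorm_explicit_le (h : IsLimitAlong a₀ a β u₀ u s κ T u_inf) : ∃ C : ℝ≥0,
    ∀ᶠ j in atTop, ∀ᵐ t ∂volume.restrict (Ioo 0 (T j)),
      eLpNorm (wtd (-|s|) fun ξ => (resolvent (kern a₀ a) (symb ξ) t : ℂ) * 𝓕 u₀ ξ) 2 volume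
        ≤ ENNReal.ofReal (κ j ^ |s|) * C := by
  obtain ⟨C, hC⟩ := h.conv.2 1
  refine ⟨C, ?_⟩
  filter_upwards [hC, h.space.eventually_ge_atTop 1, h.time.eventually_gt_atTop 0] with j h1 h2 h3
  have h5 := ae_Ioo_of_comp_mul h3 (p := fun t =>
    eLpNorm (wtd (-|s|) fun ξ => (resolvent (kern a₀ a) (symb ξ) t : ℂ) * 𝓕 u₀ ξ) 2 volume
        ≤ ENNReal.ofReal (κ j ^ |s|) * C) (M := 1) ?_
  · simpa using h5
  filter_upwards [h1, ae_Ioo_of_ae_Ioi (ae_Ioi_comp_mul h.fourier h3) 1] with t h6 h7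
  have h8 := (h7.dilate (by linarith : 0 < κ j)).eSobolevNorm_eq s
  refine (eLpNorm_wtd_le_comp_smul s h2 _).trans (mul_le_mul_right ?_ _)
  rw [← h8]; exact h6

/-- At an arbitrary scale `S` the needed time interval lies inside `(0, T j)` for some `j`. The
constant depends on `S`, so this yields integrability at each scale but no uniform control of the
tails. -/
theorem exists_lintegral_prof_le (h : IsLimitAlong a₀ a β u₀ u s κ T u_inf) : ∃ N : ℝ, 0 ≤ N ∧
    ∀ M : ℝ, ∀ᶠ S in atTop, ∃ C : ℝ≥0, ∀ᵐ t ∂volume.restrict (Ioo 0 M),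
      ∫⁻ ξ, ‖prof a₀ a β u₀ (scale a₀ a β S) S t ξ‖ₑ * ENNReal.ofReal (wt (-N) ξ) ≤ C := by
  obtain ⟨N, hN, C₁, hC₁⟩ := exists_lintegral_enorm_mul_wt_le n (-|s|)
  obtain ⟨C₂, hC₂⟩ := h.exists_eLpNorm_explicit_le
  refine ⟨N, hN, fun M => ?_⟩
  filter_upwards [resolvent_scaledKernel h.regVar h.index.1, scale_sq h.regVar h.index.1,
    eventually_gt_atTop 0] with S hr ⟨_, hs, _⟩ hS
  obtain ⟨j, hj, hTj⟩ := (hC₂.and (h.time.eventually_ge_atTop (S * M))).exists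
  obtain ⟨D, hD⟩ := exists_eLpNorm_dilate_le (n := n) (-|s|) (B := scale a₀ a β S) hs
  refine ⟨C₁ * (D * ((κ j ^ |s|).toNNReal * C₂)), ?_⟩
  have h1 := ae_restrict_of_ae_restrict_of_subset (Ioo_subset_Ioo_right hTj) hj
  have h2 : ∀ᵐ t ∂volume.restrict (Ioo 0 M), eLpNorm (wtd (-|s|) fun ξ =>
      (resolvent (kern a₀ a) (symb ξ) (S * t) : ℂ) * 𝓕 u₀ ξ) 2 volume
        ≤ ENNReal.ofReal (κ j ^ |s|) * C₂ := by
    have := ae_Ioo_of_comp_mul (inv_pos.2 hS) (M := S * M) (p := fun t => eLpNorm (wtd (-|s|)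
      fun ξ => (resolvent (kern a₀ a) (symb ξ) (S * t) : ℂ) * 𝓕 u₀ ξ) 2 volume
        ≤ ENNReal.ofReal (κ j ^ |s|) * C₂) (by
        filter_upwards [h1] with t ht
        rwa [mul_inv_cancel_left₀ hS.ne'])
    rwa [inv_mul_cancel_left₀ hS.ne'] at this
  filter_upwards [h2] with t ht
  refine (hC₁ _ (continuous_prof_right h.admissible h.integrable β _ hS.le t).aestronglyMeasurable).trans ?_
  push_cast
  refine mul_le_mul_right (le_trans (le_of_eq ?_) ((hD _ ⟨le_rfl, le_rfl⟩ _).trans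
    (mul_le_mul_right ht _))) _
  congr 2
  ext ξ
  rw [prof, hr, symb_smul, div_self hs.ne']
  congr 3
  field_simp

end IsLimitAlong

end SelfSimilar

namespace SelfSimilar

/-! ### Resolvents do not grow exponentially at almost every frequency. -/

variable {n : ℕ} {u : ℝ → 𝓢'(Rn n, ℂ)} {a₀ : ℝ} {a : ℝ → ℝ} {u₀ : Rn n → ℂ} {β s : ℝ}
  {κ T : ℕ → ℝ} {u_inf : ℝ → 𝓢'(Rn n, ℂ)}

namespace IsLimitAlong

/-- The square of `k(T)` is `T A(T)` up to a constant and `A` grows at most linearly, so `k(T)`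
grows at most linearly; the given scale is comparable to it because the limiting ratio is positive.
-/
theorem exists_space_le (h : IsLimitAlong a₀ a β u₀ u s κ T u_inf) {c : ℝ} (hc0 : 0 < c)
    (hc : Tendsto (fun j => scale a₀ a β (T j) / κ j) atTop (𝓝 c)) :
    ∃ D : ℝ, 0 < D ∧ ∀ᶠ j in atTop, κ j ≤ D * (1 + T j) := by
  have hΓ : 0 < Real.Gamma (1 + β) := Real.Gamma_pos_of_pos (by linarith [h.index.1])
  obtain ⟨C, hC⟩ := h.admissible.isTameKernel.growth
  refine ⟨2 / c * √(|C| * Real.Gamma (1 + β)) + 1, by positivity, ?_⟩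
  filter_upwards [hc.eventually_const_lt (half_lt_self hc0), h.time.eventually_ge_atTop 0,
    h.time.eventually (scale_sq h.regVar h.index.1), h.space.eventually_gt_atTop 0]
    with j h1 h2 ⟨h3, h4, h5⟩ h6
  have h7 : scale a₀ a β (T j) ≤ √(|C| * Real.Gamma (1 + β)) * (1 + T j) := by
    refine (pow_le_pow_iff_left₀ h4.le (by positivity) two_ne_zero).1 ?_
    rw [h5, mul_pow, Real.sq_sqrt (by positivity)]
    have h8 : kern a₀ a (T j) ≤ |C| * (1 + T j) :=
      (le_abs_self _).trans ((hC _ h2).trans (by gcongr; exact le_abs_self C))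
    calc T j * (kern a₀ a (T j) * Real.Gamma (1 + β))
        ≤ (1 + T j) * (|C| * (1 + T j) * Real.Gamma (1 + β)) := by gcongr; linarith
      _ = _ := by ring
  rw [lt_div_iff₀ h6] at h1
  have h9 : κ j ≤ 2 / c * scale a₀ a β (T j) := by
    rw [div_mul_eq_mul_div, le_div_iff₀ hc0]; linarith
  calc κ j ≤ 2 / c * (√(|C| * Real.Gamma (1 + β)) * (1 + T j)) := h9.trans (by gcongr)
    _ ≤ _ := by nlinarith

theorem tendsto_exp_mul_space (h : IsLimitAlong a₀ a β u₀ u s κ T u_inf) {c : ℝ} (hc0 : 0 < c)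
    (hc : Tendsto (fun j => scale a₀ a β (T j) / κ j) atTop (𝓝 c)) {δ : ℝ} (hδ : 0 < δ) {p : ℝ}
    (hp : 0 ≤ p) : Tendsto (fun j => Real.exp (-δ * T j) * (κ j ^ p * T j)) atTop (𝓝 0) := by
  obtain ⟨D, hD, hDle⟩ := h.exists_space_le hc0 hc
  have h1 : Tendsto (fun j => Real.exp δ * D ^ p *
      ((1 + T j) ^ (p + 1) * Real.exp (-δ * (1 + T j)))) atTop (𝓝 0) := by
    simpa using ((tendsto_rpow_mul_exp_neg_mul_atTop_nhds_zero (p + 1) δ hδ).comp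
      (tendsto_atTop_add_const_left _ 1 h.time)).const_mul (Real.exp δ * D ^ p)
  refine squeeze_zero' ?_ ?_ h1
  · filter_upwards [h.time.eventually_ge_atTop 0, h.space.eventually_ge_atTop 0] with j h2 h3
    positivity
  · filter_upwards [h.time.eventually_ge_atTop 0, h.space.eventually_ge_atTop 0, hDle]
      with j h2 h3 h4
    have h5 : κ j ^ p * T j ≤ D ^ p * (1 + T j) ^ (p + 1) := by
      rw [Real.rpow_add (by positivity), Real.rpow_one, ← mul_assoc,
        ← Real.mul_rpow hD.le (by positivity)]
      gcongr
      linarith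
    calc _ ≤ Real.exp (-δ * T j) * (D ^ p * (1 + T j) ^ (p + 1)) := by gcongr
      _ = _ := by
        rw [show -δ * T j = δ + -δ * (1 + T j) by ring, Real.exp_add]; ring

theorem continuous_explicit (ha : IsAdmissibleKernel a₀ a) (hu₀ : Integrable u₀) :
    Continuous fun p : Rn n × ℝ => (resolvent (kern a₀ a) (symb p.1) p.2 : ℂ) * 𝓕 u₀ p.1 :=
  (Complex.continuous_ofReal.comp ((continuous_resolvent
    ha.isTameKernel.integrableOn_Ioc).comp (g := fun _ : ℝ × ℝ => _)
    (f := fun p : Rn n × ℝ => (symb p.1, p.2)) ((continuous_symb.comp continuous_fst).prodMk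
      continuous_snd))).mul ((continuous_fourier_of_integrable hu₀).comp continuous_fst)

theorem measurable_explicit (ha : IsAdmissibleKernel a₀ a) (hu₀ : Integrable u₀) (N : ℝ) :
    Measurable fun p : Rn n × ℝ =>
      ‖(resolvent (kern a₀ a) (symb p.1) p.2 : ℂ) * 𝓕 u₀ p.1‖ₑ * ENNReal.ofReal (wt (-N) p.1) :=
  (continuous_explicit ha hu₀).measurable.enorm.mul
    (((continuous_wt (-N)).comp continuous_fst).measurable.ennreal_ofReal)

/-- The truncated weighted mass of the explicit Fourier transform. -/
theorem tendsto_lintegral_truncated (h : IsLimitAlong a₀ a β u₀ u s κ T u_inf) {c : ℝ}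
    (hc0 : 0 < c) (hc : Tendsto (fun j => scale a₀ a β (T j) / κ j) atTop (𝓝 c)) {N : ℝ} {C₁ : ℝ≥0}
    (hC₁ : ∀ m : Rn n → ℂ, AEStronglyMeasurable m →
      ∫⁻ ξ, ‖m ξ‖ₑ * ENNReal.ofReal (wt (-N) ξ) ≤ C₁ * eLpNorm (wtd (-|s|) m) 2 volume)
    {δ : ℝ} (hδ : 0 < δ) :
    Tendsto (fun j => ∫⁻ ξ : Rn n, ENNReal.ofReal (Real.exp (-δ * T j)) *
      ∫⁻ t in Ioo 0 (T j), ‖(resolvent (kern a₀ a) (symb ξ) t : ℂ) * 𝓕 u₀ ξ‖ₑ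
        * ENNReal.ofReal (wt (-N) ξ)) atTop (𝓝 0) := by
  have hcont := continuous_explicit h.admissible h.integrable
  have hmeas := measurable_explicit h.admissible h.integrable N
  obtain ⟨C₂, hC₂⟩ := h.exists_eLpNorm_explicit_le
  have h1 : Tendsto (fun j => (C₁ * C₂ : ℝ≥0∞) * ENNReal.ofReal
      (Real.exp (-δ * T j) * (κ j ^ |s| * T j))) atTop (𝓝 0) := by
    have := ENNReal.Tendsto.const_mul (a := (C₁ * C₂ : ℝ≥0∞)) (ENNReal.tendsto_ofReal
      (h.tendsto_exp_mul_space hc0 hc hδ (abs_nonneg s))) (Or.inr (by finiteness))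
    simpa using this
  refine tendsto_of_tendsto_of_tendsto_of_le_of_le' tendsto_const_nhds h1
    (Eventually.of_forall fun j => bot_le) ?_
  filter_upwards [hC₂, h.space.eventually_ge_atTop 0] with j h2 h3
  rw [lintegral_const_mul _ hmeas.lintegral_prod_right', lintegral_lintegral_swap hmeas.aemeasurable,
    ENNReal.ofReal_mul (Real.exp_pos _).le, mul_left_comm]
  refine mul_le_mul_right ?_ _
  calc ∫⁻ t in Ioo 0 (T j), ∫⁻ ξ : Rn n, ‖(resolvent (kern a₀ a) (symb ξ) t : ℂ) * 𝓕 u₀ ξ‖ₑ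
        * ENNReal.ofReal (wt (-N) ξ)
      ≤ ∫⁻ t in Ioo 0 (T j), C₁ * (ENNReal.ofReal (κ j ^ |s|) * C₂) := by
        refine lintegral_mono_ae ?_
        filter_upwards [h2] with t ht
        refine (hC₁ _ (hcont.comp (Continuous.prodMk_left t)).aestronglyMeasurable).trans ?_
        exact mul_le_mul_right ht _
    _ = _ := by
        rw [lintegral_const, Measure.restrict_apply_univ, Real.volume_Ioo, sub_zero,
          ENNReal.ofReal_mul (by positivity)]
        ring

/-- The exponentially damped time integrals, integrated over the frequencies, tend to zero along `T
j`. By Fatou's lemma their lower limits vanish for almost every frequency, simultaneously for the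
countably many rates `1 / (k + 1)`. Where `𝓕 u₀` does not vanish it can be divided out. -/
theorem ae_isSubexponential (h : IsLimitAlong a₀ a β u₀ u s κ T u_inf) {c : ℝ}
    (hc0 : 0 < c) (hc : Tendsto (fun j => scale a₀ a β (T j) / κ j) atTop (𝓝 c)) :
    ∀ᵐ ξ : Rn n, 𝓕 u₀ ξ ≠ 0 → IsSubexponential (kern a₀ a) (symb ξ) := by
  obtain ⟨N, hN, C₁, hC₁⟩ := exists_lintegral_enorm_mul_wt_le n (-|s|)
  have hcontr := fun lam => continuous_resolvent_right h.admissible.isTameKernel.integrableOn_Ioc lam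
  set F : ℕ → ℕ → Rn n → ℝ≥0∞ := fun k j ξ =>
    ENNReal.ofReal (Real.exp (-(1 / ((k : ℝ) + 1)) * T j)) *
      ∫⁻ t in Ioo 0 (T j), ‖(resolvent (kern a₀ a) (symb ξ) t : ℂ) * 𝓕 u₀ ξ‖ₑ
        * ENNReal.ofReal (wt (-N) ξ) with hF
  have hFe : ∀ k j ξ, F k j ξ = ENNReal.ofReal (Real.exp (-(1 / ((k : ℝ) + 1)) * T j) *
      ∫ t in Ioc 0 (T j), |resolvent (kern a₀ a) (symb ξ) t|)
        * (‖𝓕 u₀ ξ‖ₑ * ENNReal.ofReal (wt (-N) ξ)) := fun k j ξ => by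
    simp only [hF, enorm_mul]
    rw [lintegral_mul_const' _ _ ENNReal.ofReal_ne_top, lintegral_mul_const' _ _ enorm_ne_top,
      ENNReal.ofReal_mul (Real.exp_pos _).le, integral_Ioc_eq_integral_Ioo,
      show (∫⁻ t in Ioo 0 (T j), ‖(resolvent (kern a₀ a) (symb ξ) t : ℂ)‖ₑ)
        = ∫⁻ t in Ioo 0 (T j), ‖resolvent (kern a₀ a) (symb ξ) t‖ₑ from
        lintegral_congr fun t => by rw [← ofReal_norm, Complex.norm_real, ofReal_norm],
      ← ofReal_integral_norm_eq_lintegral_enorm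
        ((hcontr _).integrableOn_Icc.mono_set Ioo_subset_Icc_self)]
    simp only [Real.norm_eq_abs]
    ring
  have hmeas : ∀ k j, Measurable (F k j) := fun k j =>
    (measurable_explicit h.admissible h.integrable N).lintegral_prod_right'.const_mul _
  have hlim : ∀ᵐ ξ : Rn n, ∀ k, liminf (fun j => F k j ξ) atTop = 0 := ae_all_iff.2 fun k => by
    have h1 := lintegral_liminf_le (μ := (volume : Measure (Rn n))) (u := atTop) (hmeas k)
    rw [(h.tendsto_lintegral_truncated hc0 hc hC₁
      (by positivity : 0 < 1 / ((k : ℝ) + 1))).liminf_eq] at h1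
    exact (lintegral_eq_zero_iff (Measurable.liminf (hmeas k))).1 (le_antisymm h1 (bot_le))
  filter_upwards [hlim] with ξ hξ h0 δ hδ ε hε
  obtain ⟨k, hk⟩ := exists_nat_one_div_lt hδ
  set G := ‖𝓕 u₀ ξ‖ₑ * ENNReal.ofReal (wt (-N) ξ) with hG
  have hG0 : 0 < G := ENNReal.mul_pos (enorm_ne_zero.2 h0) (ENNReal.ofReal_pos.2 (wt_pos _ _)).ne'
  have hGt : G ≠ ⊤ := ENNReal.mul_ne_top enorm_ne_top ENNReal.ofReal_ne_top
  have h2 : ∃ᶠ j in atTop, F k j ξ < ENNReal.ofReal ε * G :=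
    frequently_lt_of_liminf_lt (by isBoundedDefault)
      (by rw [hξ k]; exact ENNReal.mul_pos (ENNReal.ofReal_pos.2 hε).ne' hG0.ne')
  refine h.time.frequently ((h2.and_eventually (h.time.eventually_ge_atTop 0)).mono
    fun j ⟨h3, h4⟩ => ?_)
  rw [hFe, ENNReal.mul_lt_mul_iff_left hG0.ne' hGt, ENNReal.ofReal_lt_ofReal_iff hε] at h3
  refine lt_of_le_of_lt ?_ h3
  have : 0 ≤ ∫ t in Ioc 0 (T j), |resolvent (kern a₀ a) (symb ξ) t| :=
    integral_nonneg fun t => abs_nonneg _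
  gcongr

theorem eventually_ae_isSubexponential (h : IsLimitAlong a₀ a β u₀ u s κ T u_inf) {c : ℝ}
    (hc0 : 0 < c) (hc : Tendsto (fun j => scale a₀ a β (T j) / κ j) atTop (𝓝 c)) :
    ∀ᶠ S in atTop, ∀ᵐ ξ : Rn n, 𝓕 u₀ ((scale a₀ a β S)⁻¹ • ξ) ≠ 0 →
      IsSubexponential (scaledKernel (kern a₀ a) β S) (symb ξ) := by
  filter_upwards [resolvent_scaledKernel h.regVar h.index.1, scale_sq h.regVar h.index.1,
    eventually_gt_atTop 0] with S hr ⟨_, hs, _⟩ hS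
  filter_upwards [(Measure.quasiMeasurePreserving_smul (volume : Measure (Rn n))
    (inv_ne_zero hs.ne')).ae (h.ae_isSubexponential hc0 hc)] with ξ hξ h0
  refine (hξ h0).comp_mul hS fun t => ?_
  rw [hr, symb_smul]
  congr 1
  field_simp

end IsLimitAlong

end SelfSimilar

namespace SelfSimilar

/-! ### Fourier transforms of space-time test functions -/

variable {n : ℕ}

namespace SpaceTimeTest

/-- The spatial Fourier transform `ψ(ξ, t)` of a test function. -/
noncomputable def spatial (Φ : SpaceTimeTest n) (ξ : Rn n) (t : ℝ) : ℂ :=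
  (𝓕⁻ (Φ.slice t) : 𝓢(Rn n, ℂ)) ξ

theorem spatial_eq (Φ : SpaceTimeTest n) (ξ : Rn n) (t : ℝ) :
    Φ.spatial ξ t = ∫ x, Real.fourierChar (inner ℝ x ξ) • Φ.toFun (x, t) := by
  rw [spatial, SchwartzMap.fourierInv_coe, Real.fourierInv_eq]
  rfl

theorem continuous_spatial (Φ : SpaceTimeTest n) :
    Continuous fun p : Rn n × ℝ => Φ.spatial p.1 p.2 := by
  have hQ : IsCompact (Prod.fst '' tsupport Φ.toFun) := Φ.compact.isCompact.image continuous_fst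
  have h0 : Continuous (Function.uncurry fun (p : Rn n × ℝ) (x : Rn n) =>
      Real.fourierChar (inner ℝ x p.1) • Φ.toFun (x, p.2)) := by
    have := Φ.smooth.continuous
    have := Real.continuous_fourierChar
    simp only [Function.uncurry_def, Circle.smul_def]
    fun_prop
  refine (continuous_parametric_integral_of_continuous (μ := volume) h0 hQ).congr fun p => ?_
  rw [spatial_eq]
  refine setIntegral_eq_integral_of_forall_compl_eq_zero fun x hx => ?_
  rw [image_eq_zero_of_notMem_tsupport (fun h => hx ⟨_, h, rfl⟩), smul_zero]

theorem slice_eq_zero (Φ : SpaceTimeTest n) {t : ℝ} (ht : ∀ p ∈ tsupport Φ.toFun, p.2 ≠ t) :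
    Φ.slice t = 0 := by
  ext x
  exact image_eq_zero_of_notMem_tsupport (f := Φ.toFun) (x := (x, t)) (fun h => ht _ h rfl)

theorem exists_slice_eq_zero (Φ : SpaceTimeTest n) :
    ∃ M : ℝ, 0 < M ∧ ∀ t, M ≤ |t| → Φ.slice t = 0 := by
  obtain ⟨M, hM⟩ := (Φ.compact.isCompact.image continuous_snd).isBounded.exists_norm_le
  refine ⟨|M| + 1, by positivity, fun t ht => Φ.slice_eq_zero fun p hp h => ?_⟩
  have := hM _ ⟨p, hp, rfl⟩
  rw [h, Real.norm_eq_abs] at this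
  linarith [le_abs_self M]

theorem spatial_eq_zero (Φ : SpaceTimeTest n) {t : ℝ} (h : Φ.slice t = 0) (ξ : Rn n) :
    Φ.spatial ξ t = 0 := by
  rw [spatial_eq]
  simp [← slice_apply, h]

/-- The test function `e^t Φ(x, t)`, on the Euclidean space-time. -/
noncomputable def expWeighted (Φ : SpaceTimeTest n) : 𝓢(WithLp 2 (Rn n × ℝ), ℂ) :=
  HasCompactSupport.toSchwartzMap
    (f := fun p : WithLp 2 (Rn n × ℝ) => (Real.exp p.ofLp.2 : ℂ) * Φ.toFun p.ofLp)
    ((Φ.compact.comp_homeomorph (WithLp.prodContinuousLinearEquiv 2 ℝ (Rn n) ℝ).toHomeomorph).mul_left)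
    (by
      have h1 : ContDiff ℝ ∞ (fun p : WithLp 2 (Rn n × ℝ) => p.ofLp) :=
        (WithLp.prodContinuousLinearEquiv 2 ℝ (Rn n) ℝ).contDiff
      exact (Complex.ofRealCLM.contDiff.comp (Real.contDiff_exp.comp (contDiff_snd.comp h1))).mul
        (Φ.smooth.comp h1))

/-- The space-time Fourier transform of `e^t Φ(x, t)`. -/
noncomputable def spaceTime (Φ : SpaceTimeTest n) (ξ : Rn n) (y : ℝ) : ℂ :=
  (𝓕⁻ Φ.expWeighted : 𝓢(WithLp 2 (Rn n × ℝ), ℂ)) (WithLp.toLp 2 (ξ, y))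

theorem continuous_spaceTime (Φ : SpaceTimeTest n) :
    Continuous fun p : Rn n × ℝ => Φ.spaceTime p.1 p.2 :=
  (SchwartzMap.continuous _).comp (WithLp.prod_continuous_toLp 2 (Rn n) ℝ)

theorem exists_norm_spaceTime_le (Φ : SpaceTimeTest n) (m : ℕ) : ∃ D : ℝ, 0 < D ∧ ∀ ξ y,
    ‖Φ.spaceTime ξ y‖ ≤ D * ((1 + ‖ξ‖) ^ m)⁻¹ * ((1 + y ^ 2) ^ 2)⁻¹ := by
  set D := 2 ^ (m + 4) * (Finset.Iic (m + 4, 0)).sup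
    (fun m => SchwartzMap.seminorm ℝ m.1 m.2) (𝓕⁻ Φ.expWeighted : 𝓢(WithLp 2 (Rn n × ℝ), ℂ))
  have hD : 0 ≤ D := by positivity
  refine ⟨D + 1, by positivity, fun ξ y => ?_⟩
  have h1 := SchwartzMap.one_add_le_sup_seminorm_apply (𝕜 := ℝ) (m := (m + 4, 0)) le_rfl le_rfl
    (𝓕⁻ Φ.expWeighted : 𝓢(WithLp 2 (Rn n × ℝ), ℂ)) (WithLp.toLp 2 (ξ, y))
  rw [norm_iteratedFDeriv_zero] at h1
  have h2 : ‖ξ‖ ≤ ‖WithLp.toLp 2 (ξ, y)‖ := WithLp.norm_fst_le _ (WithLp.toLp 2 (ξ, y))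
  have h3 : |y| ≤ ‖WithLp.toLp 2 (ξ, y)‖ := WithLp.norm_snd_le _ (WithLp.toLp 2 (ξ, y))
  set q := ‖WithLp.toLp 2 (ξ, y)‖
  rw [mul_assoc, ← mul_inv, ← div_eq_mul_inv, le_div_iff₀ (by positivity), mul_comm]
  have h4 : 1 + y ^ 2 ≤ (1 + q) ^ 2 := by
    rw [← sq_abs y]; nlinarith [abs_nonneg y]
  calc (1 + ‖ξ‖) ^ m * (1 + y ^ 2) ^ 2 * ‖Φ.spaceTime ξ y‖
      ≤ (1 + q) ^ m * ((1 + q) ^ 2) ^ 2 * ‖Φ.spaceTime ξ y‖ := by gcongr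
    _ = (1 + q) ^ (m + 4) * ‖Φ.spaceTime ξ y‖ := by ring
    _ ≤ D := h1
    _ ≤ D + 1 := by linarith

theorem exists_isDecaying (Φ : SpaceTimeTest n) : ∃ D : ℝ, 0 < D ∧ IsDecaying D Φ.spaceTime := by
  obtain ⟨D, hD, h⟩ := Φ.exists_norm_spaceTime_le (n + 5)
  refine ⟨D, hD, Φ.continuous_spaceTime, fun ξ y => ?_⟩
  rw [Real.rpow_neg (by positivity), show (n : ℝ) + 5 = ((n + 5 : ℕ) : ℝ) by push_cast; ring,
    Real.rpow_natCast]
  exact h ξ y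

/-- Fubini's theorem splits the space-time transform into the spatial transform followed by the one
in time. -/
theorem spaceTime_eq (Φ : SpaceTimeTest n) (ξ : Rn n) (y : ℝ) :
    Φ.spaceTime ξ y = 𝓕⁻ (fun t : ℝ => (Real.exp t : ℂ) * Φ.spatial ξ t) y := by
  rw [spaceTime, SchwartzMap.fourierInv_coe, Real.fourierInv_eq, Real.fourierInv_eq,
    ← (WithLp.volume_preserving_toLp (Rn n) ℝ).integral_comp
      (MeasurableEquiv.toLp 2 (Rn n × ℝ)).measurableEmbedding]
  have hint : Integrable (fun p : Rn n × ℝ => Real.fourierChar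
      (inner ℝ (WithLp.toLp 2 p) (WithLp.toLp 2 (ξ, y))) • Φ.expWeighted (WithLp.toLp 2 p))
      (volume.prod volume) := by
    have h1 : Integrable (fun p : WithLp 2 (Rn n × ℝ) => Real.fourierChar
      (inner ℝ p (WithLp.toLp 2 (ξ, y))) • Φ.expWeighted p) := by
      refine (Real.fourierIntegral_convergent_iff (μ := volume) (f := Φ.expWeighted)
        (-WithLp.toLp 2 (ξ, y))).2 (SchwartzMap.integrable _) |>.congr (Eventually.of_forall fun p => ?_)
      simp
    exact (WithLp.volume_preserving_toLp (Rn n) ℝ).integrable_comp_of_integrable h1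
  rw [Measure.volume_eq_prod, integral_prod_symm _ hint]
  congr 1; ext t
  rw [spatial_eq, ← integral_const_mul, Circle.smul_def, smul_eq_mul, ← integral_const_mul]
  congr 1; ext x
  change Real.fourierChar (inner ℝ (WithLp.toLp 2 (x, t)) (WithLp.toLp 2 (ξ, y))) •
    ((Real.exp t : ℂ) * Φ.toFun (x, t)) = _
  rw [WithLp.prod_inner_apply]
  simp only [Circle.smul_def, AddChar.map_add_eq_mul, Circle.coe_mul, smul_eq_mul]
  ring

/-- Fourier inversion in time. The weight `exp t` built into the transform shifts the frequencies to
the line `Re z = 1`, where Laplace transforms of the kernels converge. -/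
theorem spatial_eq_integral (Φ : SpaceTimeTest n) (ξ : Rn n) (t : ℝ) :
    Φ.spatial ξ t = ∫ y, Φ.spaceTime ξ y * Complex.exp (-lineAt y * t) := by
  set f : ℝ → ℂ := fun t => (Real.exp t : ℂ) * Φ.spatial ξ t with hf
  have hc : Continuous f := by
    have := Φ.continuous_spatial.comp (Continuous.prodMk_right ξ)
    exact (Complex.continuous_ofReal.comp Real.continuous_exp).mul this
  obtain ⟨M, -, hM⟩ := Φ.exists_slice_eq_zero
  have hs : HasCompactSupport f := by
    refine HasCompactSupport.intro (isCompact_Icc (a := -M) (b := M)) fun t ht => ?_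
    have : M ≤ |t| := by
      by_contra! h
      exact ht ⟨(abs_lt.1 h).1.le, (abs_lt.1 h).2.le⟩
    rw [hf]; simp only
    rw [Φ.spatial_eq_zero (hM t this), mul_zero]
  have hinv : 𝓕⁻ f = Φ.spaceTime ξ := by
    ext y; rw [spaceTime_eq]
  obtain ⟨D, hD, hdec⟩ := Φ.exists_isDecaying
  have hint : Integrable (𝓕 f) := by
    have h1 := (hdec.integrable ξ).comp_neg
    refine h1.congr (Eventually.of_forall fun y => ?_)
    simp only
    rw [← hinv, Real.fourierInv_eq_fourier_neg, neg_neg]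
  have h2 := congrFun (hc.fourier_fourierInv_eq (hc.integrable_of_hasCompactSupport hs) hint) t
  rw [hinv, Real.fourier_eq'] at h2
  have h3 : Φ.spatial ξ t = Complex.exp (-t) * f t := by
    rw [hf]; simp only
    rw [Complex.ofReal_exp, ← mul_assoc, ← Complex.exp_add]; simp
  rw [h3, ← h2, ← integral_const_mul]
  congr 1; ext y
  rw [smul_eq_mul, ← mul_assoc, ← Complex.exp_add, mul_comm, lineAt]
  congr 2
  simp
  ring

theorem exists_norm_spatial_le (Φ : SpaceTimeTest n) (N : ℝ) : ∃ C : ℝ, 0 ≤ C ∧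
    ∀ ξ t, 0 ≤ t → ‖Φ.spatial ξ t‖ ≤ C * wt (-N) ξ := by
  obtain ⟨m, hm⟩ := exists_nat_ge |N|
  obtain ⟨D, hD, h⟩ := Φ.exists_norm_spaceTime_le m
  have hI := integrable_inv_sq_one_add_sq
  refine ⟨D * ∫ y : ℝ, ((1 + y ^ 2) ^ 2)⁻¹, by positivity, fun ξ t ht => ?_⟩
  have h1 : ((1 + ‖ξ‖) ^ m)⁻¹ ≤ wt (-N) ξ := by
    refine le_trans ?_ (wt_mono (s := -m) (by linarith [le_abs_self N]) ξ)
    unfold wt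
    rw [← Real.rpow_natCast, ← Real.rpow_neg (by positivity)]
    have h2 : 1 + ‖ξ‖ ^ 2 ≤ (1 + ‖ξ‖) ^ (2 : ℝ) := by
      rw [Real.rpow_two]; nlinarith [norm_nonneg ξ]
    refine le_trans (le_of_eq ?_) (Real.rpow_le_rpow_of_nonpos (by positivity) h2
      (by linarith [(Nat.cast_nonneg m : (0 : ℝ) ≤ m)]))
    rw [← Real.rpow_mul (by positivity)]
    congr 1; ring
  rw [spatial_eq_integral]
  refine (norm_integral_le_of_norm_le (hI.const_mul (D * wt (-N) ξ))
    (Eventually.of_forall fun y => ?_)).trans (le_of_eq ?_)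
  · rw [norm_mul, norm_cexp_neg_mul, lineAt_re]
    have : Real.exp (-1 * t) ≤ 1 := Real.exp_le_one_iff.2 (by linarith)
    calc _ ≤ ‖Φ.spaceTime ξ y‖ * 1 := by gcongr
      _ ≤ D * ((1 + ‖ξ‖) ^ m)⁻¹ * ((1 + y ^ 2) ^ 2)⁻¹ := by rw [mul_one]; exact h ξ y
      _ ≤ _ := by gcongr
  · rw [integral_const_mul]; ring

end SpaceTimeTest

end SelfSimilar

namespace SelfSimilar

/-! ### Convergence in the sense of distributions -/

variable {n : ℕ}

theorem SpaceTimeTest.continuous_spatial_swap (Φ : SpaceTimeTest n) :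
    Continuous fun p : ℝ × Rn n => Φ.spatial p.2 p.1 :=
  Φ.continuous_spatial.comp (g := fun q : Rn n × ℝ => Φ.spatial q.1 q.2)
    (f := fun p : ℝ × Rn n => (p.2, p.1)) (continuous_snd.prodMk continuous_fst)

theorem SpaceTimeTest.integrable_prod_mul_spatial (Φ : SpaceTimeTest n) {F : ℝ × Rn n → ℂ}
    (hF : Continuous F) {N M : ℝ} {C : ℝ≥0} (hb : ∀ᵐ t ∂volume.restrict (Ioo 0 M),
      ∫⁻ ξ, ‖F (t, ξ)‖ₑ * ENNReal.ofReal (wt (-N) ξ) ≤ C) :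
    Integrable (fun p : ℝ × Rn n => F p * Φ.spatial p.2 p.1)
      ((volume.restrict (Ioo 0 M)).prod volume) := by
  obtain ⟨D, hD, h⟩ := Φ.exists_norm_spatial_le N
  have hc : Continuous fun p : ℝ × Rn n => F p * Φ.spatial p.2 p.1 :=
    hF.mul Φ.continuous_spatial_swap
  refine ⟨hc.aestronglyMeasurable, ?_⟩
  rw [hasFiniteIntegral_iff_enorm, lintegral_prod _ hc.measurable.enorm.aemeasurable]
  refine lt_of_le_of_lt (lintegral_mono_ae (g := fun _ => ENNReal.ofReal D * C) ?_) ?_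
  · filter_upwards [hb, ae_restrict_mem measurableSet_Ioo] with t ht htm
    refine le_trans ?_ (mul_le_mul_right ht (ENNReal.ofReal D))
    rw [← lintegral_const_mul' _ _ ENNReal.ofReal_ne_top]
    refine lintegral_mono fun ξ => ?_
    simp only
    rw [enorm_mul, mul_left_comm, ← ENNReal.ofReal_mul hD, ← ofReal_norm (Φ.spatial ξ t)]
    gcongr
    exact h ξ t htm.1.le
  · rw [lintegral_const, Measure.restrict_apply_univ, Real.volume_Ioo]
    finiteness

theorem integral_integral_eq_add {M : ℝ} {G : ℝ → Rn n → ℂ}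
    (hG : Integrable (fun p : ℝ × Rn n => G p.1 p.2) ((volume.restrict (Ioo 0 M)).prod volume))
    (R : ℝ) : ∫ t in Ioo 0 M, ∫ ξ, G t ξ = (∫ t in Ioo 0 M, ∫ ξ in {ξ | R ≤ ‖ξ‖}, G t ξ)
      + ∫ t in Ioo 0 M, ∫ ξ in {ξ | R ≤ ‖ξ‖}ᶜ, G t ξ := by
  have hS : MeasurableSet {ξ : Rn n | R ≤ ‖ξ‖} := measurableSet_le measurable_const measurable_norm
  have h1 : ∀ Q : Set (Rn n), Integrable (fun p : ℝ × Rn n => G p.1 p.2)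
      ((volume.restrict (Ioo 0 M)).prod (volume.restrict Q)) := fun Q =>
    hG.mono_measure (Measure.prod_mono le_rfl Measure.restrict_le_self)
  rw [← integral_add (h1 _).integral_prod_left (h1 _).integral_prod_left]
  refine integral_congr_ae ?_
  filter_upwards [hG.prod_right_ae] with t ht
  exact (integral_add_compl hS ht).symm

/-- Tails of one fixed integrable function; this handles the limit profile, which needs no
uniformity. -/
theorem tendsto_tail {M : ℝ} {G : ℝ → Rn n → ℂ}
    (hG : Integrable (fun p : ℝ × Rn n => G p.1 p.2) ((volume.restrict (Ioo 0 M)).prod volume)) :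
    Tendsto (fun R : ℕ => ∫ t in Ioo 0 M, ∫ ξ in {ξ | (R : ℝ) ≤ ‖ξ‖}, G t ξ) atTop (𝓝 0) := by
  have h1 := tendsto_setIntegral_of_antitone (μ := (volume.restrict (Ioo 0 M)).prod volume)
    (s := fun R : ℕ => (univ : Set ℝ) ×ˢ {ξ : Rn n | (R : ℝ) ≤ ‖ξ‖})
    (f := fun p : ℝ × Rn n => G p.1 p.2)
    (fun R => MeasurableSet.univ.prod (measurableSet_le measurable_const measurable_norm))
    (fun R R' h => prod_mono_right fun ξ (hξ : (R' : ℝ) ≤ ‖ξ‖) =>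
      (Nat.cast_le.2 h).trans hξ) ⟨0, hG.integrableOn⟩
  have h2 : ⋂ R : ℕ, (univ : Set ℝ) ×ˢ {ξ : Rn n | (R : ℝ) ≤ ‖ξ‖} = ∅ := by
    refine eq_empty_of_forall_notMem fun p hp => ?_
    obtain ⟨R, hR⟩ := exists_nat_gt ‖p.2‖
    exact not_le.2 hR (mem_iInter.1 hp R).2
  rw [h2, setIntegral_empty] at h1
  refine h1.congr fun R => ?_
  rw [← Measure.prod_restrict, Measure.restrict_univ, integral_prod]
  exact hG.mono_measure (Measure.prod_mono le_rfl Measure.restrict_le_self)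

/-- The pointwise bound is used on the ball of radius `R`, where it is multiplied by the finite
volume; outside the ball the two integrals are estimated separately and no cancellation is used. -/
theorem norm_integral_sub_le {M : ℝ} (hM : 0 ≤ M) {G G' : ℝ → Rn n → ℂ}
    (hG : Integrable (fun p : ℝ × Rn n => G p.1 p.2) ((volume.restrict (Ioo 0 M)).prod volume))
    (hG' : Integrable (fun p : ℝ × Rn n => G' p.1 p.2) ((volume.restrict (Ioo 0 M)).prod volume))
    {R ε τ τ' : ℝ} (hε : 0 ≤ ε) (h : ∀ t ∈ Ioo 0 M, ∀ ξ, ‖ξ‖ ≤ R → ‖G t ξ - G' t ξ‖ ≤ ε)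
    (hτ : ‖∫ t in Ioo 0 M, ∫ ξ in {ξ | R ≤ ‖ξ‖}, G t ξ‖ ≤ τ)
    (hτ' : ‖∫ t in Ioo 0 M, ∫ ξ in {ξ | R ≤ ‖ξ‖}, G' t ξ‖ ≤ τ') :
    ‖(∫ t in Ioo 0 M, ∫ ξ, G t ξ) - ∫ t in Ioo 0 M, ∫ ξ, G' t ξ‖
      ≤ ε * (volume.real (Metric.closedBall (0 : Rn n) R) * M) + (τ + τ') := by
  set Q : Set (Rn n) := {ξ | R ≤ ‖ξ‖}ᶜ with hQ
  have hQs : Q ⊆ Metric.closedBall 0 R := fun ξ hξ => by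
    exact mem_closedBall_zero_iff.2 (not_le.1 (show ¬R ≤ ‖ξ‖ from hξ)).le
  have hQt : volume (Metric.closedBall (0 : Rn n) R) ≠ ⊤ := measure_closedBall_lt_top.ne
  have h1 : ∀ Q : Set (Rn n), ∀ {H : ℝ → Rn n → ℂ}, Integrable (fun p : ℝ × Rn n => H p.1 p.2)
      ((volume.restrict (Ioo 0 M)).prod volume) → Integrable (fun p : ℝ × Rn n => H p.1 p.2)
      ((volume.restrict (Ioo 0 M)).prod (volume.restrict Q)) := fun Q _ hH =>
    hH.mono_measure (Measure.prod_mono le_rfl Measure.restrict_le_self)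
  have h2 : ‖(∫ t in Ioo 0 M, ∫ ξ in Q, G t ξ) - ∫ t in Ioo 0 M, ∫ ξ in Q, G' t ξ‖
      ≤ ε * (volume.real (Metric.closedBall (0 : Rn n) R) * M) := by
    rw [← integral_sub (h1 Q hG).integral_prod_left (h1 Q hG').integral_prod_left]
    have h3 : ∀ᵐ t ∂volume.restrict (Ioo 0 M), ‖(∫ ξ in Q, G t ξ) - ∫ ξ in Q, G' t ξ‖
        ≤ ε * volume.real (Metric.closedBall (0 : Rn n) R) := by
      filter_upwards [(h1 Q hG).prod_right_ae, (h1 Q hG').prod_right_ae,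
        ae_restrict_mem measurableSet_Ioo] with t h4 h5 ht
      rw [← integral_sub h4 h5]
      refine (norm_setIntegral_le_of_norm_le_const ((measure_mono hQs).trans_lt hQt.lt_top)
        fun ξ hξ => h t ht ξ (mem_closedBall_zero_iff.1 (hQs hξ))).trans ?_
      exact mul_le_mul_of_nonneg_left (measureReal_mono hQs hQt) hε
    refine (norm_setIntegral_le_of_norm_le_const_ae' (by simp)
      (C := ε * volume.real (Metric.closedBall (0 : Rn n) R)) ?_).trans (le_of_eq ?_)
    · exact (ae_restrict_iff' measurableSet_Ioo).1 h3
    · rw [Real.volume_real_Ioo_of_le hM]; ring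
  rw [integral_integral_eq_add hG R, integral_integral_eq_add hG' R, add_sub_add_comm]
  refine (norm_add_le _ _).trans ?_
  rw [add_comm]
  exact add_le_add h2 ((norm_sub_le _ _).trans (add_le_add hτ hτ'))

end SelfSimilar

namespace SelfSimilar

/-! ### Low and high frequencies combined. -/

variable {n : ℕ} {u : ℝ → 𝓢'(Rn n, ℂ)} {a₀ : ℝ} {a : ℝ → ℝ} {u₀ : Rn n → ℂ} {β s : ℝ}
  {κ T : ℕ → ℝ} {u_inf : ℝ → 𝓢'(Rn n, ℂ)} {w : ℝ → 𝓢'(Rn n, ℂ)}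

/-- The space-time pairing on the Fourier side. -/
theorem integral_apply_slice {Φ : SpaceTimeTest n} {M : ℝ} (hM : ∀ t, M ≤ |t| → Φ.slice t = 0)
    {V : ℝ → 𝓢'(Rn n, ℂ)} {m : ℝ → Rn n → ℂ}
    (h : ∀ᵐ t ∂volume.restrict (Ioi (0 : ℝ)), FourierRep (V t) (m t)) :
    ∫ t in Ioi (0 : ℝ), V t (Φ.slice t) = ∫ t in Ioo 0 M, ∫ ξ, m t ξ * Φ.spatial ξ t := by
  rw [setIntegral_eq_of_subset_of_forall_sdiff_eq_zero (t := Ioi 0) measurableSet_Ioi (s := Ioo 0 M)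
    (f := fun t => V t (Φ.slice t)) (fun t ht => ht.1) fun t ht => ?_]
  · refine integral_congr_ae ?_
    filter_upwards [ae_Ioo_of_ae_Ioi h M] with t ht
    exact ht.apply_eq _
  · rw [hM t, map_zero]
    by_contra! hlt
    exact ht.2 ⟨ht.1, (le_abs_self t).trans_lt hlt⟩

namespace IsLimitAlong

theorem eventually_integrable_prof (h : IsLimitAlong a₀ a β u₀ u s κ T u_inf)
    (Φ : SpaceTimeTest n) (M : ℝ) : ∀ᶠ S in atTop, Integrable (fun p : ℝ × Rn n =>
      prof a₀ a β u₀ (scale a₀ a β S) S p.1 p.2 * Φ.spatial p.2 p.1)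
      ((volume.restrict (Ioo 0 M)).prod volume) := by
  obtain ⟨N, -, hN⟩ := h.exists_lintegral_prof_le
  filter_upwards [hN M, eventually_ge_atTop 0] with S ⟨C, hC⟩ hS
  exact Φ.integrable_prod_mul_spatial (continuous_prof h.admissible h.integrable β _ hS) hC

theorem integrable_mlProfile (h : IsLimitAlong a₀ a β u₀ u s κ T u_inf)
    (hnt : IsNontrivial u_inf) {c : ℝ} (hc0 : 0 < c)
    (hc : Tendsto (fun j => scale a₀ a β (T j) / κ j) atTop (𝓝 c)) (Φ : SpaceTimeTest n) (M : ℝ) :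
    Integrable (fun p : ℝ × Rn n => (∫ x, u₀ x) * mlProfile β p.1 p.2 * Φ.spatial p.2 p.1)
      ((volume.restrict (Ioo 0 M)).prod volume) := by
  obtain ⟨C, hC⟩ := h.exists_eLpNorm_mlProfile_le hnt hc0 hc M
  obtain ⟨N, -, C', hC'⟩ := exists_lintegral_enorm_mul_wt_le n s
  have h1 := Φ.integrable_prod_mul_spatial (continuous_mlProfile h.index.1) (N := N) (M := M)
    (C := C' * C) (by
      filter_upwards [ae_restrict_mem measurableSet_Ioo] with t ht
      refine (hC' _ (continuous_mlProfile_right h.index.1 t).aestronglyMeasurable).trans ?_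
      push_cast
      exact mul_le_mul_right (hC t ⟨ht.1.le, ht.2.le⟩) _)
  refine (h1.const_mul (∫ x, u₀ x)).congr (Eventually.of_forall fun p => ?_)
  ring

/-- The rescaled kernels fulfil the hypotheses of the uniform high-frequency estimate for all large
`S`: nonnegativity of the Laplace transform at `1` comes from its limit `1`, and subexponential
resolvents come from the given sequence by a change of time scale. -/
theorem exists_eventually_tail_le (hn : 1 ≤ n) (h : IsLimitAlong a₀ a β u₀ u s κ T u_inf)
    {c : ℝ} (hc0 : 0 < c) (hc : Tendsto (fun j => scale a₀ a β (T j) / κ j) atTop (𝓝 c))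
    (Φ : SpaceTimeTest n) {M : ℝ} (hΦ : ∀ t, M ≤ |t| → Φ.slice t = 0) :
    ∃ C : ℝ, ∀ᶠ S in atTop, ∀ R : ℝ, 1 ≤ R → ‖∫ t in Ioo 0 M, ∫ ξ in {ξ : Rn n | R ≤ ‖ξ‖},
      prof a₀ a β u₀ (scale a₀ a β S) S t ξ * Φ.spatial ξ t‖ ≤ C / R := by
  obtain ⟨C, hC, hb⟩ := exists_norm_integral_resolvent_le (n := n) hn
  obtain ⟨D, hD, hdec⟩ := Φ.exists_isDecaying
  have hI : 0 ≤ ∫ x, ‖u₀ x‖ := integral_nonneg fun _ => norm_nonneg _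
  refine ⟨C * (((∫ x, ‖u₀ x‖) + 1) * D), ?_⟩
  filter_upwards [h.eventually_integrable_prof Φ M, eventually_ge_atTop 0,
    scale_sq h.regVar h.index.1, h.eventually_ae_isSubexponential hc0 hc,
    (h.regVar.kern.tendsto_laplace_one h.admissible.isTameKernel h.index.1).eventually_const_le zero_lt_one]
    with S hint hS ⟨_, hs, _⟩ hsub hlap R hR
  have e : ∀ t ξ, prof a₀ a β u₀ (scale a₀ a β S) S t ξ
      = (resolvent (scaledKernel (kern a₀ a) β S) (symb ξ) t : ℂ)
        * 𝓕 u₀ ((scale a₀ a β S)⁻¹ • ξ) := fun t ξ => by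
    rw [prof, div_self hs.ne', one_pow, one_mul]
  simp only [e] at hint ⊢
  rw [mul_div_assoc]
  exact hb _ (h.admissible.isTameKernel.scaled β hS) hlap _
    ((continuous_fourier_of_integrable h.integrable).comp (continuous_const_smul _)) hsub _
    (by positivity) (fun ξ => (norm_fourier_le _).trans (by linarith)) D hD _ hdec M
    (fun ξ t => Φ.spatial ξ t)
    (fun ξ t ht => Φ.spatial_eq_zero (hΦ t (ht.trans (le_abs_self t))) ξ)
    Φ.spatial_eq_integral hint R hR

theorem eventually_norm_sub_le (hn : 1 ≤ n) (h : IsLimitAlong a₀ a β u₀ u s κ T u_inf)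
    (hnt : IsNontrivial u_inf) {c : ℝ} (hc0 : 0 < c)
    (hc : Tendsto (fun j => scale a₀ a β (T j) / κ j) atTop (𝓝 c))
    (Φ : SpaceTimeTest n) {M : ℝ} (hM : 0 < M) (hΦ : ∀ t, M ≤ |t| → Φ.slice t = 0)
    {ε : ℝ} (hε : 0 < ε) : ∀ᶠ S in atTop,
    ‖(∫ t in Ioo 0 M, ∫ ξ, prof a₀ a β u₀ (scale a₀ a β S) S t ξ * Φ.spatial ξ t)
      - ∫ t in Ioo 0 M, ∫ ξ, (∫ x, u₀ x) * mlProfile β t ξ * Φ.spatial ξ t‖ ≤ ε := by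
  obtain ⟨C, hC⟩ := h.exists_eventually_tail_le hn hc0 hc Φ hΦ
  obtain ⟨D, hD, hψ⟩ := Φ.exists_norm_spatial_le 0
  have hint := h.integrable_mlProfile hnt hc0 hc Φ M
  have h1 := tendsto_tail (G := fun t ξ => (∫ x, u₀ x) * mlProfile β t ξ * Φ.spatial ξ t) hint
  have h2 : Tendsto (fun R : ℕ => C / R) atTop (𝓝 0) :=
    tendsto_const_nhds.div_atTop tendsto_natCast_atTop_atTop
  -- The order of choices matters: the tail bound holds for all `R` beyond a threshold in `S`
  -- independent of `R`. Thus `R` can be fixed first, and the locally uniform convergence on that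
  -- ball is used afterwards.
  obtain ⟨R, h3, h4, hR⟩ := ((h1.norm.eventually_le_const (u := ε / 3) (by simpa using hε)).and
    ((h2.eventually_le_const (u := ε / 3) (by positivity)).and (eventually_ge_atTop 1))).exists
  set V := volume.real (Metric.closedBall (0 : Rn n) R) * M
  have hV : 0 ≤ V := by positivity
  have hδ : 0 < ε / (3 * (D + 1) * (V + 1)) := by positivity
  filter_upwards [hC, h.eventually_integrable_prof Φ M, eventually_norm_prof_sub_le (n := n)
    h.admissible h.integrable h.regVar h.index.1 R M hδ] with S h5 h6 h7
  refine (norm_integral_sub_le hM.le h6 hint (R := R) (ε := ε / (3 * (D + 1) * (V + 1)) * D)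
    (by positivity) (fun t ht ξ hξ => ?_) ((h5 R (by exact_mod_cast hR)).trans h4) h3).trans ?_
  · rw [← sub_mul, norm_mul]
    refine mul_le_mul (h7 t ⟨ht.1.le, ht.2.le⟩ ξ hξ) ((hψ ξ t ht.1.le).trans (le_of_eq ?_))
      (norm_nonneg _) hδ.le
    simp [wt]
  · have : ε / (3 * (D + 1) * (V + 1)) * D * V ≤ ε / 3 := by
      rw [div_mul_eq_mul_div, div_mul_eq_mul_div, div_le_div_iff₀ (by positivity) (by positivity)]
      nlinarith [mul_nonneg hD hV, mul_nonneg hε.le hD, mul_nonneg hε.le hV]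
    linarith

theorem tendstoDistribution (hn : 1 ≤ n) (h : IsLimitAlong a₀ a β u₀ u s κ T u_inf)
    (hnt : IsNontrivial u_inf) {c : ℝ} (hc0 : 0 < c)
    (hc : Tendsto (fun j => scale a₀ a β (T j) / κ j) atTop (𝓝 c))
    (hw : ∀ t, 0 ≤ t → FourierRep (w t) (mlProfile β t)) :
    TendstoDistribution (fun S t => rescale u (scale a₀ a β) S t)
      (fun t => (∫ x, u₀ x) • w t) := by
  intro Φ _
  obtain ⟨M, hM, hΦ⟩ := Φ.exists_slice_eq_zero
  rw [integral_apply_slice hΦ (m := fun t ξ => (∫ x, u₀ x) * mlProfile β t ξ) (by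
    filter_upwards [ae_restrict_mem measurableSet_Ioi] with t ht
    exact (hw t (le_of_lt ht)).const_smul _)]
  rw [Metric.tendsto_nhds]
  intro ε hε
  filter_upwards [h.eventually_norm_sub_le hn hnt hc0 hc Φ hM hΦ (half_pos hε),
    h.fourier.prof h.regVar h.index.1, scale_sq h.regVar h.index.1] with S h1 h2 ⟨_, hs, _⟩
  rw [integral_apply_slice hΦ (m := fun t ξ => prof a₀ a β u₀ (scale a₀ a β S) S t ξ) (by
    filter_upwards [h2] with t ht using ht _ hs), dist_eq_norm]
  linarith

end IsLimitAlong

end SelfSimilar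

/-! ### Assembly of the theorem. -/

theorem theorem3p1 (n : ℕ) (hn : 1 ≤ n) (a₀ : ℝ) (a : ℝ → ℝ)
    (ha : SelfSimilar.IsAdmissibleKernel a₀ a)
    (u₀ : SelfSimilar.Rn n → ℂ) (hu₀ : Integrable u₀)
    (u : ℝ → 𝓢'(SelfSimilar.Rn n, ℂ)) (hu : SelfSimilar.IsWeakSolution a₀ a u₀ u)
    (β : ℝ) (hβ : β ∈ Ioc (-1 : ℝ) 1)
    (hA : SelfSimilar.IsRegularlyVarying (SelfSimilar.primitive a₀ a) β)
    (k₀ : ℝ → ℝ) (hk₀_nonneg : ∀ t : ℝ, 0 ≤ t → 0 ≤ k₀ t) (hk₀_mono : MonotoneOn k₀ (Ici 0))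
    (hk₀_top : Tendsto k₀ atTop atTop)
    (T : ℕ → ℝ) (hT : Tendsto T atTop atTop)
    (s : ℝ) (u_inf : ℝ → 𝓢'(SelfSimilar.Rn n, ℂ))
    (hu_inf_nontrivial : SelfSimilar.IsNontrivial u_inf)
    (hu_inf_mem : ∀ᵐ t ∂volume.restrict (Ioi (0 : ℝ)),
      TemperedDistribution.MemSobolev s 2 (u_inf t))
    (hconv : SelfSimilar.TendstoAEBoundedly s
      (fun j t => SelfSimilar.rescale u k₀ (T j) t) u_inf) :
    ∃ (w : ℝ → 𝓢'(SelfSimilar.Rn n, ℂ)) (c : ℝ),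
      -- the limiting distribution `w_{1+β}`
      SelfSimilar.IsMittagLefflerFamily (1 + β) w ∧
      SelfSimilar.IsFractionalFundamentalSolution β w ∧
      -- the given scaling agrees with `k` up to an asymptotically constant factor
      0 < c ∧
      Tendsto (fun j => SelfSimilar.scale a₀ a β (T j) / k₀ (T j)) atTop (𝓝 c) ∧
      -- `U₀ w_{1+β}` is the given limit, up to that factor
      (∀ᵐ t ∂volume.restrict (Ioi (0 : ℝ)),
        (∫ x, u₀ x) • w t = SelfSimilar.dilate c (u_inf t)) ∧
      -- `k₀` may be replaced with `k`
      SelfSimilar.TendstoAEBoundedly s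
        (fun j t => SelfSimilar.rescale u (SelfSimilar.scale a₀ a β) (T j) t)
        (fun t => (∫ x, u₀ x) • w t) ∧
      -- convergence along the full limit
      SelfSimilar.TendstoDistribution
        (fun S t => SelfSimilar.rescale u (SelfSimilar.scale a₀ a β) S t)
        (fun t => (∫ x, u₀ x) • w t) ∧
      SelfSimilar.FourierTendstoLocallyUniformly
        (fun S t => SelfSimilar.rescale u (SelfSimilar.scale a₀ a β) S t)
        (fun t ξ => (∫ x, u₀ x) *
          SelfSimilar.mittagLeffler (1 + β) ((-(‖ξ‖ ^ 2 * t ^ (1 + β)) : ℝ) : ℂ)) := by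
  have hκ := hk₀_top.comp hT
  -- The bound on the unit time interval alone suffices to identify the Fourier transform of `u` at
  -- almost every time.
  obtain ⟨C, hC⟩ := hconv.2 1
  have h : SelfSimilar.IsLimitAlong a₀ a β u₀ u s (fun j => k₀ (T j)) T u_inf :=
    ⟨ha, hu₀, hA, hβ, hκ, hT, hu.hasExplicitFourier ha hu₀ (hκ.eventually_gt_atTop 0) hT hC,
      hu_inf_mem, hconv⟩
  obtain ⟨c, hc0, hc⟩ := h.exists_limit hn hu_inf_nontrivial
  obtain ⟨w, hw⟩ := h.exists_family hu_inf_nontrivial hc0 hc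
  exact ⟨w, c, SelfSimilar.isMittagLefflerFamily_of_fourierRep hβ.1 hw,
    SelfSimilar.isFractionalFundamentalSolution_of_fourierRep hβ.1 hw
      (h.exists_eLpNorm_mlProfile_le hu_inf_nontrivial hc0 hc),
    hc0, hc, h.smul_eq_dilate hc0 hc hw, h.tendstoAEBoundedly_scale hc0 hc hw,
    h.tendstoDistribution hn hu_inf_nontrivial hc0 hc hw,
    h.fourier.fourierTendstoLocallyUniformly ha hu₀ hA hβ.1⟩
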